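/- Let $K$ be a field of characteristic $0$ and let $h\in K$, $h\neq 0$ (for example $h\in\mathbb C^\times$, or $K=\mathbb C((h))$ with $h$ an indeterminate). Let $\mathcal B$ be the quantized Borel subalgebra of $U_h(osp(2/1))$: the $K$-superalgebra generated by the power series $f(X)\in K[[X]]$ (even), $H$ (even) and $V_+$ (odd) with $$[H,X]=\tfrac1h\sinh(hX),\quad [X,V_+]=0,\quad [H,V_+]=\tfrac12V_+\cosh(hX),\quad V_+^2=\tfrac1{4h}\sinh(hX),$$ the first two relations being extended to power series by $[H,f(X)]=\tfrac1h\sinh(hX)f'(X)$ and $[V_+,f(X)]=0$. Let $\mathcal B\hat\otimes\mathcal B$ be its completed super tensor square, generated by $K[[X\otimes1,1\otimes X]]$ and the two copies of $H,V_+$, elements of different copies commuting in the graded sense. Put $T=e^{hX}$. (1) Every element of $\mathcal B$ is uniquely a sum $\sum H^kf_{k,m}(X)V_+^m$ with $m\in\{0,1\}$ and finitely many nonzero $f_{k,m}\in K[[X]]$; thus the elements $E_{k\ell m}=H^kX^\ell V_+^m$ form a (topological) basis. The analogous statement holds for $\mathcal B\hat\otimes\mathcal B$, and $\mathcal B$ is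 the direct sum of its even part ($m=0$) and its odd part ($m=1$). There are unique algebra morphisms $\Delta:\mathcal B\to\mathcal B\hat\otimes\mathcal B$, $\varepsilon:\mathcal B\to K$ and a unique linear super-antimorphism $S:\mathcal B\to\mathcal B$ with $$\Delta(X)=X\otimes1+1\otimes X,\quad \Delta(V_+)=V_+\otimes T^{-1/2}+T^{1/2}\otimes V_+,$$ $$\Delta(H)=H\otimes T^{-1}+T\otimes H+2hV_+T^{1/2}\otimes V_+T^{-1/2},$$ $$\varepsilon(H)=\varepsilon(X)=\varepsilon(V_+)=0,\quad S(H)=-H-2hV_+^2,\ S(X)=-X,\ S(V_+)=-V_+$$ (and $\Delta(f(X))=f(X\otimes1+1\otimes X)$, $\varepsilon(f(X))=f(0)$, $S(f(X))=f(-X)$ for power series $f$). They satisfy the axioms of a Hopf superalgebra. (2) Let $\mathcal B^*$ be the space of linear functionals on $\mathcal B$ that are continuous in the $X$-adic topology, i.e. vanish on $X^L\mathcal B$ for some $L$, with the operations dual to those of $\mathcal B$: $(\varphi\psi)(b)=(\varphi\otimes\psi)(\Delta b)$, unit $\varepsilon$, $\Delta(\varphi)(a\otimes b)=\varphi(ab)$,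 $\varepsilon(\varphi)=\varphi(1)$, $S(\varphi)=\varphi\circ S$. Let $e^{k\ell m}$ be the functionals dual to the $E_{k\ell m}$, and put $x=e^{100}$, $y=e^{010}$, $z=e^{001}$; $x,y$ are even and $z$ is odd. Then $\mathcal B^*$ is the algebra generated by the power series in $x$ and by $y$, $z$ with the defining relations $$z^2=2h(1-e^{-x}),\quad [x,y]=2h(e^{-x}-1),\quad [x,z]=0,\quad [y,z]=h\,z\,e^{-x}$$ (the relations with $x$ extended to power series: $[y,f(x)]=2h(1-e^{-x})f'(x)$, $[z,f(x)]=0$), where $f(x)=\sum_k f_kx^k$ is taken pointwise on $\mathcal B$. Moreover $e^{k00}=x^k/k!$, $e^{k01}=x^kz/k!$, and $$\Delta(x)=x\otimes1+1\otimes x,\quad \Delta(y)=y\otimes e^{-x}+1\otimes y+\tfrac14z\otimes ze^{-x/2},\quad \Delta(z)=z\otimes e^{-x/2}+1\otimes z,$$ $$\varepsilon(x)=\varepsilon(y)=\varepsilon(z)=0,\quad S(x)=-x,\quad S(y)=-ye^x+\tfrac h2(e^x-1),\quad S(z)=-ze^{x/2}.$$ (3) There is an isomorphism of Hopf superalgebras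 $\rho:\mathcal B\to\mathcal B^*$ (a linear bijection preserving parity and compatible with product, unit, coproduct, counit and antipode) with $$\rho(H)=\frac1{2h}\,y\,e^{x/2},\qquad \rho(X)=\frac1{2h}\,x,\qquad \rho(V_+)=\frac1{4h}\,z\,e^{x/4},$$ and $\rho(f(X))=f(x/2h)$ for power series $f$. Thus $\mathcal B$ is self-dual. -/

import Mathlib

open scoped PowerSeries

noncomputable section

namespace OspBorel

variable {K : Type*} [Field K] [CharZero K]

/-! ### Exponential series -/

/-- The series `e^{cX}`. -/
def expS (c : K) : K⟦X⟧ := PowerSeries.rescale c (PowerSeries.exp K)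

/-- The series `sinh (cX)`. -/
def sinhS (c : K) : K⟦X⟧ := (1 / 2 : K) • (expS c - expS (-c))

/-- The series `cosh (cX)`. -/
def coshS (c : K) : K⟦X⟧ := (1 / 2 : K) • (expS c + expS (-c))

/-! ### Algebras with one formal even generator, one even generator and one odd generator

Exponentials of the generator `X` occur in all relations, so power series in `X` are admitted as
elements: the algebra is generated by `K⟦X⟧`, by an even element `H` and by an odd element `V`. -/

/-- Generating symbols. -/
inductive Gen (K : Type*) [Field K] where
  | ser (f : K⟦X⟧)
  | H
  | V

/-- The relations `[H, f] = δ f'` (the extension to power series of `[H, X] = δ`), `[V, f] = 0`,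
`[H, V] = V γ`, `V ^ 2 = s`, where `δ, γ, s` are power series in `X`; the first three relations say
that the power series in `X` form a homomorphic image of the algebra `K⟦X⟧`. -/
inductive Rel (δ γ s : K⟦X⟧) : FreeAlgebra K (Gen K) → FreeAlgebra K (Gen K) → Prop
  | ser_scalar (c : K) :
      Rel δ γ s (FreeAlgebra.ι K (Gen.ser (PowerSeries.C c)))
        (algebraMap K (FreeAlgebra K (Gen K)) c)
  | ser_add (f g : K⟦X⟧) :
      Rel δ γ s (FreeAlgebra.ι K (Gen.ser (f + g)))
        (FreeAlgebra.ι K (Gen.ser f) + FreeAlgebra.ι K (Gen.ser g))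
  | ser_mul (f g : K⟦X⟧) :
      Rel δ γ s (FreeAlgebra.ι K (Gen.ser (f * g)))
        (FreeAlgebra.ι K (Gen.ser f) * FreeAlgebra.ι K (Gen.ser g))
  | H_ser (f : K⟦X⟧) :
      Rel δ γ s (FreeAlgebra.ι K Gen.H * FreeAlgebra.ι K (Gen.ser f))
        (FreeAlgebra.ι K (Gen.ser f) * FreeAlgebra.ι K Gen.H +
          FreeAlgebra.ι K (Gen.ser (δ * PowerSeries.derivative K f)))
  | V_ser (f : K⟦X⟧) :
      Rel δ γ s (FreeAlgebra.ι K Gen.V * FreeAlgebra.ι K (Gen.ser f))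
        (FreeAlgebra.ι K (Gen.ser f) * FreeAlgebra.ι K Gen.V)
  | H_V :
      Rel δ γ s (FreeAlgebra.ι K Gen.H * FreeAlgebra.ι K Gen.V)
        (FreeAlgebra.ι K Gen.V * FreeAlgebra.ι K Gen.H +
          FreeAlgebra.ι K Gen.V * FreeAlgebra.ι K (Gen.ser γ))
  | V_V :
      Rel δ γ s (FreeAlgebra.ι K Gen.V * FreeAlgebra.ι K Gen.V)
        (FreeAlgebra.ι K (Gen.ser s))

/-- The algebra presented by `K⟦X⟧`, `H`, `V` and the relations `Rel δ γ s`. -/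
abbrev Alg (δ γ s : K⟦X⟧) : Type _ := RingQuot (Rel δ γ s)

section
variable (δ γ s : K⟦X⟧)

/-- The element `f(X)` of the algebra, for a power series `f`. -/
def ser (f : K⟦X⟧) : Alg δ γ s :=
  RingQuot.mkAlgHom K (Rel δ γ s) (FreeAlgebra.ι K (Gen.ser f))

/-- The even generator `H`. -/
def genH : Alg δ γ s := RingQuot.mkAlgHom K (Rel δ γ s) (FreeAlgebra.ι K Gen.H)

/-- The odd generator `V`. -/
def genV : Alg δ γ s := RingQuot.mkAlgHom K (Rel δ γ s) (FreeAlgebra.ι K Gen.V)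

end

/-! ### The completed super tensor square

The completed super tensor square of `Alg δ γ s` is generated by the power series in the two
variables `X₀ = X ⊗ 1` and `X₁ = 1 ⊗ X` and by `H₀ = H ⊗ 1`, `H₁ = 1 ⊗ H`, `V₀ = V ⊗ 1`,
`V₁ = 1 ⊗ V`; elements in different tensor factors commute in the graded sense. -/

/-- Generating symbols of the tensor square. -/
inductive Gen₂ (K : Type*) [Field K] where
  | ser (f : MvPowerSeries (Fin 2) K)
  | H (i : Fin 2)
  | V (i : Fin 2)

/-- The series `f(X_i)` in the variables `X₀, X₁`. -/
def slot (i : Fin 2) (f : K⟦X⟧) : MvPowerSeries (Fin 2) K :=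
  PowerSeries.subst (MvPowerSeries.X i : MvPowerSeries (Fin 2) K) f

/-- Relations of the tensor square: those of `Rel δ γ s` in each factor, and graded commutation
of the two factors. -/
inductive Rel₂ (δ γ s : K⟦X⟧) : FreeAlgebra K (Gen₂ K) → FreeAlgebra K (Gen₂ K) → Prop
  | ser_scalar (c : K) :
      Rel₂ δ γ s (FreeAlgebra.ι K (Gen₂.ser (MvPowerSeries.C c)))
        (algebraMap K (FreeAlgebra K (Gen₂ K)) c)
  | ser_add (f g : MvPowerSeries (Fin 2) K) :
      Rel₂ δ γ s (FreeAlgebra.ι K (Gen₂.ser (f + g)))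
        (FreeAlgebra.ι K (Gen₂.ser f) + FreeAlgebra.ι K (Gen₂.ser g))
  | ser_mul (f g : MvPowerSeries (Fin 2) K) :
      Rel₂ δ γ s (FreeAlgebra.ι K (Gen₂.ser (f * g)))
        (FreeAlgebra.ι K (Gen₂.ser f) * FreeAlgebra.ι K (Gen₂.ser g))
  | H_ser (i : Fin 2) (f : MvPowerSeries (Fin 2) K) :
      Rel₂ δ γ s (FreeAlgebra.ι K (Gen₂.H i) * FreeAlgebra.ι K (Gen₂.ser f))
        (FreeAlgebra.ι K (Gen₂.ser f) * FreeAlgebra.ι K (Gen₂.H i) +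
          FreeAlgebra.ι K (Gen₂.ser (slot i δ * MvPowerSeries.pderiv K i f)))
  | V_ser (i : Fin 2) (f : MvPowerSeries (Fin 2) K) :
      Rel₂ δ γ s (FreeAlgebra.ι K (Gen₂.V i) * FreeAlgebra.ι K (Gen₂.ser f))
        (FreeAlgebra.ι K (Gen₂.ser f) * FreeAlgebra.ι K (Gen₂.V i))
  | H_V (i : Fin 2) :
      Rel₂ δ γ s (FreeAlgebra.ι K (Gen₂.H i) * FreeAlgebra.ι K (Gen₂.V i))
        (FreeAlgebra.ι K (Gen₂.V i) * FreeAlgebra.ι K (Gen₂.H i) +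
          FreeAlgebra.ι K (Gen₂.V i) * FreeAlgebra.ι K (Gen₂.ser (slot i γ)))
  | V_V (i : Fin 2) :
      Rel₂ δ γ s (FreeAlgebra.ι K (Gen₂.V i) * FreeAlgebra.ι K (Gen₂.V i))
        (FreeAlgebra.ι K (Gen₂.ser (slot i s)))
  | comm_H_H :
      Rel₂ δ γ s (FreeAlgebra.ι K (Gen₂.H 0) * FreeAlgebra.ι K (Gen₂.H 1))
        (FreeAlgebra.ι K (Gen₂.H 1) * FreeAlgebra.ι K (Gen₂.H 0))
  | comm_H_V (i j : Fin 2) (hij : i ≠ j) :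
      Rel₂ δ γ s (FreeAlgebra.ι K (Gen₂.H i) * FreeAlgebra.ι K (Gen₂.V j))
        (FreeAlgebra.ι K (Gen₂.V j) * FreeAlgebra.ι K (Gen₂.H i))
  | anticomm_V_V :
      Rel₂ δ γ s (FreeAlgebra.ι K (Gen₂.V 0) * FreeAlgebra.ι K (Gen₂.V 1))
        (-(FreeAlgebra.ι K (Gen₂.V 1) * FreeAlgebra.ι K (Gen₂.V 0)))

/-- The completed super tensor square of `Alg δ γ s`. -/
abbrev Alg₂ (δ γ s : K⟦X⟧) : Type _ := RingQuot (Rel₂ δ γ s)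

section
variable (δ γ s : K⟦X⟧)

/-- The element `f(X₀, X₁)` of the tensor square. -/
def ser₂ (f : MvPowerSeries (Fin 2) K) : Alg₂ δ γ s :=
  RingQuot.mkAlgHom K (Rel₂ δ γ s) (FreeAlgebra.ι K (Gen₂.ser f))

/-- `H ⊗ 1` (for `i = 0`) and `1 ⊗ H` (for `i = 1`). -/
def genH₂ (i : Fin 2) : Alg₂ δ γ s :=
  RingQuot.mkAlgHom K (Rel₂ δ γ s) (FreeAlgebra.ι K (Gen₂.H i))

/-- `V ⊗ 1` (for `i = 0`) and `1 ⊗ V` (for `i = 1`). -/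
def genV₂ (i : Fin 2) : Alg₂ δ γ s :=
  RingQuot.mkAlgHom K (Rel₂ δ γ s) (FreeAlgebra.ι K (Gen₂.V i))

/-- The sum `∑ H^k f_{k,m}(X) V^m` with finitely many nonzero `f_{k,m}`, `m ∈ {0, 1}`. -/
def expand (c : ℕ × Fin 2 →₀ K⟦X⟧) : Alg δ γ s :=
  c.sum fun i f => genH δ γ s ^ i.1 * ser δ γ s f * genV δ γ s ^ (i.2 : ℕ)

/-- The sum `∑ H₀^k H₁^k' f(X₀, X₁) V₀^m V₁^m'` over the indices `((k, m), (k', m'))`. -/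
def expand₂ (c : (ℕ × Fin 2) × (ℕ × Fin 2) →₀ MvPowerSeries (Fin 2) K) : Alg₂ δ γ s :=
  c.sum fun i f => genH₂ δ γ s 0 ^ i.1.1 * genH₂ δ γ s 1 ^ i.2.1 * ser₂ δ γ s f *
    (genV₂ δ γ s 0 ^ (i.1.2 : ℕ) * genV₂ δ γ s 1 ^ (i.2.2 : ℕ))

end

/-! ### The quantized Borel subalgebra and the algebra that presents its dual -/

/-- The quantized Borel subalgebra: `[H, X] = h⁻¹ sinh (hX)`, `[X, V] = 0`,
`[H, V] = V cosh (hX) / 2`, `V ^ 2 = sinh (hX) / (4h)`. -/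
abbrev B (h : K) : Type _ :=
  Alg (h⁻¹ • sinhS h) ((1 / 2 : K) • coshS h) ((4 * h)⁻¹ • sinhS h)

/-- The completed super tensor square of `B h`. -/
abbrev BB (h : K) : Type _ :=
  Alg₂ (h⁻¹ • sinhS h) ((1 / 2 : K) • coshS h) ((4 * h)⁻¹ • sinhS h)

/-- The algebra generated by the power series in `x`, by `y` and by `z`, with
`[x, y] = 2h (e^{-x} - 1)`, `[x, z] = 0`, `[y, z] = h z e^{-x}`, `z ^ 2 = 2h (1 - e^{-x})`. -/
abbrev A (h : K) : Type _ :=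
  Alg ((2 * h) • (1 - expS (-1 : K))) (h • expS (-1 : K)) ((2 * h) • (1 - expS (-1 : K)))

namespace B
variable (h : K)

/-- `f(X)` in `B h`. -/
def ser (f : K⟦X⟧) : B h := OspBorel.ser _ _ _ f
/-- The generator `H`. -/
def H : B h := genH _ _ _
/-- The generator `V_+`. -/
def V : B h := genV _ _ _
/-- The sum `∑ H^k f_{k,m}(X) V_+^m`. -/
def expand (c : ℕ × Fin 2 →₀ K⟦X⟧) : B h := OspBorel.expand _ _ _ c
/-- The basis element `E_{klm} = H^k X^l V_+^m`. -/
def E (k l : ℕ) (m : Fin 2) : B h := H h ^ k * ser h (PowerSeries.X ^ l) * V h ^ (m : ℕ)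

/-- The dual basis functional `e^{klm}`: the coefficient of `H^k X^l V_+^m`. The coefficients of an
element are well defined as soon as `expand` is bijective. -/
def e (k l : ℕ) (m : Fin 2) (b : B h) : K :=
  PowerSeries.coeff l (Function.invFun (expand h) b (k, m))

/-- The even part (`p = 0`) and the odd part (`p = 1`) of `B h`. -/
def part (p : Fin 2) : Submodule K (B h) :=
  Submodule.span K {b | ∃ (k : ℕ) (f : K⟦X⟧), b = H h ^ k * ser h f * V h ^ (p : ℕ)}

end B

namespace BB
variable (h : K)

/-- `f(X ⊗ 1, 1 ⊗ X)`. -/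
def ser (f : MvPowerSeries (Fin 2) K) : BB h := ser₂ _ _ _ f
/-- `H ⊗ 1` and `1 ⊗ H`. -/
def H (i : Fin 2) : BB h := genH₂ _ _ _ i
/-- `V_+ ⊗ 1` and `1 ⊗ V_+`. -/
def V (i : Fin 2) : BB h := genV₂ _ _ _ i
/-- `e^{cX} ⊗ 1` and `1 ⊗ e^{cX}`. -/
def exp (i : Fin 2) (c : K) : BB h := ser h (slot i (expS c))
/-- The sum `∑ H₀^k H₁^k' f(X₀, X₁) V₀^m V₁^m'`. -/
def expand (c : (ℕ × Fin 2) × (ℕ × Fin 2) →₀ MvPowerSeries (Fin 2) K) : BB h :=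
  expand₂ _ _ _ c

/-- The value on `u` of the continuous functional on the completed tensor square that is given on
simple tensors by `a ⊗ b ↦ β a b`, for a bilinear `β`: the sum `∑ u_{IJ} β (E_I) (E_J)`, where
`u = ∑ u_{IJ} E_I ⊗ E_J` over `I = (k, l, m)`, `J = (k', l', m')`. The sum over `(l, l')` has
finitely many nonzero terms if `β (E_I) (E_J)` vanishes for fixed `k, k'` and large `l` or `l'`. -/
def pair (β : B h → B h → K) (u : BB h) : K :=
  (Function.invFun (expand h) u).sum fun i f =>
    ∑ᶠ l : Fin 2 →₀ ℕ,
      MvPowerSeries.coeff l f * β (B.E h i.1.1 (l 0) i.1.2) (B.E h i.2.1 (l 1) i.2.2)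

end BB

namespace A
variable (h : K)

/-- `f(x)` in `A h`. -/
def ser (f : K⟦X⟧) : A h := OspBorel.ser _ _ _ f
/-- The exponential `e^{cx}`. -/
def exp (c : K) : A h := ser h (expS c)
/-- The generator `x`. -/
def x : A h := ser h PowerSeries.X
/-- The generator `y`. -/
def y : A h := genH _ _ _
/-- The generator `z`. -/
def z : A h := genV _ _ _

end A

/-! ### The Hopf structure of the Borel subalgebra and of its dual -/

/-- The coproduct, counit and antipode of `B h` on generators, with `T = e^{hX}`:
`Δ(X) = X ⊗ 1 + 1 ⊗ X`, `Δ(H) = H ⊗ T⁻¹ + T ⊗ H + 2h V T^{1/2} ⊗ V T^{-1/2}`,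
`Δ(V) = V ⊗ T^{-1/2} + T^{1/2} ⊗ V`, `ε(X) = ε(H) = ε(V) = 0`,
`S(X) = -X`, `S(H) = -H - 2h V²`, `S(V) = -V`. The maps `Δ` and `ε` are algebra morphisms, `S` is
an antimorphism in the graded sense. The formulas for `X` are written out for power series. -/
structure IsStructure (h : K) (Δ : B h →ₐ[K] BB h) (ε : B h →ₐ[K] K) (S : B h →ₗ[K] B h) :
    Prop where
  comul_ser : ∀ f : K⟦X⟧, Δ (B.ser h f) =
    BB.ser h (PowerSeries.subst
      (MvPowerSeries.X 0 + MvPowerSeries.X 1 : MvPowerSeries (Fin 2) K) f)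
  comul_H : Δ (B.H h) = BB.H h 0 * BB.exp h 1 (-h) + BB.exp h 0 h * BB.H h 1 +
    (2 * h) • ((BB.V h 0 * BB.exp h 0 (h / 2)) * (BB.V h 1 * BB.exp h 1 (-h / 2)))
  comul_V : Δ (B.V h) = BB.V h 0 * BB.exp h 1 (-h / 2) + BB.exp h 0 (h / 2) * BB.V h 1
  counit_ser : ∀ f : K⟦X⟧, ε (B.ser h f) = PowerSeries.constantCoeff f
  counit_H : ε (B.H h) = 0
  counit_V : ε (B.V h) = 0
  antipode_ser : ∀ f : K⟦X⟧, S (B.ser h f) = B.ser h (PowerSeries.rescale (-1) f)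
  antipode_H : S (B.H h) = -B.H h - (2 * h) • B.V h ^ 2
  antipode_V : S (B.V h) = -B.V h
  antipode_mul : ∀ (p q : Fin 2) (a b : B h), a ∈ B.part h p → b ∈ B.part h q →
    S (a * b) = (-1 : K) ^ ((p : ℕ) * (q : ℕ)) • (S b * S a)

/-- The dual `B*`: the linear functionals that are continuous for the `X`-adic topology of `B h`,
that is, vanish on `X ^ L * B h` for some `L`. These are the sums `∑ c_{klm} e^{klm}` in which `l`
is bounded. -/
def Bdual (h : K) : Submodule K (Module.Dual K (B h)) where
  carrier := {φ | ∃ L : ℕ, ∀ b, φ (B.ser h (PowerSeries.X ^ L) * b) = 0}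
  zero_mem' := ⟨0, fun _ => rfl⟩
  smul_mem' := by
    rintro c φ ⟨L, hL⟩
    exact ⟨L, fun b => by simp [hL b]⟩
  add_mem' := by
    have key : ∀ (L M : ℕ) (b : B h), B.ser h (PowerSeries.X ^ (L + M)) * b =
        B.ser h (PowerSeries.X ^ L) * (B.ser h (PowerSeries.X ^ M) * b) := by
      intro L M b
      rw [pow_add, ← mul_assoc]
      congr 1
      have := RingQuot.mkAlgHom_rel K (Rel.ser_mul (δ := h⁻¹ • sinhS h)
        (γ := (1 / 2 : K) • coshS h) (s := (4 * h)⁻¹ • sinhS h)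
        (PowerSeries.X ^ L) (PowerSeries.X ^ M))
      rw [map_mul] at this
      exact this
    rintro φ ψ ⟨L, hL⟩ ⟨M, hM⟩
    refine ⟨L + M, fun b => ?_⟩
    have h1 := hL (B.ser h (PowerSeries.X ^ M) * b)
    have h2 := hM (B.ser h (PowerSeries.X ^ L) * b)
    rw [← key] at h1 h2
    rw [add_comm M L] at h2
    simp [h1, h2]

/-- The product of `B*`, dual to the coproduct: `(φ ψ)(b) = (φ ⊗ ψ)(Δ b)`. Its unit is `ε`. -/
def dualMul {h : K} (Δ : B h →ₐ[K] BB h) (φ ψ : Bdual h) (b : B h) : K :=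
  BB.pair h (fun a a' => (φ : Module.Dual K (B h)) a * (ψ : Module.Dual K (B h)) a') (Δ b)

/-- The coproduct of `B*`, dual to the product: `Δ(φ)` is the continuous bilinear form
`(a, b) ↦ φ(ab)`; the tensor `φ ⊗ ψ` is the form `(a, b) ↦ φ(a) ψ(b)`. -/
def dualComul {h : K} (φ : Bdual h) (a b : B h) : K := (φ : Module.Dual K (B h)) (a * b)

/-- The counit of `B*`, dual to the unit. -/
def dualCounit {h : K} (φ : Bdual h) : K := (φ : Module.Dual K (B h)) 1

/-- The antipode of `B*`, dual to the antipode. -/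
def dualAntipode {h : K} (S : B h →ₗ[K] B h) (φ : Bdual h) (b : B h) : K :=
  (φ : Module.Dual K (B h)) (S b)

/-- `φ ∈ B*` is even (`p = 0`) or odd (`p = 1`): it vanishes on the part of other parity. -/
def IsDualParity {h : K} (p : Fin 2) (φ : Bdual h) : Prop :=
  ∀ q : Fin 2, q ≠ p → ∀ b ∈ B.part h q, (φ : Module.Dual K (B h)) b = 0

end OspBorel

end

open scoped PowerSeries
set_option linter.unusedSectionVars false
set_option linter.unusedSimpArgs false
set_option linter.unnecessarySeqFocus false

noncomputable section

namespace OspBorel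

variable {K : Type*} [Field K] [CharZero K]

/-! ### Presented algebras: relations, lifting, induction -/

/-! Everything is read off from one module. The presented algebra `A` is made a module over `B` in
such a way that `(a, b) ↦ ε(b · a)` is the duality pairing. In this module `X` acts as the
derivation `∂/∂y`. It is locally nilpotent, so all power series in `X` act (`LocNil.act`, `dX`), and
an identity between series of operators has to be checked only on powers of `X` (`series_ext`,
`series_ext₂`).

The other operators come from a single matrix representation `lam` of `A` over itself. Put `T =
e^{hX}` and `W = V T^{1/2}`. Then `T`, `W`, `H`, `1`, `2h W T⁻¹`, `T⁻¹` are the entries of an upper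
triangular matrix whose coproduct is matrix multiplication, up to the signs of the grading.
Multiplicativity of `lam` therefore says that `T`, `W`, `H` satisfy the twisted Leibniz rules
dictated by `Δ`. With these rules the relations of `B` are verified on operators by induction along
right multiplication by `f(x)`, `y`, `z`, and `A` becomes a module algebra (`mul_act₂_comul`).

The pairing is triangular. If `c = f(x) + g(x) z`, then `X^l` sends `y^l c` to `l! c`, and `c` pairs
with `H^k V^m` through the Taylor coefficients of `f` and `g`. This computation yields the
independence of the monomials of `B` (`B.expand_bijective`) and the bijectivity of `A → B*`
(`pairing_injective`, `exists_pairing_eq`). The resulting dual basis separates the monomials of the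
tensor square (`expand₂_bijective`). Matrix coefficients of locally nilpotent representations are
continuous functionals (`matrixCoeff_eq_pair`), so the module algebra property says that the product
of `A` is dual to `Δ`. The coproducts of `x`, `y`, `z` are obtained by expanding `b · x`, `b · y`,
`b · z` inside finite-dimensional submodules.

The antipode of `B` is built from a morphism into an opposite endomorphism ring, with the signs
absorbed by the parity automorphism (`antiHom`). For its axiom, `B*` is made a module over the
tensor square by `φ ↦ φ(S(a) · a')`; in this form the axiom is multiplicative in `b` and is checked
on generators (`evalLeft_comul`, `evalRight_comul`). The dual antipode on `x`, `y`, `z` is found by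
solving the axiom inside `A`, and it reverses products because `S` reverses the coproduct
(`pairing_mul_actS`).

For self-duality, explicit mutually inverse morphisms identify `B` with `A` (`isoA`), so that `ρ = θ
∘ isoA` is multiplicative at once. The remaining point is that the bilinear form `ρ(a)(b)` is
symmetric (`form_symm`): the rules for an operator on `a g'` have coefficients that do not change
when the operators and the images of the generators are interchanged. Symmetry exchanges product and
coproduct. Compatibility with the antipode propagates from `1` along left multiplication by
generators (`pairing_isoA_antipode`). -/

instance algRing (δ γ s : K⟦X⟧) : Ring (Alg δ γ s) :=
  { RingQuot.instSemiring _, RingQuot.instRing _ with }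

instance alg₂Ring (δ γ s : K⟦X⟧) : Ring (Alg₂ δ γ s) :=
  { RingQuot.instSemiring _, RingQuot.instRing _ with }

section Alg
variable {δ γ s : K⟦X⟧}

theorem ser_C (c : K) : ser δ γ s (PowerSeries.C c) = algebraMap K _ c := by
  have := RingQuot.mkAlgHom_rel K (Rel.ser_scalar (δ := δ) (γ := γ) (s := s) c)
  rwa [AlgHom.commutes] at this

theorem ser_add (f g : K⟦X⟧) : ser δ γ s (f + g) = ser δ γ s f + ser δ γ s g := by
  have := RingQuot.mkAlgHom_rel K (Rel.ser_add (δ := δ) (γ := γ) (s := s) f g)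
  rwa [map_add] at this

theorem ser_mul (f g : K⟦X⟧) : ser δ γ s (f * g) = ser δ γ s f * ser δ γ s g := by
  have := RingQuot.mkAlgHom_rel K (Rel.ser_mul (δ := δ) (γ := γ) (s := s) f g)
  rwa [map_mul] at this

variable (δ γ s) in
/-- `f ↦ f(X)` as an algebra morphism. -/
def serHom : K⟦X⟧ →ₐ[K] Alg δ γ s where
  toFun := ser δ γ s
  map_one' := by have := ser_C (δ := δ) (γ := γ) (s := s) (1 : K); rwa [map_one, map_one] at this
  map_mul' := ser_mul
  map_zero' := by have := ser_C (δ := δ) (γ := γ) (s := s) (0 : K); rwa [map_zero, map_zero] at this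
  map_add' := ser_add
  commutes' c := ser_C c

theorem serHom_apply (f : K⟦X⟧) : serHom δ γ s f = ser δ γ s f := rfl

theorem genH_mul_ser (f : K⟦X⟧) : genH δ γ s * ser δ γ s f =
    ser δ γ s f * genH δ γ s + ser δ γ s (δ * PowerSeries.derivative K f) := by
  have := RingQuot.mkAlgHom_rel K (Rel.H_ser (δ := δ) (γ := γ) (s := s) f)
  rwa [map_add, map_mul, map_mul] at this

theorem genV_mul_ser (f : K⟦X⟧) : genV δ γ s * ser δ γ s f = ser δ γ s f * genV δ γ s := by
  have := RingQuot.mkAlgHom_rel K (Rel.V_ser (δ := δ) (γ := γ) (s := s) f)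
  rwa [map_mul, map_mul] at this

theorem genH_mul_genV : genH δ γ s * genV δ γ s =
    genV δ γ s * genH δ γ s + genV δ γ s * ser δ γ s γ := by
  have := RingQuot.mkAlgHom_rel K (Rel.H_V (δ := δ) (γ := γ) (s := s))
  rwa [map_add, map_mul, map_mul, map_mul] at this

theorem genV_mul_genV : genV δ γ s * genV δ γ s = ser δ γ s s := by
  have := RingQuot.mkAlgHom_rel K (Rel.V_V (δ := δ) (γ := γ) (s := s))
  rwa [map_mul] at this

variable {E : Type*} [Ring E] [Algebra K E]

/-- Algebra morphisms out of `Alg δ γ s`. -/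
def lift (φ : K⟦X⟧ →ₐ[K] E) (H V : E)
    (hH : ∀ f, H * φ f = φ f * H + φ (δ * PowerSeries.derivative K f))
    (hV : ∀ f, V * φ f = φ f * V) (hHV : H * V = V * H + V * φ γ) (hVV : V * V = φ s) :
    Alg δ γ s →ₐ[K] E :=
  RingQuot.liftAlgHom K ⟨FreeAlgebra.lift K
    (fun g : Gen K => match g with | .ser f => φ f | .H => H | .V => V), by
    rintro _ _ (c | ⟨f, g⟩ | ⟨f, g⟩ | f | f | _ | _)
    · rw [FreeAlgebra.lift_ι_apply, AlgHom.commutes]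
      exact φ.commutes c
    all_goals simp [FreeAlgebra.lift_ι_apply, hHV, hVV]
    · simpa using hH f
    · exact hV f⟩

section lift
variable (φ : K⟦X⟧ →ₐ[K] E) (H V : E)
    (hH : ∀ f, H * φ f = φ f * H + φ (δ * PowerSeries.derivative K f))
    (hV : ∀ f, V * φ f = φ f * V) (hHV : H * V = V * H + V * φ γ) (hVV : V * V = φ s)

theorem lift_ser (f : K⟦X⟧) : lift φ H V hH hV hHV hVV (ser δ γ s f) = φ f := by
  simp [lift, ser, RingQuot.liftAlgHom_mkAlgHom_apply]
theorem lift_genH : lift φ H V hH hV hHV hVV (genH δ γ s) = H := by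
  simp [lift, genH, RingQuot.liftAlgHom_mkAlgHom_apply]
theorem lift_genV : lift φ H V hH hV hHV hVV (genV δ γ s) = V := by
  simp [lift, genV, RingQuot.liftAlgHom_mkAlgHom_apply]
end lift

theorem algHom_ext {F G : Alg δ γ s →ₐ[K] E} (hs : ∀ f, F (ser δ γ s f) = G (ser δ γ s f))
    (hH : F (genH δ γ s) = G (genH δ γ s)) (hV : F (genV δ γ s) = G (genV δ γ s)) : F = G := by
  apply RingQuot.ringQuot_ext'
  apply FreeAlgebra.hom_ext
  funext g
  cases g
  · exact hs _
  · exact hH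
  · exact hV

/-- A subalgebra that contains the generators is everything. -/
theorem mem_of_generators (S : Subalgebra K (Alg δ γ s)) (hs : ∀ f, ser δ γ s f ∈ S)
    (hH : genH δ γ s ∈ S) (hV : genV δ γ s ∈ S) (a : Alg δ γ s) : a ∈ S := by
  obtain ⟨b, rfl⟩ := RingQuot.mkAlgHom_surjective K (Rel δ γ s) a
  induction b using FreeAlgebra.induction with
  | grade0 r => rw [AlgHom.commutes]; exact S.algebraMap_mem r
  | grade1 x =>
    cases x
    · exact hs _
    · exact hH
    · exact hV
  | mul a b ha hb => rw [map_mul]; exact S.mul_mem ha hb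
  | add a b ha hb => rw [map_add]; exact S.add_mem ha hb

/-- A subspace that contains `1` and is stable under right multiplication by the generators is
everything. -/
theorem mem_of_mul_right (N : Submodule K (Alg δ γ s)) (h1 : 1 ∈ N)
    (hs : ∀ f, ∀ a ∈ N, a * ser δ γ s f ∈ N) (hH : ∀ a ∈ N, a * genH δ γ s ∈ N)
    (hV : ∀ a ∈ N, a * genV δ γ s ∈ N) (a : Alg δ γ s) : a ∈ N := by
  -- The elements `b` with `N b ⊆ N` form a subalgebra, so the generators suffice; the claim follows
  -- by applying such a `b` to `1`.
  let S : Subalgebra K (Alg δ γ s) :=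
    { carrier := {b | ∀ a ∈ N, a * b ∈ N}
      mul_mem' := fun {x y} hx hy a ha => by rw [← mul_assoc]; exact hy _ (hx _ ha)
      add_mem' := fun {x y} hx hy a ha => by rw [mul_add]; exact N.add_mem (hx _ ha) (hy _ ha)
      algebraMap_mem' := fun r a ha => by
        rw [← Algebra.commutes, ← Algebra.smul_def]; exact N.smul_mem _ ha }
  have := mem_of_generators S hs hH hV a 1 h1
  rwa [one_mul] at this

/-- Two linear maps agree if they agree at `1` and the agreement propagates along left
multiplication by the generators. -/
theorem linearMap_eq_of_mul_right {M : Type*} [AddCommGroup M] [Module K M]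
    (F G : Alg δ γ s →ₗ[K] M) (h1 : F 1 = G 1)
    (hs : ∀ f a, F a = G a → F (a * ser δ γ s f) = G (a * ser δ γ s f))
    (hH : ∀ a, F a = G a → F (a * genH δ γ s) = G (a * genH δ γ s))
    (hV : ∀ a, F a = G a → F (a * genV δ γ s) = G (a * genV δ γ s)) (a : Alg δ γ s) :
    F a = G a :=
  mem_of_mul_right (LinearMap.eqLocus F G) h1 hs hH hV a

/-- Left multiplication by `f(X)` makes `Alg δ γ s` a module over the power series. -/
@[reducible] def serModule : Module K⟦X⟧ (Alg δ γ s) :=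
  Module.compHom _ (serHom δ γ s).toRingHom

attribute [local instance] serModule

theorem smul_eq_ser_mul (f : K⟦X⟧) (a : Alg δ γ s) : f • a = ser δ γ s f * a := rfl

/-- Power series are treated as scalars from here on, which reduces an identity in the algebra to
identities between the power series that multiply each word in `H` and `V`. -/
theorem serTower : IsScalarTower K K⟦X⟧ (Alg δ γ s) where
  smul_assoc c f a := by
    rw [smul_eq_ser_mul, smul_eq_ser_mul, ← serHom_apply, map_smul, smul_mul_assoc]; rfl

theorem serTower' : IsScalarTower K⟦X⟧ (Alg δ γ s) (Alg δ γ s) where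
  smul_assoc f a b := by simp only [smul_eq_ser_mul, smul_eq_mul, mul_assoc]

theorem genV_mul_smul (f : K⟦X⟧) (a : Alg δ γ s) : genV δ γ s * f • a = f • (genV δ γ s * a) := by
  simp only [smul_eq_ser_mul, ← mul_assoc, genV_mul_ser]

theorem genH_mul_smul (f : K⟦X⟧) (a : Alg δ γ s) : genH δ γ s * f • a =
    f • (genH δ γ s * a) + (δ * PowerSeries.derivative K f) • a := by
  simp only [smul_eq_ser_mul, ← mul_assoc, genH_mul_ser, add_mul]

theorem ser_eq_smul (f : K⟦X⟧) : ser δ γ s f = f • (1 : Alg δ γ s) := by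
  rw [smul_eq_ser_mul, mul_one]

theorem genH_mul_genV' : genH δ γ s * genV δ γ s =
    genV δ γ s * genH δ γ s + γ • genV δ γ s := by
  rw [genH_mul_genV, genV_mul_ser]; rfl

variable (δ γ s) in
/-- The parity automorphism. -/
def parity : Alg δ γ s →ₐ[K] Alg δ γ s :=
  lift (serHom δ γ s) (genH δ γ s) (-genV δ γ s) genH_mul_ser
    (fun f => by simp [serHom_apply, genV_mul_ser])
    (by simp [serHom_apply, genH_mul_genV, add_comm]) (by simp [serHom_apply, genV_mul_genV])

theorem parity_ser (f : K⟦X⟧) : parity δ γ s (ser δ γ s f) = ser δ γ s f := lift_ser ..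
theorem parity_genH : parity δ γ s (genH δ γ s) = genH δ γ s := lift_genH ..
theorem parity_genV : parity δ γ s (genV δ γ s) = -genV δ γ s := lift_genV ..

theorem parity_parity (a : Alg δ γ s) : parity δ γ s (parity δ γ s a) = a := by
  have : (parity δ γ s).comp (parity δ γ s) = AlgHom.id K _ := by
    apply algHom_ext <;> simp [parity_ser, parity_genH, parity_genV]
  exact DFunLike.congr_fun this a

/-- The element `H^k f(X) V^m`. -/
def mono (δ γ s : K⟦X⟧) (k : ℕ) (f : K⟦X⟧) (m : Fin 2) : Alg δ γ s :=
  genH δ γ s ^ k * ser δ γ s f * genV δ γ s ^ (m : ℕ)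

variable (δ γ s) in
/-- `f ↦ H^k f(X) V^m` as a linear map. -/
def monoL (i : ℕ × Fin 2) : K⟦X⟧ →ₗ[K] Alg δ γ s :=
  LinearMap.mulRight K (genV δ γ s ^ (i.2 : ℕ)) ∘ₗ LinearMap.mulLeft K (genH δ γ s ^ i.1) ∘ₗ
    (serHom δ γ s).toLinearMap

variable (δ γ s) in
/-- `expand` as a linear map. -/
def expandL : (ℕ × Fin 2 →₀ K⟦X⟧) →ₗ[K] Alg δ γ s := Finsupp.lsum K (monoL δ γ s)

/-- Normal ordering: the span of the monomials contains `1` and is stable under right multiplication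
by every generator, since a generator can be moved to its place at the cost of further monomials. -/
theorem mem_of_mono (N : Submodule K (Alg δ γ s)) (hN : ∀ k f m, mono δ γ s k f m ∈ N)
    (a : Alg δ γ s) : a ∈ N := by
  let N' : Submodule K (Alg δ γ s) := Submodule.span K {a | ∃ k f m, a = mono δ γ s k f m}
  have hN' : N' ≤ N := by
    apply Submodule.span_le.2
    rintro _ ⟨k, f, m, rfl⟩
    exact hN k f m
  have hm : ∀ k f m, mono δ γ s k f m ∈ N' := fun k f m => Submodule.subset_span ⟨k, f, m, rfl⟩
  apply hN'
  have key (g : Alg δ γ s) (hg : ∀ k f m, mono δ γ s k f m * g ∈ N') : ∀ a ∈ N', a * g ∈ N' := by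
    intro a ha
    have : N' ≤ N'.comap (LinearMap.mulRight K g) := by
      apply Submodule.span_le.2
      rintro _ ⟨k, f, m, rfl⟩
      exact hg k f m
    exact this ha
  apply mem_of_mul_right
  · convert hm 0 1 0 using 1
    simp [mono, ← serHom_apply]
  · intro g
    apply key
    intro k f m
    convert hm k (f * g) m using 1
    have : genV δ γ s ^ (m : ℕ) * ser δ γ s g = ser δ γ s g * genV δ γ s ^ (m : ℕ) := by
      fin_cases m <;> simp [genV_mul_ser]
    rw [mono, mono, mul_assoc, this, ser_mul]
    simp only [mul_assoc]
  · apply key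
    intro k f m
    -- The relations solved for the wrongly ordered products: passing `H` to the left only changes
    -- the series, by `δ f'` and by `γ`.
    have h0 : ser δ γ s f * genH δ γ s = genH δ γ s * ser δ γ s f -
        ser δ γ s (δ * PowerSeries.derivative K f) := by rw [genH_mul_ser]; abel
    have h1 : genV δ γ s * genH δ γ s = genH δ γ s * genV δ γ s -
        ser δ γ s γ * genV δ γ s := by rw [genH_mul_genV, genV_mul_ser]; abel
    fin_cases m
    · have : mono δ γ s k f 0 * genH δ γ s = mono δ γ s (k + 1) f 0 -
          mono δ γ s k (δ * PowerSeries.derivative K f) 0 := by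
        simp only [mono, Fin.val_zero, pow_zero, mul_one, mul_assoc, h0, mul_sub, pow_succ]
      exact this ▸ N'.sub_mem (hm _ _ _) (hm _ _ _)
    · have : mono δ γ s k f 1 * genH δ γ s = mono δ γ s (k + 1) f 1 -
          mono δ γ s k (δ * PowerSeries.derivative K f) 1 - mono δ γ s k (f * γ) 1 := by
        simp only [mono, Fin.val_one, pow_one, mul_assoc, h1, mul_sub, ser_mul]
        rw [← mul_assoc (ser δ γ s f) (genH δ γ s), h0, pow_succ]
        simp only [sub_mul, mul_sub, mul_assoc, ser_mul]
      exact this ▸ N'.sub_mem (N'.sub_mem (hm _ _ _) (hm _ _ _)) (hm _ _ _)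
  · apply key
    intro k f m
    fin_cases m
    · convert hm k f 1 using 1
      simp [mono]
    · convert hm k (f * s) 0 using 1
      simp [mono, mul_assoc, genV_mul_genV, ser_mul]

theorem expandL_single (k : ℕ) (f : K⟦X⟧) (m : Fin 2) :
    expandL δ γ s (Finsupp.single (k, m) f) = mono δ γ s k f m := by
  rw [expandL, Finsupp.lsum_single]; rfl

theorem expand_surjective : Function.Surjective (expand δ γ s) := by
  intro a
  refine mem_of_mono (LinearMap.range (expandL δ γ s)) (fun k f m => ?_) a
  exact ⟨Finsupp.single (k, m) f, expandL_single k f m⟩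

theorem linearMap_ext_mono {M : Type*} [AddCommGroup M] [Module K M] {F G : Alg δ γ s →ₗ[K] M}
    (h : ∀ k f m, F (mono δ γ s k f m) = G (mono δ γ s k f m)) : F = G :=
  LinearMap.ext fun a => mem_of_mono (LinearMap.eqLocus F G) h a

end Alg

/-! ### The tensor square: relations, lifting, spanning -/

section Alg₂
variable {δ γ s : K⟦X⟧}

theorem ser₂_C (c : K) : ser₂ δ γ s (MvPowerSeries.C c) = algebraMap K _ c := by
  have := RingQuot.mkAlgHom_rel K (Rel₂.ser_scalar (δ := δ) (γ := γ) (s := s) c)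
  rwa [AlgHom.commutes] at this

theorem ser₂_add (f g : MvPowerSeries (Fin 2) K) :
    ser₂ δ γ s (f + g) = ser₂ δ γ s f + ser₂ δ γ s g := by
  have := RingQuot.mkAlgHom_rel K (Rel₂.ser_add (δ := δ) (γ := γ) (s := s) f g)
  rwa [map_add] at this

theorem ser₂_mul (f g : MvPowerSeries (Fin 2) K) :
    ser₂ δ γ s (f * g) = ser₂ δ γ s f * ser₂ δ γ s g := by
  have := RingQuot.mkAlgHom_rel K (Rel₂.ser_mul (δ := δ) (γ := γ) (s := s) f g)
  rwa [map_mul] at this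

variable (δ γ s) in
/-- `f ↦ f(X₀, X₁)` as an algebra morphism. -/
def serHom₂ : MvPowerSeries (Fin 2) K →ₐ[K] Alg₂ δ γ s where
  toFun := ser₂ δ γ s
  map_one' := by have := ser₂_C (δ := δ) (γ := γ) (s := s) (1 : K); rwa [map_one, map_one] at this
  map_mul' := ser₂_mul
  map_zero' := by
    have := ser₂_C (δ := δ) (γ := γ) (s := s) (0 : K); rwa [map_zero, map_zero] at this
  map_add' := ser₂_add
  commutes' c := ser₂_C c

theorem serHom₂_apply (f : MvPowerSeries (Fin 2) K) : serHom₂ δ γ s f = ser₂ δ γ s f := rfl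

theorem genH₂_mul_ser₂ (i : Fin 2) (f : MvPowerSeries (Fin 2) K) :
    genH₂ δ γ s i * ser₂ δ γ s f = ser₂ δ γ s f * genH₂ δ γ s i +
      ser₂ δ γ s (slot i δ * MvPowerSeries.pderiv K i f) := by
  have := RingQuot.mkAlgHom_rel K (Rel₂.H_ser (δ := δ) (γ := γ) (s := s) i f)
  rwa [map_add, map_mul, map_mul] at this

theorem genV₂_mul_ser₂ (i : Fin 2) (f : MvPowerSeries (Fin 2) K) :
    genV₂ δ γ s i * ser₂ δ γ s f = ser₂ δ γ s f * genV₂ δ γ s i := by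
  have := RingQuot.mkAlgHom_rel K (Rel₂.V_ser (δ := δ) (γ := γ) (s := s) i f)
  rwa [map_mul, map_mul] at this

theorem genH₂_mul_genV₂ (i : Fin 2) : genH₂ δ γ s i * genV₂ δ γ s i =
    genV₂ δ γ s i * genH₂ δ γ s i + genV₂ δ γ s i * ser₂ δ γ s (slot i γ) := by
  have := RingQuot.mkAlgHom_rel K (Rel₂.H_V (δ := δ) (γ := γ) (s := s) i)
  rwa [map_add, map_mul, map_mul, map_mul] at this

theorem genV₂_mul_genV₂ (i : Fin 2) :
    genV₂ δ γ s i * genV₂ δ γ s i = ser₂ δ γ s (slot i s) := by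
  have := RingQuot.mkAlgHom_rel K (Rel₂.V_V (δ := δ) (γ := γ) (s := s) i)
  rwa [map_mul] at this

theorem genH₂_comm : genH₂ δ γ s 0 * genH₂ δ γ s 1 = genH₂ δ γ s 1 * genH₂ δ γ s 0 := by
  have := RingQuot.mkAlgHom_rel K (Rel₂.comm_H_H (δ := δ) (γ := γ) (s := s))
  rwa [map_mul, map_mul] at this

theorem genH₂_comm_genV₂ {i j : Fin 2} (hij : i ≠ j) :
    genH₂ δ γ s i * genV₂ δ γ s j = genV₂ δ γ s j * genH₂ δ γ s i := by
  have := RingQuot.mkAlgHom_rel K (Rel₂.comm_H_V (δ := δ) (γ := γ) (s := s) i j hij)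
  rwa [map_mul, map_mul] at this

theorem genV₂_anticomm :
    genV₂ δ γ s 0 * genV₂ δ γ s 1 = -(genV₂ δ γ s 1 * genV₂ δ γ s 0) := by
  have := RingQuot.mkAlgHom_rel K (Rel₂.anticomm_V_V (δ := δ) (γ := γ) (s := s))
  rw [map_mul, map_neg, map_mul] at this
  exact this

variable {E : Type*} [Ring E] [Algebra K E]

/-- The relations of the tensor square for images of the generators in an algebra. -/
structure IsLift₂ (δ γ s : K⟦X⟧) (φ : MvPowerSeries (Fin 2) K →ₐ[K] E) (H V : Fin 2 → E) :
    Prop where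
  H_ser : ∀ i f, H i * φ f = φ f * H i + φ (slot i δ * MvPowerSeries.pderiv K i f)
  V_ser : ∀ i f, V i * φ f = φ f * V i
  H_V : ∀ i, H i * V i = V i * H i + V i * φ (slot i γ)
  V_V : ∀ i, V i * V i = φ (slot i s)
  comm_H_H : H 0 * H 1 = H 1 * H 0
  comm_H_V : ∀ i j, i ≠ j → H i * V j = V j * H i
  anticomm_V_V : V 0 * V 1 = -(V 1 * V 0)

/-- Algebra morphisms out of `Alg₂ δ γ s`. -/
def lift₂ {φ : MvPowerSeries (Fin 2) K →ₐ[K] E} {H V : Fin 2 → E} (h : IsLift₂ δ γ s φ H V) :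
    Alg₂ δ γ s →ₐ[K] E :=
  RingQuot.liftAlgHom K ⟨FreeAlgebra.lift K
    (fun g : Gen₂ K => match g with | .ser f => φ f | .H i => H i | .V i => V i), by
    rintro _ _ (c | ⟨f, g⟩ | ⟨f, g⟩ | ⟨i, f⟩ | ⟨i, f⟩ | i | i | _ | ⟨i, j, hij⟩ | _)
    · rw [FreeAlgebra.lift_ι_apply, AlgHom.commutes]
      exact φ.commutes c
    all_goals simp only [map_mul, map_add, map_neg, FreeAlgebra.lift_ι_apply]
    · rw [h.H_ser, map_mul]
    · exact h.V_ser i f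
    · exact h.H_V i
    · exact h.V_V i
    · exact h.comm_H_H
    · exact h.comm_H_V i j hij
    · exact h.anticomm_V_V⟩

section lift
variable {φ : MvPowerSeries (Fin 2) K →ₐ[K] E} {H V : Fin 2 → E} (h : IsLift₂ δ γ s φ H V)

theorem lift₂_ser₂ (f : MvPowerSeries (Fin 2) K) : lift₂ h (ser₂ δ γ s f) = φ f := by
  simp [lift₂, ser₂, RingQuot.liftAlgHom_mkAlgHom_apply]
theorem lift₂_genH₂ (i : Fin 2) : lift₂ h (genH₂ δ γ s i) = H i := by
  simp [lift₂, genH₂, RingQuot.liftAlgHom_mkAlgHom_apply]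
theorem lift₂_genV₂ (i : Fin 2) : lift₂ h (genV₂ δ γ s i) = V i := by
  simp [lift₂, genV₂, RingQuot.liftAlgHom_mkAlgHom_apply]
end lift

/-- A subalgebra of the tensor square that contains the generators is everything. -/
theorem mem_of_generators₂ (S : Subalgebra K (Alg₂ δ γ s)) (hs : ∀ f, ser₂ δ γ s f ∈ S)
    (hH : ∀ i, genH₂ δ γ s i ∈ S) (hV : ∀ i, genV₂ δ γ s i ∈ S) (a : Alg₂ δ γ s) : a ∈ S := by
  obtain ⟨b, rfl⟩ := RingQuot.mkAlgHom_surjective K (Rel₂ δ γ s) a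
  induction b using FreeAlgebra.induction with
  | grade0 r => rw [AlgHom.commutes]; exact S.algebraMap_mem r
  | grade1 x =>
    cases x
    · exact hs _
    · exact hH _
    · exact hV _
  | mul a b ha hb => rw [map_mul]; exact S.mul_mem ha hb
  | add a b ha hb => rw [map_add]; exact S.add_mem ha hb

/-- A subspace of the tensor square that contains `1` and is stable under right multiplication by
the generators is everything. -/
theorem mem_of_mul_right₂ (N : Submodule K (Alg₂ δ γ s)) (h1 : 1 ∈ N)
    (hs : ∀ f, ∀ a ∈ N, a * ser₂ δ γ s f ∈ N) (hH : ∀ i, ∀ a ∈ N, a * genH₂ δ γ s i ∈ N)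
    (hV : ∀ i, ∀ a ∈ N, a * genV₂ δ γ s i ∈ N) (a : Alg₂ δ γ s) : a ∈ N := by
  let S : Subalgebra K (Alg₂ δ γ s) :=
    { carrier := {b | ∀ a ∈ N, a * b ∈ N}
      mul_mem' := fun {x y} hx hy a ha => by rw [← mul_assoc]; exact hy _ (hx _ ha)
      add_mem' := fun {x y} hx hy a ha => by rw [mul_add]; exact N.add_mem (hx _ ha) (hy _ ha)
      algebraMap_mem' := fun r a ha => by
        rw [← Algebra.commutes, ← Algebra.smul_def]; exact N.smul_mem _ ha }
  have := mem_of_generators₂ S hs hH hV a 1 h1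
  rwa [one_mul] at this

/-- Left multiplication by `f(X₀, X₁)` makes `Alg₂ δ γ s` a module over the power series. -/
@[reducible] def serModule₂ : Module (MvPowerSeries (Fin 2) K) (Alg₂ δ γ s) :=
  Module.compHom _ (serHom₂ δ γ s).toRingHom

attribute [local instance] serModule₂

theorem smul_eq_ser₂_mul (f : MvPowerSeries (Fin 2) K) (a : Alg₂ δ γ s) :
    f • a = ser₂ δ γ s f * a := rfl

theorem serTower₂ : IsScalarTower K (MvPowerSeries (Fin 2) K) (Alg₂ δ γ s) where
  smul_assoc c f a := by
    rw [smul_eq_ser₂_mul, smul_eq_ser₂_mul, ← serHom₂_apply, map_smul, smul_mul_assoc]; rfl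

theorem smul₂_mul (f : MvPowerSeries (Fin 2) K) (a b : Alg₂ δ γ s) : f • a * b = f • (a * b) := by
  simp only [smul_eq_ser₂_mul, mul_assoc]

theorem genV₂_mul_smul (i : Fin 2) (f : MvPowerSeries (Fin 2) K) (a : Alg₂ δ γ s) :
    genV₂ δ γ s i * f • a = f • (genV₂ δ γ s i * a) := by
  simp only [smul_eq_ser₂_mul, ← mul_assoc, genV₂_mul_ser₂]

theorem genH₂_mul_smul (i : Fin 2) (f : MvPowerSeries (Fin 2) K) (a : Alg₂ δ γ s) :
    genH₂ δ γ s i * f • a = f • (genH₂ δ γ s i * a) +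
      (slot i δ * MvPowerSeries.pderiv K i f) • a := by
  simp only [smul_eq_ser₂_mul, ← mul_assoc, genH₂_mul_ser₂, add_mul]

theorem ser₂_eq_smul (f : MvPowerSeries (Fin 2) K) : ser₂ δ γ s f = f • (1 : Alg₂ δ γ s) := by
  rw [smul_eq_ser₂_mul, mul_one]

theorem genV₂_mul_genV₂_mul (i : Fin 2) (a : Alg₂ δ γ s) :
    genV₂ δ γ s i * (genV₂ δ γ s i * a) = slot i s • a := by
  rw [← mul_assoc, genV₂_mul_genV₂]; rfl

theorem genV₂_mul_genV₂' (i : Fin 2) :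
    genV₂ δ γ s i * genV₂ δ γ s i = slot i s • (1 : Alg₂ δ γ s) := by
  rw [genV₂_mul_genV₂, ser₂_eq_smul]

theorem genH₂_mul_genV₂' (i : Fin 2) : genH₂ δ γ s i * genV₂ δ γ s i =
    genV₂ δ γ s i * genH₂ δ γ s i + slot i γ • genV₂ δ γ s i := by
  rw [genH₂_mul_genV₂, genV₂_mul_ser₂]; rfl

/-- The element `H₀^k H₁^k' f(X₀, X₁) V₀^m V₁^m'`. -/
def mono₂ (δ γ s : K⟦X⟧) (i : (ℕ × Fin 2) × (ℕ × Fin 2)) (f : MvPowerSeries (Fin 2) K) :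
    Alg₂ δ γ s :=
  genH₂ δ γ s 0 ^ i.1.1 * genH₂ δ γ s 1 ^ i.2.1 * ser₂ δ γ s f *
    (genV₂ δ γ s 0 ^ (i.1.2 : ℕ) * genV₂ δ γ s 1 ^ (i.2.2 : ℕ))

/-- `expand₂` as a linear map. -/
def expandL₂ (δ γ s : K⟦X⟧) :
    ((ℕ × Fin 2) × (ℕ × Fin 2) →₀ MvPowerSeries (Fin 2) K) →ₗ[K] Alg₂ δ γ s :=
  Finsupp.lsum K fun i => LinearMap.mulRight K
    (genV₂ δ γ s 0 ^ (i.1.2 : ℕ) * genV₂ δ γ s 1 ^ (i.2.2 : ℕ)) ∘ₗ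
      LinearMap.mulLeft K (genH₂ δ γ s 0 ^ i.1.1 * genH₂ δ γ s 1 ^ i.2.1) ∘ₗ
        (serHom₂ δ γ s).toLinearMap

theorem expandL₂_single (i f) : expandL₂ δ γ s (Finsupp.single i f) = mono₂ δ γ s i f := by
  rw [expandL₂, Finsupp.lsum_single]; rfl

theorem genH₂_commute_pow (k k' : ℕ) :
    Commute (genH₂ δ γ s 0 ^ k) (genH₂ δ γ s 1 ^ k') :=
  Commute.pow_pow genH₂_comm k k'

/-- Moving `H_i` to the left of `V₀^m V₁^m'`. -/
theorem genV₂_pow_mul_genH₂ (i : Fin 2) (m m' : Fin 2) : ∃ g : MvPowerSeries (Fin 2) K,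
    genV₂ δ γ s 0 ^ (m : ℕ) * genV₂ δ γ s 1 ^ (m' : ℕ) * genH₂ δ γ s i =
      (genH₂ δ γ s i - ser₂ δ γ s g) * (genV₂ δ γ s 0 ^ (m : ℕ) * genV₂ δ γ s 1 ^ (m' : ℕ)) := by
  have h1 (i : Fin 2) : genV₂ δ γ s i * genH₂ δ γ s i =
      genH₂ δ γ s i * genV₂ δ γ s i - ser₂ δ γ s (slot i γ) * genV₂ δ γ s i := by
    rw [genH₂_mul_genV₂, genV₂_mul_ser₂]; abel
  have h0 : genV₂ δ γ s 1 * genH₂ δ γ s 0 = genH₂ δ γ s 0 * genV₂ δ γ s 1 :=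
    (genH₂_comm_genV₂ (by decide)).symm
  have h2 : genV₂ δ γ s 0 * genH₂ δ γ s 1 = genH₂ δ γ s 1 * genV₂ δ γ s 0 :=
    (genH₂_comm_genV₂ (by decide)).symm
  have hz : ser₂ δ γ s 0 = 0 := map_zero (serHom₂ δ γ s)
  fin_cases i <;> fin_cases m <;> fin_cases m'
  · exact ⟨0, by simp [hz]⟩
  · exact ⟨0, by simp [hz, h0]⟩
  · exact ⟨slot 0 γ, by simp [h1, sub_mul]⟩
  · refine ⟨slot 0 γ, ?_⟩
    simp only [Fin.zero_eta, pow_one]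
    rw [mul_assoc, h0, ← mul_assoc, h1, sub_mul, sub_mul, mul_assoc, mul_assoc]
  · exact ⟨0, by simp [hz]⟩
  · exact ⟨slot 1 γ, by simp [h1, sub_mul]⟩
  · exact ⟨0, by simp [hz, h2]⟩
  · refine ⟨slot 1 γ, ?_⟩
    simp only [Fin.mk_one, pow_one]
    rw [mul_assoc, h1, mul_sub, ← mul_assoc, h2, ← mul_assoc, genV₂_mul_ser₂, sub_mul, mul_assoc,
      mul_assoc]

/-- Normal ordering again; the only new phenomenon is the sign when `V₀` passes `V₁`. -/
theorem mem_of_mono₂ (N : Submodule K (Alg₂ δ γ s)) (hN : ∀ i f, mono₂ δ γ s i f ∈ N)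
    (a : Alg₂ δ γ s) : a ∈ N := by
  let N' : Submodule K (Alg₂ δ γ s) := Submodule.span K {a | ∃ i f, a = mono₂ δ γ s i f}
  have hN' : N' ≤ N := by
    apply Submodule.span_le.2
    rintro _ ⟨i, f, rfl⟩
    exact hN i f
  have hm : ∀ i f, mono₂ δ γ s i f ∈ N' := fun i f => Submodule.subset_span ⟨i, f, rfl⟩
  apply hN'
  have key (g : Alg₂ δ γ s) (hg : ∀ i f, mono₂ δ γ s i f * g ∈ N') : ∀ a ∈ N', a * g ∈ N' := by
    intro a ha
    have : N' ≤ N'.comap (LinearMap.mulRight K g) := by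
      apply Submodule.span_le.2
      rintro _ ⟨i, f, rfl⟩
      exact hg i f
    exact this ha
  have hV0 (i f) : mono₂ δ γ s i f * genV₂ δ γ s 0 ∈ N' := by
    obtain ⟨⟨k, m⟩, ⟨k', m'⟩⟩ := i
    have h10 : genV₂ δ γ s 1 * genV₂ δ γ s 0 = -(genV₂ δ γ s 0 * genV₂ δ γ s 1) := by
      rw [genV₂_anticomm, neg_neg]
    fin_cases m <;> fin_cases m'
    · convert hm ((k, 1), (k', 0)) f using 1
      simp [mono₂]
    · convert N'.neg_mem (hm ((k, 1), (k', 1)) f) using 1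
      simp [mono₂, mul_assoc, h10]
    · convert hm ((k, 0), (k', 0)) (f * slot 0 s) using 1
      simp [mono₂, mul_assoc, genV₂_mul_genV₂, ser₂_mul]
    · convert N'.neg_mem (hm ((k, 0), (k', 1)) (f * slot 0 s)) using 1
      simp [mono₂, mul_assoc, h10, ser₂_mul, ← genV₂_mul_genV₂]
  have hV1 (i f) : mono₂ δ γ s i f * genV₂ δ γ s 1 ∈ N' := by
    obtain ⟨⟨k, m⟩, ⟨k', m'⟩⟩ := i
    fin_cases m'
    · convert hm ((k, m), (k', 1)) f using 1
      simp [mono₂, mul_assoc]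
    · convert hm ((k, m), (k', 0)) (f * slot 1 s) using 1
      have : genV₂ δ γ s 0 ^ (m : ℕ) * ser₂ δ γ s (slot 1 s) =
          ser₂ δ γ s (slot 1 s) * genV₂ δ γ s 0 ^ (m : ℕ) := by
        fin_cases m <;> simp [genV₂_mul_ser₂]
      simp [mono₂, mul_assoc, genV₂_mul_genV₂, ser₂_mul, this]
  have hH (j : Fin 2) (k k' : ℕ) : ∃ i : ℕ × ℕ, genH₂ δ γ s 0 ^ k * genH₂ δ γ s 1 ^ k' *
      genH₂ δ γ s j = genH₂ δ γ s 0 ^ i.1 * genH₂ δ γ s 1 ^ i.2 := by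
    fin_cases j
    · refine ⟨(k + 1, k'), ?_⟩
      rw [pow_succ, mul_assoc, mul_assoc]
      congr 1
      simpa using (genH₂_commute_pow (δ := δ) (γ := γ) (s := s) 1 k').eq.symm
    · exact ⟨(k, k' + 1), by rw [pow_succ, mul_assoc]; rfl⟩
  apply mem_of_mul_right₂
  · convert hm ((0, 0), (0, 0)) 1 using 1
    simp [mono₂, ← serHom₂_apply]
  · intro g
    apply key
    rintro ⟨⟨k, m⟩, ⟨k', m'⟩⟩ f
    convert hm ((k, m), (k', m')) (f * g) using 1
    have : genV₂ δ γ s 0 ^ (m : ℕ) * genV₂ δ γ s 1 ^ (m' : ℕ) * ser₂ δ γ s g =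
        ser₂ δ γ s g * (genV₂ δ γ s 0 ^ (m : ℕ) * genV₂ δ γ s 1 ^ (m' : ℕ)) := by
      have h0 := genV₂_mul_ser₂ (δ := δ) (γ := γ) (s := s) 0 g
      have h1 := genV₂_mul_ser₂ (δ := δ) (γ := γ) (s := s) 1 g
      fin_cases m <;> fin_cases m' <;> simp [h0, h1]
      rw [mul_assoc, h1, ← mul_assoc, h0, mul_assoc]
    simp only [mono₂]
    rw [mul_assoc, this, ser₂_mul]
    simp only [mul_assoc]
  · intro j
    apply key
    rintro ⟨⟨k, m⟩, ⟨k', m'⟩⟩ f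
    obtain ⟨g, hg⟩ := genV₂_pow_mul_genH₂ (δ := δ) (γ := γ) (s := s) j m m'
    obtain ⟨i, hi⟩ := hH j k k'
    have h0 : ser₂ δ γ s f * genH₂ δ γ s j = genH₂ δ γ s j * ser₂ δ γ s f -
        ser₂ δ γ s (slot j δ * MvPowerSeries.pderiv K j f) := by rw [genH₂_mul_ser₂]; abel
    have : mono₂ δ γ s ((k, m), (k', m')) f * genH₂ δ γ s j =
        mono₂ δ γ s ((i.1, m), (i.2, m')) f -
        mono₂ δ γ s ((k, m), (k', m')) (slot j δ * MvPowerSeries.pderiv K j f) -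
        mono₂ δ γ s ((k, m), (k', m')) (f * g) := by
      simp only [mono₂]
      rw [mul_assoc _ _ (genH₂ δ γ s j), hg, ← hi, ser₂_mul f g]
      set W := genV₂ δ γ s 0 ^ (m : ℕ) * genV₂ δ γ s 1 ^ (m' : ℕ)
      set P := genH₂ δ γ s 0 ^ k * genH₂ δ γ s 1 ^ k'
      calc P * ser₂ δ γ s f * ((genH₂ δ γ s j - ser₂ δ γ s g) * W)
          = P * ((ser₂ δ γ s f * genH₂ δ γ s j) - ser₂ δ γ s f * ser₂ δ γ s g) * W := by
            simp only [mul_sub, sub_mul, mul_assoc]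
        _ = _ := by rw [h0]; simp only [mul_sub, sub_mul, mul_assoc]
    exact this ▸ N'.sub_mem (N'.sub_mem (hm _ _) (hm _ _)) (hm _ _)
  · intro j
    apply key
    fin_cases j
    · exact hV0
    · exact hV1

theorem expand₂_surjective : Function.Surjective (expand₂ δ γ s) := by
  intro a
  refine mem_of_mono₂ (LinearMap.range (expandL₂ δ γ s)) (fun i f => ?_) a
  exact ⟨Finsupp.single i f, expandL₂_single i f⟩

end Alg₂

/-! ### Exponential series and substitutions -/

theorem coeff_expS (c : K) (n : ℕ) : PowerSeries.coeff n (expS c) = c ^ n / n.factorial := by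
  rw [expS, PowerSeries.coeff_rescale, PowerSeries.coeff_exp]
  simp [div_eq_mul_inv]

theorem constantCoeff_expS (c : K) : PowerSeries.constantCoeff (expS c) = 1 := by
  rw [← PowerSeries.coeff_zero_eq_constantCoeff_apply, coeff_expS]; simp

theorem expS_zero : expS (0 : K) = 1 := by
  ext n
  rw [coeff_expS, PowerSeries.coeff_one]
  rcases eq_or_ne n 0 with rfl | hn <;> simp [*]

theorem expS_add (a b : K) : expS (a + b) = expS a * expS b :=
  (PowerSeries.exp_mul_exp_eq_exp_add a b).symm

theorem expS_mul_neg (c : K) : expS c * expS (-c) = 1 := by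
  rw [← expS_add, add_neg_cancel, expS_zero]

theorem derivative_expS (c : K) : PowerSeries.derivative K (expS c) = c • expS c := by
  ext n
  rw [PowerSeries.coeff_derivative, PowerSeries.coeff_smul, coeff_expS, coeff_expS,
    Nat.factorial_succ, smul_eq_mul]
  have : (n.factorial : K) ≠ 0 := by exact_mod_cast n.factorial_ne_zero
  have : (n + 1 : K) ≠ 0 := by exact_mod_cast n.succ_ne_zero
  push_cast
  field_simp
  ring

theorem rescale_expS (a c : K) : PowerSeries.rescale a (expS c) = expS (a * c) := by
  ext n
  rw [PowerSeries.coeff_rescale, coeff_expS, coeff_expS, mul_pow, mul_div_assoc]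

theorem derivative_rescale (a : K) (f : K⟦X⟧) : PowerSeries.derivative K (PowerSeries.rescale a f) =
    a • PowerSeries.rescale a (PowerSeries.derivative K f) := by
  ext n
  simp only [PowerSeries.coeff_derivative, PowerSeries.coeff_rescale, PowerSeries.coeff_smul,
    smul_eq_mul]
  ring

theorem slot_hasSubst (i : Fin 2) :
    PowerSeries.HasSubst (MvPowerSeries.X i : MvPowerSeries (Fin 2) K) := PowerSeries.HasSubst.X i

/-- `slot i` as an algebra morphism. -/
def slotHom (i : Fin 2) : K⟦X⟧ →ₐ[K] MvPowerSeries (Fin 2) K :=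
  PowerSeries.substAlgHom (slot_hasSubst i)

theorem slotHom_apply (i : Fin 2) (f : K⟦X⟧) : slotHom i f = slot i f := by
  rw [slotHom, PowerSeries.coe_substAlgHom]; rfl

theorem slot_mul (i : Fin 2) (f g : K⟦X⟧) : slot i (f * g) = slot i f * slot i g := by
  simp only [← slotHom_apply, map_mul]

theorem slot_X (i : Fin 2) : slot i (PowerSeries.X : K⟦X⟧) = MvPowerSeries.X i :=
  PowerSeries.subst_X (slot_hasSubst i)

theorem coeff_slot_zero (f : K⟦X⟧) (d : Fin 2 →₀ ℕ) :
    MvPowerSeries.coeff d (slot 0 f) = if d 1 = 0 then PowerSeries.coeff (d 0) f else 0 := by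
  rw [slot, PowerSeries.coeff_subst_single]
  congr 1
  simp [Finsupp.ext_iff, Fin.forall_fin_two]

theorem coeff_slot_one (f : K⟦X⟧) (d : Fin 2 →₀ ℕ) :
    MvPowerSeries.coeff d (slot 1 f) = if d 0 = 0 then PowerSeries.coeff (d 1) f else 0 := by
  rw [slot, PowerSeries.coeff_subst_single]
  congr 1
  simp [Finsupp.ext_iff, Fin.forall_fin_two]

theorem pderiv_slot_self (i : Fin 2) (f : K⟦X⟧) :
    MvPowerSeries.pderiv K i (slot i f) = slot i (PowerSeries.derivative K f) := by
  ext d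
  rw [MvPowerSeries.coeff_pderiv]
  fin_cases i <;> simp [coeff_slot_zero, coeff_slot_one, PowerSeries.coeff_derivative]

theorem pderiv_slot_of_ne {i j : Fin 2} (hij : i ≠ j) (f : K⟦X⟧) :
    MvPowerSeries.pderiv K i (slot j f) = 0 := by
  ext d
  rw [MvPowerSeries.coeff_pderiv]
  fin_cases i <;> fin_cases j <;> simp_all [coeff_slot_zero, coeff_slot_one]

theorem add_hasSubst :
    PowerSeries.HasSubst (MvPowerSeries.X 0 + MvPowerSeries.X 1 : MvPowerSeries (Fin 2) K) :=
  (slot_hasSubst 0).add (slot_hasSubst 1)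

/-- `f ↦ f(X₀ + X₁)`. -/
def addHom : K⟦X⟧ →ₐ[K] MvPowerSeries (Fin 2) K := PowerSeries.substAlgHom add_hasSubst

theorem addHom_apply (f : K⟦X⟧) : addHom f = PowerSeries.subst
    (MvPowerSeries.X 0 + MvPowerSeries.X 1 : MvPowerSeries (Fin 2) K) f := by
  rw [addHom, PowerSeries.coe_substAlgHom]

theorem addHom_X : addHom (PowerSeries.X : K⟦X⟧) = MvPowerSeries.X 0 + MvPowerSeries.X 1 := by
  rw [addHom_apply, PowerSeries.subst_X add_hasSubst]

theorem coeff_addHom (f : K⟦X⟧) (d : Fin 2 →₀ ℕ) : MvPowerSeries.coeff d (addHom f) =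
    (d 0 + d 1).choose (d 0) * PowerSeries.coeff (d 0 + d 1) f := by
  rw [addHom_apply, PowerSeries.coeff_subst_X_zero_add_X_one]

theorem pderiv_addHom (i : Fin 2) (f : K⟦X⟧) :
    MvPowerSeries.pderiv K i (addHom f) = addHom (PowerSeries.derivative K f) := by
  ext d
  rw [MvPowerSeries.coeff_pderiv, coeff_addHom, coeff_addHom, PowerSeries.coeff_derivative]
  fin_cases i
  -- The absorption identity `(n + 1) C(n, k) = C(n + 1, k + 1) (k + 1)`; the second variable needs
  -- it after replacing `k` by `n - k`.
  · have := Nat.add_one_mul_choose_eq (d 0 + d 1) (d 0)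
    have h : ((d 0 + d 1 + 1 : ℕ) : K) * ((d 0 + d 1).choose (d 0) : ℕ) =
      ((d 0 + d 1 + 1).choose (d 0 + 1) : ℕ) * ((d 0 + 1 : ℕ) : K) := by exact_mod_cast this
    simp only [Fin.zero_eta, Finsupp.coe_add, Pi.add_apply, Finsupp.single_eq_same]
    rw [Finsupp.single_eq_of_ne (by decide), add_zero, add_right_comm]
    push_cast at h ⊢
    linear_combination (-PowerSeries.coeff (d 0 + d 1 + 1) f) * h
  · have := Nat.add_one_mul_choose_eq (d 0 + d 1) (d 1)
    rw [Nat.choose_symm_of_eq_add (show d 0 + d 1 = d 1 + d 0 by omega),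
      Nat.choose_symm_of_eq_add (show d 0 + d 1 + 1 = (d 1 + 1) + d 0 by omega)] at this
    have h : ((d 0 + d 1 + 1 : ℕ) : K) * ((d 0 + d 1).choose (d 0) : ℕ) =
      ((d 0 + d 1 + 1).choose (d 0) : ℕ) * ((d 1 + 1 : ℕ) : K) := by exact_mod_cast this
    simp only [Fin.mk_one, Finsupp.coe_add, Pi.add_apply, Finsupp.single_eq_same]
    rw [Finsupp.single_eq_of_ne (by decide), add_zero, ← add_assoc]
    push_cast at h ⊢
    linear_combination (-PowerSeries.coeff (d 0 + d 1 + 1) f) * h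

/-- This is why the exponentials of `X` are group-like. On coefficients it is `C(m + n, m) / (m +
n)! = 1 / (m! n!)`. -/
theorem addHom_expS (c : K) : addHom (expS c) = slot 0 (expS c) * slot 1 (expS c) := by
  ext d
  rw [coeff_addHom, coeff_expS, slot, slot, PowerSeries.coeff_subst_X_zero_subst_mul_X_one,
    coeff_expS, coeff_expS, Nat.choose_symm_add, Nat.add_choose, Nat.cast_div
      (Nat.factorial_mul_factorial_dvd_factorial_add _ _)
      (by exact_mod_cast mul_ne_zero (Nat.factorial_ne_zero _) (Nat.factorial_ne_zero _))]
  have h1 : ((d 0).factorial : K) ≠ 0 := by exact_mod_cast Nat.factorial_ne_zero _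
  have h2 : ((d 1).factorial : K) ≠ 0 := by exact_mod_cast Nat.factorial_ne_zero _
  have h3 : ((d 0 + d 1).factorial : K) ≠ 0 := by exact_mod_cast Nat.factorial_ne_zero _
  push_cast
  field_simp
  ring

/-! ### Continuity -/

/-- A linear map on power series that vanishes on the powers of `X` and on some `(X ^ n)`
vanishes. -/
theorem series_ext {N : Type*} [AddCommGroup N] [Module K N] (L : K⟦X⟧ →ₗ[K] N) (n : ℕ)
    (hn : ∀ g, L (PowerSeries.X ^ n * g) = 0) (hX : ∀ l, L (PowerSeries.X ^ l) = 0) (f : K⟦X⟧) :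
    L f = 0 := by
  -- Modulo a multiple of `X^n` a series is a polynomial, that is, a finite combination of powers of
  -- `X`.
  rw [PowerSeries.eq_X_pow_mul_shift_add_trunc n f, map_add, hn, zero_add]
  rw [← Polynomial.coeToPowerSeries.ringHom_apply,
    Polynomial.as_sum_range (PowerSeries.trunc n f), map_sum, map_sum]
  refine Finset.sum_eq_zero fun i _ => ?_
  rw [Polynomial.coeToPowerSeries.ringHom_apply, Polynomial.coe_monomial,
    PowerSeries.monomial_eq_C_mul_X_pow]
  rw [← PowerSeries.smul_eq_C_mul, map_smul, hX, smul_zero]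

/-- Division by `X₀^n` with a remainder that is polynomial in `X₀` over the series in `X₁`; it
reduces continuity in two variables to continuity in one. -/
theorem series_decomp₂ (f : MvPowerSeries (Fin 2) K) (n : ℕ) : ∃ g : MvPowerSeries (Fin 2) K,
    f = ∑ i ∈ Finset.range n, MvPowerSeries.X 0 ^ i *
      slot 1 (PowerSeries.mk fun l =>
        MvPowerSeries.coeff (Finsupp.single 0 i + Finsupp.single 1 l) f) +
      MvPowerSeries.X 0 ^ n * g := by
  obtain ⟨g, hg⟩ : ∃ g : MvPowerSeries (Fin 2) K, ∀ d, MvPowerSeries.coeff d g =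
      MvPowerSeries.coeff (d + Finsupp.single 0 n) f :=
    ⟨fun d => MvPowerSeries.coeff (d + Finsupp.single 0 n) f, fun d => rfl⟩
  refine ⟨g, ?_⟩
  ext d
  have hd : d = Finsupp.single 0 (d 0) + Finsupp.single 1 (d 1) := by
    ext i; fin_cases i <;> simp
  have hle (i : ℕ) : Finsupp.single 0 i ≤ d ↔ i ≤ d 0 := by
    rw [Finsupp.single_le_iff]
  simp only [map_add, map_sum, MvPowerSeries.X_pow_eq, MvPowerSeries.coeff_monomial_mul, one_mul,
    coeff_slot_one, hle]
  by_cases h : d 0 < n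
  · rw [if_neg (not_le.2 h), add_zero, Finset.sum_eq_single (d 0)]
    · have h1 : (d - Finsupp.single 0 (d 0) : Fin 2 →₀ ℕ) 1 = d 1 := by simp
      rw [if_pos le_rfl, if_pos (by simp), PowerSeries.coeff_mk, h1, ← hd]
    · intro i _ hi
      split_ifs with h1 h2
      · rw [Finsupp.tsub_apply, Finsupp.single_eq_same] at h2
        omega
      all_goals rfl
    · intro h'
      exact absurd (Finset.mem_range.2 h) h'
  · rw [if_pos (not_lt.1 h), Finset.sum_eq_zero, zero_add]
    · rw [hg, tsub_add_cancel_of_le ((hle n).2 (not_lt.1 h))]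
    · intro i hi
      have := Finset.mem_range.1 hi
      rw [if_pos (by omega), if_neg]
      simp
      omega

/-- The two-variable density principle behind every later extension from monomials to series: divide
by `X₀^n`, then apply `series_ext` to each coefficient in `X₁`. -/
theorem series_ext₂ {N : Type*} [AddCommGroup N] [Module K N]
    (L : MvPowerSeries (Fin 2) K →ₗ[K] N) (n : ℕ)
    (h0 : ∀ g, L (MvPowerSeries.X 0 ^ n * g) = 0) (h1 : ∀ g, L (MvPowerSeries.X 1 ^ n * g) = 0)
    (hX : ∀ i j, L (MvPowerSeries.X 0 ^ i * MvPowerSeries.X 1 ^ j) = 0)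
    (f : MvPowerSeries (Fin 2) K) : L f = 0 := by
  obtain ⟨g, hg⟩ := series_decomp₂ f n
  rw [hg, map_add, h0, add_zero, map_sum]
  refine Finset.sum_eq_zero fun i _ => ?_
  have := series_ext (L ∘ₗ LinearMap.mulLeft K (MvPowerSeries.X 0 ^ i) ∘ₗ (slotHom 1).toLinearMap) n
  simp only [LinearMap.comp_apply, LinearMap.mulLeft_apply, AlgHom.toLinearMap_apply, map_mul,
    map_pow, slotHom_apply, slot_X] at this
  refine this (fun g => ?_) (fun l => hX i l) _
  rw [mul_left_comm]
  exact h1 _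

theorem monomial_eq_X_pow (d : Fin 2 →₀ ℕ) (c : K) : MvPowerSeries.monomial d c =
    c • (MvPowerSeries.X 0 ^ d 0 * MvPowerSeries.X 1 ^ d 1 : MvPowerSeries (Fin 2) K) := by
  have hd : d = Finsupp.single 0 (d 0) + Finsupp.single 1 (d 1) := by
    ext i; fin_cases i <;> simp
  rw [MvPowerSeries.X_pow_eq, MvPowerSeries.X_pow_eq, MvPowerSeries.monomial_mul_monomial, ← hd,
    one_mul, ← map_smul, smul_eq_mul, mul_one]

/-- A continuous linear map is the sum of its values on the terms of the series. -/
theorem series_eq_finsum₂ (L : MvPowerSeries (Fin 2) K →ₗ[K] K) (n : ℕ)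
    (h0 : ∀ g, L (MvPowerSeries.X 0 ^ n * g) = 0) (h1 : ∀ g, L (MvPowerSeries.X 1 ^ n * g) = 0)
    (f : MvPowerSeries (Fin 2) K) : L f = ∑ᶠ d : Fin 2 →₀ ℕ, MvPowerSeries.coeff d f *
      L (MvPowerSeries.X 0 ^ d 0 * MvPowerSeries.X 1 ^ d 1) := by
  have hv (d : Fin 2 →₀ ℕ) (hd : ¬ (d 0 < n ∧ d 1 < n)) :
      L (MvPowerSeries.X 0 ^ d 0 * MvPowerSeries.X 1 ^ d 1) = 0 := by
    by_cases h : n ≤ d 0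
    · obtain ⟨k, hk⟩ := Nat.exists_eq_add_of_le h
      rw [hk, pow_add, mul_assoc]; exact h0 _
    · obtain ⟨k, hk⟩ := Nat.exists_eq_add_of_le (show n ≤ d 1 by omega)
      rw [hk, pow_add, mul_left_comm]; exact h1 _
  -- The box of exponents below `n`; outside it `L` kills the monomial.
  set S : Finset (Fin 2 →₀ ℕ) := (Set.finite_Iic
    (Finsupp.single 0 n + Finsupp.single 1 n : Fin 2 →₀ ℕ)).toFinset.filter
      (fun d => d 0 < n ∧ d 1 < n) with hS
  have hmem (d : Fin 2 →₀ ℕ) : d ∈ S ↔ d 0 < n ∧ d 1 < n := by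
    simp only [hS, Finset.mem_filter, Set.Finite.mem_toFinset, Set.mem_Iic, and_iff_right_iff_imp]
    rintro ⟨h, h'⟩
    rw [Finsupp.le_def, Fin.forall_fin_two]
    simp
    omega
  have hs (f : MvPowerSeries (Fin 2) K) : ∑ᶠ d : Fin 2 →₀ ℕ, MvPowerSeries.coeff d f *
      L (MvPowerSeries.X 0 ^ d 0 * MvPowerSeries.X 1 ^ d 1) =
      ∑ d ∈ S, MvPowerSeries.coeff d f *
        L (MvPowerSeries.X 0 ^ d 0 * MvPowerSeries.X 1 ^ d 1) := by
    apply finsum_eq_sum_of_support_subset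
    intro d hd
    by_contra h
    exact hd (by simp only [hv d (fun h' => h ((hmem d).2 h')), mul_zero])
  rw [hs]
  -- The difference of the two sides. It still vanishes on multiples of `X_i^n`, because such a
  -- series has no coefficient inside the box, so `series_ext₂` applies.
  let L' : MvPowerSeries (Fin 2) K →ₗ[K] K := L - ∑ d ∈ S,
    L (MvPowerSeries.X 0 ^ d 0 * MvPowerSeries.X 1 ^ d 1) • MvPowerSeries.coeff d
  have h := series_ext₂ L' n (fun g => ?_) (fun g => ?_) (fun i j => ?_) f
  · simpa [L', sub_eq_zero, mul_comm] using h
  · simp only [L', LinearMap.sub_apply, h0, LinearMap.sum_apply, LinearMap.smul_apply, zero_sub,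
      neg_eq_zero]
    refine Finset.sum_eq_zero fun d hd => ?_
    rw [MvPowerSeries.X_pow_eq 0 n, MvPowerSeries.coeff_monomial_mul, if_neg, smul_zero]
    rw [Finsupp.single_le_iff]
    have := (hmem d).1 hd
    omega
  · simp only [L', LinearMap.sub_apply, h1, LinearMap.sum_apply, LinearMap.smul_apply, zero_sub,
      neg_eq_zero]
    refine Finset.sum_eq_zero fun d hd => ?_
    rw [MvPowerSeries.X_pow_eq 1 n, MvPowerSeries.coeff_monomial_mul, if_neg, smul_zero]
    rw [Finsupp.single_le_iff]
    have := (hmem d).1 hd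
    omega
  · classical
    set e : Fin 2 →₀ ℕ := Finsupp.single 0 i + Finsupp.single 1 j
    have e0 : e 0 = i := by simp [e]
    have e1 : e 1 = j := by simp [e]
    have he := monomial_eq_X_pow e (1 : K)
    rw [one_smul, e0, e1] at he
    simp only [L', LinearMap.sub_apply, LinearMap.sum_apply, LinearMap.smul_apply,
      ← he, MvPowerSeries.coeff_monomial, smul_eq_mul, mul_ite, mul_one, mul_zero,
      Finset.sum_ite_eq', e0, e1]
    split_ifs with h
    · exact sub_self _
    · rw [he, ← e0, ← e1, hv e (fun h' => h ((hmem e).2 h')), sub_zero]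

/-! ### Power series in two commuting locally nilpotent operators -/

section act
variable {N : Type*} [AddCommGroup N] [Module K N]

/-- Two commuting locally nilpotent operators. -/
structure LocNil (D : Fin 2 → Module.End K N) : Prop where
  comm : Commute (D 0) (D 1)
  nil : ∀ v, ∃ n, ∀ i, (D i ^ n) v = 0

namespace LocNil
variable {D : Fin 2 → Module.End K N} (h : LocNil D)
include h

theorem nil_of_le {i : Fin 2} {v : N} {n m : ℕ} (hn : (D i ^ n) v = 0) (hm : n ≤ m) :
    (D i ^ m) v = 0 := by
  obtain ⟨k, rfl⟩ := Nat.exists_eq_add_of_le hm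
  rw [add_comm, pow_add, Module.End.mul_apply, hn, map_zero]

theorem monomial_apply_eq_zero {v : N} {n : ℕ} (hn : ∀ i, (D i ^ n) v = 0) {a b : ℕ}
    (hab : n ≤ a ∨ n ≤ b) : (D 0 ^ a * D 1 ^ b) v = 0 := by
  rcases hab with ha | hb
  · rw [(h.comm.pow_pow a b).eq, Module.End.mul_apply, h.nil_of_le (hn 0) ha, map_zero]
  · rw [Module.End.mul_apply, h.nil_of_le (hn 1) hb, map_zero]

theorem finite_support (f : MvPowerSeries (Fin 2) K) (v : N) :
    (Function.support fun d : Fin 2 →₀ ℕ =>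
      MvPowerSeries.coeff d f • (D 0 ^ d 0 * D 1 ^ d 1) v).Finite := by
  obtain ⟨n, hn⟩ := h.nil v
  refine (Set.finite_Iic (Finsupp.single 0 n + Finsupp.single 1 n : Fin 2 →₀ ℕ)).subset ?_
  intro d hd
  by_contra hd'
  refine hd ?_
  simp only
  rw [h.monomial_apply_eq_zero hn, smul_zero]
  by_contra h'
  push Not at h'
  apply hd'
  rw [Set.mem_Iic, Finsupp.le_def, Fin.forall_fin_two]
  simp
  omega

/-- The linear map `f ↦ f(D₀, D₁)`. -/
def actL : MvPowerSeries (Fin 2) K →ₗ[K] Module.End K N where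
  toFun f :=
    { toFun := fun v => ∑ᶠ d : Fin 2 →₀ ℕ, MvPowerSeries.coeff d f • (D 0 ^ d 0 * D 1 ^ d 1) v
      map_add' := fun v w => by
        rw [← finsum_add_distrib (h.finite_support f v) (h.finite_support f w)]
        simp only [map_add, smul_add]
      map_smul' := fun c v => by
        rw [RingHom.id_apply, smul_finsum' _ (h.finite_support f v)]
        simp only [map_smul, smul_comm c] }
  map_add' f g := by
    ext v
    simp only [LinearMap.coe_mk, AddHom.coe_mk, LinearMap.add_apply]
    rw [← finsum_add_distrib (h.finite_support f v) (h.finite_support g v)]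
    simp only [map_add, add_smul]
  map_smul' c f := by
    ext v
    simp only [LinearMap.coe_mk, AddHom.coe_mk, LinearMap.smul_apply, RingHom.id_apply]
    rw [smul_finsum' _ (h.finite_support f v)]
    simp only [map_smul, smul_eq_mul, mul_smul]

theorem actL_apply (f : MvPowerSeries (Fin 2) K) (v : N) : h.actL f v =
    ∑ᶠ d : Fin 2 →₀ ℕ, MvPowerSeries.coeff d f • (D 0 ^ d 0 * D 1 ^ d 1) v := rfl

theorem actL_X_pow (a b : ℕ) :
    h.actL (MvPowerSeries.X 0 ^ a * MvPowerSeries.X 1 ^ b) = D 0 ^ a * D 1 ^ b := by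
  classical
  ext v
  set e : Fin 2 →₀ ℕ := Finsupp.single 0 a + Finsupp.single 1 b
  have e0 : e 0 = a := by simp [e]
  have e1 : e 1 = b := by simp [e]
  have he := monomial_eq_X_pow e (1 : K)
  rw [one_smul, e0, e1] at he
  rw [← he, actL_apply, finsum_eq_single _ e]
  · rw [MvPowerSeries.coeff_monomial, if_pos rfl, one_smul, e0, e1]
  · intro d hd
    rw [MvPowerSeries.coeff_monomial, if_neg hd, zero_smul]

theorem actL_X_pow_mul (i : Fin 2) {n : ℕ} {v : N} (hn : ∀ i, (D i ^ n) v = 0) {m : ℕ}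
    (hm : n ≤ m) (g : MvPowerSeries (Fin 2) K) : h.actL (MvPowerSeries.X i ^ m * g) v = 0 := by
  rw [actL_apply]
  refine finsum_eq_zero_of_forall_eq_zero fun d => ?_
  rw [MvPowerSeries.X_pow_eq, MvPowerSeries.coeff_monomial_mul]
  split_ifs with hd
  · rw [Finsupp.single_le_iff] at hd
    rw [h.monomial_apply_eq_zero hn, smul_zero]
    fin_cases i
    · exact Or.inl (hm.trans hd)
    · exact Or.inr (hm.trans hd)
  · rw [zero_smul]

/-- Multiplicativity is reached in two stages: here the second factor is a monomial and continuity
in `f` is used; in `act` the second factor is arbitrary and this lemma is the monomial case. -/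
theorem actL_mul_X_pow (f : MvPowerSeries (Fin 2) K) (a b : ℕ) :
    h.actL (f * (MvPowerSeries.X 0 ^ a * MvPowerSeries.X 1 ^ b)) =
      h.actL f * (D 0 ^ a * D 1 ^ b) := by
  ext v
  obtain ⟨n, hn⟩ := h.nil v
  obtain ⟨n', hn'⟩ := h.nil ((D 0 ^ a * D 1 ^ b) v)
  let L : MvPowerSeries (Fin 2) K →ₗ[K] N :=
    LinearMap.applyₗ v ∘ₗ h.actL ∘ₗ
      LinearMap.mulRight K (MvPowerSeries.X 0 ^ a * MvPowerSeries.X 1 ^ b) -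
    LinearMap.applyₗ ((D 0 ^ a * D 1 ^ b) v) ∘ₗ h.actL
  have hL (f) : L f = h.actL (f * (MvPowerSeries.X 0 ^ a * MvPowerSeries.X 1 ^ b)) v -
      h.actL f ((D 0 ^ a * D 1 ^ b) v) := rfl
  have := series_ext₂ L (max n n') (fun g => ?_) (fun g => ?_) (fun i j => ?_) f
  · rw [hL, sub_eq_zero] at this
    exact this
  · rw [hL, mul_assoc, h.actL_X_pow_mul 0 hn (le_max_left _ _),
      h.actL_X_pow_mul 0 hn' (le_max_right _ _), sub_zero]
  · rw [hL, mul_assoc, h.actL_X_pow_mul 1 hn (le_max_left _ _),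
      h.actL_X_pow_mul 1 hn' (le_max_right _ _), sub_zero]
  · rw [hL, sub_eq_zero, mul_mul_mul_comm, ← pow_add, ← pow_add, h.actL_X_pow, h.actL_X_pow,
      ← Module.End.mul_apply, pow_add, pow_add]
    congr 1
    rw [mul_assoc, mul_assoc, ← mul_assoc (D 0 ^ a), (h.comm.pow_pow a j).eq, mul_assoc]

/-- The algebra morphism `f ↦ f(D₀, D₁)`. -/
def act : MvPowerSeries (Fin 2) K →ₐ[K] Module.End K N :=
  AlgHom.ofLinearMap h.actL (by simpa using h.actL_X_pow 0 0) (by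
    intro f g
    ext v
    obtain ⟨n, hn⟩ := h.nil v
    let L : MvPowerSeries (Fin 2) K →ₗ[K] N :=
      LinearMap.applyₗ v ∘ₗ h.actL ∘ₗ LinearMap.mulLeft K f - h.actL f ∘ₗ
        LinearMap.applyₗ v ∘ₗ h.actL
    have hL (g) : L g = h.actL (f * g) v - h.actL f (h.actL g v) := rfl
    have := series_ext₂ L n (fun g => ?_) (fun g => ?_) (fun i j => ?_) g
    · rw [hL, sub_eq_zero] at this
      exact this
    · rw [hL, mul_left_comm, h.actL_X_pow_mul 0 hn le_rfl, h.actL_X_pow_mul 0 hn le_rfl, map_zero,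
        sub_zero]
    · rw [hL, mul_left_comm, h.actL_X_pow_mul 1 hn le_rfl, h.actL_X_pow_mul 1 hn le_rfl, map_zero,
        sub_zero]
    · rw [hL, h.actL_mul_X_pow, h.actL_X_pow, Module.End.mul_apply, sub_self])

theorem act_X_pow (a b : ℕ) :
    h.act (MvPowerSeries.X 0 ^ a * MvPowerSeries.X 1 ^ b) = D 0 ^ a * D 1 ^ b := h.actL_X_pow a b

theorem act_X (i : Fin 2) : h.act (MvPowerSeries.X i) = D i := by
  fin_cases i
  · simpa using h.act_X_pow 1 0
  · simpa using h.act_X_pow 0 1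

theorem act_X_pow_mul (i : Fin 2) {n : ℕ} {v : N} (hn : ∀ i, (D i ^ n) v = 0) {m : ℕ}
    (hm : n ≤ m) (g : MvPowerSeries (Fin 2) K) : h.act (MvPowerSeries.X i ^ m * g) v = 0 :=
  h.actL_X_pow_mul i hn hm g

end LocNil

end act

attribute [local instance] serModule serTower serTower'

instance natAlgebraPowerSeries : Algebra ℕ K⟦X⟧ := Semiring.toNatAlgebra

instance intAlgebraPowerSeries : Algebra ℤ K⟦X⟧ := Ring.toIntAlgebra _

/-! ### The algebra `A` and the action of the Borel subalgebra on it -/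

/-- The constant coefficient as an algebra morphism. -/
def constHom : K⟦X⟧ →ₐ[K] K :=
  { PowerSeries.constantCoeff with commutes' := fun c => PowerSeries.constantCoeff_C c }

theorem constHom_apply (f : K⟦X⟧) : constHom f = PowerSeries.constantCoeff f := rfl

section upper
variable {E : Type*} [Ring E]

/-- Upper triangular matrices of size 3. -/
def upper (a b c d e f : E) : Matrix (Fin 3) (Fin 3) E := !![a, b, c; 0, d, e; 0, 0, f]

theorem upper_mul (a b c d e f a' b' c' d' e' f' : E) :
    upper a b c d e f * upper a' b' c' d' e' f' = upper (a * a') (a * b' + b * d')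
      (a * c' + b * e' + c * f') (d * d') (d * e' + e * f') (f * f') := by
  ext i j
  fin_cases i <;> fin_cases j <;> simp [upper, Matrix.mul_apply, Fin.sum_univ_three]

theorem upper_add (a b c d e f a' b' c' d' e' f' : E) :
    upper a b c d e f + upper a' b' c' d' e' f' =
      upper (a + a') (b + b') (c + c') (d + d') (e + e') (f + f') := by
  ext i j
  fin_cases i <;> fin_cases j <;> simp [upper]

theorem upper_zero : upper (0 : E) 0 0 0 0 0 = 0 := by
  ext i j
  fin_cases i <;> fin_cases j <;> simp [upper]

theorem upper_one : upper (1 : E) 0 0 1 0 1 = 1 := by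
  ext i j
  fin_cases i <;> fin_cases j <;> simp [upper]

theorem upper_algebraMap [Algebra K E] (c : K) :
    upper (algebraMap K E c) 0 0 (algebraMap K E c) 0 (algebraMap K E c) =
      algebraMap K (Matrix (Fin 3) (Fin 3) E) c := by
  ext i j
  fin_cases i <;> fin_cases j <;> simp [upper, Matrix.algebraMap_matrix_apply]

end upper

namespace A
variable (h : K)

/-- The series `2h(1 - e^{-x})`. -/
abbrev dl : K⟦X⟧ := (2 * h) • (1 - expS (-1 : K))
/-- The series `h e^{-x}`. -/
abbrev gm : K⟦X⟧ := h • expS (-1 : K)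

theorem derivative_dl : PowerSeries.derivative K (dl h) = (2 * h) • expS (-1 : K) := by
  rw [Derivation.map_smul, map_sub, derivative_expS, Derivation.map_one_eq_zero]
  simp

theorem derivative_gm : PowerSeries.derivative K (gm h) = -gm h := by
  rw [Derivation.map_smul, derivative_expS]
  simp

/-- `f ↦ f(x)`. -/
def serHom : K⟦X⟧ →ₐ[K] A h := OspBorel.serHom _ _ _

variable {h}

theorem serHom_apply (f : K⟦X⟧) : serHom h f = ser h f := rfl
theorem ser_eq_smul (f : K⟦X⟧) : ser h f = f • (1 : A h) := OspBorel.ser_eq_smul f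
theorem smul_eq_ser_mul (f : K⟦X⟧) (a : A h) : f • a = ser h f * a := rfl
theorem ser_one : ser h 1 = 1 := map_one (serHom h)
theorem ser_mul (f g : K⟦X⟧) : ser h (f * g) = ser h f * ser h g := OspBorel.ser_mul f g
theorem ser_smul (c : K) (f : K⟦X⟧) : ser h (c • f) = c • ser h f := map_smul (serHom h) c f
theorem y_mul_smul (f : K⟦X⟧) (a : A h) :
    y h * f • a = f • (y h * a) + (dl h * PowerSeries.derivative K f) • a :=
  OspBorel.genH_mul_smul f a
theorem z_mul_smul (f : K⟦X⟧) (a : A h) : z h * f • a = f • (z h * a) :=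
  OspBorel.genV_mul_smul f a
theorem y_mul_z : y h * z h = z h * y h + gm h • z h := OspBorel.genH_mul_genV'
theorem z_mul_z : z h * z h = dl h • 1 := by
  rw [← ser_eq_smul]; exact OspBorel.genV_mul_genV
theorem y_mul_ser (f : K⟦X⟧) :
    y h * ser h f = ser h f * y h + ser h (dl h * PowerSeries.derivative K f) :=
  OspBorel.genH_mul_ser f
theorem z_mul_ser (f : K⟦X⟧) : z h * ser h f = ser h f * z h := OspBorel.genV_mul_ser f

theorem algHom_ext {E : Type*} [Ring E] [Algebra K E] {F G : A h →ₐ[K] E}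
    (hs : ∀ f, F (ser h f) = G (ser h f)) (hH : F (y h) = G (y h)) (hV : F (z h) = G (z h)) :
    F = G := OspBorel.algHom_ext hs hH hV

theorem linearMap_eq_of_mul_right {M : Type*} [AddCommGroup M] [Module K M]
    (F G : A h →ₗ[K] M) (h1 : F 1 = G 1)
    (hs : ∀ f a, F a = G a → F (a * ser h f) = G (a * ser h f))
    (hH : ∀ a, F a = G a → F (a * y h) = G (a * y h))
    (hV : ∀ a, F a = G a → F (a * z h) = G (a * z h)) (a : A h) : F a = G a :=
  OspBorel.linearMap_eq_of_mul_right F G h1 hs hH hV a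

theorem mem_of_mul_right (N : Submodule K (A h)) (h1 : 1 ∈ N)
    (hs : ∀ f, ∀ a ∈ N, a * ser h f ∈ N) (hH : ∀ a ∈ N, a * y h ∈ N)
    (hV : ∀ a ∈ N, a * z h ∈ N) (a : A h) : a ∈ N :=
  OspBorel.mem_of_mul_right N h1 hs hH hV a

variable (h)

/-- The parity automorphism of `A`. -/
def par : A h →ₐ[K] A h := parity _ _ _

/-- The counit of `A`. -/
def counit : A h →ₐ[K] K :=
  lift constHom 0 0 (by intro f; simp [constHom_apply, constantCoeff_expS]) (by intro f; simp)
    (by simp) (by simp [constHom_apply, constantCoeff_expS])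

variable {h}
theorem par_ser (f : K⟦X⟧) : par h (ser h f) = ser h f := parity_ser f
theorem par_y : par h (y h) = y h := parity_genH
theorem par_z : par h (z h) = -z h := parity_genV
theorem counit_ser (f : K⟦X⟧) : counit h (ser h f) = PowerSeries.constantCoeff f := lift_ser ..
theorem counit_y : counit h (y h) = 0 := lift_genH ..
theorem counit_z : counit h (z h) = 0 := lift_genV ..

theorem counit_par (a : A h) : counit h (par h a) = counit h a := by
  have : (counit h).comp (par h) = counit h := by
    apply algHom_ext <;> simp [par_ser, par_y, par_z, counit_z]
  exact DFunLike.congr_fun this a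

theorem par_par (a : A h) : par h (par h a) = a := parity_parity a

variable (h)

/-- The matrices of `f(x)` under `lam`. -/
def lamSer : K⟦X⟧ →ₐ[K] Matrix (Fin 3) (Fin 3) (A h) where
  -- The corner entry will be the action of `H` on `f(x)`, namely `f'(x)`; multiplicativity is the
  -- Leibniz rule.
  toFun f := upper (ser h f) 0 (ser h (PowerSeries.derivative K f)) (ser h f) 0 (ser h f)
  map_one' := by simp [← serHom_apply, upper_one]
  map_zero' := by simp [← serHom_apply, upper_zero]
  map_add' f g := by simp [← serHom_apply, upper_add]
  map_mul' f g := by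
    simp only [upper_mul, ← serHom_apply, ← map_mul, ← map_add, Derivation.leibniz, smul_eq_mul,
      mul_zero, zero_mul, add_zero]
    rw [mul_comm g]
  commutes' c := by
    have : PowerSeries.derivative K (algebraMap K K⟦X⟧ c) = 0 := Derivation.map_algebraMap _ _
    simp only [this, ← serHom_apply, map_zero, AlgHom.commutes, upper_algebraMap]

theorem lamSer_apply (f : K⟦X⟧) : lamSer h f =
    upper (ser h f) 0 (ser h (PowerSeries.derivative K f)) (ser h f) 0 (ser h f) := rfl

/-- The matrix of `y` under `lam`. -/
def lamY : Matrix (Fin 3) (Fin 3) (A h) :=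
  -- These are the values at `y` of the six operators that appear in `lam_eq`: `T y = y + h`, `W y =
  -- z / 4`, `H y = -y`, the parity, `2h` times the parity of `W T⁻¹ y`, and `T⁻¹ y = y - h`.
  upper (y h + h • 1) ((1 / 4 : K) • z h) (-y h) (y h) (-(h / 2) • z h) (y h - h • 1)

/-- The matrix of `z` under `lam`. -/
def lamZ : Matrix (Fin 3) (Fin 3) (A h) :=
  -- The values of the same operators at `z`: `T z = z`, `W z = 1`, `H z = -z / 2`; the parity gives
  -- `-z`.
  upper (z h) 1 (-(1 / 2 : K) • z h) (-z h) ((2 * h) • 1) (z h)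


/-- Among the power series the fractions `1/2` and `1/4` occur only as images of scalars; this and
the next fact are the arithmetic that closes the coefficient identities for `lamZ`. -/
theorem algebraMap_quarter_mul : algebraMap K K⟦X⟧ (1 / 4) * 4 = 1 := by
  rw [← map_ofNat (algebraMap K K⟦X⟧) 4, ← map_mul, ← map_one (algebraMap K K⟦X⟧)]
  norm_num

theorem algebraMap_half : algebraMap K K⟦X⟧ (1 / 2) = algebraMap K K⟦X⟧ (1 / 4) * 2 := by
  rw [← map_ofNat (algebraMap K K⟦X⟧) 2, ← map_mul]
  norm_num

theorem cast_eq_algebraMap (c : K) : (Algebra.cast c : K⟦X⟧) = algebraMap K K⟦X⟧ c := rfl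

/-- The relations of `A` for the matrices are checked entry by entry: series are moved to the left
of `y` and `z`, and the coefficients of each word are compared. -/
theorem lamY_mul_lamSer (f : K⟦X⟧) : lamY h * lamSer h f =
    lamSer h f * lamY h + lamSer h (dl h * PowerSeries.derivative K f) := by
  rw [lamSer_apply, lamSer_apply, lamY, upper_mul, upper_mul, upper_add]
  simp only [Derivation.leibniz, derivative_dl]
  congr 1 <;> simp only [ser_eq_smul, mul_add, add_mul, mul_sub, sub_mul, neg_mul, mul_neg, mul_one,
    one_mul, mul_zero, zero_mul, add_zero, zero_add, smul_mul_assoc, mul_smul_comm, y_mul_smul,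
    z_mul_smul, smul_eq_mul] <;> match_scalars <;>
    (try simp only [Algebra.smul_def, map_mul, map_ofNat, map_neg]) <;> try ring1

theorem lamZ_mul_lamSer (f : K⟦X⟧) : lamZ h * lamSer h f = lamSer h f * lamZ h := by
  rw [lamSer_apply, lamZ, upper_mul, upper_mul]
  congr 1 <;> simp only [ser_eq_smul, mul_add, add_mul, mul_sub, sub_mul, neg_mul, mul_neg, mul_one,
    one_mul, mul_zero, zero_mul, add_zero, zero_add, smul_mul_assoc, mul_smul_comm, y_mul_smul,
    z_mul_smul, smul_eq_mul] <;> match_scalars <;>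
    (try simp only [Algebra.smul_def, map_mul, map_ofNat, map_neg]) <;> try ring1

theorem lamY_mul_lamZ : lamY h * lamZ h = lamZ h * lamY h + lamZ h * lamSer h (gm h) := by
  rw [lamSer_apply, lamZ, lamY, upper_mul, upper_mul, upper_mul, upper_add, derivative_gm]
  congr 1 <;> simp only [ser_eq_smul, mul_add, add_mul, mul_sub, sub_mul, neg_mul, mul_neg, mul_one,
    one_mul, mul_zero, zero_mul, add_zero, zero_add, smul_mul_assoc, mul_smul_comm, y_mul_smul,
    z_mul_smul, y_mul_z, z_mul_z, smul_eq_mul] <;> match_scalars <;>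
    (try simp only [Algebra.smul_def, map_mul, map_ofNat, map_neg]) <;> try ring1
  all_goals
    simp only [cast_eq_algebraMap, map_mul, div_eq_mul_one_div h 2, algebraMap_half]
    generalize algebraMap K K⟦X⟧ h = c, (expS (-1) : K⟦X⟧) = e
    have hq := algebraMap_quarter_mul (K := K)
    first
      | linear_combination (-(c * (1 - e))) * hq
      | linear_combination (-2 * c * (1 - e)) * hq
      | linear_combination (-2 * c ^ 2 * (1 - e)) * hq
      | ring1

theorem lamZ_mul_lamZ : lamZ h * lamZ h = lamSer h (dl h) := by
  rw [lamSer_apply, lamZ, upper_mul, derivative_dl]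
  congr 1 <;> simp only [ser_eq_smul, mul_add, add_mul, mul_sub, sub_mul, neg_mul, mul_neg, mul_one,
    one_mul, mul_zero, zero_mul, add_zero, zero_add, smul_mul_assoc, mul_smul_comm, y_mul_smul,
    z_mul_smul, y_mul_z, z_mul_z, smul_eq_mul] <;> match_scalars <;>
    (try simp only [Algebra.smul_def, map_mul, map_ofNat, map_neg]) <;> try ring1
  all_goals
    simp only [cast_eq_algebraMap, map_mul, div_eq_mul_one_div h 2, algebraMap_half]
    generalize algebraMap K K⟦X⟧ h = c, (expS (-1) : K⟦X⟧) = e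
    have hq := algebraMap_quarter_mul (K := K)
    first
      | linear_combination (-(c * (1 - e))) * hq
      | linear_combination (-2 * c * (1 - e)) * hq

end A

namespace LocNil
variable {N N' : Type*} [AddCommGroup N] [Module K N] [AddCommGroup N'] [Module K N']

/-- A linear map that intertwines `D` and `D'` intertwines the actions of power series. -/
theorem act_intertwine {D : Fin 2 → Module.End K N} (h : LocNil D) {D' : Fin 2 → Module.End K N'}
    (h' : LocNil D') (R : N →ₗ[K] N') (hR : ∀ i v, R (D i v) = D' i (R v))
    (f : MvPowerSeries (Fin 2) K) (v : N) : R (h.act f v) = h'.act f (R v) := by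
  obtain ⟨n, hn⟩ := h.nil v
  obtain ⟨n', hn'⟩ := h'.nil (R v)
  let L : MvPowerSeries (Fin 2) K →ₗ[K] N' :=
    R ∘ₗ LinearMap.applyₗ v ∘ₗ h.act.toLinearMap -
      LinearMap.applyₗ (R v) ∘ₗ h'.act.toLinearMap
  have hL (g) : L g = R (h.act g v) - h'.act g (R v) := rfl
  have hpow (i : Fin 2) (k : ℕ) (w : N) : R ((D i ^ k) w) = (D' i ^ k) (R w) := by
    induction k generalizing w with
    | zero => rfl
    | succ k ih => rw [pow_succ, pow_succ, Module.End.mul_apply, ih, hR, Module.End.mul_apply]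
  have := series_ext₂ L (max n n') (fun g => ?_) (fun g => ?_) (fun i j => ?_) f
  · rwa [hL, sub_eq_zero] at this
  · rw [hL, h.act_X_pow_mul 0 hn (le_max_left _ _), h'.act_X_pow_mul 0 hn' (le_max_right _ _),
      map_zero, sub_zero]
  · rw [hL, h.act_X_pow_mul 1 hn (le_max_left _ _), h'.act_X_pow_mul 1 hn' (le_max_right _ _),
      map_zero, sub_zero]
  · rw [hL, h.act_X_pow, h'.act_X_pow, Module.End.mul_apply, Module.End.mul_apply, hpow, hpow,
      sub_self]

end LocNil

namespace A
variable (h : K)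

/-! ### The matrix representation `lam` and the derivation `∂/∂y` -/

/-- A morphism from `A` to matrices over `A`; its first row encodes operators on `A`. -/
def lam : A h →ₐ[K] Matrix (Fin 3) (Fin 3) (A h) :=
  lift (lamSer h) (lamY h) (lamZ h) (lamY_mul_lamSer h) (lamZ_mul_lamSer h) (lamY_mul_lamZ h)
    (lamZ_mul_lamZ h)

theorem lam_ser (f : K⟦X⟧) : lam h (ser h f) =
    upper (ser h f) 0 (ser h (PowerSeries.derivative K f)) (ser h f) 0 (ser h f) := lift_ser ..
theorem lam_y : lam h (y h) = upper (y h + h • 1) ((1 / 4 : K) • z h) (-y h) (y h)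
    (-(h / 2) • z h) (y h - h • 1) := lift_genH ..
theorem lam_z : lam h (z h) =
    upper (z h) 1 (-(1 / 2 : K) • z h) (-z h) ((2 * h) • 1) (z h) := lift_genV ..

/-- The entries of the first row of `lam`. -/
def row (j : Fin 3) : Module.End K (A h) :=
  LinearMap.proj j ∘ₗ LinearMap.proj (0 : Fin 3) ∘ₗ (lam h).toLinearMap

/-- The operator by which `X` acts: the derivation `∂/∂y`, through dual numbers. -/
def dualHom : A h →ₐ[K] DualNumber (A h) :=
  lift ((TrivSqZeroExt.inlAlgHom K (A h) (A h)).comp (serHom h)) (TrivSqZeroExt.inl (y h) +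
    TrivSqZeroExt.inr 1) (TrivSqZeroExt.inl (z h))
    (by intro f
        ext <;> simp [serHom_apply, y_mul_ser, ser_smul])
    (by intro f
        ext <;> simp [serHom_apply, z_mul_ser])
    (by ext
        · simp [serHom_apply, y_mul_z, smul_eq_ser_mul, ser_smul, z_mul_ser]
        · simp [serHom_apply])
    (by ext
        · simp [serHom_apply, z_mul_z, smul_eq_ser_mul, ser_smul]
        · simp [serHom_apply])

/-- The derivation `∂/∂y`. -/
def D : Module.End K (A h) where
  toFun a := (dualHom h a).snd
  map_add' a b := by simp
  map_smul' c a := by simp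

variable {h}

theorem fst_dualHom (a : A h) : (dualHom h a).fst = a := by
  have : (TrivSqZeroExt.fstHom K (A h) (A h)).comp (dualHom h) = AlgHom.id K _ := by
    apply algHom_ext
    · intro f
      exact congrArg TrivSqZeroExt.fst (lift_ser ..)
    · exact (congrArg TrivSqZeroExt.fst (lift_genH ..)).trans (by simp)
    · exact congrArg TrivSqZeroExt.fst (lift_genV ..)
  exact DFunLike.congr_fun this a

theorem D_mul (a b : A h) : D h (a * b) = a * D h b + D h a * b := by
  change (dualHom h (a * b)).snd = _
  rw [map_mul, TrivSqZeroExt.snd_mul, fst_dualHom, fst_dualHom]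
  rfl

theorem D_ser (f : K⟦X⟧) : D h (ser h f) = 0 := congrArg TrivSqZeroExt.snd (lift_ser ..)
theorem D_z : D h (z h) = 0 := congrArg TrivSqZeroExt.snd (lift_genV ..)
theorem D_y : D h (y h) = 1 := (congrArg TrivSqZeroExt.snd (lift_genH ..)).trans (by simp)
theorem D_one : D h 1 = 0 := by rw [← ser_one, D_ser]

theorem D_pow_one {n : ℕ} (hn : 0 < n) : (D h ^ n) 1 = 0 := by
  obtain ⟨k, rfl⟩ := Nat.exists_eq_add_of_lt hn
  rw [zero_add, pow_succ, Module.End.mul_apply, D_one, map_zero]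

theorem D_pow_mul (n : ℕ) {b : A h} (hb : D h b = 0) (a : A h) :
    (D h ^ n) (a * b) = (D h ^ n) a * b := by
  induction n generalizing a with
  | zero => rfl
  | succ n ih => rw [pow_succ, Module.End.mul_apply, Module.End.mul_apply, D_mul, hb, mul_zero,
      zero_add, ih]

theorem D_pow_mul_y (n : ℕ) (a : A h) :
    (D h ^ n) (a * y h) = (D h ^ n) a * y h + (n : K) • (D h ^ (n - 1)) a := by
  induction n generalizing a with
  | zero => simp
  | succ n ih =>
    rw [pow_succ, Module.End.mul_apply, Module.End.mul_apply, D_mul, D_y, mul_one, map_add, ih,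
      Nat.add_sub_cancel]
    rcases n with _ | n
    · simp [add_comm]
    · have : (D h ^ (n + 1 - 1)) (D h a) = (D h ^ (n + 1)) a := by
        rw [Nat.add_sub_cancel, pow_succ, Module.End.mul_apply]
      rw [this]
      push_cast
      module

/-- The elements killed by a power of `D` are stable under right multiplication: `f(x)` and `z` are
constants for `D`, and `y` costs one more power. -/
theorem D_nil (a : A h) : ∃ n, (D h ^ n) a = 0 := by
  have le {a : A h} {n m : ℕ} (hn : (D h ^ n) a = 0) (hm : n ≤ m) : (D h ^ m) a = 0 := by
    obtain ⟨k, rfl⟩ := Nat.exists_eq_add_of_le hm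
    rw [add_comm, pow_add, Module.End.mul_apply, hn, map_zero]
  let N : Submodule K (A h) :=
    { carrier := {a | ∃ n, (D h ^ n) a = 0}
      zero_mem' := ⟨0, rfl⟩
      smul_mem' := by
        rintro c a ⟨n, hn⟩
        exact ⟨n, by rw [map_smul, hn, smul_zero]⟩
      add_mem' := by
        rintro a b ⟨n, hn⟩ ⟨m, hm⟩
        exact ⟨max n m, by
          rw [map_add, le hn (le_max_left _ _), le hm (le_max_right _ _), add_zero]⟩ }
  refine mem_of_mul_right N ⟨1, ?_⟩ ?_ ?_ ?_ a
  · rw [pow_one, D_one]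
  · rintro f a ⟨n, hn⟩
    exact ⟨n, by rw [D_pow_mul n (D_ser f), hn, zero_mul]⟩
  · rintro a ⟨n, hn⟩
    exact ⟨n + 1, by
      rw [D_pow_mul_y, le hn (Nat.le_succ n), Nat.add_sub_cancel, hn, zero_mul, smul_zero,
        add_zero]⟩
  · rintro a ⟨n, hn⟩
    exact ⟨n, by rw [D_pow_mul n D_z, hn, zero_mul]⟩

variable (h)

/-- The single operator `D` is completed by the zero operator, so that the calculus for pairs also
serves for one variable. -/
theorem locNil : LocNil ![D h, 0] where
  comm := Commute.zero_right _
  nil v := by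
    obtain ⟨n, hn⟩ := D_nil v
    -- The extra one is for the zero operator, whose power `0 ^ 0` is the identity.
    refine ⟨n + 1, fun i => ?_⟩
    fin_cases i
    · change (D h ^ (n + 1)) v = 0
      rw [pow_succ', Module.End.mul_apply, hn, map_zero]
    · change ((0 : Module.End K (A h)) ^ (n + 1)) v = 0
      rw [pow_succ, mul_zero]; rfl

/-- The action of the power series in `X` on `A`: `X` acts as `∂/∂y`. -/
def dX : K⟦X⟧ →ₐ[K] Module.End K (A h) := (locNil h).act.comp (slotHom 0)

variable {h}

theorem dX_X_pow (n : ℕ) : dX h (PowerSeries.X ^ n) = D h ^ n := by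
  rw [map_pow]
  congr 1
  change (locNil h).act (slotHom 0 _) = _
  rw [slotHom_apply, slot_X, LocNil.act_X]
  rfl

theorem dX_X_pow_mul {n : ℕ} {a : A h} (hn : (D h ^ n) a = 0) (g : K⟦X⟧) :
    dX h (PowerSeries.X ^ n * g) a = 0 := by
  rw [mul_comm _ g, map_mul, dX_X_pow, Module.End.mul_apply, hn, map_zero]

theorem dX_intertwine (R : Module.End K (A h)) (hR : ∀ a, R (D h a) = D h (R a)) (f : K⟦X⟧)
    (a : A h) : R (dX h f a) = dX h f (R a) := by
  refine (locNil h).act_intertwine (locNil h) R (fun i v => ?_) _ _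
  fin_cases i
  · exact hR v
  · exact map_zero R

theorem dX_mul {b : A h} (hb : D h b = 0) (f : K⟦X⟧) (a : A h) : dX h f (a * b) = dX h f a * b := by
  refine (dX_intertwine (LinearMap.mulRight K b) (fun a => ?_) f a).symm
  change D h a * b = D h (a * b)
  rw [D_mul, hb, mul_zero, zero_add]

theorem dX_mul_ser (f g : K⟦X⟧) (a : A h) : dX h f (a * ser h g) = dX h f a * ser h g :=
  dX_mul (D_ser g) f a

theorem dX_mul_z (f : K⟦X⟧) (a : A h) : dX h f (a * z h) = dX h f a * z h := dX_mul D_z f a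

/-- The commutator of `f(∂/∂y)` with multiplication by `y` is `f'(∂/∂y)`. For powers this is
Leibniz; for the continuity bound one needs `X^{n+1}` instead of `X^n`, because `f'` loses one
factor `X`. -/
theorem dX_mul_y (f : K⟦X⟧) (a : A h) : dX h f (a * y h) =
    dX h f a * y h + dX h (PowerSeries.derivative K f) a := by
  obtain ⟨n, hn⟩ := D_nil a
  let L : K⟦X⟧ →ₗ[K] A h :=
    LinearMap.applyₗ (a * y h) ∘ₗ (dX h).toLinearMap -
      LinearMap.mulRight K (y h) ∘ₗ LinearMap.applyₗ a ∘ₗ (dX h).toLinearMap -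
      LinearMap.applyₗ a ∘ₗ (dX h).toLinearMap ∘ₗ (PowerSeries.derivative K).toLinearMap
  have hL (f) : L f = dX h f (a * y h) - dX h f a * y h - dX h (PowerSeries.derivative K f) a := rfl
  have hn1 : (D h ^ (n + 1)) a = 0 := by rw [pow_succ', Module.End.mul_apply, hn, map_zero]
  have := series_ext L (n + 1) (fun g => ?_) (fun l => ?_) f
  · rw [hL, sub_sub, sub_eq_zero] at this
    exact this
  · rw [hL, dX_X_pow_mul hn1, dX_X_pow_mul, Derivation.leibniz, map_add, smul_eq_mul,
      LinearMap.add_apply, dX_X_pow_mul hn1, Derivation.leibniz_pow]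
    · simp only [Nat.add_sub_cancel, smul_eq_mul, zero_mul, sub_zero, zero_add]
      rw [mul_smul_comm, map_nsmul, mul_left_comm, LinearMap.smul_apply, dX_X_pow_mul hn, smul_zero,
        sub_zero]
    · rw [D_pow_mul_y, hn1, Nat.add_sub_cancel, hn, zero_mul, smul_zero, add_zero]
  · rw [hL, dX_X_pow, D_pow_mul_y, Derivation.leibniz_pow, PowerSeries.derivative_X, map_nsmul,
      smul_eq_mul, mul_one, dX_X_pow, LinearMap.smul_apply, ← Nat.cast_smul_eq_nsmul K]
    abel

theorem dX_one (f : K⟦X⟧) : dX h f 1 = PowerSeries.constantCoeff f • 1 := by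
  let L : K⟦X⟧ →ₗ[K] A h := LinearMap.applyₗ 1 ∘ₗ (dX h).toLinearMap -
    LinearMap.toSpanSingleton K _ 1 ∘ₗ constHom.toLinearMap
  have hL (f) : L f = dX h f 1 - PowerSeries.constantCoeff f • 1 := rfl
  have := series_ext L 1 (fun g => ?_) (fun l => ?_) f
  · rwa [hL, sub_eq_zero] at this
  · rw [hL, dX_X_pow_mul (D_pow_one one_pos)]
    simp
  · rw [hL, dX_X_pow]
    rcases l with _ | l
    · simp
    · rw [D_pow_one (Nat.succ_pos l)]
      simp

/-! ### The operators of `lam` -/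

theorem row_apply (j : Fin 3) (a : A h) : row h j a = lam h a 0 j := rfl

theorem row_one (j : Fin 3) : row h j 1 = if j = 0 then 1 else 0 := by
  rw [row_apply, map_one]
  fin_cases j <;> simp [Matrix.one_apply]

theorem row_mul (j : Fin 3) (a b : A h) : row h j (a * b) =
    row h 0 a * lam h b 0 j + row h 1 a * lam h b 1 j + row h 2 a * lam h b 2 j := by
  simp only [row_apply, map_mul, Matrix.mul_apply, Fin.sum_univ_three]

/-- `T = e^{hX}` acts as the first entry of `lam`. -/
theorem row_zero : row h 0 = dX h (expS h) := by
  ext a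
  refine linearMap_eq_of_mul_right _ _ ?_ ?_ ?_ ?_ a
  · rw [row_one, dX_one, constantCoeff_expS]; simp
  · intro f a ha
    rw [row_mul, lam_ser, dX_mul_ser, ← ha]
    simp [upper]
  · intro a ha
    rw [row_mul, lam_y, dX_mul_y, ← ha, derivative_expS, map_smul, LinearMap.smul_apply, ← ha]
    simp [upper, mul_add]
  · intro a ha
    rw [row_mul, lam_z, dX_mul_z, ← ha]
    simp [upper]

variable (h)

/-- The operator by which `T = e^{hX}` acts. -/
def opT : Module.End K (A h) := dX h (expS h)

/-- The operator by which `V T^{1/2}` acts. -/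
def opW : Module.End K (A h) := row h 1

/-- The operator by which `H` acts. -/
def opH : Module.End K (A h) := row h 2

variable {h}

/-- Multiplicativity of `lam` read in one column: the operator on a product is twisted by entries of
the matrix of `b`. For `b` a generator these entries are explicit, which gives the recursions below.
-/
theorem opW_mul (a b : A h) : opW h (a * b) =
    opT h a * lam h b 0 1 + opW h a * lam h b 1 1 + opH h a * lam h b 2 1 := by
  rw [opT, ← row_zero]; exact row_mul 1 a b
theorem opH_mul (a b : A h) : opH h (a * b) =
    opT h a * lam h b 0 2 + opW h a * lam h b 1 2 + opH h a * lam h b 2 2 := by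
  rw [opT, ← row_zero]; exact row_mul 2 a b

theorem opW_one : opW h 1 = 0 := row_one 1
theorem opH_one : opH h 1 = 0 := row_one 2

theorem opW_mul_ser (a : A h) (f : K⟦X⟧) : opW h (a * ser h f) = opW h a * ser h f := by
  rw [opW_mul, lam_ser]; simp [upper]
theorem opW_mul_y (a : A h) : opW h (a * y h) =
    (1 / 4 : K) • (opT h a * z h) + opW h a * y h := by
  rw [opW_mul, lam_y]; simp [upper]
theorem opW_mul_z (a : A h) : opW h (a * z h) = opT h a - opW h a * z h := by
  rw [opW_mul, lam_z]; simp [upper, sub_eq_add_neg]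
theorem opH_mul_ser (a : A h) (f : K⟦X⟧) : opH h (a * ser h f) =
    opT h a * ser h (PowerSeries.derivative K f) + opH h a * ser h f := by
  rw [opH_mul, lam_ser]; simp [upper]
theorem opH_mul_y (a : A h) : opH h (a * y h) =
    opH h a * y h - h • opH h a - opT h a * y h - (h / 2) • (opW h a * z h) := by
  rw [opH_mul, lam_y]; simp [upper, mul_sub]; module
theorem opH_mul_z (a : A h) : opH h (a * z h) =
    opH h a * z h + (2 * h) • opW h a - (1 / 2 : K) • (opT h a * z h) := by
  rw [opH_mul, lam_z]; simp [upper]; module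

theorem opT_mul_ser (a : A h) (f : K⟦X⟧) : opT h (a * ser h f) = opT h a * ser h f :=
  dX_mul_ser _ _ _
theorem opT_mul_z (a : A h) : opT h (a * z h) = opT h a * z h := dX_mul_z _ _
theorem opT_mul_y (a : A h) : opT h (a * y h) = opT h a * y h + h • opT h a := by
  rw [opT, dX_mul_y, derivative_expS, map_smul, LinearMap.smul_apply]
theorem opT_one : opT h 1 = 1 := by
  rw [opT, dX_one, constantCoeff_expS, one_smul]

theorem dX_dX (f g : K⟦X⟧) (a : A h) : dX h f (dX h g a) = dX h (f * g) a := by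
  rw [map_mul, Module.End.mul_apply]

theorem dX_comm (f g : K⟦X⟧) (a : A h) : dX h f (dX h g a) = dX h g (dX h f a) := by
  rw [dX_dX, dX_dX, mul_comm f g]

theorem D_comm_dX (f : K⟦X⟧) (a : A h) : D h (dX h f a) = dX h f (D h a) := by
  have : D h = dX h PowerSeries.X := by rw [← pow_one (D h), ← dX_X_pow, pow_one]
  rw [this, dX_comm]

theorem D_opT (a : A h) : D h (opT h a) = opT h (D h a) := D_comm_dX _ _

/-- The operator form of `[V, X] = 0`; `dX_intertwine` extends it to all series in `X`. -/
theorem opW_D (a : A h) : opW h (D h a) = D h (opW h a) := by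
  refine linearMap_eq_of_mul_right (opW h ∘ₗ D h) (D h ∘ₗ opW h) ?_ ?_ ?_ ?_ a <;>
    simp only [LinearMap.comp_apply]
  · rw [D_one, opW_one, map_zero, map_zero]
  · intro f a ha
    rw [D_mul, D_ser, mul_zero, zero_add, opW_mul_ser, opW_mul_ser, D_mul, D_ser, mul_zero,
      zero_add, ha]
  · intro a ha
    rw [D_mul, D_y, mul_one, map_add, opW_mul_y, opW_mul_y, map_add, map_smul, D_mul, D_mul, D_z,
      D_y, mul_zero, zero_add, mul_one, ha, D_opT]
    abel
  · intro a ha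
    rw [D_mul, D_z, mul_zero, zero_add, opW_mul_z, opW_mul_z, map_sub, D_mul, D_z, ha, D_opT,
      mul_zero, zero_add]

theorem opW_dX (f : K⟦X⟧) (a : A h) : opW h (dX h f a) = dX h f (opW h a) :=
  dX_intertwine _ opW_D f a

theorem opW_opT (a : A h) : opW h (opT h a) = opT h (opW h a) := opW_dX _ a

end A

/-! ### Series identities for the Borel subalgebra -/

section series
variable (h : K)

/-- The series `h⁻¹ sinh (hX)`. -/
abbrev dlB : K⟦X⟧ := h⁻¹ • sinhS h
/-- The series `cosh (hX) / 2`. -/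
abbrev gmB : K⟦X⟧ := (1 / 2 : K) • coshS h
/-- The series `(4h)⁻¹ sinh (hX)`. -/
abbrev sqB : K⟦X⟧ := (4 * h)⁻¹ • sinhS h
/-- The series `(8h)⁻¹ (e^{2hX} - 1)`. -/
abbrev sqW : K⟦X⟧ := (8 * h)⁻¹ • (expS (2 * h) - 1)

theorem derivative_sinhS : PowerSeries.derivative K (sinhS h) = h • coshS h := by
  rw [sinhS, coshS, Derivation.map_smul, map_sub, derivative_expS, derivative_expS]
  module

theorem constantCoeff_sinhS : PowerSeries.constantCoeff (sinhS h) = 0 := by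
  simp [sinhS, constantCoeff_expS]

variable {h} (hh : h ≠ 0)
include hh

/-- The derivative is `cosh (hX)`, written as `e^{hX} - sinh (hX)` so that only `T` and the series
`δ` itself enter the induction in `opH_dX`. -/
theorem derivative_dlB : PowerSeries.derivative K (dlB h) = expS h - h • dlB h := by
  rw [Derivation.map_smul, derivative_sinhS, smul_smul, smul_smul, mul_inv_cancel₀ hh,
    inv_mul_cancel₀ hh, sinhS, coshS]
  module

theorem derivative_sqW :
    PowerSeries.derivative K (sqW h) = (1 / 4 : K) • expS (2 * h) := by
  rw [Derivation.map_smul, map_sub, derivative_expS, Derivation.map_one_eq_zero, sub_zero,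
    smul_smul]
  congr 1
  field_simp
  norm_num

theorem smul_dlB_mul_expS : h • (dlB h * expS h) = (4 * h) • sqW h := by
  rw [dlB, sinhS, smul_mul_assoc, smul_smul, mul_inv_cancel₀ hh, one_smul, smul_mul_assoc, sub_mul,
    ← expS_add, ← expS_add, smul_smul, neg_add_cancel, expS_zero, ← two_mul]
  congr 1
  field_simp
  norm_num

theorem sqW_mul_expS : sqW h * expS (-h) = sqB h := by
  rw [sqB, sinhS, smul_mul_assoc, sub_mul, one_mul, ← expS_add, smul_smul]
  congr 2
  · field_simp; norm_num
  · congr 1; ring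

end series

namespace A
variable {h : K}

/-! ### The action of the Borel subalgebra on `A` -/

variable (h) in
/-- The parity operator. -/
def opP : Module.End K (A h) := (par h).toLinearMap

theorem opP_mul (a b : A h) : opP h (a * b) = opP h a * opP h b := map_mul (par h) a b
theorem opP_mul_ser (a : A h) (f : K⟦X⟧) : opP h (a * ser h f) = opP h a * ser h f := by
  rw [opP_mul]; congr 1; exact par_ser f
theorem opP_mul_y (a : A h) : opP h (a * y h) = opP h a * y h := by
  rw [opP_mul]; congr 1; exact par_y
theorem opP_mul_z (a : A h) : opP h (a * z h) = -(opP h a * z h) := by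
  rw [opP_mul, ← mul_neg]; congr 1; exact par_z
theorem opP_opP (a : A h) : opP h (opP h a) = a := par_par a
theorem opP_one : opP h 1 = 1 := map_one (par h)

theorem opP_D (a : A h) : opP h (D h a) = D h (opP h a) := by
  refine linearMap_eq_of_mul_right (opP h ∘ₗ D h) (D h ∘ₗ opP h) ?_ ?_ ?_ ?_ a <;>
    simp only [LinearMap.comp_apply]
  · rw [D_one, opP_one, map_zero, D_one]
  · intro f a ha
    simp only [D_mul, D_ser, mul_zero, zero_add, opP_mul_ser, ha]
  · intro a ha
    simp only [D_mul, D_y, mul_one, map_add, opP_mul_y, ha]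
  · intro a ha
    simp only [D_mul, D_z, mul_zero, zero_add, opP_mul_z, ha, map_neg]

theorem opP_dX (f : K⟦X⟧) (a : A h) : opP h (dX h f a) = dX h f (opP h a) :=
  dX_intertwine _ opP_D f a

theorem opP_opT (a : A h) : opP h (opT h a) = opT h (opP h a) := opP_dX _ a

theorem opP_opW (a : A h) : opP h (opW h a) = -opW h (opP h a) := by
  refine linearMap_eq_of_mul_right (opP h ∘ₗ opW h) (-(opW h ∘ₗ opP h)) ?_ ?_ ?_ ?_ a <;>
    simp only [LinearMap.comp_apply, LinearMap.neg_apply]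
  · rw [opW_one, opP_one, map_zero, opW_one, neg_zero]
  · intro f a ha
    rw [opW_mul_ser, opP_mul_ser, ha, opP_mul_ser, opW_mul_ser, neg_mul]
  · intro a ha
    rw [opW_mul_y, map_add, map_smul, opP_mul_z, opP_mul_y, ha, opP_mul_y, opW_mul_y, opP_opT,
      neg_mul]
    module
  · intro a ha
    rw [opW_mul_z, map_sub, opP_mul_z, ha, opP_mul_z, map_neg, opW_mul_z, opP_opT]
    simp only [neg_mul]
    abel

theorem opP_opH (a : A h) : opP h (opH h a) = opH h (opP h a) := by
  refine linearMap_eq_of_mul_right (opP h ∘ₗ opH h) (opH h ∘ₗ opP h) ?_ ?_ ?_ ?_ a <;>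
    simp only [LinearMap.comp_apply]
  · rw [opH_one, opP_one, map_zero, opH_one]
  · intro f a ha
    rw [opH_mul_ser, map_add, opP_mul_ser, opP_mul_ser, opP_mul_ser, opH_mul_ser, ha, opP_opT]
  · intro a ha
    simp only [opH_mul_y, map_sub, map_smul, opP_mul_y, opP_mul_z, ha, opP_opT, opP_opW, neg_mul]
    module
  · intro a ha
    simp only [opH_mul_z, map_sub, map_add, map_neg, map_smul, opP_mul_z, ha, opP_opT, opP_opW, neg_mul]
    module

section
variable (hh : h ≠ 0)
include hh

/-- This is `W² = V² T`. Multiplying by `y` on the right produces the extra term `T² / 4`, which is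
the derivative of the series `sqW`; multiplying by `z` produces terms that cancel because `W` and
`T` commute. -/
theorem opW_opW (a : A h) : opW h (opW h a) = dX h (sqW h) a := by
  refine linearMap_eq_of_mul_right (opW h ∘ₗ opW h) (dX h (sqW h)) ?_ ?_ ?_ ?_ a <;>
    simp only [LinearMap.comp_apply]
  · rw [opW_one, map_zero, dX_one]
    simp [constantCoeff_expS]
  · intro f a ha
    rw [opW_mul_ser, opW_mul_ser, dX_mul_ser, ha]
  · intro a ha
    have e : dX h ((1 / 4 : K) • expS (2 * h)) a = (1 / 4 : K) • opT h (opT h a) := by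
      rw [map_smul, LinearMap.smul_apply, opT, dX_dX, ← expS_add, ← two_mul h]
    rw [opW_mul_y, map_add, map_smul, opW_mul_y, opW_mul_z, dX_mul_y, derivative_sqW hh, ha, e,
      opW_opT]
    module
  · intro a ha
    rw [opW_mul_z, map_sub, opW_mul_z, dX_mul_z, ha, opW_opT]
    abel

/-- The induction has to treat all series at once, since right multiplication by `y` brings in `f'`;
hence the maps into the product over all `f`. -/
theorem opH_dX (f : K⟦X⟧) (a : A h) : opH h (dX h f a) =
    dX h f (opH h a) + dX h (dlB h * PowerSeries.derivative K f) a := by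
  refine congrFun (linearMap_eq_of_mul_right
    (LinearMap.pi fun f => opH h ∘ₗ dX h f) (LinearMap.pi fun f => dX h f ∘ₗ opH h +
      dX h (dlB h * PowerSeries.derivative K f)) ?_ ?_ ?_ ?_ a) f
  · ext1 f
    simp only [LinearMap.pi_apply, LinearMap.comp_apply, LinearMap.add_apply]
    rw [dX_one, dX_one, opH_one, map_zero, map_smul, opH_one, map_mul, PowerSeries.constantCoeff_smul,
      constantCoeff_sinhS]
    simp
  · intro g a ha
    ext1 f
    have haf := congrFun ha f
    simp only [LinearMap.pi_apply, LinearMap.comp_apply, LinearMap.add_apply] at haf ⊢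
    rw [dX_mul_ser, opH_mul_ser, opH_mul_ser, map_add, dX_mul_ser, dX_mul_ser, dX_mul_ser, haf, opT,
      dX_comm]
    simp only [add_mul]
    abel
  · intro a ha
    ext1 f
    have haf := congrFun ha f
    have haf' := congrFun ha (PowerSeries.derivative K f)
    simp only [LinearMap.pi_apply, LinearMap.comp_apply, LinearMap.add_apply] at haf haf' ⊢
    rw [dX_mul_y, opH_mul_y, map_add, opH_mul_y, dX_mul_y, Derivation.leibniz, haf', haf,
      derivative_dlB hh]
    generalize dlB h = δ
    simp only [map_sub, map_add, map_smul, dX_mul_y, dX_mul_z, add_mul, smul_eq_mul, mul_sub,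
      LinearMap.sub_apply, LinearMap.add_apply, LinearMap.smul_apply, mul_smul_comm, opW_dX, opT,
      dX_dX, mul_comm (expS h)]
    rw [mul_comm (PowerSeries.derivative K f) δ]
    module
  · intro a ha
    ext1 f
    have haf := congrFun ha f
    simp only [LinearMap.pi_apply, LinearMap.comp_apply, LinearMap.add_apply] at haf ⊢
    rw [dX_mul_z, opH_mul_z, opH_mul_z, haf, dX_mul_z]
    simp only [map_sub, map_add, map_smul, dX_mul_z, add_mul, opW_dX, opT,
      dX_dX, mul_comm (expS h)]
    module

theorem opH_opT (a : A h) : opH h (opT h a) = opT h (opH h a) + (4 * h) • dX h (sqW h) a := by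
  rw [opT, opH_dX hh, derivative_expS, mul_smul_comm, smul_dlB_mul_expS hh, map_smul]
  rfl

/-- The generator `W` is preferred to `V` because the hyperbolic terms combine: `[H, W] = ½ V (cosh
+ sinh) T^{1/2} = ½ W T`. -/
theorem opH_opW (a : A h) : opH h (opW h a) =
    opW h (opH h a) + (1 / 2 : K) • opW h (opT h a) := by
  -- Expressing `T²` through the series of `W²` leaves a single independent series in the comparison
  -- of coefficients.
  have hTT (a : A h) : opT h (opT h a) = (8 * h) • dX h (sqW h) a + a := by
    rw [opT, dX_dX, ← expS_add, ← two_mul, ← LinearMap.smul_apply, ← map_smul, smul_smul,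
      mul_inv_cancel₀ (by simpa using hh), one_smul, map_sub, map_one, LinearMap.sub_apply]
    simp
  refine linearMap_eq_of_mul_right (opH h ∘ₗ opW h)
    (opW h ∘ₗ opH h + (1 / 2 : K) • (opW h ∘ₗ opT h)) ?_ ?_ ?_ ?_ a <;>
    simp only [LinearMap.comp_apply, LinearMap.add_apply, LinearMap.smul_apply]
  · rw [opW_one, opH_one, map_zero, opT_one, opW_one]; simp
  · intro f a ha
    simp only [opW_mul_ser, opH_mul_ser, opT_mul_ser, map_add, ha, opW_opT, add_mul,
      smul_mul_assoc]
    abel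
  · intro a ha
    simp only [opW_mul_y, opH_mul_y, opH_mul_z, opW_mul_z, opT_mul_y, map_add, map_sub, map_smul,
      ha, opW_opT, opW_opW hh, opH_opT hh, hTT, add_mul, smul_mul_assoc]
    match_scalars <;> field_simp <;> ring
  · intro a ha
    simp only [opW_mul_y, opH_mul_y, opH_mul_z, opW_mul_z, opT_mul_z, map_add, map_sub, map_smul,
      ha, opW_opT, opW_opW hh, opH_opT hh, hTT, add_mul, smul_mul_assoc]
    match_scalars <;> field_simp <;> ring

end

variable (h)

/-- The operator by which `V` acts. -/
def opV : Module.End K (A h) := opW h * dX h (expS (-h / 2))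

variable {h}

theorem opV_apply (a : A h) : opV h a = opW h (dX h (expS (-h / 2)) a) := rfl

theorem opV_dX (f : K⟦X⟧) (a : A h) : opV h (dX h f a) = dX h f (opV h a) := by
  rw [opV_apply, opV_apply, dX_comm, opW_dX]

theorem opW_eq (a : A h) : opW h a = opV h (dX h (expS (h / 2)) a) := by
  rw [opV_apply, dX_dX, ← expS_add, neg_div, neg_add_cancel, expS_zero, map_one]
  rfl

theorem opP_opV (a : A h) : opP h (opV h a) = -opV h (opP h a) := by
  rw [opV_apply, opP_opW, opP_dX, opV_apply]

theorem opV_opV (hh : h ≠ 0) (a : A h) : opV h (opV h a) = dX h (sqB h) a := by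
  rw [opV_apply (opV h a), opV_apply a, ← opW_dX, opW_opW hh, dX_dX, dX_dX, mul_assoc, ← expS_add,
    ← sqW_mul_expS hh]
  congr 4
  ring

/-- Obtained from `W` by the factor `T^{-1/2}`: its commutator with `H` contributes `-½ sinh`, and
`½ (T - sinh) = ½ cosh`. -/
theorem opH_opV (hh : h ≠ 0) (a : A h) :
    opH h (opV h a) = opV h (opH h a) + opV h (dX h (gmB h) a) := by
  rw [opV_apply, opH_opW hh, opH_dX hh, opV_apply, opV_apply, map_add, add_assoc, opT, dX_dX,
    dX_dX, ← map_smul, ← map_add, ← LinearMap.smul_apply, ← map_smul, ← LinearMap.add_apply,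
    ← map_add]
  rw [derivative_expS, mul_comm (expS h), dlB, gmB, sinhS, coshS]
  have : h⁻¹ * (1 / 2) * (-h / 2) = -(1 / 4) := by field_simp; norm_num
  simp only [mul_smul_comm, smul_mul_assoc, smul_smul, this, ← mul_comm (expS (-h / 2)), mul_add,
    mul_sub, map_add, map_sub, map_smul, LinearMap.add_apply, LinearMap.sub_apply,
    LinearMap.smul_apply]
  match_scalars <;> field_simp
  ring

theorem D_eq_dX : D h = dX h PowerSeries.X := by rw [← pow_one (D h), ← dX_X_pow, pow_one]

variable (h) in
/-- The action of the Borel subalgebra on `A`. -/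
def act (hh : h ≠ 0) : B h →ₐ[K] Module.End K (A h) :=
  lift (dX h) (opH h) (opV h)
    (fun f => LinearMap.ext fun a => opH_dX hh f a)
    (fun f => LinearMap.ext fun a => opV_dX f a)
    (LinearMap.ext fun a => opH_opV hh a)
    (LinearMap.ext fun a => opV_opV hh a)

variable (hh : h ≠ 0)
theorem act_ser (f : K⟦X⟧) : act h hh (B.ser h f) = dX h f := lift_ser ..
theorem act_H : act h hh (B.H h) = opH h := lift_genH ..
theorem act_V : act h hh (B.V h) = opV h := lift_genV ..

/-! ### Operators on products -/

/-- The matrix entries are elements of `B` acting on `a`, arranged so that their coproducts are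
given by matrix multiplication; the parity operators in the second row carry the signs caused by the
odd entries. This turns the recursions on generators into Leibniz rules for arbitrary products. -/
theorem lam_eq (a : A h) : lam h a = upper (opT h a) (opW h a) (opH h a) (opP h a)
    ((2 * h) • opP h (opW h (dX h (expS (-h)) a))) (dX h (expS (-h)) a) := by
  have hT (a : A h) : opT h (dX h (expS (-h)) a) = a := by
    rw [opT, dX_dX, expS_mul_neg, map_one]; rfl
  -- The first row holds by the choice of operators and `row_zero`; only the two lower rows need
  -- induction.
  suffices H : ∀ a : A h, lam h a 1 = ![0, opP h a,
      (2 * h) • opP h (opW h (dX h (expS (-h)) a))] ∧ lam h a 2 = ![0, 0, dX h (expS (-h)) a] by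
    ext i j
    obtain ⟨h1, h2⟩ := H a
    fin_cases i
    · fin_cases j
      · exact (row_apply 0 a).symm.trans (by rw [row_zero]; rfl)
      · rfl
      · rfl
    · exact congrFun h1 j
    · exact congrFun h2 j
  intro a
  have h0 : ∀ a : A h, (lam h a 1, lam h a 2) = ((![0, opP h a,
      (2 * h) • opP h (opW h (dX h (expS (-h)) a))], ![0, 0, dX h (expS (-h)) a]) :
        (Fin 3 → A h) × (Fin 3 → A h)) := by
    have mul1 (a b : A h) (j : Fin 3) : lam h (a * b) 1 j =
        lam h a 1 0 * lam h b 0 j + lam h a 1 1 * lam h b 1 j + lam h a 1 2 * lam h b 2 j := by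
      rw [map_mul, Matrix.mul_apply, Fin.sum_univ_three]
    have mul2 (a b : A h) (j : Fin 3) : lam h (a * b) 2 j =
        lam h a 2 0 * lam h b 0 j + lam h a 2 1 * lam h b 1 j + lam h a 2 2 * lam h b 2 j := by
      rw [map_mul, Matrix.mul_apply, Fin.sum_univ_three]
    let F : A h →ₗ[K] (Fin 3 → A h) × (Fin 3 → A h) :=
      LinearMap.prod (LinearMap.proj (1 : Fin 3) ∘ₗ (lam h).toLinearMap)
        (LinearMap.proj (2 : Fin 3) ∘ₗ (lam h).toLinearMap)
    let G : A h →ₗ[K] (Fin 3 → A h) × (Fin 3 → A h) :=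
      LinearMap.prod (LinearMap.pi ![0, opP h, (2 * h) • (opP h ∘ₗ opW h ∘ₗ dX h (expS (-h)))])
        (LinearMap.pi ![0, 0, dX h (expS (-h))])
    have hG (a : A h) : G a = (![0, opP h a,
        (2 * h) • opP h (opW h (dX h (expS (-h)) a))], ![0, 0, dX h (expS (-h)) a]) := by
      ext i <;> fin_cases i <;> rfl
    have hF (a : A h) : F a = (lam h a 1, lam h a 2) := rfl
    intro a
    rw [← hF, ← hG]
    refine linearMap_eq_of_mul_right F G ?_ ?_ ?_ ?_ a
    · rw [hF, hG, map_one, dX_one, constantCoeff_expS, one_smul, opW_one, opP_one]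
      ext i <;> fin_cases i <;> simp [Matrix.one_apply]
    all_goals simp only [hF, hG, Prod.mk.injEq]
    · rintro f a ⟨h1, h2⟩
      constructor <;> ext j
      · rw [mul1, h1, lam_ser, dX_mul_ser, opW_mul_ser, opP_mul_ser, opP_mul_ser]
        fin_cases j <;> simp [upper]
      · rw [mul2, h2, lam_ser, dX_mul_ser]
        fin_cases j <;> simp [upper]
    · rintro a ⟨h1, h2⟩
      constructor <;> ext j
      · rw [mul1, h1, lam_y, dX_mul_y, derivative_expS, opP_mul_y, map_smul, LinearMap.smul_apply,
          map_add, map_smul, opW_mul_y, hT]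
        simp only [map_add, map_smul, opP_mul_z, opP_mul_y]
        fin_cases j
        · simp [upper]
        · simp [upper]
        · simp [upper, mul_sub]
          module
      · rw [mul2, h2, lam_y, dX_mul_y, derivative_expS, map_smul, LinearMap.smul_apply]
        fin_cases j <;> simp [upper, mul_add, sub_eq_add_neg]
    · rintro a ⟨h1, h2⟩
      constructor <;> ext j
      · rw [mul1, h1, lam_z, dX_mul_z, opP_mul_z, opW_mul_z, map_sub, hT, opP_mul_z]
        fin_cases j
        · simp [upper]
        · simp [upper]
        · simp [upper]
      · rw [mul2, h2, lam_z, dX_mul_z]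
        fin_cases j <;> simp [upper]
  have := h0 a
  exact ⟨congrArg Prod.fst this, congrArg Prod.snd this⟩

theorem opW_mul' (a b : A h) : opW h (a * b) = opT h a * opW h b + opW h a * opP h b := by
  rw [opW_mul, lam_eq]; simp [upper]

/-- The three terms of `Δ(H)` acting on a product. The sign rule is implemented by the parity
operator on the second factor. -/
theorem opH_mul' (a b : A h) : opH h (a * b) = opT h a * opH h b +
    (2 * h) • (opW h a * opP h (opW h (dX h (expS (-h)) b))) +
    opH h a * dX h (expS (-h)) b := by
  rw [opH_mul, lam_eq]; simp [upper]

end A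

attribute [local instance] serModule₂ serTower₂

instance natAlgebraMvPowerSeries : Algebra ℕ (MvPowerSeries (Fin 2) K) := Semiring.toNatAlgebra

instance intAlgebraMvPowerSeries : Algebra ℤ (MvPowerSeries (Fin 2) K) := Ring.toIntAlgebra _

theorem cast_eq_algebraMap' (c : K) :
    (Algebra.cast c : MvPowerSeries (Fin 2) K) = algebraMap K _ c := rfl

/-! ### Relations in `B` and its tensor square, and the coproduct -/

namespace B
variable {h : K}

variable (h) in
/-- `f ↦ f(X)`. -/
def serHom : K⟦X⟧ →ₐ[K] B h := OspBorel.serHom _ _ _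

theorem serHom_apply (f : K⟦X⟧) : serHom h f = ser h f := rfl
theorem ser_one : ser h 1 = 1 := map_one (serHom h)
theorem ser_mul (f g : K⟦X⟧) : ser h (f * g) = ser h f * ser h g := OspBorel.ser_mul f g
theorem ser_smul (c : K) (f : K⟦X⟧) : ser h (c • f) = c • ser h f := map_smul (serHom h) c f
theorem ser_add (f g : K⟦X⟧) : ser h (f + g) = ser h f + ser h g := map_add (serHom h) f g
theorem ser_sub (f g : K⟦X⟧) : ser h (f - g) = ser h f - ser h g := map_sub (serHom h) f g
theorem ser_neg (f : K⟦X⟧) : ser h (-f) = -ser h f := map_neg (serHom h) f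
theorem H_mul_ser (f : K⟦X⟧) :
    H h * ser h f = ser h f * H h + ser h (dlB h * PowerSeries.derivative K f) :=
  OspBorel.genH_mul_ser f
theorem V_mul_ser (f : K⟦X⟧) : V h * ser h f = ser h f * V h := OspBorel.genV_mul_ser f
theorem H_mul_V : H h * V h = V h * H h + V h * ser h (gmB h) := OspBorel.genH_mul_genV
theorem V_mul_V : V h * V h = ser h (sqB h) := OspBorel.genV_mul_genV

theorem algHom_ext {E : Type*} [Ring E] [Algebra K E] {F G : B h →ₐ[K] E}
    (hs : ∀ f, F (ser h f) = G (ser h f)) (hH : F (H h) = G (H h)) (hV : F (V h) = G (V h)) :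
    F = G := OspBorel.algHom_ext hs hH hV

theorem mem_of_generators (S : Subalgebra K (B h)) (hs : ∀ f, ser h f ∈ S) (hH : H h ∈ S)
    (hV : V h ∈ S) (b : B h) : b ∈ S := OspBorel.mem_of_generators S hs hH hV b

end B

namespace BB
variable {h : K}

variable (h) in
/-- `f ↦ f(X₀, X₁)`. -/
def serHom : MvPowerSeries (Fin 2) K →ₐ[K] BB h := OspBorel.serHom₂ _ _ _

theorem serHom_apply (f) : serHom h f = ser h f := rfl
theorem ser_eq_smul (f) : ser h f = f • (1 : BB h) := OspBorel.ser₂_eq_smul f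
theorem smul_eq_ser_mul (f) (a : BB h) : f • a = ser h f * a := rfl
theorem smul_mul (f : MvPowerSeries (Fin 2) K) (a b : BB h) : f • a * b = f • (a * b) :=
  OspBorel.smul₂_mul f a b
theorem V_mul_smul (i : Fin 2) (f : MvPowerSeries (Fin 2) K) (a : BB h) :
    V h i * f • a = f • (V h i * a) := OspBorel.genV₂_mul_smul i f a
theorem H_mul_smul (i : Fin 2) (f : MvPowerSeries (Fin 2) K) (a : BB h) :
    H h i * f • a = f • (H h i * a) + (slot i (dlB h) * MvPowerSeries.pderiv K i f) • a :=
  OspBorel.genH₂_mul_smul i f a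
theorem V_mul_V (i : Fin 2) : V h i * V h i = slot i (sqB h) • 1 := OspBorel.genV₂_mul_genV₂' i
theorem V_mul_V_mul (i : Fin 2) (a : BB h) : V h i * (V h i * a) = slot i (sqB h) • a :=
  OspBorel.genV₂_mul_genV₂_mul i a
theorem H_mul_V (i : Fin 2) : H h i * V h i = V h i * H h i + slot i (gmB h) • V h i :=
  OspBorel.genH₂_mul_genV₂' i
theorem V_anticomm : V h 1 * V h 0 = -(V h 0 * V h 1) := by
  rw [V, V, genV₂_anticomm, neg_neg]
theorem V_anticomm_mul (a : BB h) : V h 1 * (V h 0 * a) = -(V h 0 * (V h 1 * a)) := by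
  rw [← mul_assoc, V_anticomm, neg_mul, mul_assoc]
theorem H_comm_V {i j : Fin 2} (hij : i ≠ j) : H h i * V h j = V h j * H h i :=
  OspBorel.genH₂_comm_genV₂ hij
theorem H_mul_ser (i : Fin 2) (f) : H h i * ser h f =
    ser h f * H h i + ser h (slot i (dlB h) * MvPowerSeries.pderiv K i f) := genH₂_mul_ser₂ i f
theorem V_mul_ser (i : Fin 2) (f) : V h i * ser h f = ser h f * V h i := genV₂_mul_ser₂ i f

variable (h)

/-- The series `e^{hX₀/2}` and `e^{-hX₁/2}`. -/
abbrev pS : MvPowerSeries (Fin 2) K := slot 0 (expS (h / 2))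
abbrev qS : MvPowerSeries (Fin 2) K := slot 1 (expS (-h / 2))

/-- The coproduct of `H`. -/
def comulH : BB h := H h 0 * exp h 1 (-h) + exp h 0 h * H h 1 +
    (2 * h) • ((V h 0 * exp h 0 (h / 2)) * (V h 1 * exp h 1 (-h / 2)))

/-- The coproduct of `V`. -/
def comulV : BB h := V h 0 * exp h 1 (-h / 2) + exp h 0 (h / 2) * V h 1

variable {h}

theorem slot_expS_add (i : Fin 2) (a b : K) :
    slot i (expS (a + b)) = slot i (expS a) * slot i (expS b) := by
  rw [expS_add, slot_mul]

theorem slot_smul (i : Fin 2) (c : K) (f : K⟦X⟧) : slot i (c • f) = c • slot i f := by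
  simp only [← slotHom_apply, map_smul]
theorem slot_add (i : Fin 2) (f g : K⟦X⟧) : slot i (f + g) = slot i f + slot i g := by
  simp only [← slotHom_apply, map_add]
theorem slot_sub (i : Fin 2) (f g : K⟦X⟧) : slot i (f - g) = slot i f - slot i g := by
  simp only [← slotHom_apply, map_sub]

theorem pderiv_slot_expS (i : Fin 2) (c : K) :
    MvPowerSeries.pderiv K i (slot i (expS c)) = c • slot i (expS c) := by
  rw [pderiv_slot_self, derivative_expS, slot_smul]

theorem slot_one_neg : slot 1 (expS (-h)) = qS h * qS h := by
  rw [← slot_expS_add, ← add_div, ← two_mul, mul_div_cancel_left₀ _ two_ne_zero]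
theorem slot_zero_pos : slot 0 (expS h) = pS h * pS h := by
  rw [← slot_expS_add, ← add_div, ← two_mul, mul_div_cancel_left₀ _ two_ne_zero]

theorem pderiv_pS : MvPowerSeries.pderiv K 0 (pS h) = (h / 2) • pS h := pderiv_slot_expS _ _
theorem pderiv_qS : MvPowerSeries.pderiv K 1 (qS h) = (-h / 2) • qS h := pderiv_slot_expS _ _
theorem pderiv_pS' : MvPowerSeries.pderiv K 1 (pS h) = 0 := pderiv_slot_of_ne (by decide) _
theorem pderiv_qS' : MvPowerSeries.pderiv K 0 (qS h) = 0 := pderiv_slot_of_ne (by decide) _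

theorem comulV_eq : comulV h = qS h • V h 0 + pS h • V h 1 := by
  rw [comulV, exp, exp, V_mul_ser]; rfl

/-- Normal form with the series on the left, in terms of `p = e^{hX₀/2}` and `q = e^{-hX₁/2}` only.
No derivative appears, since `H₀` commutes with series in `X₁`. -/
theorem comulH_eq : comulH h = (qS h * qS h) • H h 0 + (pS h * pS h) • H h 1 +
    (2 * h) • (pS h * qS h) • (V h 0 * V h 1) := by
  rw [comulH, exp, exp, exp, exp, H_mul_ser, V_mul_ser, V_mul_ser, slot_one_neg, slot_zero_pos]
  simp only [← smul_eq_ser_mul, smul_mul, V_mul_smul, Derivation.leibniz, pderiv_qS', smul_zero,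
    add_zero, mul_zero, smul_smul]
  rw [← serHom_apply, map_zero, add_zero]

section hyperbolic
variable (h)

theorem slot_zero_neg : slot 0 (expS (-h)) =
    (slot 0 (expS (-h / 2)) : MvPowerSeries (Fin 2) K) * slot 0 (expS (-h / 2)) := by
  rw [← slot_expS_add, ← add_div, ← two_mul, mul_div_cancel_left₀ _ two_ne_zero]
theorem slot_one_pos : slot 1 (expS h) =
    (slot 1 (expS (h / 2)) : MvPowerSeries (Fin 2) K) * slot 1 (expS (h / 2)) := by
  rw [← slot_expS_add, ← add_div, ← two_mul, mul_div_cancel_left₀ _ two_ne_zero]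

theorem slot_zero_sinhS : slot 0 (sinhS h) = (1 / 2 : K) • (pS h * pS h -
    slot 0 (expS (-h / 2)) * slot 0 (expS (-h / 2))) := by
  rw [sinhS, slot_smul, slot_sub, slot_zero_pos, slot_zero_neg]
theorem slot_one_sinhS : slot 1 (sinhS h) =
    (1 / 2 : K) • (slot 1 (expS (h / 2)) * slot 1 (expS (h / 2)) - qS h * qS h) := by
  rw [sinhS, slot_smul, slot_sub, slot_one_pos, slot_one_neg]
theorem slot_zero_coshS : slot 0 (coshS h) = (1 / 2 : K) • (pS h * pS h +
    slot 0 (expS (-h / 2)) * slot 0 (expS (-h / 2))) := by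
  rw [coshS, slot_smul, slot_add, slot_zero_pos, slot_zero_neg]
theorem slot_one_coshS : slot 1 (coshS h) =
    (1 / 2 : K) • (slot 1 (expS (h / 2)) * slot 1 (expS (h / 2)) + qS h * qS h) := by
  rw [coshS, slot_smul, slot_add, slot_one_pos, slot_one_neg]
theorem addHom_sinhS : addHom (sinhS h) =
    (1 / 2 : K) • (pS h * pS h * (slot 1 (expS (h / 2)) * slot 1 (expS (h / 2))) -
      slot 0 (expS (-h / 2)) * slot 0 (expS (-h / 2)) * (qS h * qS h)) := by
  rw [sinhS, map_smul, map_sub, addHom_expS, addHom_expS, slot_one_pos, slot_one_neg, slot_zero_pos,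
    slot_zero_neg]
theorem addHom_coshS : addHom (coshS h) =
    (1 / 2 : K) • (pS h * pS h * (slot 1 (expS (h / 2)) * slot 1 (expS (h / 2))) +
      slot 0 (expS (-h / 2)) * slot 0 (expS (-h / 2)) * (qS h * qS h)) := by
  rw [coshS, map_smul, map_add, addHom_expS, addHom_expS, slot_one_pos, slot_one_neg, slot_zero_pos,
    slot_zero_neg]

/-- The addition formula `e^{-b} sinh a + e^{a} sinh b = sinh (a + b)`. It makes `Δ` respect `[H,
X]`, and in the next lemma, with another constant, `V²`. -/
theorem addHom_dlB :
    qS h * qS h * slot 0 (dlB h) + pS h * pS h * slot 1 (dlB h) = addHom (dlB h) := by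
  simp only [dlB, slot_smul, map_smul, slot_zero_sinhS, slot_one_sinhS, addHom_sinhS]
  simp only [Algebra.smul_def]
  ring

theorem addHom_sqB :
    qS h * qS h * slot 0 (sqB h) + pS h * pS h * slot 1 (sqB h) = addHom (sqB h) := by
  simp only [sqB, slot_smul, map_smul, slot_zero_sinhS, slot_one_sinhS, addHom_sinhS]
  simp only [Algebra.smul_def]
  ring

/-- The two mixed addition formulas `e^{-b} cosh a + e^{a} sinh b = cosh (a + b) = e^{a} cosh b -
e^{-b} sinh a`, needed for the coefficients of `V₀` and of `V₁` in `[Δ(H), Δ(V)]`. -/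
theorem addHom_gmB_zero (hh : h ≠ 0) : qS h * qS h * slot 0 (gmB h) +
    (h / 2) • (pS h * pS h * slot 1 (dlB h)) = addHom (gmB h) := by
  simp only [gmB, dlB, slot_smul, map_smul, slot_zero_coshS, slot_one_sinhS, addHom_coshS,
    mul_smul_comm, smul_smul]
  rw [show h / 2 * (h⁻¹ * (1 / 2)) = 1 / 2 * (1 / 2) by field_simp]
  simp only [Algebra.smul_def]
  ring

theorem addHom_gmB_one (hh : h ≠ 0) : pS h * pS h * slot 1 (gmB h) -
    (h / 2) • (qS h * qS h * slot 0 (dlB h)) = addHom (gmB h) := by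
  simp only [gmB, dlB, slot_smul, map_smul, slot_one_coshS, slot_zero_sinhS, addHom_coshS,
    mul_smul_comm, smul_smul]
  rw [show h / 2 * (h⁻¹ * (1 / 2)) = 1 / 2 * (1 / 2) by field_simp]
  simp only [Algebra.smul_def]
  ring

theorem slot_sqB (hh : h ≠ 0) (i : Fin 2) :
    (2 * h) • slot i (sqB h) = (h / 2) • slot i (dlB h) := by
  simp only [sqB, dlB, slot_smul, smul_smul]
  congr 1
  field_simp
  norm_num

end hyperbolic

theorem comulH_mul_comul (f : K⟦X⟧) : comulH h * ser h (addHom f) = ser h (addHom f) * comulH h +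
    ser h (addHom (dlB h * PowerSeries.derivative K f)) := by
  rw [comulH_eq, map_mul, ← addHom_dlB]
  simp only [add_mul, mul_add, smul_mul, ser_eq_smul, V_mul_smul, H_mul_smul, mul_one, one_mul,
    smul_mul_assoc, pderiv_addHom, mul_assoc]
  module

theorem comulV_mul_comul (f : K⟦X⟧) : comulV h * ser h (addHom f) = ser h (addHom f) * comulV h := by
  rw [comulV_eq]
  simp only [add_mul, mul_add, smul_mul, ser_eq_smul, V_mul_smul, mul_one, one_mul]
  module

theorem comulV_mul_comulV : comulV h * comulV h = ser h (addHom (sqB h)) := by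
  rw [comulV_eq, ← addHom_sqB]
  simp only [add_mul, mul_add, smul_mul, ser_eq_smul, V_mul_smul, mul_one, one_mul, V_anticomm,
    V_mul_V, smul_smul, smul_neg]
  module

theorem comulH_mul_comulV (hh : h ≠ 0) : comulH h * comulV h = comulV h * comulH h +
    comulV h * ser h (addHom (gmB h)) := by
  have e0 : (qS h * qS h * slot 0 (gmB h)) * qS h = (addHom (gmB h) -
    (h / 2) • (pS h * pS h * slot 1 (dlB h))) * qS h := by rw [← addHom_gmB_zero h hh]; ring
  have e1 : (pS h * pS h * slot 1 (gmB h)) * pS h = (addHom (gmB h) +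
    (h / 2) • (qS h * qS h * slot 0 (dlB h))) * pS h := by rw [← addHom_gmB_one h hh]; ring
  -- The term `2h p q V₀ V₁` of `Δ(H)` multiplied by `V_i` leaves `2h V_i²`; rewritten through
  -- `δ(X_i)` it supplies the `sinh` part of the mixed addition formulas.
  have e2 := slot_sqB h hh 0
  have e3 := slot_sqB h hh 1
  rw [comulV_eq, comulH_eq]
  simp only [add_mul, mul_add, smul_mul, ser_eq_smul, V_mul_smul, H_mul_smul, mul_one, one_mul,
    V_anticomm, V_mul_V, V_mul_V_mul, V_anticomm_mul, mul_assoc, H_mul_V, smul_smul, smul_neg,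
    H_comm_V (show (0 : Fin 2) ≠ 1 by decide), H_comm_V (show (1 : Fin 2) ≠ 0 by decide),
    Derivation.leibniz, pderiv_pS, pderiv_pS', pderiv_qS, pderiv_qS', smul_mul_assoc, mul_smul_comm,
    mul_neg, neg_mul]
  generalize slot 0 (sqB h) = s0, slot 1 (sqB h) = s1, slot 0 (dlB h) = d0, slot 1 (dlB h) = d1,
    slot 0 (gmB h) = g0, slot 1 (gmB h) = g1, addHom (gmB h) = g at *
  match_scalars
  all_goals
    simp only [Algebra.smul_def, neg_div, map_neg, cast_eq_algebraMap', map_mul] at *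
  · ring
  · linear_combination e0 + (2 * pS h * pS h * qS h) * e3
  · ring
  · linear_combination e1 - (2 * qS h * qS h * pS h) * e2
  · ring
  · ring

variable (h) in
/-- The coproduct. -/
def comul (hh : h ≠ 0) : B h →ₐ[K] BB h :=
  lift ((serHom h).comp addHom) (comulH h) (comulV h) comulH_mul_comul comulV_mul_comul
    (comulH_mul_comulV hh) comulV_mul_comulV

variable (hh : h ≠ 0)
theorem comul_ser (f : K⟦X⟧) : comul h hh (B.ser h f) = ser h (addHom f) := lift_ser ..
theorem comul_H : comul h hh (B.H h) = comulH h := lift_genH ..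
theorem comul_V : comul h hh (B.V h) = comulV h := lift_genV ..

end BB

/-! ### Representations of the tensor square by locally nilpotent operators -/

namespace LocNil
variable {N : Type*} [AddCommGroup N] [Module K N] {D : Fin 2 → Module.End K N} (h : LocNil D)
include h

theorem exists_common (v w : N) : ∃ n, (∀ i, (D i ^ n) v = 0) ∧ ∀ i, (D i ^ n) w = 0 := by
  obtain ⟨n, hn⟩ := h.nil v
  obtain ⟨m, hm⟩ := h.nil w
  exact ⟨max n m, fun i => h.nil_of_le (hn i) (le_max_left _ _),
    fun i => h.nil_of_le (hm i) (le_max_right _ _)⟩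

/-- If `[R, D_i] = e_i(D)` then `[R, f(D)] = (∑ e_i ∂_i f)(D)`. -/
theorem act_derivation (R : Module.End K N) (e : Fin 2 → MvPowerSeries (Fin 2) K)
    (hR : ∀ i v, R (D i v) = D i (R v) + h.act (e i) v) (f : MvPowerSeries (Fin 2) K) (v : N) :
    R (h.act f v) = h.act f (R v) + h.act (e 0 * MvPowerSeries.pderiv K 0 f +
      e 1 * MvPowerSeries.pderiv K 1 f) v := by
  let δ (f : MvPowerSeries (Fin 2) K) : MvPowerSeries (Fin 2) K :=
    e 0 * MvPowerSeries.pderiv K 0 f + e 1 * MvPowerSeries.pderiv K 1 f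
  have hδ (f g) : δ (f * g) = δ f * g + f * δ g := by
    simp only [δ, Derivation.leibniz, smul_eq_mul]; ring
  -- Since `δ` is a derivation, the series for which the formula holds form a subalgebra; it
  -- contains the variables, and continuity does the rest.
  let S : Subalgebra K (MvPowerSeries (Fin 2) K) :=
    { carrier := {f | ∀ v, R (h.act f v) = h.act f (R v) + h.act (δ f) v}
      add_mem' := by
        intro f g hf hg v
        have : δ (f + g) = δ f + δ g := by simp only [δ, map_add]; ring
        rw [this, map_add, map_add, LinearMap.add_apply, LinearMap.add_apply, LinearMap.add_apply,
          map_add, hf, hg]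
        abel
      mul_mem' := by
        intro f g hf hg v
        rw [map_mul, Module.End.mul_apply, hf, hg, hδ]
        simp only [map_mul, map_add, Module.End.mul_apply, LinearMap.add_apply]
        abel
      algebraMap_mem' := by
        intro c v
        have : δ (algebraMap K _ c) = 0 := by
          simp only [δ, Derivation.map_algebraMap, mul_zero, add_zero]
        rw [this, map_zero, LinearMap.zero_apply, add_zero, AlgHom.commutes,
          Module.algebraMap_end_apply, Module.algebraMap_end_apply, map_smul] }
  have hX (i : Fin 2) : MvPowerSeries.X i ∈ S := by
    intro v
    have : δ (MvPowerSeries.X i) = e i := by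
      simp only [δ]
      rw [← slot_X]
      fin_cases i
      · change e 0 * MvPowerSeries.pderiv K 0 (slot 0 _) + e 1 * MvPowerSeries.pderiv K 1 (slot 0 _)
          = e 0
        rw [pderiv_slot_self, pderiv_slot_of_ne (by decide), PowerSeries.derivative_X,
          ← slotHom_apply, map_one, mul_one, mul_zero, add_zero]
      · change e 0 * MvPowerSeries.pderiv K 0 (slot 1 _) + e 1 * MvPowerSeries.pderiv K 1 (slot 1 _)
          = e 1
        rw [pderiv_slot_self, pderiv_slot_of_ne (by decide), PowerSeries.derivative_X,
          ← slotHom_apply, map_one, mul_one, mul_zero, zero_add]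
    rw [this, h.act_X, hR]
  obtain ⟨n, hv, hRv⟩ := h.exists_common v (R v)
  let L : MvPowerSeries (Fin 2) K →ₗ[K] N :=
    R ∘ₗ LinearMap.applyₗ v ∘ₗ h.act.toLinearMap - LinearMap.applyₗ (R v) ∘ₗ h.act.toLinearMap -
      LinearMap.applyₗ v ∘ₗ h.act.toLinearMap ∘ₗ
        (LinearMap.mulLeft K (e 0) ∘ₗ (MvPowerSeries.pderiv K 0).toLinearMap +
        LinearMap.mulLeft K (e 1) ∘ₗ (MvPowerSeries.pderiv K 1).toLinearMap)
  have hL (g) : L g = R (h.act g v) - h.act g (R v) - h.act (δ g) v := rfl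
  -- The exponent is `n + 1` because `δ` may remove one factor `X_i`.
  have key (i : Fin 2) (g : MvPowerSeries (Fin 2) K) : L (MvPowerSeries.X i ^ (n + 1) * g) = 0 := by
    have : δ (MvPowerSeries.X i ^ (n + 1)) = MvPowerSeries.X i ^ n *
        ((n + 1 : ℕ) • δ (MvPowerSeries.X i)) := by
      simp only [δ, Derivation.leibniz_pow, Nat.add_sub_cancel, smul_eq_mul, nsmul_eq_mul]
      ring
    rw [hL, hδ, this, map_add, mul_assoc, LinearMap.add_apply, h.act_X_pow_mul i hv le_rfl,
      h.act_X_pow_mul i hv (Nat.le_succ n), h.act_X_pow_mul i hv (Nat.le_succ n),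
      h.act_X_pow_mul i hRv (Nat.le_succ n)]
    simp
  have := series_ext₂ L (n + 1) (key 0) (key 1) (fun i j => ?_) f
  · rw [hL, sub_sub, sub_eq_zero] at this
    exact this
  · rw [hL, sub_sub, sub_eq_zero]
    exact S.mul_mem (S.pow_mem (hX 0) i) (S.pow_mem (hX 1) j) v

theorem act_commute (R : Module.End K N) (hR : ∀ i v, R (D i v) = D i (R v))
    (f : MvPowerSeries (Fin 2) K) (v : N) : R (h.act f v) = h.act f (R v) :=
  h.act_intertwine h R hR f v

/-- Commutators with arbitrary series follow from those with the two operators `D_i`, so a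
representation is given by finitely many operator identities. -/
theorem isLift₂ {δ γ s : K⟦X⟧} (H V : Fin 2 → Module.End K N)
    (hHD : ∀ i v, H i (D i v) = D i (H i v) + h.act (slot i δ) v)
    (hHD' : ∀ i j, i ≠ j → ∀ v, H i (D j v) = D j (H i v))
    (hVD : ∀ i j v, V i (D j v) = D j (V i v))
    (hHV : ∀ i, H i * V i = V i * H i + V i * h.act (slot i γ))
    (hVV : ∀ i, V i * V i = h.act (slot i s)) (hHH : H 0 * H 1 = H 1 * H 0)
    (hHV' : ∀ i j, i ≠ j → H i * V j = V j * H i) (hVV' : V 0 * V 1 = -(V 1 * V 0)) :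
    IsLift₂ δ γ s h.act H V where
  H_ser i f := by
    ext v
    have := h.act_derivation (H i) (fun j => if i = j then slot i δ else 0) (fun j v => ?_) f v
    · fin_cases i <;> simpa using this
    · by_cases hij : i = j
      · subst hij
        rw [if_pos rfl, hHD]
      · rw [if_neg hij, hHD' i j hij, map_zero, LinearMap.zero_apply, add_zero]
  V_ser i f := LinearMap.ext fun v => h.act_commute (V i) (hVD i) f v
  H_V := hHV
  V_V := hVV
  comm_H_H := hHH
  comm_H_V := hHV'
  anticomm_V_V := hVV'

/-- In each term of the binomial expansion of exponent `n + n` one of the two exponents is at least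
`n`. -/
theorem add_pow_apply_eq_zero {v : N} {n : ℕ} (hn : ∀ i, (D i ^ n) v = 0) :
    ((D 0 + D 1) ^ (n + n)) v = 0 := by
  rw [h.comm.add_pow, LinearMap.sum_apply]
  refine Finset.sum_eq_zero fun m hm => ?_
  rw [(Nat.cast_commute _ _).symm.eq, ← nsmul_eq_mul, LinearMap.smul_apply,
    h.monomial_apply_eq_zero hn, smul_zero]
  rw [Finset.mem_range] at hm
  omega

theorem act_addHom_X_pow_mul {v : N} {n : ℕ} (hn : ∀ i, (D i ^ n) v = 0) (g : K⟦X⟧) :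
    h.act (addHom (PowerSeries.X ^ (n + n) * g)) v = 0 := by
  rw [mul_comm _ g, map_mul, map_mul, map_pow, addHom_X, map_pow, map_add, h.act_X, h.act_X,
    Module.End.mul_apply, h.add_pow_apply_eq_zero hn, map_zero]

end LocNil

/-! ### The action of the tensor square on `A ⊗ A` -/

namespace A
open TensorProduct
variable {h : K}

variable (h) in
/-- The operators by which `X ⊗ 1` and `1 ⊗ X` act. -/
def D₂ : Fin 2 → Module.End K (A h ⊗[K] A h) :=
  ![TensorProduct.map (D h) LinearMap.id, TensorProduct.map LinearMap.id (D h)]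

theorem D₂_zero_pow (n : ℕ) (a b : A h) : (D₂ h 0 ^ n) (a ⊗ₜ b) = (D h ^ n) a ⊗ₜ b := by
  induction n generalizing a with
  | zero => rfl
  | succ n ih => rw [pow_succ, Module.End.mul_apply, pow_succ, Module.End.mul_apply, ← ih]; rfl

theorem D₂_one_pow (n : ℕ) (a b : A h) : (D₂ h 1 ^ n) (a ⊗ₜ b) = a ⊗ₜ (D h ^ n) b := by
  induction n generalizing b with
  | zero => rfl
  | succ n ih => rw [pow_succ, Module.End.mul_apply, pow_succ, Module.End.mul_apply, ← ih]; rfl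

variable (h) in
theorem locNil₂ : LocNil (D₂ h) where
  comm := TensorProduct.ext' fun _ _ => rfl
  nil v := by
    induction v with
    | zero => exact ⟨0, fun _ => map_zero _⟩
    | tmul a b =>
      obtain ⟨n, hn⟩ := (locNil h).exists_common a b
      refine ⟨n, fun i => ?_⟩
      fin_cases i
      · exact (D₂_zero_pow n a b).trans (by rw [show (D h ^ n) a = 0 from hn.1 0, zero_tmul])
      · exact (D₂_one_pow n a b).trans (by rw [show (D h ^ n) b = 0 from hn.2 0, tmul_zero])
    | add v w hv hw =>
      obtain ⟨n, hn⟩ := hv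
      obtain ⟨m, hm⟩ := hw
      have le {i : Fin 2} {v : A h ⊗[K] A h} {n m : ℕ} (hn : (D₂ h i ^ n) v = 0) (hm : n ≤ m) :
          (D₂ h i ^ m) v = 0 := by
        obtain ⟨k, rfl⟩ := Nat.exists_eq_add_of_le hm
        rw [add_comm, pow_add, Module.End.mul_apply, hn, map_zero]
      exact ⟨max n m, fun i => by
        rw [map_add, le (hn i) (le_max_left _ _), le (hm i) (le_max_right _ _), add_zero]⟩

theorem act_slot_zero (f : K⟦X⟧) (a b : A h) :
    (locNil₂ h).act (slot 0 f) (a ⊗ₜ b) = dX h f a ⊗ₜ b := by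
  obtain ⟨n, hn⟩ := (locNil₂ h).nil (a ⊗ₜ b)
  obtain ⟨m, hm⟩ := D_nil a
  let L : K⟦X⟧ →ₗ[K] A h ⊗[K] A h :=
    LinearMap.applyₗ (a ⊗ₜ b) ∘ₗ (locNil₂ h).act.toLinearMap ∘ₗ (slotHom 0).toLinearMap -
      (TensorProduct.mk K (A h) (A h)).flip b ∘ₗ LinearMap.applyₗ a ∘ₗ (dX h).toLinearMap
  have hL (f) : L f = (locNil₂ h).act (slotHom 0 f) (a ⊗ₜ b) - dX h f a ⊗ₜ b := rfl
  have := series_ext L (n + m) (fun g => ?_) (fun l => ?_) f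
  · rwa [hL, sub_eq_zero, slotHom_apply] at this
  · rw [hL, map_mul, map_pow, slotHom_apply, slot_X,
      (locNil₂ h).act_X_pow_mul 0 hn (Nat.le_add_right _ _), pow_add, mul_assoc, mul_left_comm,
      dX_X_pow_mul hm, zero_tmul, sub_zero]
  · rw [hL, map_pow, slotHom_apply, slot_X, map_pow, (locNil₂ h).act_X, D₂_zero_pow, dX_X_pow,
      sub_self]

theorem act_slot_one (f : K⟦X⟧) (a b : A h) :
    (locNil₂ h).act (slot 1 f) (a ⊗ₜ b) = a ⊗ₜ dX h f b := by
  obtain ⟨n, hn⟩ := (locNil₂ h).nil (a ⊗ₜ b)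
  obtain ⟨m, hm⟩ := D_nil b
  let L : K⟦X⟧ →ₗ[K] A h ⊗[K] A h :=
    LinearMap.applyₗ (a ⊗ₜ b) ∘ₗ (locNil₂ h).act.toLinearMap ∘ₗ (slotHom 1).toLinearMap -
      TensorProduct.mk K (A h) (A h) a ∘ₗ LinearMap.applyₗ b ∘ₗ (dX h).toLinearMap
  have hL (f) : L f = (locNil₂ h).act (slotHom 1 f) (a ⊗ₜ b) - a ⊗ₜ dX h f b := rfl
  have := series_ext L (n + m) (fun g => ?_) (fun l => ?_) f
  · rwa [hL, sub_eq_zero, slotHom_apply] at this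
  · rw [hL, map_mul, map_pow, slotHom_apply, slot_X,
      (locNil₂ h).act_X_pow_mul 1 hn (Nat.le_add_right _ _), pow_add, mul_assoc, mul_left_comm,
      dX_X_pow_mul hm, tmul_zero, sub_zero]
  · rw [hL, map_pow, slotHom_apply, slot_X, map_pow, (locNil₂ h).act_X, D₂_one_pow, dX_X_pow,
      sub_self]

variable (h) in
/-- The operators by which `H ⊗ 1` and `1 ⊗ H` act. -/
def opH₂ : Fin 2 → Module.End K (A h ⊗[K] A h) :=
  ![TensorProduct.map (opH h) LinearMap.id, TensorProduct.map LinearMap.id (opH h)]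

variable (h) in
/-- The operators by which `V ⊗ 1` and `1 ⊗ V` act. -/
def opV₂ : Fin 2 → Module.End K (A h ⊗[K] A h) :=
  -- The parity operator on the second factor makes the two odd operators anticommute.
  ![TensorProduct.map (opV h) (opP h), TensorProduct.map LinearMap.id (opV h)]

theorem opH_D (hh : h ≠ 0) (a : A h) : opH h (D h a) = D h (opH h a) + dX h (dlB h) a := by
  have := opH_dX hh PowerSeries.X a
  rwa [← D_eq_dX, PowerSeries.derivative_X, mul_one] at this

theorem opV_D (a : A h) : opV h (D h a) = D h (opV h a) := by
  rw [D_eq_dX, opV_dX]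

theorem isLift₂ (hh : h ≠ 0) :
    IsLift₂ (dlB h) (gmB h) (sqB h) (locNil₂ h).act (opH₂ h) (opV₂ h) := by
  refine (locNil₂ h).isLift₂ _ _ ?_ ?_ ?_ ?_ ?_ ?_ ?_ ?_
  · intro i v
    refine LinearMap.congr_fun (f := opH₂ h i ∘ₗ D₂ h i) (g := D₂ h i ∘ₗ opH₂ h i +
      (locNil₂ h).act (slot i (dlB h))) (TensorProduct.ext' fun a b => ?_) v
    fin_cases i
    · change opH h (D h a) ⊗ₜ b = D h (opH h a) ⊗ₜ b + (locNil₂ h).act (slot 0 (dlB h)) (a ⊗ₜ b)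
      rw [act_slot_zero, opH_D hh, add_tmul]
    · change a ⊗ₜ opH h (D h b) = a ⊗ₜ D h (opH h b) + (locNil₂ h).act (slot 1 (dlB h)) (a ⊗ₜ b)
      rw [act_slot_one, opH_D hh, tmul_add]
  · intro i j hij v
    refine LinearMap.congr_fun (f := opH₂ h i ∘ₗ D₂ h j) (g := D₂ h j ∘ₗ opH₂ h i)
      (TensorProduct.ext' fun a b => ?_) v
    fin_cases i <;> fin_cases j <;> first | rfl | simp at hij
  · intro i j v
    refine LinearMap.congr_fun (f := opV₂ h i ∘ₗ D₂ h j) (g := D₂ h j ∘ₗ opV₂ h i)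
      (TensorProduct.ext' fun a b => ?_) v
    fin_cases i <;> fin_cases j
    · change opV h (D h a) ⊗ₜ opP h b = D h (opV h a) ⊗ₜ opP h b
      rw [opV_D]
    · change opV h a ⊗ₜ opP h (D h b) = opV h a ⊗ₜ D h (opP h b)
      rw [opP_D]
    · rfl
    · change a ⊗ₜ opV h (D h b) = a ⊗ₜ D h (opV h b)
      rw [opV_D]
  · intro i
    refine TensorProduct.ext' fun a b => ?_
    fin_cases i
    · change opH h (opV h a) ⊗ₜ opP h b = opV h (opH h a) ⊗ₜ opP h b +
        opV₂ h 0 ((locNil₂ h).act (slot 0 (gmB h)) (a ⊗ₜ b))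
      rw [act_slot_zero, opH_opV hh, add_tmul]
      rfl
    · change a ⊗ₜ opH h (opV h b) = a ⊗ₜ opV h (opH h b) +
        opV₂ h 1 ((locNil₂ h).act (slot 1 (gmB h)) (a ⊗ₜ b))
      rw [act_slot_one, opH_opV hh, tmul_add]
      rfl
  · intro i
    refine TensorProduct.ext' fun a b => ?_
    fin_cases i
    · change opV h (opV h a) ⊗ₜ opP h (opP h b) = (locNil₂ h).act (slot 0 (sqB h)) (a ⊗ₜ b)
      rw [act_slot_zero, opV_opV hh, opP_opP]
    · change a ⊗ₜ opV h (opV h b) = (locNil₂ h).act (slot 1 (sqB h)) (a ⊗ₜ b)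
      rw [act_slot_one, opV_opV hh]
  · exact TensorProduct.ext' fun a b => rfl
  · intro i j hij
    refine TensorProduct.ext' fun a b => ?_
    fin_cases i <;> fin_cases j
    · simp at hij
    · rfl
    · change opV h a ⊗ₜ opH h (opP h b) = opV h a ⊗ₜ opP h (opH h b)
      rw [opP_opH]
    · simp at hij
  · refine TensorProduct.ext' fun a b => ?_
    change opV h a ⊗ₜ opP h (opV h b) = -(opV h a ⊗ₜ opV h (opP h b))
    rw [opP_opV, tmul_neg]

variable (h) in
/-- The action of the tensor square on `A ⊗ A`. -/
def act₂ (hh : h ≠ 0) : BB h →ₐ[K] Module.End K (A h ⊗[K] A h) := lift₂ (isLift₂ hh)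

variable (hh : h ≠ 0)
theorem act₂_ser (f) : act₂ h hh (BB.ser h f) = (locNil₂ h).act f := lift₂_ser₂ ..
theorem act₂_H (i) : act₂ h hh (BB.H h i) = opH₂ h i := lift₂_genH₂ ..
theorem act₂_V (i) : act₂ h hh (BB.V h i) = opV₂ h i := lift₂_genV₂ ..

/-! ### The product of `A` is a morphism of modules -/

/-- Because `D` is a derivation, multiplication intertwines `D ⊗ 1 + 1 ⊗ D` with `D`; this passes to
powers and then, by continuity, to series. -/
theorem mul_act_addHom (f : K⟦X⟧) (v : A h ⊗[K] A h) :
    LinearMap.mul' K (A h) ((locNil₂ h).act (addHom f) v) = dX h f (LinearMap.mul' K (A h) v) := by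
  have hD (l : ℕ) (v) : LinearMap.mul' K (A h) (((D₂ h 0 + D₂ h 1) ^ l) v) =
      (D h ^ l) (LinearMap.mul' K (A h) v) := by
    have h1 (v) : LinearMap.mul' K (A h) ((D₂ h 0 + D₂ h 1) v) =
        D h (LinearMap.mul' K (A h) v) := by
      refine LinearMap.congr_fun (f := LinearMap.mul' K (A h) ∘ₗ (D₂ h 0 + D₂ h 1))
        (g := D h ∘ₗ LinearMap.mul' K (A h)) (TensorProduct.ext' fun a b => ?_) v
      change LinearMap.mul' K (A h) (D h a ⊗ₜ b + a ⊗ₜ D h b) = D h (LinearMap.mul' K (A h) (a ⊗ₜ b))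
      rw [map_add, LinearMap.mul'_apply, LinearMap.mul'_apply, LinearMap.mul'_apply, D_mul, add_comm]
    induction l generalizing v with
    | zero => rfl
    | succ l ih => rw [pow_succ, pow_succ, Module.End.mul_apply, Module.End.mul_apply, ih, h1]
  obtain ⟨n, hn⟩ := (locNil₂ h).nil v
  obtain ⟨m, hm⟩ := D_nil (LinearMap.mul' K (A h) v)
  let L : K⟦X⟧ →ₗ[K] A h :=
    LinearMap.mul' K (A h) ∘ₗ LinearMap.applyₗ v ∘ₗ (locNil₂ h).act.toLinearMap ∘ₗ
      addHom.toLinearMap - LinearMap.applyₗ (LinearMap.mul' K (A h) v) ∘ₗ (dX h).toLinearMap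
  have hL (f) : L f = LinearMap.mul' K (A h) ((locNil₂ h).act (addHom f) v) -
    dX h f (LinearMap.mul' K (A h) v) := rfl
  have := series_ext L (n + n + m) (fun g => ?_) (fun l => ?_) f
  · rwa [hL, sub_eq_zero] at this
  · rw [hL, pow_add, mul_assoc, (locNil₂ h).act_addHom_X_pow_mul hn, mul_left_comm,
      dX_X_pow_mul hm, map_zero, sub_zero]
  · rw [hL, map_pow, addHom_X, map_pow, map_add, (locNil₂ h).act_X, (locNil₂ h).act_X, hD, dX_X_pow,
      sub_self]

/-- A group-like element acts on a module algebra by algebra endomorphisms. -/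
theorem dX_expS_mul (c : K) (a b : A h) :
    dX h (expS c) (a * b) = dX h (expS c) a * dX h (expS c) b := by
  have := mul_act_addHom (expS c) (a ⊗ₜ b)
  rwa [addHom_expS, map_mul, Module.End.mul_apply, act_slot_one, act_slot_zero,
    LinearMap.mul'_apply, LinearMap.mul'_apply, eq_comm] at this

theorem opV_mul (a b : A h) : opV h (a * b) = dX h (expS (h / 2)) a * opV h b +
    opV h a * opP h (dX h (expS (-h / 2)) b) := by
  rw [opV_apply, dX_expS_mul, opW_mul', ← opV_apply, ← opV_apply, opT, dX_dX, ← expS_add]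
  congr 4
  ring_nf

/-- `A` is a module algebra over `B`. The elements `b` with this property form a subalgebra because
`Δ` and both actions are multiplicative; on generators it is the collection of Leibniz rules found
above. -/
theorem mul_act₂_comul (b : B h) (v : A h ⊗[K] A h) :
    LinearMap.mul' K (A h) (act₂ h hh (BB.comul h hh b) v) =
      act h hh b (LinearMap.mul' K (A h) v) := by
  let S : Subalgebra K (B h) :=
    { carrier := {b | ∀ v, LinearMap.mul' K (A h) (act₂ h hh (BB.comul h hh b) v) =
        act h hh b (LinearMap.mul' K (A h) v)}
      add_mem' := by
        intro a b ha hb v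
        simp only [map_add, LinearMap.add_apply, ha v, hb v]
      mul_mem' := by
        intro a b ha hb v
        simp only [map_mul, Module.End.mul_apply, ha _, hb _]
      algebraMap_mem' := by
        intro c v
        simp only [AlgHom.commutes, Module.algebraMap_end_apply, map_smul] }
  refine B.mem_of_generators S ?_ ?_ ?_ b v
  · intro f v
    rw [BB.comul_ser, act₂_ser, act_ser, mul_act_addHom]
  · intro v
    refine LinearMap.congr_fun (f := LinearMap.mul' K (A h) ∘ₗ (act₂ h hh (BB.comul h hh (B.H h))))
      (g := act h hh (B.H h) ∘ₗ LinearMap.mul' K (A h)) (TensorProduct.ext' fun a b => ?_) v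
    rw [BB.comul_H, BB.comulH, act_H]
    simp only [map_add, map_mul, map_smul, BB.exp, act₂_H, act₂_V, act₂_ser, LinearMap.comp_apply,
      LinearMap.add_apply, LinearMap.smul_apply, Module.End.mul_apply, act_slot_one]
    have e1 : opH₂ h 0 (a ⊗ₜ[K] dX h (expS (-h)) b) = opH h a ⊗ₜ dX h (expS (-h)) b := rfl
    have e2 : opH₂ h 1 (a ⊗ₜ[K] b) = a ⊗ₜ opH h b := rfl
    have e3 : opV₂ h 1 (a ⊗ₜ[K] dX h (expS (-h / 2)) b) = a ⊗ₜ opV h (dX h (expS (-h / 2)) b) := rfl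
    rw [e1, e2, e3, act_slot_zero, act_slot_zero]
    change LinearMap.mul' K (A h) _ + LinearMap.mul' K (A h) _ + (2 * h) • LinearMap.mul' K (A h)
      (opV h (dX h (expS (h / 2)) a) ⊗ₜ opP h (opV h (dX h (expS (-h / 2)) b))) = _
    simp only [LinearMap.mul'_apply]
    rw [opH_mul', ← opW_eq, opV_apply, dX_dX, ← expS_add, ← add_div, ← two_mul,
      mul_div_cancel_left₀ _ two_ne_zero, opT]
    abel
  · intro v
    refine LinearMap.congr_fun (f := LinearMap.mul' K (A h) ∘ₗ (act₂ h hh (BB.comul h hh (B.V h))))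
      (g := act h hh (B.V h) ∘ₗ LinearMap.mul' K (A h)) (TensorProduct.ext' fun a b => ?_) v
    rw [BB.comul_V, BB.comulV, act_V]
    simp only [map_add, map_mul, map_smul, BB.exp, act₂_H, act₂_V, act₂_ser, LinearMap.comp_apply,
      LinearMap.add_apply, LinearMap.smul_apply, Module.End.mul_apply, act_slot_one]
    have e2 : opV₂ h 1 (a ⊗ₜ[K] b) = a ⊗ₜ opV h b := rfl
    rw [e2, act_slot_zero]
    change LinearMap.mul' K (A h) (opV h a ⊗ₜ opP h (dX h (expS (-h / 2)) b)) +
      LinearMap.mul' K (A h) _ = _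
    simp only [LinearMap.mul'_apply]
    rw [opV_mul, add_comm]

end A

/-! ### `X B = B X` -/

namespace B
variable {h : K}

theorem exists_dlB_eq (h : K) : ∃ g : K⟦X⟧, dlB h = PowerSeries.X * g := by
  rw [← dvd_def, PowerSeries.X_dvd_iff, PowerSeries.constantCoeff_smul, constantCoeff_sinhS,
    smul_zero]

/-- Since `[H, X]` is divisible by `X`, the element `X` is normal: it passes through `H` at the cost
of shifting `H` by a series. Hence left and right multiples of `X^L` agree, and so do the two
notions of continuity. -/
theorem H_mul_X : ∃ g : K⟦X⟧, H h * ser h PowerSeries.X = ser h PowerSeries.X * (H h + ser h g) ∧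
    ser h PowerSeries.X * H h = (H h - ser h g) * ser h PowerSeries.X := by
  obtain ⟨g, hg⟩ := exists_dlB_eq h
  refine ⟨g, ?_, ?_⟩
  · rw [H_mul_ser, PowerSeries.derivative_X, mul_one, hg, ser_mul, mul_add]
  · rw [sub_mul, H_mul_ser, PowerSeries.derivative_X, mul_one, hg, ← ser_mul,
      mul_comm PowerSeries.X g, add_sub_cancel_right]

theorem X_pow_mul (L : ℕ) (b : B h) :
    ∃ b', ser h (PowerSeries.X ^ L) * b = b' * ser h (PowerSeries.X ^ L) := by
  have key (b : B h) : ∃ b', ser h PowerSeries.X * b = b' * ser h PowerSeries.X := by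
    let S : Subalgebra K (B h) :=
      { carrier := {b | ∃ b', ser h PowerSeries.X * b = b' * ser h PowerSeries.X}
        add_mem' := by
          rintro a b ⟨a', ha⟩ ⟨b', hb⟩
          exact ⟨a' + b', by rw [mul_add, ha, hb, add_mul]⟩
        mul_mem' := by
          rintro a b ⟨a', ha⟩ ⟨b', hb⟩
          exact ⟨a' * b', by rw [← mul_assoc, ha, mul_assoc, hb, mul_assoc]⟩
        algebraMap_mem' := fun c => ⟨algebraMap K _ c, (Algebra.commutes c _).symm⟩ }
    refine mem_of_generators S (fun f => ⟨ser h f, ?_⟩) ?_ ⟨V h, (V_mul_ser _).symm⟩ b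
    · rw [← ser_mul, ← ser_mul, mul_comm PowerSeries.X f]
    · obtain ⟨g, -, hg⟩ := H_mul_X (h := h)
      exact ⟨_, hg⟩
  induction L with
  | zero => exact ⟨b, by rw [pow_zero, ser_one, one_mul, mul_one]⟩
  | succ L ih =>
    obtain ⟨b', hb'⟩ := ih
    obtain ⟨b'', hb''⟩ := key b'
    exact ⟨b'', by rw [pow_succ', ser_mul, mul_assoc, hb', ← mul_assoc, hb'', mul_assoc]⟩

theorem mul_X_pow (L : ℕ) (b : B h) :
    ∃ b', b * ser h (PowerSeries.X ^ L) = ser h (PowerSeries.X ^ L) * b' := by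
  have key (b : B h) : ∃ b', b * ser h PowerSeries.X = ser h PowerSeries.X * b' := by
    let S : Subalgebra K (B h) :=
      { carrier := {b | ∃ b', b * ser h PowerSeries.X = ser h PowerSeries.X * b'}
        add_mem' := by
          rintro a b ⟨a', ha⟩ ⟨b', hb⟩
          exact ⟨a' + b', by rw [mul_add, ← ha, ← hb, add_mul]⟩
        mul_mem' := by
          rintro a b ⟨a', ha⟩ ⟨b', hb⟩
          exact ⟨a' * b', by rw [mul_assoc, hb, ← mul_assoc, ha, mul_assoc]⟩
        algebraMap_mem' := fun c => ⟨algebraMap K _ c, Algebra.commutes c _⟩ }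
    refine mem_of_generators S (fun f => ⟨ser h f, ?_⟩) ?_ ⟨V h, V_mul_ser _⟩ b
    · rw [← ser_mul, ← ser_mul, mul_comm PowerSeries.X f]
    · obtain ⟨g, hg, -⟩ := H_mul_X (h := h)
      exact ⟨_, hg⟩
  induction L generalizing b with
  | zero => exact ⟨b, by rw [pow_zero, ser_one, one_mul, mul_one]⟩
  | succ L ih =>
    obtain ⟨b', hb'⟩ := ih b
    obtain ⟨b'', hb''⟩ := key b'
    exact ⟨b'', by rw [pow_succ, ser_mul, ← mul_assoc, hb', mul_assoc, hb'', mul_assoc]⟩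

/-- A functional is continuous as soon as it vanishes on some `B X^L`. -/
theorem mem_Bdual {φ : Module.Dual K (B h)} {L : ℕ}
    (hL : ∀ b, φ (b * ser h (PowerSeries.X ^ L)) = 0) : φ ∈ Bdual h := by
  refine ⟨L, fun b => ?_⟩
  obtain ⟨b', hb'⟩ := X_pow_mul L b
  rw [hb', hL]

theorem exists_of_mem_Bdual {φ : Module.Dual K (B h)} (hφ : φ ∈ Bdual h) :
    ∃ L, ∀ b, φ (b * ser h (PowerSeries.X ^ L)) = 0 := by
  obtain ⟨L, hL⟩ := hφ
  refine ⟨L, fun b => ?_⟩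
  obtain ⟨b', hb'⟩ := mul_X_pow L b
  rw [hb', hL]

variable (h) in
/-- The element `H^k f(X) V^m`. -/
def mono (k : ℕ) (f : K⟦X⟧) (m : Fin 2) : B h := H h ^ k * ser h f * V h ^ (m : ℕ)

theorem E_eq (k l : ℕ) (m : Fin 2) : E h k l m = mono h k (PowerSeries.X ^ l) m := rfl

theorem V_pow_mul_ser (m : ℕ) (f : K⟦X⟧) : V h ^ m * ser h f = ser h f * V h ^ m :=
  (Commute.pow_left (V_mul_ser f : Commute (V h) (ser h f)) m).eq

theorem mono_mul_ser (k : ℕ) (f g : K⟦X⟧) (m : Fin 2) :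
    mono h k f m * ser h g = mono h k (f * g) m := by
  rw [mono, mono, mul_assoc, V_pow_mul_ser, ser_mul]
  simp only [mul_assoc]

theorem mem_of_mono (N : Submodule K (B h)) (hN : ∀ k f m, mono h k f m ∈ N) (b : B h) : b ∈ N :=
  OspBorel.mem_of_mono N hN b

theorem linearMap_ext_mono {M : Type*} [AddCommGroup M] [Module K M] {F G : B h →ₗ[K] M}
    (hFG : ∀ k f m, F (mono h k f m) = G (mono h k f m)) : F = G :=
  OspBorel.linearMap_ext_mono hFG

variable (h) in
/-- `expand` as a linear map. -/
def expandL : (ℕ × Fin 2 →₀ K⟦X⟧) →ₗ[K] B h := OspBorel.expandL _ _ _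

theorem expandL_apply (c : ℕ × Fin 2 →₀ K⟦X⟧) : expandL h c = expand h c := rfl

theorem expandL_single (k : ℕ) (f : K⟦X⟧) (m : Fin 2) :
    expandL h (Finsupp.single (k, m) f) = mono h k f m := OspBorel.expandL_single k f m

theorem expand_eq_sum (c : ℕ × Fin 2 →₀ K⟦X⟧) :
    expand h c = c.sum fun i f => mono h i.1 f i.2 := rfl

end B

/-! ### The pairing of `A` and `B` -/

namespace A
variable {h : K}

theorem opV_mul_ser (a : A h) (f : K⟦X⟧) : opV h (a * ser h f) = opV h a * ser h f := by
  rw [opV_apply, dX_mul_ser, opW_mul_ser, opV_apply]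

theorem dX_ser (f g : K⟦X⟧) : dX h f (ser h g) = PowerSeries.constantCoeff f • ser h g := by
  rw [← one_mul (ser h g), dX_mul_ser, dX_one, smul_mul_assoc]
theorem dX_z (f : K⟦X⟧) : dX h f (z h) = PowerSeries.constantCoeff f • z h := by
  rw [← one_mul (z h), dX_mul_z, dX_one, smul_mul_assoc]
theorem dX_y (f : K⟦X⟧) : dX h f (y h) =
    PowerSeries.constantCoeff f • y h + PowerSeries.coeff 1 f • 1 := by
  rw [← one_mul (y h), dX_mul_y, dX_one, dX_one, smul_mul_assoc]
  congr 2
  rw [← PowerSeries.coeff_zero_eq_constantCoeff_apply, PowerSeries.coeff_derivative]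
  simp
theorem opV_ser (f : K⟦X⟧) : opV h (ser h f) = 0 := by
  rw [← one_mul (ser h f), opV_mul_ser, opV_apply, dX_one, map_smul, opW_one, smul_zero, zero_mul]
theorem opV_one : opV h 1 = 0 := by rw [← ser_one, opV_ser]
theorem opV_z : opV h (z h) = 1 := by
  rw [opV_apply, dX_z, constantCoeff_expS, one_smul, ← one_mul (z h), opW_mul_z, opT_one, opW_one,
    zero_mul, sub_zero]
theorem opV_y : opV h (y h) = (1 / 4 : K) • z h := by
  rw [opV_apply, dX_y, constantCoeff_expS, one_smul, map_add, map_smul, opW_one, smul_zero,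
    add_zero, ← one_mul (y h), opW_mul_y, opT_one, opW_one, zero_mul, one_mul, add_zero]
theorem opH_ser (f : K⟦X⟧) : opH h (ser h f) = ser h (PowerSeries.derivative K f) := by
  rw [← one_mul (ser h f), opH_mul_ser, opT_one, opH_one, one_mul, zero_mul, add_zero]
theorem opH_z : opH h (z h) = -(1 / 2 : K) • z h := by
  rw [← one_mul (z h), opH_mul_z, opT_one, opH_one, opW_one]
  simp
theorem opH_y : opH h (y h) = -y h := by
  rw [← one_mul (y h), opH_mul_y, opT_one, opH_one, opW_one]
  simp
theorem ser_mul_z (f : K⟦X⟧) : ser h f * z h = z h * ser h f := (z_mul_ser f).symm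
theorem opV_ser_mul_z (f : K⟦X⟧) : opV h (ser h f * z h) = ser h f := by
  rw [ser_mul_z, opV_mul_ser, opV_z, one_mul]

theorem opH_pow_ser (k : ℕ) (f : K⟦X⟧) :
    (opH h ^ k) (ser h f) = ser h ((PowerSeries.derivative K)^[k] f) := by
  induction k generalizing f with
  | zero => rfl
  | succ k ih => rw [pow_succ, Module.End.mul_apply, opH_ser, ih, Function.iterate_succ_apply]

theorem counit_opP (a : A h) : counit h (opP h a) = counit h a := counit_par a

theorem opP_opH_pow (k : ℕ) (a : A h) : opP h ((opH h ^ k) a) = (opH h ^ k) (opP h a) := by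
  induction k generalizing a with
  | zero => rfl
  | succ k ih => rw [pow_succ, Module.End.mul_apply, ih, opP_opH, Module.End.mul_apply]

/-- `H` preserves parity and the counit vanishes on odd elements. -/
theorem counit_opH_pow_eq_zero (k : ℕ) {a : A h} (ha : opP h a = -a) :
    counit h ((opH h ^ k) a) = 0 := by
  have := counit_opP ((opH h ^ k) a)
  rw [opP_opH_pow, ha, map_neg, map_neg, neg_eq_iff_add_eq_zero, ← two_mul] at this
  exact (mul_eq_zero.1 this).resolve_left two_ne_zero

theorem opP_z : opP h (z h) = -z h := par_z
theorem opP_ser (f : K⟦X⟧) : opP h (ser h f) = ser h f := par_ser f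
theorem opP_ser_mul_z (f : K⟦X⟧) : opP h (ser h f * z h) = -(ser h f * z h) := by
  rw [opP_mul_z, opP_ser]

variable (hh : h ≠ 0)

/-- The pairing `A × B → K`, `(a, b) ↦ ε(b a)`. -/
def pairing : A h →ₗ[K] Module.Dual K (B h) :=
  LinearMap.mk₂ K (fun a b => counit h (act h hh b a))
    (fun a a' b => by rw [map_add, map_add]) (fun c a b => by rw [map_smul, map_smul])
    (fun a b b' => by rw [map_add, LinearMap.add_apply, map_add])
    (fun c a b => by rw [map_smul, LinearMap.smul_apply, map_smul])

theorem pairing_apply (a : A h) (b : B h) : pairing hh a b = counit h (act h hh b a) := rfl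

/-- Right multiplication in `B` is adjoint to the action on `A`; nearly every evaluation of the
pairing is moved into `A` by this. -/
theorem pairing_mul_right (a : A h) (b c : B h) :
    pairing hh a (b * c) = pairing hh (act h hh c a) b := by
  rw [pairing_apply, pairing_apply, map_mul, Module.End.mul_apply]

theorem pairing_one_right (a : A h) : pairing hh a 1 = counit h a := by
  rw [pairing_apply, map_one, Module.End.one_apply]

theorem pairing_mul_X_pow (a : A h) (b : B h) (L : ℕ) :
    pairing hh a (b * B.ser h (PowerSeries.X ^ L)) = pairing hh ((D h ^ L) a) b := by
  rw [pairing_mul_right, act_ser, dX_X_pow]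

theorem act_mono (k : ℕ) (u : K⟦X⟧) (m : Fin 2) (a : A h) :
    act h hh (B.mono h k u m) a = (opH h ^ k) (dX h u ((opV h ^ (m : ℕ)) a)) := by
  rw [B.mono, map_mul, map_mul, map_pow, map_pow, act_H, act_V, act_ser, Module.End.mul_apply,
    Module.End.mul_apply]

theorem counit_opH_pow_ser (k : ℕ) (f : K⟦X⟧) :
    counit h ((opH h ^ k) (ser h f)) = k.factorial * PowerSeries.coeff k f := by
  rw [opH_pow_ser, counit_ser, PowerSeries.constantCoeff_iterate_derivative]

/-- On `f(x)` the operator `H` is differentiation, `X` is zero and `V` is zero, so only a Taylor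
coefficient of `f` survives. With a factor `z`, the next lemma uses `V (f z) = f` and parity. -/
theorem pairing_ser (f u : K⟦X⟧) (k : ℕ) (m : Fin 2) : pairing hh (ser h f) (B.mono h k u m) =
    if m = 0 then k.factorial * PowerSeries.coeff k f * PowerSeries.constantCoeff u else 0 := by
  rw [pairing_apply, act_mono]
  fin_cases m
  · change counit h ((opH h ^ k) (dX h u (ser h f))) = _
    rw [dX_ser, map_smul, map_smul, counit_opH_pow_ser, smul_eq_mul, mul_comm]
    rfl
  · change counit h ((opH h ^ k) (dX h u ((opV h ^ 1) (ser h f)))) = _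
    rw [pow_one, opV_ser, map_zero, map_zero, map_zero, if_neg (by decide)]

theorem pairing_ser_mul_z (f u : K⟦X⟧) (k : ℕ) (m : Fin 2) :
    pairing hh (ser h f * z h) (B.mono h k u m) =
    if m = 1 then k.factorial * PowerSeries.coeff k f * PowerSeries.constantCoeff u else 0 := by
  rw [pairing_apply, act_mono]
  fin_cases m
  · change counit h ((opH h ^ k) (dX h u (ser h f * z h))) = _
    rw [counit_opH_pow_eq_zero, if_neg (by decide)]
    rw [opP_dX, opP_ser_mul_z, map_neg]
  · change counit h ((opH h ^ k) (dX h u ((opV h ^ 1) (ser h f * z h)))) = _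
    rw [pow_one, opV_ser_mul_z, dX_ser, map_smul, map_smul, counit_opH_pow_ser,
      smul_eq_mul, mul_comm]
    rfl

/-- `X y = 1` gives the single nonzero value: `H y = -y` has counit zero, `H` kills `1`, and `V y`
is odd. -/
theorem pairing_y (k : ℕ) (u : K⟦X⟧) (m : Fin 2) : pairing hh (y h) (B.mono h k u m) =
    if k = 0 ∧ m = 0 then PowerSeries.coeff 1 u else 0 := by
  have hy (k : ℕ) : counit h ((opH h ^ k) (y h)) = 0 := by
    induction k with
    | zero => exact counit_y
    | succ k ih => rw [pow_succ, Module.End.mul_apply, opH_y, map_neg, map_neg, ih, neg_zero]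
  rw [pairing_apply, act_mono]
  fin_cases m
  · change counit h ((opH h ^ k) (dX h u (y h))) = _
    rw [dX_y, map_add, map_smul, map_smul, map_add, map_smul, map_smul, hy, smul_zero, zero_add]
    rcases k with _ | k
    · simp
    · rw [pow_succ, Module.End.mul_apply, opH_one]; simp
  · change counit h ((opH h ^ k) (dX h u ((opV h ^ 1) (y h)))) = _
    rw [pow_one, opV_y, counit_opH_pow_eq_zero]
    · simp
    · rw [opP_dX, map_smul, opP_z, smul_neg, map_neg]

theorem pairing_mem_Bdual (a : A h) : pairing hh a ∈ Bdual h := by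
  obtain ⟨L, hL⟩ := D_nil a
  refine B.mem_Bdual (L := L) fun b => ?_
  rw [pairing_mul_X_pow, hL, map_zero, LinearMap.zero_apply]

/-! ### Bases -/

theorem D_pow_y_mul (n : ℕ) (a : A h) :
    (D h ^ n) (y h * a) = y h * (D h ^ n) a + (n : K) • (D h ^ (n - 1)) a := by
  induction n generalizing a with
  | zero => simp
  | succ n ih =>
    rw [pow_succ, Module.End.mul_apply, Module.End.mul_apply, D_mul, D_y, one_mul, map_add, ih,
      Nat.add_sub_cancel]
    rcases n with _ | n
    · simp
    · have : (D h ^ (n + 1 - 1)) (D h a) = (D h ^ (n + 1)) a := by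
        rw [Nat.add_sub_cancel, pow_succ, Module.End.mul_apply]
      rw [this]
      push_cast
      module

/-- The lowering step on which the independence of monomials, injectivity and surjectivity all rest:
`X^n` isolates the top coefficient in `y`, up to `n!`. -/
theorem D_pow_y_pow_mul (n : ℕ) {c : A h} (hc : D h c = 0) :
    (D h ^ n) (y h ^ n * c) = (n.factorial : K) • c := by
  induction n with
  | zero => simp
  | succ n ih =>
    have : (D h ^ (n + 1)) (y h ^ n * c) = 0 := by
      rw [pow_succ', Module.End.mul_apply, ih, map_smul, hc, smul_zero]
    rw [pow_succ' (y h), mul_assoc, D_pow_y_mul, this, Nat.add_sub_cancel, ih, mul_zero, zero_add,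
      smul_smul]
    push_cast [Nat.factorial_succ]
    rfl

theorem D_ser_mul_z (f : K⟦X⟧) : D h (ser h f * z h) = 0 := by
  rw [D_mul, D_ser, D_z, mul_zero, zero_mul, add_zero]

/-- The power series that agrees with `f` after division by `X^l`. -/
def shiftS (l : ℕ) : K⟦X⟧ →ₗ[K] K⟦X⟧ where
  toFun f := PowerSeries.mk fun n => PowerSeries.coeff (n + l) f
  map_add' f g := by ext; simp
  map_smul' c f := by ext; simp

theorem X_pow_mul_shiftS {l : ℕ} {f : K⟦X⟧} (hf : ∀ n < l, PowerSeries.coeff n f = 0) :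
    shiftS l f * PowerSeries.X ^ l = f := by
  ext n
  rw [PowerSeries.coeff_mul_X_pow']
  split_ifs with hl
  · simp [shiftS, Nat.sub_add_cancel hl]
  · exact (hf n (by omega)).symm

end A

namespace B
variable {h : K} (hh : h ≠ 0)
include hh
open A in
-- Strong induction on the degree in `X`. Once the coefficients of lower degree vanish, the relation
-- has the form `c' X^l = 0`; pairing with `y^l a`, where `D a = 0`, yields `l!` times the pairing
-- of `a` with `c'`, and suitable `a` read off its constant coefficients.
theorem coeff_eq_zero_of_expand (l : ℕ) : ∀ c : ℕ × Fin 2 →₀ K⟦X⟧, expandL h c = 0 →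
    ∀ i, PowerSeries.coeff l (c i) = 0 := by
  induction l using Nat.strong_induction_on with
  | _ l ih =>
    rintro c hc ⟨k, m⟩
    let c' : ℕ × Fin 2 →₀ K⟦X⟧ := Finsupp.mapRange (shiftS l) (map_zero _) c
    have hc' : expandL h c' * ser h (PowerSeries.X ^ l) = 0 := by
      rw [← hc, expandL_apply, expandL_apply, expand_eq_sum, expand_eq_sum, Finsupp.sum_mapRange_index,
        Finsupp.sum_mul]
      · refine Finsupp.sum_congr fun i _ => ?_
        rw [mono_mul_ser, X_pow_mul_shiftS]
        exact fun n hn => ih n hn c hc i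
      · intro i
        rw [mono, ← serHom_apply, map_zero, mul_zero, zero_mul]
    -- The algebra is not known to have no zero divisors, so `X^l` is cancelled through the pairing.
    have test (a : A h) (ha : D h a = 0) : A.pairing hh a (expandL h c') = 0 := by
      have h1 : A.pairing hh (y h ^ l * a) (expandL h c' * ser h (PowerSeries.X ^ l)) = 0 := by
        rw [hc', map_zero]
      rw [pairing_mul_X_pow, D_pow_y_pow_mul l ha, map_smul, LinearMap.smul_apply, smul_eq_mul] at h1
      exact (mul_eq_zero.1 h1).resolve_left (by exact_mod_cast l.factorial_ne_zero)
    have hk : (k.factorial : K) ≠ 0 := by exact_mod_cast k.factorial_ne_zero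
    have hcoeff : PowerSeries.coeff l (c (k, m)) = PowerSeries.constantCoeff (c' (k, m)) := by
      rw [← PowerSeries.coeff_zero_eq_constantCoeff_apply, Finsupp.mapRange_apply]
      simp [shiftS]
    rw [hcoeff]
    have hsum (a : A h) : A.pairing hh a (expandL h c') =
        c'.sum fun i f => A.pairing hh a (mono h i.1 f i.2) := by
      rw [expandL_apply, expand_eq_sum, map_finsuppSum]
    -- The test elements are `x^k` for the index `(k, 0)` and `x^k z` for `(k, 1)`; each meets
    -- exactly one monomial.
    fin_cases m
    · have := test (A.ser h (PowerSeries.X ^ k)) (D_ser _)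
      rw [hsum, Finsupp.sum_eq_single (k, 0)] at this
      · rw [pairing_ser, if_pos rfl, PowerSeries.coeff_X_pow_self, mul_one] at this
        exact (mul_eq_zero.1 this).resolve_left hk
      · rintro ⟨k', m'⟩ - hne
        rw [pairing_ser, PowerSeries.coeff_X_pow]
        split_ifs with h1 h2
        · exact absurd (Prod.ext h2 h1) hne
        · simp
        · rfl
      · intro; simp [pairing_ser]
    · have := test (A.ser h (PowerSeries.X ^ k) * z h) (D_ser_mul_z _)
      rw [hsum, Finsupp.sum_eq_single (k, 1)] at this
      · rw [pairing_ser_mul_z, if_pos rfl, PowerSeries.coeff_X_pow_self, mul_one] at this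
        exact (mul_eq_zero.1 this).resolve_left hk
      · rintro ⟨k', m'⟩ - hne
        rw [pairing_ser_mul_z, PowerSeries.coeff_X_pow]
        split_ifs with h1 h2
        · exact absurd (Prod.ext h2 h1) hne
        · simp
        · rfl
      · intro; simp [pairing_ser_mul_z]

theorem expand_bijective : Function.Bijective (expand h) := by
  refine ⟨?_, OspBorel.expand_surjective⟩
  refine (injective_iff_map_eq_zero (expandL h)).2 fun c hc => ?_
  ext i l
  exact coeff_eq_zero_of_expand hh l c hc i

/-- The functional `e^{klm}` on monomials. -/
theorem e_mono (k l : ℕ) (m : Fin 2) (k' : ℕ) (u : K⟦X⟧) (m' : Fin 2) :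
    e h k l m (mono h k' u m') = if k' = k ∧ m' = m then PowerSeries.coeff l u else 0 := by
  rw [e, ← expandL_single, expandL_apply,
    Function.leftInverse_invFun (expand_bijective hh).1, Finsupp.single_apply]
  simp only [Prod.mk.injEq]
  split_ifs <;> simp

/-- `e^{klm}` as a linear functional. -/
def eL (k l : ℕ) (m : Fin 2) : Module.Dual K (B h) :=
  PowerSeries.coeff l ∘ₗ Finsupp.lapply (k, m) ∘ₗ
    (LinearEquiv.ofBijective (expandL h) (expand_bijective hh)).symm.toLinearMap

theorem eL_apply (k l : ℕ) (m : Fin 2) (b : B h) : eL hh k l m b = e h k l m b := by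
  obtain ⟨c, rfl⟩ := (expand_bijective hh).2 b
  rw [e, Function.leftInverse_invFun (expand_bijective hh).1]
  change PowerSeries.coeff l ((LinearEquiv.ofBijective (expandL h) (expand_bijective hh)).symm
    (LinearEquiv.ofBijective (expandL h) (expand_bijective hh) c) (k, m)) = _
  rw [LinearEquiv.symm_apply_apply]

theorem eL_mono (k l : ℕ) (m : Fin 2) (k' : ℕ) (u : K⟦X⟧) (m' : Fin 2) :
    eL hh k l m (mono h k' u m') = if k' = k ∧ m' = m then PowerSeries.coeff l u else 0 := by
  rw [eL_apply, e_mono hh]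

/-- A right multiple of `X^{l+1}` has no coefficient in degree `l`. -/
theorem eL_mem (k l : ℕ) (m : Fin 2) : eL hh k l m ∈ Bdual h := by
  refine mem_Bdual (L := l + 1) fun b => ?_
  refine LinearMap.congr_fun (f := eL hh k l m ∘ₗ LinearMap.mulRight K _) (g := 0)
    (linearMap_ext_mono fun k' u m' => ?_) b
  rw [LinearMap.comp_apply, LinearMap.mulRight_apply, mono_mul_ser, eL_mono,
    PowerSeries.coeff_mul_X_pow', if_neg (by omega : ¬l + 1 ≤ l)]
  simp

end B

namespace A
variable {h : K} (hh : h ≠ 0)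

/-! ### The duality isomorphism -/

/-- The map `θ`. -/
def thetaL : A h →ₗ[K] Bdual h := (pairing hh).codRestrict (Bdual h) (pairing_mem_Bdual hh)

variable (h) in
/-- The elements `f(x) + g(x) z`. -/
def constants : Submodule K (A h) :=
  LinearMap.range (LinearMap.coprod (serHom h).toLinearMap
    (LinearMap.mulRight K (z h) ∘ₗ (serHom h).toLinearMap))

theorem mem_constants {a : A h} : a ∈ constants h ↔ ∃ f g, ser h f + ser h g * z h = a := by
  rw [constants, LinearMap.mem_range, Prod.exists]
  rfl

theorem D_constants {a : A h} (ha : a ∈ constants h) : D h a = 0 := by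
  obtain ⟨f, g, rfl⟩ := mem_constants.1 ha
  rw [map_add, D_ser, D_ser_mul_z, add_zero]

variable (h) in
/-- The elements of degree less than `n` in `y`. -/
def degLT : ℕ → Submodule K (A h)
  | 0 => ⊥
  | n + 1 => degLT n ⊔ (constants h).map (LinearMap.mulLeft K (y h ^ n))

theorem D_pow_degLT (n : ℕ) : ∀ a ∈ degLT h n, (D h ^ n) a = 0 := by
  induction n with
  | zero =>
    intro a ha
    rw [(Submodule.mem_bot K).1 ha, map_zero]
  | succ n ih =>
    intro a ha
    obtain ⟨b, hb, d, hd, rfl⟩ := Submodule.mem_sup.1 ha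
    obtain ⟨c, hc, rfl⟩ := Submodule.mem_map.1 hd
    rw [pow_succ', Module.End.mul_apply, map_add, ih b hb, zero_add, LinearMap.mulLeft_apply,
      D_pow_y_pow_mul n (D_constants hc), map_smul, D_constants hc, smul_zero]

theorem exists_mem_degLT (a : A h) : ∃ n, a ∈ degLT h n := by
  have hmono : Monotone (degLT h) := monotone_nat_of_le_succ fun n => le_sup_left
  have : a ∈ ⨆ n, degLT h n := by
    refine OspBorel.mem_of_mono _ (fun k f m => ?_) a
    refine (le_iSup (degLT h) (k + 1)) (le_sup_right (a := degLT h k) ?_)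
    refine Submodule.mem_map.2 ⟨ser h f * z h ^ (m : ℕ), mem_constants.2 ?_, (mul_assoc _ _ _).symm⟩
    fin_cases m
    · exact ⟨f, 0, by simp [← serHom_apply]⟩
    · exact ⟨0, f, by simp [← serHom_apply]⟩
  exact (Submodule.mem_iSup_of_directed _ hmono.directed_le).1 this

theorem eq_zero_of_constants {c : A h} (hc : c ∈ constants h) (h0 : pairing hh c = 0) : c = 0 := by
  obtain ⟨f, g, rfl⟩ := mem_constants.1 hc
  have key (k : ℕ) (m : Fin 2) := LinearMap.congr_fun h0 (B.mono h k 1 m)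
  simp only [map_add, LinearMap.add_apply, pairing_ser, pairing_ser_mul_z, map_one, mul_one,
    LinearMap.zero_apply] at key
  have hk (k : ℕ) : (k.factorial : K) ≠ 0 := by exact_mod_cast k.factorial_ne_zero
  have hf : f = 0 := by
    ext k
    have := key k 0
    simpa [hk k] using this
  have hg : g = 0 := by
    ext k
    have := key k 1
    simpa [hk k] using this
  rw [hf, hg]
  simp [← serHom_apply]

/-- Induction on the degree in `y`: evaluated on right multiples of `X^n`, the functional sees only
the top coefficient, which is a constant for `D` and is determined by its functional. -/
theorem pairing_injective : Function.Injective (pairing hh) := by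
  refine (injective_iff_map_eq_zero (pairing hh)).2 fun a ha => ?_
  obtain ⟨n, hn⟩ := exists_mem_degLT a
  induction n generalizing a with
  | zero => exact (Submodule.mem_bot K).1 hn
  | succ n ih =>
    obtain ⟨b, hb, d, hd, rfl⟩ := Submodule.mem_sup.1 hn
    obtain ⟨c, hc, rfl⟩ := Submodule.mem_map.1 hd
    have h1 : pairing hh ((n.factorial : K) • c) = 0 := by
      ext u
      have := pairing_mul_X_pow hh (b + LinearMap.mulLeft K (y h ^ n) c) u n
      rwa [ha, map_add (D h ^ n), D_pow_degLT n b hb, zero_add, LinearMap.mulLeft_apply,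
        D_pow_y_pow_mul n (D_constants hc), eq_comm] at this
    rw [map_smul] at h1
    have hc0 := eq_zero_of_constants hh hc ((smul_eq_zero.1 h1).resolve_left
      (by exact_mod_cast n.factorial_ne_zero))
    rw [hc0, map_zero, add_zero] at ha ⊢
    exact ih b ha hb

/-- A functional that kills `B X` is determined by its values on `H^k V^m`. Divided by `k!`, they
are the Taylor coefficients of the two series required. -/
theorem exists_constants (φ : Module.Dual K (B h))
    (hφ : ∀ b, φ (b * B.ser h PowerSeries.X) = 0) : ∃ c ∈ constants h, pairing hh c = φ := by
  have hk (k : ℕ) : (k.factorial : K) ≠ 0 := by exact_mod_cast k.factorial_ne_zero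
  refine ⟨_, mem_constants.2 ⟨PowerSeries.mk fun k => (k.factorial : K)⁻¹ * φ (B.mono h k 1 0),
    PowerSeries.mk fun k => (k.factorial : K)⁻¹ * φ (B.mono h k 1 1), rfl⟩, ?_⟩
  refine B.linearMap_ext_mono fun k u m => ?_
  have hu : φ (B.mono h k u m) = φ (B.mono h k 1 m) * PowerSeries.constantCoeff u := by
    have e1 : B.mono h k u m = PowerSeries.constantCoeff u • B.mono h k 1 m +
        B.mono h k (PowerSeries.mk fun p => PowerSeries.coeff (p + 1) u) m *
          B.ser h PowerSeries.X := by
      rw [B.mono_mul_ser]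
      conv_lhs => rw [PowerSeries.eq_shift_mul_X_add_const u]
      rw [B.mono, B.mono, B.mono, B.ser_add, mul_add, add_mul, add_comm]
      congr 1
      rw [← mul_one (PowerSeries.C _), ← PowerSeries.smul_eq_C_mul, B.ser_smul]
      simp
    rw [e1, map_add, hφ, add_zero, map_smul, smul_eq_mul, mul_comm]
  rw [hu, map_add, LinearMap.add_apply, pairing_ser, pairing_ser_mul_z]
  fin_cases m
  · simp [hk k]
  · simp [hk k]

/-- Surjectivity by lowering the order of continuity `L`, one power of `X` at a time. -/
theorem exists_pairing_eq (L : ℕ) (φ : Module.Dual K (B h))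
    (hφ : ∀ b, φ (b * B.ser h (PowerSeries.X ^ L)) = 0) : ∃ a, pairing hh a = φ := by
  induction L generalizing φ with
  | zero =>
    refine ⟨0, ?_⟩
    ext b
    have := hφ b
    rw [pow_zero, B.ser_one, mul_one] at this
    rw [map_zero, this, LinearMap.zero_apply]
  | succ L ih =>
    -- The functional `b ↦ φ(b X^L)` kills `B X`, so it comes from a constant `c`; subtracting the
    -- functional of `y^L c / L!` leaves one that kills `B X^L`.
    obtain ⟨c, hc, hcφ⟩ := exists_constants hh
      (φ ∘ₗ LinearMap.mulRight K (B.ser h (PowerSeries.X ^ L))) (fun b => by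
        rw [LinearMap.comp_apply, LinearMap.mulRight_apply, mul_assoc, ← B.ser_mul, ← pow_succ', hφ])
    obtain ⟨a, ha⟩ := ih (φ - pairing hh (y h ^ L * ((L.factorial : K)⁻¹ • c))) (fun b => by
      rw [LinearMap.sub_apply, pairing_mul_X_pow, D_pow_y_pow_mul, smul_smul, mul_inv_cancel₀, one_smul,
        hcφ, LinearMap.comp_apply, LinearMap.mulRight_apply, sub_self]
      · exact_mod_cast L.factorial_ne_zero
      · rw [map_smul, D_constants hc, smul_zero])
    exact ⟨a + y h ^ L * ((L.factorial : K)⁻¹ • c), by rw [map_add, ha, sub_add_cancel]⟩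

theorem thetaL_bijective : Function.Bijective (thetaL hh) := by
  constructor
  · intro a b hab
    exact pairing_injective hh (congrArg Subtype.val hab)
  · rintro ⟨φ, hφ⟩
    obtain ⟨L, hL⟩ := B.exists_of_mem_Bdual hφ
    obtain ⟨a, ha⟩ := exists_pairing_eq hh L φ hL
    exact ⟨a, Subtype.ext ha⟩

/-- The isomorphism of `A` and the dual of `B`. -/
def theta : A h ≃ₗ[K] Bdual h := LinearEquiv.ofBijective (thetaL hh) (thetaL_bijective hh)

theorem theta_apply (a : A h) (b : B h) : (theta hh a).1 b = pairing hh a b := rfl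

end A

/-! ### Matrix coefficients of representations of the tensor square -/

namespace BB
variable {h : K}

variable (h) in
/-- The element `H₀^k H₁^k' f(X₀, X₁) V₀^m V₁^m'`. -/
def mono (i : (ℕ × Fin 2) × (ℕ × Fin 2)) (f : MvPowerSeries (Fin 2) K) : BB h :=
  H h 0 ^ i.1.1 * H h 1 ^ i.2.1 * ser h f * (V h 0 ^ (i.1.2 : ℕ) * V h 1 ^ (i.2.2 : ℕ))

variable (h) in
/-- `expand` as a linear map. -/
def expandL : ((ℕ × Fin 2) × (ℕ × Fin 2) →₀ MvPowerSeries (Fin 2) K) →ₗ[K] BB h :=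
  OspBorel.expandL₂ _ _ _

theorem expandL_apply (c) : expandL h c = expand h c := rfl
theorem expand_eq_sum (c) : expand h c = c.sum fun i f => mono h i f := rfl

variable (h) in
/-- `mono` as a linear map. -/
def monoL (i : (ℕ × Fin 2) × (ℕ × Fin 2)) : MvPowerSeries (Fin 2) K →ₗ[K] BB h :=
  LinearMap.mulRight K (V h 0 ^ (i.1.2 : ℕ) * V h 1 ^ (i.2.2 : ℕ)) ∘ₗ
    LinearMap.mulLeft K (H h 0 ^ i.1.1 * H h 1 ^ i.2.1) ∘ₗ (serHom h).toLinearMap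

theorem monoL_apply (i f) : monoL h i f = mono h i f := rfl

section rep
variable {N : Type*} [AddCommGroup N] [Module K N] {D : Fin 2 → Module.End K N} (hN : LocNil D)
  (R : BB h →ₐ[K] Module.End K N) (hR : ∀ f, R (ser h f) = hN.act f) (ψ : N →ₗ[K] K) (v : N)
include hR

theorem rep_mono_apply (i f) : R (mono h i f) v = (R (H h 0) ^ i.1.1) ((R (H h 1) ^ i.2.1)
    (hN.act f ((R (V h 0) ^ (i.1.2 : ℕ)) ((R (V h 1) ^ (i.2.2 : ℕ)) v)))) := by
  rw [mono, map_mul, map_mul, map_mul, map_mul, hR]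
  simp only [map_pow, Module.End.mul_apply]

/-- A matrix coefficient of a locally nilpotent representation, on `mono i f`, in terms of the
coefficients of `f`. -/
theorem matrixCoeff_mono (i f) : ψ (R (mono h i f) v) = ∑ᶠ d : Fin 2 →₀ ℕ,
    MvPowerSeries.coeff d f *
      ψ (R (mono h i (MvPowerSeries.X 0 ^ d 0 * MvPowerSeries.X 1 ^ d 1)) v) := by
  -- The series act directly after the odd operators, so the bound is taken for this vector; the
  -- powers of `H₀` and `H₁` then act on zero.
  obtain ⟨n, hn⟩ := hN.nil ((R (V h 0) ^ (i.1.2 : ℕ)) ((R (V h 1) ^ (i.2.2 : ℕ)) v))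
  refine series_eq_finsum₂ (ψ ∘ₗ LinearMap.applyₗ v ∘ₗ R.toLinearMap ∘ₗ monoL h i) n
    (fun g => ?_) (fun g => ?_) f
  · change ψ (R (mono h i _) v) = 0
    rw [rep_mono_apply hN R hR, hN.act_X_pow_mul 0 hn le_rfl, map_zero, map_zero, map_zero]
  · change ψ (R (mono h i _) v) = 0
    rw [rep_mono_apply hN R hR, hN.act_X_pow_mul 1 hn le_rfl, map_zero, map_zero, map_zero]

/-- Matrix coefficients of locally nilpotent representations are continuous functionals. -/
theorem matrixCoeff_eq_pair (hinj : Function.Injective (expand h)) (β : B h → B h → K)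
    (hβ : ∀ (i : (ℕ × Fin 2) × (ℕ × Fin 2)) (l l' : ℕ),
      ψ (R (mono h i (MvPowerSeries.X 0 ^ l * MvPowerSeries.X 1 ^ l')) v) =
        β (B.E h i.1.1 l i.1.2) (B.E h i.2.1 l' i.2.2)) (u : BB h) :
    ψ (R u v) = pair h β u := by
  obtain ⟨c, rfl⟩ := OspBorel.expand₂_surjective u
  change ψ (R (expand h c) v) = pair h β (expand h c)
  rw [pair, Function.leftInverse_invFun hinj, expand_eq_sum, map_finsuppSum,
    Finsupp.sum, LinearMap.sum_apply, map_sum]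
  refine Finset.sum_congr rfl fun i _ => ?_
  rw [matrixCoeff_mono hN R hR]
  simp only [hβ]

end rep

end BB

/-! ### The basis of the tensor square, and duality of product and coproduct -/

namespace A
open TensorProduct
variable {h : K}

theorem opH₂_zero_pow (n : ℕ) (a b : A h) : (opH₂ h 0 ^ n) (a ⊗ₜ b) = (opH h ^ n) a ⊗ₜ b := by
  induction n generalizing a with
  | zero => rfl
  | succ n ih => rw [pow_succ, Module.End.mul_apply, pow_succ, Module.End.mul_apply, ← ih]; rfl
theorem opH₂_one_pow (n : ℕ) (a b : A h) : (opH₂ h 1 ^ n) (a ⊗ₜ b) = a ⊗ₜ (opH h ^ n) b := by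
  induction n generalizing b with
  | zero => rfl
  | succ n ih => rw [pow_succ, Module.End.mul_apply, pow_succ, Module.End.mul_apply, ← ih]; rfl
theorem opV₂_one_pow (n : ℕ) (a b : A h) : (opV₂ h 1 ^ n) (a ⊗ₜ b) = a ⊗ₜ (opV h ^ n) b := by
  induction n generalizing b with
  | zero => rfl
  | succ n ih => rw [pow_succ, Module.End.mul_apply, pow_succ, Module.End.mul_apply, ← ih]; rfl
theorem opV₂_zero_pow (n : ℕ) (a b : A h) :
    (opV₂ h 0 ^ n) (a ⊗ₜ b) = (opV h ^ n) a ⊗ₜ (opP h ^ n) b := by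
  induction n generalizing a b with
  | zero => rfl
  | succ n ih =>
    rw [pow_succ, Module.End.mul_apply, pow_succ, Module.End.mul_apply, pow_succ,
      Module.End.mul_apply, ← ih]
    rfl

theorem counit_opP_pow (n : ℕ) (a : A h) : counit h ((opP h ^ n) a) = counit h a := by
  induction n generalizing a with
  | zero => rfl
  | succ n ih => rw [pow_succ, Module.End.mul_apply, ih, counit_opP]

variable (hh : h ≠ 0)

/-- The parity operators that `V₀` leaves on the second factor commute with `D` and `H` and are
absorbed by the counit, so no sign remains. -/
theorem counit_act₂_mono (a a' : A h) (i : (ℕ × Fin 2) × (ℕ × Fin 2)) (l l' : ℕ) :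
    counit h (LinearMap.mul' K (A h) (act₂ h hh
      (BB.mono h i (MvPowerSeries.X 0 ^ l * MvPowerSeries.X 1 ^ l')) (a ⊗ₜ a'))) =
    pairing hh a (B.E h i.1.1 l i.1.2) * pairing hh a' (B.E h i.2.1 l' i.2.2) := by
  rw [BB.rep_mono_apply (locNil₂ h) _ (act₂_ser hh), act₂_H, act₂_H, act₂_V, act₂_V, opV₂_one_pow,
    opV₂_zero_pow, LocNil.act_X_pow, Module.End.mul_apply, D₂_one_pow, D₂_zero_pow, opH₂_one_pow,
    opH₂_zero_pow, LinearMap.mul'_apply, map_mul, pairing_apply, pairing_apply, B.E_eq, B.E_eq,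
    act_mono, act_mono, dX_X_pow, dX_X_pow]
  congr 1
  have h1 : Commute (opP h) (D h) := LinearMap.ext opP_D
  have h2 : Commute (opP h) (opH h) := LinearMap.ext opP_opH
  rw [← Module.End.mul_apply (D h ^ l'), (h1.pow_pow _ _).symm.eq, Module.End.mul_apply,
    ← Module.End.mul_apply (opH h ^ i.2.1), (h2.pow_pow _ _).symm.eq, Module.End.mul_apply,
    counit_opP_pow]

/-- The functional `ε ∘ μ` on `A ⊗ A`. -/
abbrev counitMul (h : K) : A h ⊗[K] A h →ₗ[K] K := (counit h).toLinearMap ∘ₗ LinearMap.mul' K (A h)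

theorem exists_pairing_eq_e (k l : ℕ) (m : Fin 2) : ∃ a : A h, ∀ (k' l' : ℕ) (m' : Fin 2),
    pairing hh a (B.E h k' l' m') = if k' = k ∧ l' = l ∧ m' = m then 1 else 0 := by
  obtain ⟨a, ha⟩ := (thetaL_bijective hh).2 ⟨_, B.eL_mem hh k l m⟩
  have ha' : pairing hh a = B.eL hh k l m := congrArg Subtype.val ha
  refine ⟨a, fun k' l' m' => ?_⟩
  rw [ha', B.E_eq, B.eL_mono, PowerSeries.coeff_X_pow, ← ite_and]
  congr 1
  rw [eq_iff_iff]
  tauto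

/-- Surjectivity of `A → B*` provides elements of `A` dual to the monomials of `B`; a tensor of two
of them extracts a single coefficient of an expansion. -/
theorem expand₂_bijective (hh : h ≠ 0) : Function.Bijective (BB.expand h) := by
  refine ⟨?_, OspBorel.expand₂_surjective⟩
  refine (injective_iff_map_eq_zero (BB.expandL h)).2 fun c hc => ?_
  ext ⟨⟨k, m⟩, ⟨k', m'⟩⟩ d
  obtain ⟨a, ha⟩ := exists_pairing_eq_e hh k (d 0) m
  obtain ⟨a', ha'⟩ := exists_pairing_eq_e hh k' (d 1) m'
  have key : counitMul h (act₂ h hh (BB.expandL h c) (a ⊗ₜ a')) = 0 := by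
    rw [hc, map_zero, LinearMap.zero_apply, map_zero]
  rw [BB.expandL_apply, BB.expand_eq_sum, map_finsuppSum, Finsupp.sum, LinearMap.sum_apply,
    map_sum] at key
  have hterm (i : (ℕ × Fin 2) × (ℕ × Fin 2)) :
      counitMul h (act₂ h hh (BB.mono h i (c i)) (a ⊗ₜ a')) =
        if i = ((k, m), (k', m')) then MvPowerSeries.coeff d (c i) else 0 := by
    rw [BB.matrixCoeff_mono (locNil₂ h) _ (act₂_ser hh)]
    have h1 (d' : Fin 2 →₀ ℕ) : counitMul h (act₂ h hh (BB.mono h i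
        (MvPowerSeries.X 0 ^ d' 0 * MvPowerSeries.X 1 ^ d' 1)) (a ⊗ₜ a')) =
        if i = ((k, m), (k', m')) ∧ d' = d then 1 else 0 := by
      change counit h (LinearMap.mul' K (A h) _) = _
      rw [counit_act₂_mono, ha, ha', ite_zero_mul_ite_zero, one_mul]
      congr 1
      rw [eq_iff_iff]
      obtain ⟨⟨i1, i2⟩, ⟨i3, i4⟩⟩ := i
      simp only [Prod.mk.injEq, Finsupp.ext_iff, Fin.forall_fin_two]
      tauto
    simp only [h1]
    rw [finsum_eq_single _ d]
    · by_cases hi : i = ((k, m), (k', m'))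
      · rw [if_pos ⟨hi, rfl⟩, if_pos hi, mul_one]
      · rw [if_neg (fun h => hi h.1), if_neg hi, mul_zero]
    · intro d' hd'
      rw [if_neg (fun h => hd' h.2), mul_zero]
  simp only [hterm] at key
  rw [Finset.sum_ite_eq'] at key
  split_ifs at key with hmem
  · simpa using key
  · rw [Finsupp.notMem_support_iff.1 hmem]; rfl

/-- The product of `A` is dual to the coproduct of the Borel subalgebra. -/
theorem pairing_mul (a a' : A h) (b : B h) : pairing hh (a * a') b =
    BB.pair h (fun b b' => pairing hh a b * pairing hh a' b') (BB.comul h hh b) := by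
  rw [← BB.matrixCoeff_eq_pair (locNil₂ h) (act₂ h hh) (act₂_ser hh) (counitMul h) (a ⊗ₜ a')
    (expand₂_bijective hh).1 (fun b b' => pairing hh a b * pairing hh a' b')
    (fun i l l' => counit_act₂_mono hh a a' i l l')]
  change _ = counit h (LinearMap.mul' K (A h) _)
  rw [mul_act₂_comul, LinearMap.mul'_apply, pairing_apply]

end A

/-! ### The counit, the parity and the grading -/

namespace B
variable {h : K}

variable (h) in
/-- The counit. -/
def counit : B h →ₐ[K] K :=
  lift constHom 0 0 (by intro f; simp [constHom_apply, constantCoeff_sinhS]) (by intro f; simp)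
    (by simp) (by simp [constHom_apply, constantCoeff_sinhS])

theorem counit_ser (f : K⟦X⟧) : counit h (ser h f) = PowerSeries.constantCoeff f := lift_ser ..
theorem counit_H : counit h (H h) = 0 := lift_genH ..
theorem counit_V : counit h (V h) = 0 := lift_genV ..

variable (h) in
/-- The parity automorphism. -/
def par : B h →ₐ[K] B h := parity _ _ _

theorem par_ser (f : K⟦X⟧) : par h (ser h f) = ser h f := parity_ser f
theorem par_H : par h (H h) = H h := parity_genH
theorem par_V : par h (V h) = -V h := parity_genV
theorem par_par (b : B h) : par h (par h b) = b := parity_parity b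

theorem par_mono (k : ℕ) (f : K⟦X⟧) (m : Fin 2) :
    par h (mono h k f m) = (-1 : K) ^ (m : ℕ) • mono h k f m := by
  rw [mono, map_mul, map_mul, map_pow, map_pow, par_H, par_ser, par_V]
  fin_cases m <;> simp

/-- The two parts are the eigenspaces of the parity automorphism `P`. Conversely, the projector `½
(1 + (-1)^p P)` sends every monomial into the part `p`, and it fixes `b`. -/
theorem mem_part_iff (p : Fin 2) (b : B h) : b ∈ part h p ↔ par h b = (-1 : K) ^ (p : ℕ) • b := by
  constructor
  · intro hb
    refine Submodule.span_le (p := LinearMap.eqLocus (par h).toLinearMap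
      ((-1 : K) ^ (p : ℕ) • LinearMap.id)) |>.2 ?_ hb
    rintro _ ⟨k, f, rfl⟩
    exact par_mono k f p
  · intro hb
    have h1 : (1 / 2 : K) • (b + (-1 : K) ^ (p : ℕ) • par h b) ∈ part h p := by
      have : ∀ b : B h, b + (-1 : K) ^ (p : ℕ) • par h b ∈ part h p := by
        intro b
        let F : B h →ₗ[K] B h := LinearMap.id + (-1 : K) ^ (p : ℕ) • (par h).toLinearMap
        refine mem_of_mono ((part h p).comap F) (fun k f m => ?_) b
        change mono h k f m + (-1 : K) ^ (p : ℕ) • par h (mono h k f m) ∈ part h p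
        have hmem : mono h k f p ∈ part h p := Submodule.subset_span ⟨k, f, rfl⟩
        rw [par_mono, smul_smul, ← pow_add]
        by_cases hmp : m = p
        · subst hmp
          exact add_mem hmem (Submodule.smul_mem _ _ hmem)
        · have : (-1 : K) ^ ((p : ℕ) + (m : ℕ)) = -1 := by
            fin_cases p <;> fin_cases m <;> simp at hmp ⊢
          rw [this, neg_one_smul, add_neg_cancel]
          exact zero_mem _
      exact Submodule.smul_mem _ _ (this b)
    rw [hb, smul_smul, ← mul_pow] at h1
    simp only [mul_neg, mul_one, neg_neg, one_pow, one_smul] at h1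
    rw [← two_smul K b, smul_smul] at h1
    simpa using h1

theorem par_even {b : B h} (hb : b ∈ part h 0) : par h b = b := by
  rw [(mem_part_iff 0 b).1 hb]; simp
theorem par_odd {b : B h} (hb : b ∈ part h 1) : par h b = -b := by
  rw [(mem_part_iff 1 b).1 hb]; simp

theorem isCompl_part : IsCompl (part h 0) (part h 1) := by
  constructor
  · rw [Submodule.disjoint_def]
    intro b h0 h1
    have := (par_even h0).symm.trans (par_odd h1)
    rw [eq_neg_iff_add_eq_zero, ← two_smul K b] at this
    exact (smul_eq_zero.1 this).resolve_left two_ne_zero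
  · rw [codisjoint_iff, eq_top_iff]
    intro b _
    refine mem_of_mono _ (fun k f m => ?_) b
    fin_cases m
    · exact Submodule.mem_sup_left (Submodule.subset_span ⟨k, f, rfl⟩)
    · exact Submodule.mem_sup_right (Submodule.subset_span ⟨k, f, rfl⟩)

end B

namespace A
variable {h : K} (hh : h ≠ 0)

/-- The unit of `A` spans a submodule on which `B` acts through its counit; hence the unit of `B*`
is `ε`. -/
theorem act_one (b : B h) : act h hh b 1 = B.counit h b • 1 := by
  let S : Subalgebra K (B h) :=
    { carrier := {b | act h hh b 1 = B.counit h b • 1}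
      add_mem' := by
        intro a b ha hb
        simp only [Set.mem_ofPred_eq] at ha hb ⊢
        rw [map_add, LinearMap.add_apply, ha, hb, map_add, add_smul]
      mul_mem' := by
        intro a b ha hb
        simp only [Set.mem_ofPred_eq] at ha hb ⊢
        rw [map_mul, Module.End.mul_apply, hb, map_smul, ha, map_mul, smul_smul, mul_comm (B.counit h b)]
      algebraMap_mem' := by
        intro c
        simp only [Set.mem_ofPred_eq, AlgHom.commutes, Module.algebraMap_end_apply]
        rfl }
  refine B.mem_of_generators S (fun f => ?_) ?_ ?_ b
  · change act h hh (B.ser h f) 1 = B.counit h (B.ser h f) • 1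
    rw [act_ser, dX_one, B.counit_ser]
  · change act h hh (B.H h) 1 = B.counit h (B.H h) • 1
    rw [act_H, opH_one, B.counit_H, zero_smul]
  · change act h hh (B.V h) 1 = B.counit h (B.V h) • 1
    rw [act_V, opV_one, B.counit_V, zero_smul]

theorem pairing_one (b : B h) : pairing hh 1 b = B.counit h b := by
  rw [pairing_apply, act_one, map_smul, map_one, smul_eq_mul, mul_one]

theorem par_act (b : B h) (a : A h) : opP h (act h hh b a) = act h hh (B.par h b) (opP h a) := by
  let S : Subalgebra K (B h) :=
    { carrier := {b | ∀ a, opP h (act h hh b a) = act h hh (B.par h b) (opP h a)}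
      add_mem' := by
        intro b c hb hc a
        simp only [map_add, LinearMap.add_apply, hb a, hc a]
      mul_mem' := by
        intro b c hb hc a
        simp only [map_mul, Module.End.mul_apply, hb _, hc _]
      algebraMap_mem' := by
        intro c a
        simp only [AlgHom.commutes, Module.algebraMap_end_apply, map_smul] }
  refine B.mem_of_generators S (fun f a => ?_) (fun a => ?_) (fun a => ?_) b a
  · rw [B.par_ser, act_ser, opP_dX]
  · rw [B.par_H, act_H, opP_opH]
  · rw [B.par_V, map_neg, act_V, opP_opV, LinearMap.neg_apply]

/-- The pairing is compatible with the parity automorphisms. -/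
theorem pairing_par (a : A h) (b : B h) : pairing hh (opP h a) (B.par h b) = pairing hh a b := by
  rw [pairing_apply, ← par_act, counit_opP, pairing_apply]

theorem isDualParity_theta_zero {a : A h} (ha : opP h a = a) : IsDualParity 0 (theta hh a) := by
  intro q hq b hb
  rw [theta_apply]
  fin_cases q
  · exact absurd rfl hq
  · have := pairing_par hh a b
    rw [ha, B.par_odd hb, map_neg, neg_eq_iff_add_eq_zero, ← two_mul] at this
    exact (mul_eq_zero.1 this).resolve_left two_ne_zero

theorem isDualParity_theta_one {a : A h} (ha : opP h a = -a) : IsDualParity 1 (theta hh a) := by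
  intro q hq b hb
  rw [theta_apply]
  fin_cases q
  · have := pairing_par hh a b
    rw [ha, B.par_even hb, map_neg, LinearMap.neg_apply, neg_eq_iff_add_eq_zero, ← two_mul] at this
    exact (mul_eq_zero.1 this).resolve_left two_ne_zero
  · exact absurd rfl hq

theorem pairing_ser_E (f : K⟦X⟧) (k l : ℕ) (m : Fin 2) : pairing hh (ser h f) (B.E h k l m) =
    if l = 0 ∧ m = 0 then (k.factorial : K) * PowerSeries.coeff k f else 0 := by
  rw [B.E_eq, pairing_ser]
  rcases l with _ | l <;> simp

theorem pairing_ser_mul_z_E (f : K⟦X⟧) (k l : ℕ) (m : Fin 2) :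
    pairing hh (ser h f * z h) (B.E h k l m) =
    if l = 0 ∧ m = 1 then (k.factorial : K) * PowerSeries.coeff k f else 0 := by
  rw [B.E_eq, pairing_ser_mul_z]
  rcases l with _ | l <;> simp

theorem pairing_eq_e {a : A h} {k l : ℕ} {m : Fin 2} (ha : ∀ k' u m', pairing hh a (B.mono h k' u m')
    = if k' = k ∧ m' = m then PowerSeries.coeff l u else 0) (b : B h) :
    pairing hh a b = B.e h k l m b := by
  rw [← B.eL_apply hh]
  refine LinearMap.congr_fun (B.linearMap_ext_mono fun k' u m' => ?_) b
  rw [ha, B.eL_mono]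

theorem pairing_x_eq_e (b : B h) : pairing hh (x h) b = B.e h 1 0 0 b := by
  refine pairing_eq_e hh (fun k u m => ?_) b
  rw [x, pairing_ser, PowerSeries.coeff_X]
  by_cases hk : k = 1 <;> by_cases hm : m = 0 <;> simp [hk, hm]

theorem pairing_y_eq_e (b : B h) : pairing hh (y h) b = B.e h 0 1 0 b :=
  pairing_eq_e hh (fun k u m => pairing_y hh k u m) b

theorem pairing_z_eq_e (b : B h) : pairing hh (z h) b = B.e h 0 0 1 b := by
  refine pairing_eq_e hh (fun k u m => ?_) b
  have := pairing_ser_mul_z hh 1 u k m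
  rw [ser_one, one_mul] at this
  rw [this, PowerSeries.coeff_one]
  by_cases hk : k = 0 <;> by_cases hm : m = 1 <;> simp [hk, hm]

end A

theorem rescale_smul (c d : K) (f : K⟦X⟧) :
    PowerSeries.rescale c (d • f) = d • PowerSeries.rescale c f := by
  ext n
  simp only [PowerSeries.coeff_rescale, PowerSeries.coeff_smul, smul_eq_mul]
  ring

/-- `f ↦ f(cX)`. -/
def rescaleHom (c : K) : K⟦X⟧ →ₐ[K] K⟦X⟧ :=
  AlgHom.ofLinearMap
    { PowerSeries.rescale c with map_smul' := fun d f => rescale_smul c d f }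
    (map_one (PowerSeries.rescale c)) (map_mul (PowerSeries.rescale c))

theorem rescale_sinhS (h : K) : PowerSeries.rescale (-1 : K) (sinhS h) = -sinhS h := by
  rw [sinhS, rescale_smul, map_sub, rescale_expS, rescale_expS]
  simp only [neg_mul, one_mul, neg_neg]
  rw [← smul_neg, neg_sub]

theorem rescale_coshS (h : K) : PowerSeries.rescale (-1 : K) (coshS h) = coshS h := by
  rw [coshS, rescale_smul, map_add, rescale_expS, rescale_expS]
  simp only [neg_mul, one_mul, neg_neg]
  rw [add_comm]

namespace B
variable {h : K}

/-! ### The antipode -/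

variable (h) in
/-- The antipode of `H`. -/
def SH : B h := -H h - (1 / 2 : K) • ser h (sinhS h)

/-- By the relation for `V²`, the odd correction `2h V²` equals `½ sinh (hX)`; the latter form is
used because it is a series. -/
theorem SH_eq (hh : h ≠ 0) : SH h = -H h - (2 * h) • V h ^ 2 := by
  rw [SH, pow_two, V_mul_V, ← ser_smul, ← ser_smul, smul_smul]
  congr 4
  field_simp
  norm_num

theorem par_SH : par h (SH h) = SH h := by
  rw [SH, map_sub, map_neg, map_smul, par_H, par_ser]

theorem SH_mul_ser (f : K⟦X⟧) :
    SH h * ser h f = ser h f * SH h - ser h (dlB h * PowerSeries.derivative K f) := by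
  have e : (1 / 2 : K) • ser h (sinhS h) * ser h f = ser h f * (1 / 2 : K) • ser h (sinhS h) := by
    rw [smul_mul_assoc (1 / 2 : K), mul_smul_comm (1 / 2 : K), ← ser_mul, ← ser_mul,
      mul_comm f (sinhS h)]
  rw [SH, sub_mul, mul_sub, neg_mul, mul_neg, H_mul_ser, e]
  abel

theorem SH_mul_V : SH h * V h = V h * SH h - ser h (gmB h) * V h := by
  rw [SH, sub_mul, mul_sub, neg_mul, mul_neg, H_mul_V, smul_mul_assoc, mul_smul_comm, V_mul_ser,
    V_mul_ser]
  abel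

theorem ser_mul_SH (f : K⟦X⟧) :
    ser h (PowerSeries.rescale (-1) f) * SH h = SH h * ser h (PowerSeries.rescale (-1) f) +
      ser h (PowerSeries.rescale (-1) (dlB h * PowerSeries.derivative K f)) := by
  rw [SH_mul_ser, derivative_rescale, map_mul, rescale_smul, rescale_sinhS]
  simp only [neg_smul, one_smul, mul_neg, smul_neg, neg_mul, ser_neg]
  abel

variable (h) in
/-- Left multiplication by `f(-X)`. -/
def lmulRescale : K⟦X⟧ →ₐ[K] Module.End K (B h) :=
  (Algebra.lmul K (B h)).comp ((serHom h).comp (rescaleHom (-1)))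

variable (h) in
/-- The operator `c ↦ -V c` up to the sign of `c`. -/
def SV : Module.End K (B h) := -(LinearMap.mulLeft K (V h) ∘ₗ (par h).toLinearMap)

variable (h) in
/-- Left multiplication by the antipode, as a morphism to the opposite of the endomorphism ring; for
odd elements it is composed with the parity automorphism. -/
def antiHom : B h →ₐ[K] (Module.End K (B h))ᵐᵒᵖ :=
  lift ((lmulRescale h).toOpposite fun f g => (Commute.all f g).map (lmulRescale h))
    (MulOpposite.op (LinearMap.mulLeft K (SH h))) (MulOpposite.op (SV h))
    (fun f => MulOpposite.unop_injective <| LinearMap.ext fun c => by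
      change ser h (PowerSeries.rescale (-1) f) * (SH h * c) = SH h * (ser h _ * c) + ser h _ * c
      rw [← mul_assoc, ser_mul_SH, add_mul, mul_assoc]
      rfl)
    (fun f => MulOpposite.unop_injective <| LinearMap.ext fun c => by
      change ser h (PowerSeries.rescale (-1) f) * (-(V h * par h c)) =
        -(V h * par h (ser h (PowerSeries.rescale (-1) f) * c))
      rw [map_mul, par_ser, ← mul_assoc (V h), V_mul_ser, mul_neg, mul_assoc])
    (MulOpposite.unop_injective <| LinearMap.ext fun c => by
      change -(V h * par h (SH h * c)) = SH h * (-(V h * par h c)) +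
        ser h (PowerSeries.rescale (-1) (gmB h)) * (-(V h * par h c))
      rw [rescale_smul, rescale_coshS, map_mul, par_SH, mul_neg, ← mul_assoc (SH h), SH_mul_V]
      simp only [sub_mul, mul_neg, mul_assoc]
      abel)
    (MulOpposite.unop_injective <| LinearMap.ext fun c => by
      change -(V h * par h (-(V h * par h c))) = ser h (PowerSeries.rescale (-1) (sqB h)) * c
      rw [rescale_smul, rescale_sinhS, map_neg, map_mul, par_V, par_par, smul_neg, ser_neg, neg_mul,
        neg_mul, mul_neg, mul_neg, neg_neg, ← mul_assoc, V_mul_V])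

variable (h) in
/-- The operators of `antiHom`. -/
def anti (b : B h) : Module.End K (B h) := (antiHom h b).unop

theorem anti_mul (a b c : B h) : anti h (a * b) c = anti h b (anti h a c) := by
  simp only [anti, map_mul, MulOpposite.unop_mul]; rfl
theorem anti_add (a b c : B h) : anti h (a + b) c = anti h a c + anti h b c := by
  simp only [anti, map_add, MulOpposite.unop_add]; rfl
theorem anti_smul (r : K) (b c : B h) : anti h (r • b) c = r • anti h b c := by
  simp only [anti, map_smul, MulOpposite.unop_smul]; rfl
theorem anti_algebraMap (r : K) (c : B h) : anti h (algebraMap K _ r) c = r • c := by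
  simp only [anti, AlgHom.commutes]; rfl
theorem anti_one (c : B h) : anti h 1 c = c := by
  simp only [anti, map_one]; rfl
theorem anti_ser (f : K⟦X⟧) (c : B h) :
    anti h (ser h f) c = ser h (PowerSeries.rescale (-1) f) * c :=
  LinearMap.congr_fun (congrArg MulOpposite.unop (lift_ser ..)) c
theorem anti_H (c : B h) : anti h (H h) c = SH h * c :=
  LinearMap.congr_fun (congrArg MulOpposite.unop (lift_genH ..)) c
theorem anti_V (c : B h) : anti h (V h) c = -(V h * par h c) :=
  LinearMap.congr_fun (congrArg MulOpposite.unop (lift_genV ..)) c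

variable (h) in
/-- The antipode. -/
def antipode : B h →ₗ[K] B h where
  toFun b := anti h b 1
  map_add' a b := anti_add a b 1
  map_smul' c b := anti_smul c b 1

theorem antipode_apply (b : B h) : antipode h b = anti h b 1 := rfl

theorem anti_H_pow (k : ℕ) (c : B h) : anti h (H h ^ k) c = SH h ^ k * c := by
  induction k generalizing c with
  | zero => rw [pow_zero, anti_one, pow_zero, one_mul]
  | succ k ih => rw [pow_succ, anti_mul, ih, anti_H, pow_succ', mul_assoc]

theorem anti_mono (k : ℕ) (f : K⟦X⟧) (m : Fin 2) (c : B h) : anti h (mono h k f m) c =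
    (-V h) ^ (m : ℕ) * (ser h (PowerSeries.rescale (-1) f) * SH h ^ k) *
      (if m = 0 then c else par h c) := by
  rw [mono, anti_mul, anti_mul, anti_H_pow, anti_ser]
  fin_cases m
  · change anti h (V h ^ 0) _ = _
    rw [pow_zero, anti_one]
    simp [mul_assoc]
  · change anti h (V h ^ 1) _ = _
    rw [pow_one, anti_V, map_mul, map_mul, map_pow, par_SH, par_ser]
    simp [mul_assoc]

theorem antipode_mono (k : ℕ) (f : K⟦X⟧) (m : Fin 2) : antipode h (mono h k f m) =
    (-V h) ^ (m : ℕ) * (ser h (PowerSeries.rescale (-1) f) * SH h ^ k) := by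
  rw [antipode_apply, anti_mono]
  simp

/-- This recovers the graded rule for `S(ab)` from the strict multiplicativity of the operators: the
sign comes from the parity automorphism attached to an odd `b`. -/
theorem anti_eq {p : Fin 2} {b : B h} (hb : b ∈ part h p) (c : B h) :
    anti h b c = antipode h b * (if p = 0 then c else par h c) := by
  refine Submodule.span_induction (p := fun b _ => anti h b c = antipode h b *
    (if p = 0 then c else par h c)) ?_ ?_ ?_ ?_ hb
  · rintro _ ⟨k, f, rfl⟩
    change anti h (mono h k f p) c = antipode h (mono h k f p) * _
    rw [anti_mono, antipode_mono]
  · rw [map_zero, zero_mul, anti, map_zero]; rfl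
  · intro a b _ _ ha hb
    rw [anti_add, ha, hb, map_add, add_mul]
  · intro r a _ ha
    rw [anti_smul, ha, map_smul, smul_mul_assoc]

theorem par_anti (b c : B h) : par h (anti h b c) = anti h (par h b) (par h c) := by
  let S : Subalgebra K (B h) :=
    { carrier := {b | ∀ c, par h (anti h b c) = anti h (par h b) (par h c)}
      add_mem' := by
        intro a b ha hb c
        rw [anti_add, map_add, ha c, hb c, map_add, anti_add]
      mul_mem' := by
        intro a b ha hb c
        rw [anti_mul, hb, ha, map_mul, anti_mul]
      algebraMap_mem' := by
        intro r c
        rw [anti_algebraMap, AlgHom.commutes, anti_algebraMap, map_smul] }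
  refine mem_of_generators S (fun f c => ?_) (fun c => ?_) (fun c => ?_) b c
  · rw [par_ser, anti_ser, anti_ser, map_mul, par_ser]
  · rw [par_H, anti_H, anti_H, map_mul, par_SH]
  · rw [par_V, anti_V, ← neg_one_smul K (V h), anti_smul, anti_V, map_neg, map_mul, par_V]
    simp

theorem par_antipode (b : B h) : par h (antipode h b) = antipode h (par h b) := by
  rw [antipode_apply, par_anti, map_one, antipode_apply]

theorem antipode_mem_part {p : Fin 2} {b : B h} (hb : b ∈ part h p) : antipode h b ∈ part h p := by
  rw [mem_part_iff] at hb ⊢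
  rw [par_antipode, hb, map_smul]

theorem antipode_mul (p q : Fin 2) (a b : B h) (ha : a ∈ part h p) (hb : b ∈ part h q) :
    antipode h (a * b) = (-1 : K) ^ ((p : ℕ) * (q : ℕ)) • (antipode h b * antipode h a) := by
  rw [antipode_apply, anti_mul, ← antipode_apply, anti_eq hb]
  have := (mem_part_iff p _).1 (antipode_mem_part ha)
  rw [this]
  fin_cases p <;> fin_cases q <;> simp

theorem antipode_ser (f : K⟦X⟧) : antipode h (ser h f) = ser h (PowerSeries.rescale (-1) f) := by
  rw [antipode_apply, anti_ser, mul_one]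
theorem antipode_H : antipode h (H h) = SH h := by rw [antipode_apply, anti_H, mul_one]
theorem antipode_V : antipode h (V h) = -V h := by rw [antipode_apply, anti_V, map_one, mul_one]

theorem isStructure (hh : h ≠ 0) : IsStructure h (BB.comul h hh) (counit h) (antipode h) where
  comul_ser f := by rw [BB.comul_ser, addHom_apply]
  comul_H := BB.comul_H hh
  comul_V := BB.comul_V hh
  counit_ser := counit_ser
  counit_H := counit_H
  counit_V := counit_V
  antipode_ser := antipode_ser
  antipode_H := by rw [antipode_H, SH_eq hh]
  antipode_V := antipode_V
  antipode_mul := antipode_mul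

theorem ser_mem_part (f : K⟦X⟧) : ser h f ∈ part h 0 := by
  rw [mem_part_iff, par_ser]; simp
theorem H_pow_mem_part (k : ℕ) : H h ^ k ∈ part h 0 := by
  rw [mem_part_iff, map_pow, par_H]; simp
theorem V_mem_part : V h ∈ part h 1 := by
  rw [mem_part_iff, par_V]; simp

/-- Morphisms are determined by the generators. For `S` the monomials are split into homogeneous
factors, so that graded antimultiplicativity applies with known signs. -/
theorem _root_.OspBorel.IsStructure.unique {Δ Δ' : B h →ₐ[K] BB h} {ε ε' : B h →ₐ[K] K}
    {S S' : B h →ₗ[K] B h} (h1 : IsStructure h Δ ε S) (h2 : IsStructure h Δ' ε' S') :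
    Δ' = Δ ∧ ε' = ε ∧ S' = S := by
  refine ⟨algHom_ext (fun f => ?_) ?_ ?_, algHom_ext (fun f => ?_) ?_ ?_, ?_⟩
  · rw [h1.comul_ser, h2.comul_ser]
  · rw [h1.comul_H, h2.comul_H]
  · rw [h1.comul_V, h2.comul_V]
  · rw [h1.counit_ser, h2.counit_ser]
  · rw [h1.counit_H, h2.counit_H]
  · rw [h1.counit_V, h2.counit_V]
  · have hpow (k : ℕ) : S' (H h ^ k) = S (H h ^ k) := by
      induction k with
      | zero => rw [pow_zero, ← ser_one, h1.antipode_ser, h2.antipode_ser]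
      | succ k ih =>
        have hH : H h ∈ part h 0 := by simpa using H_pow_mem_part (h := h) 1
        rw [pow_succ, h1.antipode_mul 0 0 _ _ (H_pow_mem_part k) hH,
          h2.antipode_mul 0 0 _ _ (H_pow_mem_part k) hH, ih, h1.antipode_H, h2.antipode_H]
    have heven (k : ℕ) (f : K⟦X⟧) : S' (H h ^ k * ser h f) = S (H h ^ k * ser h f) := by
      rw [h1.antipode_mul 0 0 _ _ (H_pow_mem_part k) (ser_mem_part f),
        h2.antipode_mul 0 0 _ _ (H_pow_mem_part k) (ser_mem_part f), hpow, h1.antipode_ser,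
        h2.antipode_ser]
    refine linearMap_ext_mono fun k f m => ?_
    rw [mono]
    fin_cases m
    · simpa using heven k f
    · have hp : H h ^ k * ser h f ∈ part h 0 := by
        rw [mem_part_iff, map_mul, map_pow, par_H, par_ser]; simp
      simp only [Fin.mk_one, Fin.val_one, pow_one]
      rw [h1.antipode_mul 0 1 _ _ hp V_mem_part, h2.antipode_mul 0 1 _ _ hp V_mem_part, heven,
        h1.antipode_V, h2.antipode_V]

end B

/-! ### Comparison principles for series of operators, and right modules over the tensor square -/

namespace LocNil
variable {N : Type*} [AddCommGroup N] [Module K N] {D : Fin 2 → Module.End K N} (h : LocNil D)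
include h

/-- The continuity argument in reusable form: a linear expression in `f(D_i) v` is identified by its
values on powers, provided the candidate is continuous as well. -/
theorem apply_act_slot {M : Type*} [AddCommGroup M] [Module K M] (i : Fin 2) (v : N)
    (T : N →ₗ[K] M) (L : K⟦X⟧ →ₗ[K] M) (n : ℕ) (hn : ∀ g, L (PowerSeries.X ^ n * g) = 0)
    (hL : ∀ l, T ((D i ^ l) v) = L (PowerSeries.X ^ l)) (f : K⟦X⟧) :
    T (h.act (slot i f) v) = L f := by
  obtain ⟨m, hm⟩ := h.nil v
  let L' : K⟦X⟧ →ₗ[K] M :=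
    T ∘ₗ LinearMap.applyₗ v ∘ₗ h.act.toLinearMap ∘ₗ (slotHom i).toLinearMap - L
  have hL' (f) : L' f = T (h.act (slotHom i f) v) - L f := rfl
  have := series_ext L' (m + n) (fun g => ?_) (fun l => ?_) f
  · rwa [hL', sub_eq_zero, slotHom_apply] at this
  · rw [hL', map_mul, map_pow, slotHom_apply, slot_X, h.act_X_pow_mul i hm (Nat.le_add_right _ _),
      add_comm m n, pow_add, mul_assoc, hn, map_zero, sub_zero]
  · rw [hL', map_pow, slotHom_apply, slot_X, map_pow, h.act_X, hL, sub_self]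

theorem apply_act_addHom {M : Type*} [AddCommGroup M] [Module K M] (v : N)
    (T : N →ₗ[K] M) (L : K⟦X⟧ →ₗ[K] M) (n : ℕ) (hn : ∀ g, L (PowerSeries.X ^ n * g) = 0)
    (hL : ∀ l, T (((D 0 + D 1) ^ l) v) = L (PowerSeries.X ^ l)) (f : K⟦X⟧) :
    T (h.act (addHom f) v) = L f := by
  obtain ⟨m, hm⟩ := h.nil v
  let L' : K⟦X⟧ →ₗ[K] M :=
    T ∘ₗ LinearMap.applyₗ v ∘ₗ h.act.toLinearMap ∘ₗ addHom.toLinearMap - L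
  have hL' (f) : L' f = T (h.act (addHom f) v) - L f := rfl
  have := series_ext L' (m + m + n) (fun g => ?_) (fun l => ?_) f
  · rwa [hL', sub_eq_zero] at this
  · rw [hL', pow_add, mul_assoc, h.act_addHom_X_pow_mul hm, mul_left_comm, hn, map_zero, sub_zero]
  · rw [hL', map_pow, addHom_X, map_pow, map_add, h.act_X, h.act_X, hL, sub_self]

/-- The counterpart of `isLift₂` for right modules, where every relation is read in reverse order.
-/
theorem isLift₂_op {δ γ s : K⟦X⟧} (H V : Fin 2 → Module.End K N)
    (hHD : ∀ i v, D i (H i v) = H i (D i v) + h.act (slot i δ) v)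
    (hHD' : ∀ i j, i ≠ j → ∀ v, H i (D j v) = D j (H i v))
    (hVD : ∀ i j v, V i (D j v) = D j (V i v))
    (hHV : ∀ i, V i * H i = H i * V i + h.act (slot i γ) * V i)
    (hVV : ∀ i, V i * V i = h.act (slot i s)) (hHH : H 0 * H 1 = H 1 * H 0)
    (hHV' : ∀ i j, i ≠ j → H i * V j = V j * H i) (hVV' : V 0 * V 1 = -(V 1 * V 0)) :
    IsLift₂ δ γ s (h.act.toOpposite fun f g => (Commute.all f g).map h.act)
      (fun i => MulOpposite.op (H i)) (fun i => MulOpposite.op (V i)) where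
  H_ser i f := by
    refine MulOpposite.unop_injective (LinearMap.ext fun v => ?_)
    -- Reversing the order changes the sign of the commutator.
    have := h.act_derivation (H i) (fun j => if i = j then -slot i δ else 0) (fun j v => ?_) f v
    · change h.act f (H i v) = H i (h.act f v) + h.act (slot i δ * MvPowerSeries.pderiv K i f) v
      rw [this]
      fin_cases i <;> simp
    · by_cases hij : i = j
      · subst hij
        rw [if_pos rfl, hHD, map_neg, LinearMap.neg_apply, add_neg_cancel_right]
      · rw [if_neg hij, hHD' i j hij, map_zero, LinearMap.zero_apply, add_zero]
  V_ser i f := MulOpposite.unop_injective <| LinearMap.ext fun v =>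
    (h.act_commute (V i) (hVD i) f v).symm
  H_V i := MulOpposite.unop_injective (hHV i)
  V_V i := MulOpposite.unop_injective (hVV i)
  comm_H_H := MulOpposite.unop_injective hHH.symm
  comm_H_V i j hij := MulOpposite.unop_injective (hHV' i j hij).symm
  anticomm_V_V := MulOpposite.unop_injective <| by
    change V 1 * V 0 = -(V 0 * V 1)
    rw [hVV', neg_neg]

end LocNil

namespace BB
variable {h : K}

/-- A functional on the tensor square that is continuous in each term of the expansion is given by
a pairing. -/
theorem eq_pair (hinj : Function.Injective (expand h)) (Φ : BB h →ₗ[K] K) (β : B h → B h → K)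
    (hΦ : ∀ i, ∃ n, ∀ j g, Φ (mono h i (MvPowerSeries.X j ^ n * g)) = 0)
    (hβ : ∀ (i : (ℕ × Fin 2) × (ℕ × Fin 2)) (l l' : ℕ),
      Φ (mono h i (MvPowerSeries.X 0 ^ l * MvPowerSeries.X 1 ^ l')) =
        β (B.E h i.1.1 l i.1.2) (B.E h i.2.1 l' i.2.2)) (u : BB h) :
    Φ u = pair h β u := by
  obtain ⟨c, rfl⟩ := OspBorel.expand₂_surjective u
  change Φ (expand h c) = pair h β (expand h c)
  rw [pair, Function.leftInverse_invFun hinj, expand_eq_sum, map_finsuppSum]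
  refine Finset.sum_congr rfl fun i _ => ?_
  obtain ⟨n, hn⟩ := hΦ i
  have := series_eq_finsum₂ (Φ ∘ₗ monoL h i) n (hn 0) (hn 1) (c i)
  simp only [LinearMap.comp_apply, monoL_apply, hβ] at this
  exact this

end BB

/-! ### Translation operators on the dual -/

namespace Bdual
variable {h : K}

theorem mem_mulLeft (a : B h) {φ : Module.Dual K (B h)} (hφ : φ ∈ Bdual h) :
    φ ∘ₗ LinearMap.mulLeft K a ∈ Bdual h := by
  obtain ⟨L, hL⟩ := B.exists_of_mem_Bdual hφ
  refine B.mem_Bdual (L := L) fun b => ?_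
  rw [LinearMap.comp_apply, LinearMap.mulLeft_apply, ← mul_assoc, hL]

theorem mem_mulRight (a : B h) {φ : Module.Dual K (B h)} (hφ : φ ∈ Bdual h) :
    φ ∘ₗ LinearMap.mulRight K a ∈ Bdual h := by
  obtain ⟨L, hL⟩ := hφ
  refine ⟨L, fun b => ?_⟩
  rw [LinearMap.comp_apply, LinearMap.mulRight_apply, mul_assoc, hL]

theorem mem_par {φ : Module.Dual K (B h)} (hφ : φ ∈ Bdual h) :
    φ ∘ₗ (B.par h).toLinearMap ∈ Bdual h := by
  obtain ⟨L, hL⟩ := hφ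
  refine ⟨L, fun b => ?_⟩
  rw [LinearMap.comp_apply, AlgHom.toLinearMap_apply, map_mul, B.par_ser, hL]

variable (h) in
/-- The space `Bdual h` as a type. -/
def Carrier : Type _ := Bdual h

instance : AddCommGroup (Carrier h) := inferInstanceAs (AddCommGroup (Bdual h))
instance : Module K (Carrier h) := inferInstanceAs (Module K (Bdual h))

/-- `φ ↦ φ(a ·)`. -/
def mulLeft (a : B h) : Module.End K (Carrier h) :=
  (LinearMap.mulLeft K a).dualMap.restrict fun _ => mem_mulLeft a

/-- `φ ↦ φ(· a)`. -/
def mulRight (a : B h) : Module.End K (Carrier h) :=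
  (LinearMap.mulRight K a).dualMap.restrict fun _ => mem_mulRight a

variable (h) in
/-- Composition with the parity automorphism. -/
def par : Module.End K (Carrier h) :=
  (B.par h).toLinearMap.dualMap.restrict fun _ => mem_par

theorem mulLeft_apply (a : B h) (φ : Carrier h) (c : B h) : (mulLeft a φ).1 c = φ.1 (a * c) := rfl
theorem mulRight_apply (a : B h) (φ : Carrier h) (c : B h) : (mulRight a φ).1 c = φ.1 (c * a) := rfl

theorem ext {φ ψ : Carrier h} (hφ : ∀ c, φ.1 c = ψ.1 c) : φ = ψ := Subtype.ext (LinearMap.ext hφ)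

theorem mulLeft_pow_apply (a : B h) (n : ℕ) (φ : Carrier h) (c : B h) :
    ((mulLeft a ^ n) φ).1 c = φ.1 (a ^ n * c) := by
  induction n generalizing φ with
  | zero => rw [pow_zero, pow_zero, one_mul]; rfl
  | succ n ih => rw [pow_succ, Module.End.mul_apply, ih, mulLeft_apply, pow_succ', mul_assoc]

theorem mulRight_pow_apply (a : B h) (n : ℕ) (φ : Carrier h) (c : B h) :
    ((mulRight a ^ n) φ).1 c = φ.1 (c * a ^ n) := by
  induction n generalizing φ with
  | zero => rw [pow_zero, pow_zero, mul_one]; rfl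
  | succ n ih => rw [pow_succ, Module.End.mul_apply, ih, mulRight_apply, pow_succ, mul_assoc]

theorem mulLeft_mulRight_comm (a b : B h) (φ : Carrier h) :
    mulLeft a (mulRight b φ) = mulRight b (mulLeft a φ) := ext fun c => by
  rw [mulLeft_apply, mulRight_apply, mulRight_apply, mulLeft_apply, mul_assoc]

theorem rescale_X_pow_mul (c : K) (n : ℕ) (g : K⟦X⟧) : ∃ g' : K⟦X⟧,
    PowerSeries.rescale c (PowerSeries.X ^ n * g) = PowerSeries.X ^ n * g' :=
  ⟨PowerSeries.C c ^ n * PowerSeries.rescale c g, by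
    rw [map_mul (PowerSeries.rescale c), map_pow (PowerSeries.rescale c), PowerSeries.rescale_X,
      mul_pow]
    ring⟩

/-- One exponent serves both sides and all rescalings: rescaling preserves multiples of `X^n`, and
the sum of the left and the right exponent is enough for each side. -/
theorem exists_ser_mul (φ : Carrier h) : ∃ n, ∀ (c : K) (g : K⟦X⟧) (b : B h),
    φ.1 (B.ser h (PowerSeries.rescale c (PowerSeries.X ^ n * g)) * b) = 0 ∧
    φ.1 (b * B.ser h (PowerSeries.rescale c (PowerSeries.X ^ n * g))) = 0 := by
  obtain ⟨n, hn⟩ := φ.2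
  obtain ⟨m, hm⟩ := B.exists_of_mem_Bdual φ.2
  refine ⟨m + n, fun c g b => ?_⟩
  obtain ⟨g', hg'⟩ := rescale_X_pow_mul c (m + n) g
  have h1 : PowerSeries.X ^ (m + n) * g' = PowerSeries.X ^ n * (PowerSeries.X ^ m * g') := by
    rw [pow_add, mul_assoc, mul_left_comm]
  have h2 : PowerSeries.X ^ (m + n) * g' = (PowerSeries.X ^ n * g') * PowerSeries.X ^ m := by
    rw [pow_add, mul_assoc, mul_comm (PowerSeries.X ^ m)]
  constructor
  · rw [hg', h1, B.ser_mul, mul_assoc, hn]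
  · rw [hg', h2, B.ser_mul, ← mul_assoc, hm]

/-- The operators `φ ↦ φ(cX ·)` and `φ ↦ φ(· dX)`. -/
def opX (c d : K) : Fin 2 → Module.End K (Carrier h) :=
  ![mulLeft (B.ser h (PowerSeries.rescale c PowerSeries.X)),
    mulRight (B.ser h (PowerSeries.rescale d PowerSeries.X))]

theorem opX_zero_pow (c d : K) (n : ℕ) (φ : Carrier h) (b : B h) : ((opX c d 0 ^ n) φ).1 b =
    φ.1 (B.ser h (PowerSeries.rescale c (PowerSeries.X ^ n)) * b) := by
  rw [map_pow (PowerSeries.rescale c), ← B.serHom_apply, map_pow]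
  exact mulLeft_pow_apply _ n φ b

theorem opX_one_pow (c d : K) (n : ℕ) (φ : Carrier h) (b : B h) : ((opX c d 1 ^ n) φ).1 b =
    φ.1 (b * B.ser h (PowerSeries.rescale d (PowerSeries.X ^ n))) := by
  rw [map_pow (PowerSeries.rescale d), ← B.serHom_apply, map_pow]
  exact mulRight_pow_apply _ n φ b

variable (h) in
theorem locNil (c d : K) : LocNil (opX (h := h) c d) where
  comm := LinearMap.ext fun φ => ext fun b => by
    change φ.1 (B.ser h _ * b * B.ser h _) = φ.1 (B.ser h _ * (b * B.ser h _))
    rw [mul_assoc]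
  nil φ := by
    obtain ⟨n, hn⟩ := exists_ser_mul φ
    refine ⟨n, fun i => ext fun b => ?_⟩
    fin_cases i
    · have := (hn c 1 b).1
      rw [mul_one] at this
      exact (opX_zero_pow c d n φ b).trans this
    · have := (hn d 1 b).2
      rw [mul_one] at this
      exact (opX_one_pow c d n φ b).trans this

variable (h) in
/-- Evaluation at `b`. -/
def eval (b : B h) : Carrier h →ₗ[K] K := LinearMap.applyₗ b ∘ₗ (Bdual h).subtype

theorem act_slot_zero (c d : K) (f : K⟦X⟧) (φ : Carrier h) (b : B h) :
    ((locNil h c d).act (slot 0 f) φ).1 b = φ.1 (B.ser h (PowerSeries.rescale c f) * b) := by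
  obtain ⟨n, hn⟩ := exists_ser_mul φ
  exact (locNil h c d).apply_act_slot 0 φ (eval h b) (φ.1 ∘ₗ LinearMap.mulRight K b ∘ₗ
    (B.serHom h).toLinearMap ∘ₗ (rescaleHom c).toLinearMap) n (fun g => (hn c g b).1)
    (fun l => opX_zero_pow c d l φ b) f

theorem act_slot_one (c d : K) (f : K⟦X⟧) (φ : Carrier h) (b : B h) :
    ((locNil h c d).act (slot 1 f) φ).1 b = φ.1 (b * B.ser h (PowerSeries.rescale d f)) := by
  obtain ⟨n, hn⟩ := exists_ser_mul φ
  exact (locNil h c d).apply_act_slot 1 φ (eval h b) (φ.1 ∘ₗ LinearMap.mulLeft K b ∘ₗ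
    (B.serHom h).toLinearMap ∘ₗ (rescaleHom d).toLinearMap) n (fun g => (hn d g b).2)
    (fun l => opX_one_pow c d l φ b) f

theorem act_X_pow (c d : K) (l l' : ℕ) (φ : Carrier h) (b : B h) : ((locNil h c d).act
    (MvPowerSeries.X 0 ^ l * MvPowerSeries.X 1 ^ l') φ).1 b =
    φ.1 (B.ser h (PowerSeries.rescale c (PowerSeries.X ^ l)) * b *
      B.ser h (PowerSeries.rescale d (PowerSeries.X ^ l'))) := by
  rw [(locNil h c d).act_X_pow, Module.End.mul_apply, opX_zero_pow, opX_one_pow]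

/-- At the element `1` left and right multiplication coincide, so `X₀ + X₁` acts there as `(c + d) X
= 0` and only the constant term survives. This is the antipode axiom for power series. -/
theorem act_addHom {c d : K} (hcd : c + d = 0) (f : K⟦X⟧) (φ : Carrier h) :
    ((locNil h c d).act (addHom f) φ).1 1 = φ.1 1 * PowerSeries.constantCoeff f := by
  rw [← PowerSeries.coeff_zero_eq_constantCoeff_apply]
  refine (locNil h c d).apply_act_addHom φ (eval h 1) (φ.1 1 • PowerSeries.coeff 0) 1
    (fun g => by simp) (fun l => ?_) f
  cases l with
  | zero =>
    rw [pow_zero, pow_zero, LinearMap.smul_apply, PowerSeries.coeff_zero_one, smul_eq_mul, mul_one]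
    rfl
  | succ l =>
    rw [pow_succ', Module.End.mul_apply]
    change (((opX c d 0 + opX c d 1 : Module.End K (Carrier h)) _).1 1 : K) = _
    have key (ψ : Carrier h) : ((opX c d 0 + opX c d 1 : Module.End K (Carrier h)) ψ).1 1 = 0 := by
      change ψ.1 (B.ser h _ * 1) + ψ.1 (1 * B.ser h _) = 0
      rw [mul_one, one_mul, ← map_add, ← B.ser_add, PowerSeries.rescale_X, PowerSeries.rescale_X,
        ← add_mul, ← map_add, hcd, map_zero, zero_mul, ← B.serHom_apply, map_zero, map_zero]
    rw [key]
    simp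

end Bdual

attribute [local instance] serModule₂ serTower₂

namespace B
variable {h : K}

theorem rescale_dlB : PowerSeries.rescale (-1 : K) (dlB h) = -dlB h := by
  rw [dlB, rescale_smul, rescale_sinhS, smul_neg]

theorem rescale_gmB : PowerSeries.rescale (-1 : K) (gmB h) = gmB h := by
  rw [gmB, rescale_smul, rescale_coshS]

theorem rescale_sqB : PowerSeries.rescale (-1 : K) (sqB h) = -sqB h := by
  rw [sqB, rescale_smul, rescale_sinhS, smul_neg]

theorem rescale_neg_one_X : PowerSeries.rescale (-1 : K) PowerSeries.X = -PowerSeries.X := by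
  rw [PowerSeries.rescale_X]; simp

theorem rescale_one_X : PowerSeries.rescale (1 : K) PowerSeries.X = PowerSeries.X := by
  rw [PowerSeries.rescale_one]; rfl

theorem rescale_one_apply (f : K⟦X⟧) : PowerSeries.rescale (1 : K) f = f := by
  rw [PowerSeries.rescale_one]; rfl


theorem H_mul_ser_X :
    H h * ser h PowerSeries.X = ser h PowerSeries.X * H h + ser h (dlB h) := by
  rw [H_mul_ser, PowerSeries.derivative_X, mul_one]

theorem SH_mul_ser_X : SH h * ser h PowerSeries.X = ser h PowerSeries.X * SH h - ser h (dlB h) := by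
  rw [SH_mul_ser, PowerSeries.derivative_X, mul_one]

theorem par_SH_mul (c : B h) : par h (SH h * c) = SH h * par h c := by rw [map_mul, par_SH]
theorem par_ser_mul (f : K⟦X⟧) (c : B h) : par h (ser h f * c) = ser h f * par h c := by
  rw [map_mul, par_ser]

theorem two_h_V_V (hh : h ≠ 0) (f : K⟦X⟧) :
    (2 * h) • (V h * ser h f * V h) = (1 / 2 : K) • ser h (sinhS h * f) := by
  rw [V_mul_ser, mul_assoc, V_mul_V, ← ser_mul, ← ser_smul, ← ser_smul, sqB, mul_smul_comm,
    smul_smul, mul_comm f (sinhS h)]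
  congr 2
  field_simp
  norm_num

/-- The exponent is taken as a multiple of `h` so that the factor `h⁻¹` in `[H, X]` cancels. -/
theorem H_mul_expS (hh : h ≠ 0) (c : K) : H h * ser h (expS (c * h)) =
    ser h (expS (c * h)) * H h + c • ser h (sinhS h * expS (c * h)) := by
  rw [H_mul_ser, derivative_expS, dlB, smul_mul_smul_comm, ← ser_smul]
  congr 4
  field_simp

end B

/-! ### The antipode axiom -/

namespace Bdual
variable {h : K}

variable (h) in
/-- `φ ↦ φ(S(H) ·)` and `φ ↦ φ(· H)`. -/
def opHl : Fin 2 → Module.End K (Carrier h) := ![mulLeft (B.SH h), mulRight (B.H h)]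

variable (h) in
/-- `φ ↦ φ(S(V) ·)`, with a sign, and `φ ↦ φ(· V)`. -/
def opVl : Fin 2 → Module.End K (Carrier h) := ![par h * mulLeft (-B.V h), mulRight (B.V h)]

variable (h) in
/-- `φ ↦ φ(H ·)` and `φ ↦ φ(· S(H))`. -/
def opHr : Fin 2 → Module.End K (Carrier h) := ![mulLeft (B.H h), mulRight (B.SH h)]

variable (h) in
/-- `φ ↦ φ(V ·)` and `φ ↦ φ(· S(V))`, the latter with a sign. -/
def opVr : Fin 2 → Module.End K (Carrier h) := ![mulLeft (B.V h), par h * mulRight (-B.V h)]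

open B in
-- Precomposing functionals with left multiplication reverses products, and so does `S`; together
-- they give a left action in the first factor. Right multiplication gives a left action in the
-- second factor without `S`.
theorem isLift₂_left :
    IsLift₂ (dlB h) (gmB h) (sqB h) (locNil h (-1) 1).act (opHl h) (opVl h) := by
  refine (locNil h (-1) 1).isLift₂ _ _ ?_ ?_ ?_ ?_ ?_ ?_ ?_ ?_
  · intro i φ
    refine ext fun c => ?_
    fin_cases i
    · change φ.1 (B.ser h (PowerSeries.rescale (-1) PowerSeries.X) * (SH h * c)) =
        φ.1 (SH h * (B.ser h (PowerSeries.rescale (-1) PowerSeries.X) * c)) +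
        ((locNil h (-1) 1).act (slot 0 (dlB h)) φ).1 c
      rw [act_slot_zero, ← map_add, rescale_neg_one_X, rescale_dlB, ← mul_assoc, ← mul_assoc,
        ← add_mul, ser_neg, mul_neg, SH_mul_ser_X, ser_neg]
      congr 2
      simp only [neg_mul]
      abel
    · change φ.1 (c * H h * B.ser h (PowerSeries.rescale 1 PowerSeries.X)) =
        φ.1 (c * B.ser h (PowerSeries.rescale 1 PowerSeries.X) * H h) +
        ((locNil h (-1) 1).act (slot 1 (dlB h)) φ).1 c
      rw [act_slot_one, ← map_add, rescale_one_X, rescale_one_apply, mul_assoc, mul_assoc,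
        ← mul_add, H_mul_ser_X]
  · intro i j hij φ
    fin_cases i <;> fin_cases j
    · simp at hij
    · exact mulLeft_mulRight_comm _ _ φ
    · exact (mulLeft_mulRight_comm _ _ φ).symm
    · simp at hij
  · intro i j φ
    refine ext fun c => ?_
    fin_cases i <;> fin_cases j
    · change φ.1 (B.ser h _ * (-V h * B.par h c)) = φ.1 (-V h * B.par h (B.ser h _ * c))
      rw [par_ser_mul, ← mul_assoc, ← mul_assoc, mul_neg, neg_mul (V h), V_mul_ser]
    · change φ.1 ((-V h * B.par h c) * B.ser h _) = φ.1 (-V h * B.par h (c * B.ser h _))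
      rw [map_mul (B.par h), par_ser, mul_assoc]
    · change φ.1 (B.ser h _ * (c * V h)) = φ.1 (B.ser h _ * c * V h)
      rw [mul_assoc]
    · change φ.1 (c * V h * B.ser h _) = φ.1 (c * B.ser h _ * V h)
      rw [mul_assoc, mul_assoc, V_mul_ser]
  · intro i
    refine LinearMap.ext fun φ => ext fun c => ?_
    fin_cases i
    · change φ.1 (-V h * B.par h (SH h * c)) = φ.1 (SH h * (-V h * B.par h c)) +
        ((locNil h (-1) 1).act (slot 0 (gmB h)) φ).1 (-V h * B.par h c)
      rw [act_slot_zero, ← map_add, rescale_gmB, par_SH_mul, ← mul_assoc, ← mul_assoc, ← mul_assoc,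
        ← add_mul, mul_neg, neg_mul, SH_mul_V]
      congr 2
      simp only [mul_neg]
      abel
    · change φ.1 (c * H h * V h) = φ.1 (c * V h * H h) +
        ((locNil h (-1) 1).act (slot 1 (gmB h)) φ).1 (c * V h)
      rw [act_slot_one, ← map_add, rescale_one_apply, mul_assoc, mul_assoc, mul_assoc, ← mul_add,
        H_mul_V]
  · intro i
    refine LinearMap.ext fun φ => ext fun c => ?_
    fin_cases i
    · change φ.1 (-V h * B.par h (-V h * B.par h c)) = ((locNil h (-1) 1).act (slot 0 (sqB h)) φ).1 c
      rw [act_slot_zero, rescale_sqB, map_mul (B.par h), map_neg, par_V, par_par, neg_neg, neg_mul, ← mul_assoc,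
        V_mul_V, ser_neg, neg_mul]
    · change φ.1 (c * V h * V h) = ((locNil h (-1) 1).act (slot 1 (sqB h)) φ).1 c
      rw [act_slot_one, rescale_one_apply, mul_assoc, V_mul_V]
  · exact LinearMap.ext fun φ => mulLeft_mulRight_comm _ _ φ
  · intro i j hij
    refine LinearMap.ext fun φ => ext fun c => ?_
    fin_cases i <;> fin_cases j
    · simp at hij
    · exact congrArg (fun ψ : Carrier h => ψ.1 c) (mulLeft_mulRight_comm _ _ φ)
    · change φ.1 (-V h * B.par h (c * H h)) = φ.1 (-V h * B.par h c * H h)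
      rw [map_mul (B.par h), par_H, mul_assoc]
    · simp at hij
  · refine LinearMap.ext fun φ => ext fun c => ?_
    change φ.1 (-V h * B.par h c * V h) = -φ.1 (-V h * B.par h (c * V h))
    rw [map_mul (B.par h), par_V, ← map_neg]
    simp [mul_assoc]

open B in
-- With `S` on the second factor the order of composition is reversed in both factors, so this is a
-- right action and takes values in the opposite ring.
theorem isLift₂_right : IsLift₂ (dlB h) (gmB h) (sqB h)
    ((locNil h 1 (-1)).act.toOpposite fun f g => (Commute.all f g).map (locNil h 1 (-1)).act)
    (fun i => MulOpposite.op (opHr h i)) (fun i => MulOpposite.op (opVr h i)) := by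
  refine (locNil h 1 (-1)).isLift₂_op _ _ ?_ ?_ ?_ ?_ ?_ ?_ ?_ ?_
  · intro i φ
    refine ext fun c => ?_
    fin_cases i
    · change φ.1 (H h * (B.ser h (PowerSeries.rescale 1 PowerSeries.X) * c)) =
        φ.1 (B.ser h (PowerSeries.rescale 1 PowerSeries.X) * (H h * c)) +
        ((locNil h 1 (-1)).act (slot 0 (dlB h)) φ).1 c
      rw [act_slot_zero, ← map_add, rescale_one_X, rescale_one_apply, ← mul_assoc, ← mul_assoc,
        ← add_mul, H_mul_ser_X]
    · change φ.1 (c * B.ser h (PowerSeries.rescale (-1) PowerSeries.X) * SH h) =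
        φ.1 (c * SH h * B.ser h (PowerSeries.rescale (-1) PowerSeries.X)) +
        ((locNil h 1 (-1)).act (slot 1 (dlB h)) φ).1 c
      rw [act_slot_one, ← map_add, rescale_neg_one_X, rescale_dlB, mul_assoc, mul_assoc,
        ← mul_add, ser_neg, mul_neg, SH_mul_ser_X, ser_neg]
      congr 2
      simp only [neg_mul]
      abel
  · intro i j hij φ
    fin_cases i <;> fin_cases j
    · simp at hij
    · exact mulLeft_mulRight_comm _ _ φ
    · exact (mulLeft_mulRight_comm _ _ φ).symm
    · simp at hij
  · intro i j φ
    refine ext fun c => ?_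
    fin_cases i <;> fin_cases j
    · change φ.1 (B.ser h _ * (V h * c)) = φ.1 (V h * (B.ser h _ * c))
      rw [← mul_assoc, ← mul_assoc, V_mul_ser]
    · change φ.1 (V h * c * B.ser h _) = φ.1 (V h * (c * B.ser h _))
      rw [mul_assoc]
    · change φ.1 (B.ser h _ * (B.par h c * -V h)) = φ.1 (B.par h (B.ser h _ * c) * -V h)
      rw [par_ser_mul, mul_assoc]
    · change φ.1 ((B.par h c * -V h) * B.ser h _) = φ.1 (B.par h (c * B.ser h _) * -V h)
      rw [map_mul (B.par h), par_ser, mul_assoc, mul_assoc, neg_mul (V h), mul_neg (B.ser h _), V_mul_ser]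
  · intro i
    refine LinearMap.ext fun φ => ext fun c => ?_
    fin_cases i
    · change φ.1 (H h * (V h * c)) = φ.1 (V h * (H h * c)) +
        ((locNil h 1 (-1)).act (slot 0 (gmB h)) (mulLeft (V h) φ)).1 c
      rw [act_slot_zero, mulLeft_apply, ← map_add, rescale_one_apply, ← mul_assoc, ← mul_assoc,
        ← mul_assoc, ← add_mul, H_mul_V]
    · change φ.1 (B.par h c * -V h * SH h) = φ.1 (B.par h (c * SH h) * -V h) +
        ((locNil h 1 (-1)).act (slot 1 (gmB h)) ((par h * mulRight (-V h)) φ)).1 c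
      rw [act_slot_one]
      change _ = _ + φ.1 (B.par h (c * B.ser h _) * -V h)
      rw [← map_add, rescale_gmB, map_mul (B.par h), map_mul (B.par h), par_SH, par_ser, mul_assoc, mul_assoc, mul_assoc,
        ← mul_add, neg_mul (V h), mul_neg (SH h), SH_mul_V]
      congr 2
      simp only [neg_mul, mul_neg]
      abel
  · intro i
    refine LinearMap.ext fun φ => ext fun c => ?_
    fin_cases i
    · change φ.1 (V h * (V h * c)) = ((locNil h 1 (-1)).act (slot 0 (sqB h)) φ).1 c
      rw [act_slot_zero, rescale_one_apply, ← mul_assoc, V_mul_V]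
    · change φ.1 (B.par h (B.par h c * -V h) * -V h) = ((locNil h 1 (-1)).act (slot 1 (sqB h)) φ).1 c
      rw [act_slot_one, rescale_sqB, map_mul (B.par h), map_neg, par_V, par_par, neg_neg, mul_neg, mul_assoc,
        V_mul_V, ser_neg, mul_neg]
  · exact LinearMap.ext fun φ => mulLeft_mulRight_comm _ _ φ
  · intro i j hij
    refine LinearMap.ext fun φ => ext fun c => ?_
    fin_cases i <;> fin_cases j
    · simp at hij
    · change φ.1 (B.par h (H h * c) * -V h) = φ.1 (H h * (B.par h c * -V h))
      rw [map_mul (B.par h), par_H, mul_assoc]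
    · exact congrArg (fun ψ : Carrier h => ψ.1 c) (mulLeft_mulRight_comm _ _ φ).symm
    · simp at hij
  · refine LinearMap.ext fun φ => ext fun c => ?_
    change φ.1 (B.par h (V h * c) * -V h) = -φ.1 (V h * (B.par h c * -V h))
    rw [map_mul (B.par h), par_V, ← map_neg]
    simp [mul_assoc]

end Bdual

attribute [local instance] serModule₂ serTower₂

namespace Bdual
variable {h : K}

variable (h) in
/-- The action `(a ⊗ a') φ = φ(S(a) · a')` of the tensor square. -/
def repLeft : BB h →ₐ[K] Module.End K (Carrier h) := lift₂ isLift₂_left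

theorem repLeft_ser (f) : repLeft h (BB.ser h f) = (locNil h (-1) 1).act f := lift₂_ser₂ ..
theorem repLeft_H (i) : repLeft h (BB.H h i) = opHl h i := lift₂_genH₂ _ i
theorem repLeft_V (i) : repLeft h (BB.V h i) = opVl h i := lift₂_genV₂ _ i

variable (h) in
/-- The right action `φ (a ⊗ a') = φ(a · S(a'))` of the tensor square. -/
def repRight : BB h →ₐ[K] (Module.End K (Carrier h))ᵐᵒᵖ := lift₂ isLift₂_right

theorem repRight_ser (f) : (repRight h (BB.ser h f)).unop = (locNil h 1 (-1)).act f :=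
  congrArg MulOpposite.unop (lift₂_ser₂ ..)
theorem repRight_H (i) : (repRight h (BB.H h i)).unop = opHr h i :=
  congrArg MulOpposite.unop (lift₂_genH₂ _ i)
theorem repRight_V (i) : (repRight h (BB.V h i)).unop = opVr h i :=
  congrArg MulOpposite.unop (lift₂_genV₂ _ i)

theorem repRight_mul (u v : BB h) (φ : Carrier h) :
    (repRight h (u * v)).unop φ = (repRight h v).unop ((repRight h u).unop φ) := by
  rw [map_mul]; rfl

theorem repLeft_smul (f) (u : BB h) (φ : Carrier h) :
    repLeft h (f • u) φ = (locNil h (-1) 1).act f (repLeft h u φ) := by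
  rw [BB.smul_eq_ser_mul, map_mul, repLeft_ser]; rfl

theorem repRight_smul (f) (u : BB h) (φ : Carrier h) :
    (repRight h (f • u)).unop φ = (repRight h u).unop ((locNil h 1 (-1)).act f φ) := by
  rw [BB.smul_eq_ser_mul, repRight_mul, repRight_ser]

theorem act_slot_mul_slot (c d : K) (f g : K⟦X⟧) (φ : Carrier h) (b : B h) :
    ((locNil h c d).act (slot 0 f * slot 1 g) φ).1 b =
      φ.1 (B.ser h (PowerSeries.rescale c f) * b * B.ser h (PowerSeries.rescale d g)) := by
  rw [map_mul, Module.End.mul_apply, act_slot_zero, act_slot_one]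

theorem opVl_zero_pow_apply (m : Fin 2) (φ : Carrier h) (c : B h) :
    ((opVl h 0 ^ (m : ℕ)) φ).1 c = φ.1 ((-B.V h) ^ (m : ℕ) * if m = 0 then c else B.par h c) := by
  fin_cases m
  · change φ.1 c = φ.1 ((-B.V h) ^ 0 * c)
    rw [pow_zero, one_mul]
  · change ((opVl h 0 ^ 1) φ).1 c = φ.1 ((-B.V h) ^ 1 * B.par h c)
    rw [pow_one, pow_one]; rfl

theorem opVr_one_pow_apply (m : Fin 2) (φ : Carrier h) (c : B h) :
    ((opVr h 1 ^ (m : ℕ)) φ).1 c = φ.1 ((if m = 0 then c else B.par h c) * (-B.V h) ^ (m : ℕ)) := by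
  fin_cases m
  · change φ.1 c = φ.1 (c * (-B.V h) ^ 0)
    rw [pow_zero, mul_one]
  · change ((opVr h 1 ^ 1) φ).1 c = φ.1 (B.par h c * (-B.V h) ^ 1)
    rw [pow_one, pow_one]; rfl

theorem repLeft_mono (φ : Carrier h) (i : (ℕ × Fin 2) × (ℕ × Fin 2)) (l l' : ℕ) :
    (repLeft h (BB.mono h i (MvPowerSeries.X 0 ^ l * MvPowerSeries.X 1 ^ l')) φ).1 1 =
      φ.1 (B.antipode h (B.E h i.1.1 l i.1.2) * B.E h i.2.1 l' i.2.2) := by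
  rw [BB.rep_mono_apply (locNil h (-1) 1) _ repLeft_ser, repLeft_H, repLeft_H, repLeft_V, repLeft_V]
  refine (mulLeft_pow_apply ..).trans ((mulRight_pow_apply ..).trans ?_)
  rw [act_X_pow, opVl_zero_pow_apply]
  refine (mulRight_pow_apply ..).trans ?_
  rw [B.rescale_one_apply, B.E_eq, B.antipode_mono, B.E, mul_one]
  congr 1
  -- The parity automorphism brought in by an odd `V₀` meets only even factors here.
  split_ifs with hm
  · simp only [mul_assoc]
  · simp only [map_mul, map_pow, B.par_SH, B.par_H, B.par_ser, mul_assoc]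

theorem repRight_mono (φ : Carrier h) (i : (ℕ × Fin 2) × (ℕ × Fin 2)) (f) :
    (repRight h (BB.mono h i f)).unop φ = (opVr h 1 ^ (i.2.2 : ℕ)) ((opVr h 0 ^ (i.1.2 : ℕ))
      ((locNil h 1 (-1)).act f ((opHr h 1 ^ i.2.1) ((opHr h 0 ^ i.1.1) φ)))) := by
  rw [BB.mono, repRight_mul, repRight_mul, repRight_mul, repRight_mul, repRight_ser]
  simp only [map_pow, MulOpposite.unop_pow, repRight_H, repRight_V]

theorem repRight_mono_X_pow (φ : Carrier h) (i : (ℕ × Fin 2) × (ℕ × Fin 2)) (l l' : ℕ) :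
    ((repRight h (BB.mono h i (MvPowerSeries.X 0 ^ l * MvPowerSeries.X 1 ^ l'))).unop φ).1 1 =
      φ.1 (B.E h i.1.1 l i.1.2 * B.antipode h (B.E h i.2.1 l' i.2.2)) := by
  rw [repRight_mono, opVr_one_pow_apply]
  refine (mulLeft_pow_apply ..).trans ?_
  rw [act_X_pow]
  refine (mulRight_pow_apply ..).trans ((mulLeft_pow_apply ..).trans ?_)
  rw [B.rescale_one_apply, B.E_eq _ _ i.2.2, B.antipode_mono, B.E, map_one, ite_self, one_mul]
  simp only [mul_assoc]

/-- The functional `a ⊗ a' ↦ φ(S(a) a')`. -/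
def evalLeft (φ : Carrier h) : BB h →ₗ[K] K :=
  eval h 1 ∘ₗ LinearMap.applyₗ φ ∘ₗ (repLeft h).toLinearMap

/-- The functional `a ⊗ a' ↦ φ(a S(a'))`. -/
def evalRight (φ : Carrier h) : BB h →ₗ[K] K where
  toFun u := ((repRight h u).unop φ).1 1
  map_add' u v := by rw [map_add]; rfl
  map_smul' c u := by rw [map_smul]; rfl

theorem evalLeft_apply (φ : Carrier h) (u : BB h) : evalLeft φ u = (repLeft h u φ).1 1 := rfl
theorem evalRight_apply (φ : Carrier h) (u : BB h) :
    evalRight φ u = ((repRight h u).unop φ).1 1 := rfl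

theorem evalLeft_eq_pair (hinj : Function.Injective (BB.expand h)) (φ : Carrier h) (u : BB h) :
    evalLeft φ u = BB.pair h (fun a a' => φ.1 (B.antipode h a * a')) u :=
  BB.matrixCoeff_eq_pair (locNil h (-1) 1) (repLeft h) repLeft_ser (eval h 1) φ hinj
    (fun a a' => φ.1 (B.antipode h a * a'))
    (fun i l l' => repLeft_mono φ i l l') u

theorem evalRight_eq_pair (hinj : Function.Injective (BB.expand h)) (φ : Carrier h) (u : BB h) :
    evalRight φ u = BB.pair h (fun a a' => φ.1 (a * B.antipode h a')) u := by
  refine BB.eq_pair hinj _ _ (fun i => ?_) (repRight_mono_X_pow φ) u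
  obtain ⟨n, hn⟩ := (locNil h 1 (-1)).nil ((opHr h 1 ^ i.2.1) ((opHr h 0 ^ i.1.1) φ))
  refine ⟨n, fun j g => ?_⟩
  rw [evalRight_apply, repRight_mono, (locNil h 1 (-1)).act_X_pow_mul j hn le_rfl, map_zero,
    map_zero]
  rfl

/-- The antipode axiom for `S ⊗ 1` at `H`. Moving `H` past `T⁻¹` produces `sinh · T⁻¹`; one half is
cancelled by the correction in `S(H)` and the other half by the odd term. -/
theorem expS_neg_relation (hh : h ≠ 0) : B.SH h * B.ser h (expS (-h)) +
    B.ser h (expS (-h)) * B.H h - (2 * h) • (B.V h * B.ser h (expS (-h)) * B.V h) = 0 := by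
  have e := B.H_mul_expS hh (-1)
  rw [neg_one_mul, neg_one_smul] at e
  rw [B.two_h_V_V hh, B.SH, sub_mul, neg_mul, e, smul_mul_assoc (1 / 2 : K), ← B.ser_mul]
  generalize B.ser h (sinhS h * expS (-h)) = s
  have : s = (1 / 2 : K) • s + (1 / 2 : K) • s := by rw [← add_smul]; norm_num
  nth_rewrite 1 [this]
  abel

theorem expS_pos_relation (hh : h ≠ 0) : B.H h * B.ser h (expS h) +
    B.ser h (expS h) * B.SH h - (2 * h) • (B.V h * B.ser h (expS h) * B.V h) = 0 := by
  have e := B.H_mul_expS hh 1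
  rw [one_mul, one_smul] at e
  rw [B.two_h_V_V hh, B.SH, mul_sub, mul_neg, e, mul_smul_comm (1 / 2 : K), ← B.ser_mul,
    mul_comm (expS h) (sinhS h)]
  generalize B.ser h (sinhS h * expS h) = s
  have : s = (1 / 2 : K) • s + (1 / 2 : K) • s := by rw [← add_smul]; norm_num
  nth_rewrite 1 [this]
  abel

theorem evalLeft_comulH (hh : h ≠ 0) (φ : Carrier h) : evalLeft φ (BB.comulH h) = 0 := by
  rw [BB.comulH_eq, map_add, map_add, (evalLeft φ).map_smul (2 * h), evalLeft_apply, evalLeft_apply,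
    evalLeft_apply, repLeft_smul, repLeft_smul, repLeft_smul, map_mul (repLeft h), repLeft_H, repLeft_H,
    repLeft_V, repLeft_V, ← BB.slot_one_neg, ← BB.slot_zero_pos, act_slot_zero, act_slot_one,
    act_slot_mul_slot]
  change φ.1 (B.SH h * (1 * _)) + φ.1 (_ * 1 * B.H h) +
      (2 * h) • φ.1 (-B.V h * B.par h (B.ser h _ * 1 * B.ser h _) * B.V h) = 0
  have e := congrArg φ.1 (expS_neg_relation hh)
  rw [map_sub, map_add, map_smul, map_zero] at e
  rw [one_mul, mul_one, mul_one, ← B.ser_mul, B.par_ser, B.rescale_one_apply, B.rescale_one_apply,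
    rescale_expS, rescale_expS, neg_one_mul, neg_one_mul, ← neg_div, ← expS_add, add_halves,
    neg_mul (B.V h), neg_mul (B.V h * _), map_neg, smul_neg, ← sub_eq_add_neg, e]

theorem evalLeft_comulV (φ : Carrier h) : evalLeft φ (BB.comulV h) = 0 := by
  rw [BB.comulV_eq, map_add, evalLeft_apply, evalLeft_apply, repLeft_smul, repLeft_smul,
    repLeft_V, repLeft_V, act_slot_zero, act_slot_one]
  change φ.1 (-B.V h * B.par h (1 * B.ser h _)) + φ.1 (B.ser h _ * 1 * B.V h) = 0
  rw [one_mul, mul_one, B.par_ser, neg_mul, B.V_mul_ser, map_neg, B.rescale_one_apply, rescale_expS,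
    neg_one_mul, neg_div, neg_add_cancel]

theorem evalRight_comulH (hh : h ≠ 0) (φ : Carrier h) : evalRight φ (BB.comulH h) = 0 := by
  rw [BB.comulH_eq, map_add, map_add, (evalRight φ).map_smul (2 * h), evalRight_apply,
    evalRight_apply, evalRight_apply, repRight_smul, repRight_smul, repRight_smul, repRight_mul,
    repRight_H, repRight_H, repRight_V, repRight_V, ← BB.slot_one_neg, ← BB.slot_zero_pos]
  change ((locNil h 1 (-1)).act (slot 1 _) φ).1 (B.H h * 1) +
    ((locNil h 1 (-1)).act (slot 0 _) φ).1 (1 * B.SH h) + (2 * h) •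
      ((locNil h 1 (-1)).act (slot 0 _ * slot 1 _) φ).1 (B.V h * (B.par h 1 * -B.V h)) = 0
  have e := congrArg φ.1 (expS_pos_relation hh)
  rw [map_sub, map_add, map_smul, map_zero] at e
  rw [act_slot_zero, act_slot_one, act_slot_mul_slot, one_mul, mul_one, map_one, one_mul,
    B.rescale_one_apply, B.rescale_one_apply, rescale_expS, rescale_expS, neg_one_mul, neg_one_mul,
    neg_neg, neg_div, neg_neg, mul_neg (B.V h), mul_neg (B.ser h _), neg_mul (B.ser h _ * _),
    ← mul_assoc (B.ser h _) (B.V h), ← B.V_mul_ser, mul_assoc (B.V h * _)]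
  nth_rewrite 2 [B.V_mul_ser]
  rw [← mul_assoc (B.V h * _), mul_assoc (B.V h) (B.ser h _), ← B.ser_mul, ← expS_add, add_halves,
    map_neg, smul_neg, ← sub_eq_add_neg, e]

theorem evalRight_comulV (φ : Carrier h) : evalRight φ (BB.comulV h) = 0 := by
  rw [BB.comulV_eq, map_add, evalRight_apply, evalRight_apply, repRight_smul, repRight_smul,
    repRight_V, repRight_V]
  change ((locNil h 1 (-1)).act (slot 1 _) φ).1 (B.V h * 1) +
    ((locNil h 1 (-1)).act (slot 0 _) φ).1 (B.par h 1 * -B.V h) = 0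
  rw [act_slot_zero, act_slot_one, map_one, one_mul, mul_one, mul_neg (B.ser h _), map_neg,
    B.V_mul_ser, B.rescale_one_apply, rescale_expS, neg_one_mul, neg_div, neg_neg, add_neg_cancel]

/-- The antipode axiom for `S ⊗ 1`. -/
theorem evalLeft_comul (hh : h ≠ 0) (b : B h) (φ : Carrier h) :
    evalLeft φ (BB.comul h hh b) = φ.1 1 * B.counit h b := by
  let S : Subalgebra K (B h) :=
    { carrier := {b | ∀ φ : Carrier h, evalLeft φ (BB.comul h hh b) = φ.1 1 * B.counit h b}
      add_mem' := by
        intro a b ha hb φ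
        rw [map_add, map_add, map_add, mul_add, ← ha, ← hb]
      mul_mem' := by
        intro a b ha hb φ
        -- The axiom is multiplicative: evaluate `Δ(a)` on the functional `Δ(b) φ`, whose value at
        -- `1` is already known to be `φ(1) ε(b)`.
        have : evalLeft φ (BB.comul h hh (a * b)) =
            evalLeft (repLeft h (BB.comul h hh b) φ) (BB.comul h hh a) := by
          rw [evalLeft_apply, evalLeft_apply, map_mul, map_mul, Module.End.mul_apply]
        rw [this, ha, ← evalLeft_apply, hb, map_mul, mul_assoc, mul_comm (B.counit h a)]
      algebraMap_mem' := by
        intro r φ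
        rw [AlgHom.commutes, AlgHom.commutes, evalLeft_apply, AlgHom.commutes, mul_comm (φ.1 1)]
        rfl }
  refine B.mem_of_generators S (fun f φ => ?_) (fun φ => ?_) (fun φ => ?_) b φ
  · rw [BB.comul_ser, evalLeft_apply, repLeft_ser, act_addHom (neg_add_cancel 1), B.counit_ser]
  · rw [BB.comul_H, evalLeft_comulH hh, B.counit_H, mul_zero]
  · rw [BB.comul_V, evalLeft_comulV, B.counit_V, mul_zero]

/-- The antipode axiom for `1 ⊗ S`. -/
theorem evalRight_comul (hh : h ≠ 0) (b : B h) (φ : Carrier h) :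
    evalRight φ (BB.comul h hh b) = φ.1 1 * B.counit h b := by
  let S : Subalgebra K (B h) :=
    { carrier := {b | ∀ φ : Carrier h, evalRight φ (BB.comul h hh b) = φ.1 1 * B.counit h b}
      add_mem' := by
        intro a b ha hb φ
        rw [map_add, map_add, map_add, mul_add, ← ha, ← hb]
      mul_mem' := by
        intro a b ha hb φ
        have : evalRight φ (BB.comul h hh (a * b)) =
            evalRight ((repRight h (BB.comul h hh a)).unop φ) (BB.comul h hh b) := by
          rw [evalRight_apply, evalRight_apply, map_mul, repRight_mul]
        rw [this, hb, ← evalRight_apply, ha, map_mul, mul_assoc]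
      algebraMap_mem' := by
        intro r φ
        rw [AlgHom.commutes, AlgHom.commutes, evalRight_apply, AlgHom.commutes, mul_comm (φ.1 1)]
        rfl }
  refine B.mem_of_generators S (fun f φ => ?_) (fun φ => ?_) (fun φ => ?_) b φ
  · rw [BB.comul_ser, evalRight_apply, repRight_ser, act_addHom (add_neg_cancel 1), B.counit_ser]
  · rw [BB.comul_H, evalRight_comulH hh, B.counit_H, mul_zero]
  · rw [BB.comul_V, evalRight_comulV, B.counit_V, mul_zero]

end Bdual

attribute [local instance] serModule serTower serTower' serModule₂ serTower₂

/-! ### The antipode of `B` and continuous functionals -/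

namespace B
variable {h : K}

theorem anti_mul_even (b c d : B h) (hd : par h d = d) : anti h b (c * d) = anti h b c * d := by
  let S : Subalgebra K (B h) :=
    { carrier := {b | ∀ c, anti h b (c * d) = anti h b c * d}
      add_mem' := by
        intro a b ha hb c
        rw [anti_add, anti_add, ha, hb, add_mul]
      mul_mem' := by
        intro a b ha hb c
        rw [anti_mul, anti_mul, ha, hb]
      algebraMap_mem' := by
        intro r c
        rw [anti_algebraMap, anti_algebraMap, smul_mul_assoc] }
  refine mem_of_generators S (fun f c => ?_) (fun c => ?_) (fun c => ?_) b c
  · rw [anti_ser, anti_ser, mul_assoc]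
  · rw [anti_H, anti_H, mul_assoc]
  · rw [anti_V, anti_V, map_mul, hd, ← mul_assoc, neg_mul]

theorem antipode_ser_mul (f : K⟦X⟧) (b : B h) :
    antipode h (ser h f * b) = antipode h b * ser h (PowerSeries.rescale (-1) f) := by
  rw [antipode_apply, anti_mul, anti_ser, mul_one, antipode_apply, ← anti_mul_even _ _ _ (par_ser _),
    one_mul]

/-- `S` turns a left multiple of `X^n` into a right multiple of `(-X)^n`, and `φ` is continuous for
right multiples too. -/
theorem comp_antipode_mem_Bdual {φ : Module.Dual K (B h)} (hφ : φ ∈ Bdual h) :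
    φ ∘ₗ antipode h ∈ Bdual h := by
  obtain ⟨n, hn⟩ := Bdual.exists_ser_mul (⟨φ, hφ⟩ : Bdual h)
  refine ⟨n, fun b => ?_⟩
  have := (hn (-1) 1 (antipode h b)).2
  rw [mul_one] at this
  rw [LinearMap.comp_apply, antipode_ser_mul]
  exact this

theorem counit_antipode (b : B h) : counit h (antipode h b) = counit h b := by
  have key (b : B h) : ∀ c, counit h (anti h b c) = counit h b * counit h c := by
    let S : Subalgebra K (B h) :=
      { carrier := {b | ∀ c, counit h (anti h b c) = counit h b * counit h c}
        add_mem' := by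
          intro a b ha hb c
          rw [anti_add, map_add, ha, hb, map_add, add_mul]
        mul_mem' := by
          intro a b ha hb c
          rw [anti_mul, hb, ha, map_mul, mul_assoc, mul_left_comm]
        algebraMap_mem' := by
          intro r c
          rw [anti_algebraMap, map_smul, AlgHom.commutes]; rfl }
    refine mem_of_generators S (fun f c => ?_) (fun c => ?_) (fun c => ?_) b
    · rw [anti_ser, map_mul, counit_ser, counit_ser]
      congr 1
      rw [← PowerSeries.coeff_zero_eq_constantCoeff_apply, PowerSeries.coeff_rescale]
      simp
    · rw [anti_H, map_mul, SH, map_sub, map_neg, map_smul, counit_H, counit_ser,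
        constantCoeff_sinhS]
      simp
    · rw [anti_V, map_neg, map_mul, counit_V]
      simp
  rw [antipode_apply, key, map_one, mul_one]

end B

namespace A
variable {h : K} (hh : h ≠ 0)

/-! ### The coproduct of the dual on generators -/

theorem opH_exp (c : K) : opH h (exp h c) = c • exp h c := by
  rw [exp, opH_ser, derivative_expS, ser_smul]

theorem dX_exp (f : K⟦X⟧) (c : K) : dX h f (exp h c) = PowerSeries.constantCoeff f • exp h c :=
  dX_ser _ _

theorem counit_exp (c : K) : counit h (exp h c) = 1 := by
  rw [exp, counit_ser, constantCoeff_expS]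

theorem exp_mul_exp (a b : K) : exp h a * exp h b = exp h (a + b) := by
  rw [exp, exp, exp, ← ser_mul, ← expS_add]

theorem exp_zero : exp h (0 : K) = 1 := by rw [exp, expS_zero, ser_one]

/-- `e^{cx}` spans a one-dimensional submodule, so its functional is a character of `B`, that is, a
group-like element of the dual. -/
theorem act_exp (c : K) (b : B h) : act h hh b (exp h c) = pairing hh (exp h c) b • exp h c := by
  have key : ∃ r : K, act h hh b (exp h c) = r • exp h c := by
    let S : Subalgebra K (B h) :=
      { carrier := {b | ∃ r : K, act h hh b (exp h c) = r • exp h c}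
        add_mem' := by
          rintro a b ⟨r, hr⟩ ⟨s, hs⟩
          exact ⟨r + s, by rw [map_add, LinearMap.add_apply, hr, hs, add_smul]⟩
        mul_mem' := by
          rintro a b ⟨r, hr⟩ ⟨s, hs⟩
          exact ⟨s * r, by rw [map_mul, Module.End.mul_apply, hs, map_smul, hr, smul_smul]⟩
        algebraMap_mem' := fun r => ⟨r, by rw [AlgHom.commutes]; rfl⟩ }
    refine B.mem_of_generators S (fun f => ⟨PowerSeries.constantCoeff f, ?_⟩) ⟨c, ?_⟩ ⟨0, ?_⟩ b
    · rw [act_ser]; exact dX_exp f c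
    · rw [act_H, opH_exp]
    · rw [act_V, exp, opV_ser, zero_smul]
  obtain ⟨r, hr⟩ := key
  rw [pairing_apply, hr, map_smul, counit_exp, smul_eq_mul, mul_one]

theorem pairing_exp_mul (c : K) (a b : B h) : pairing hh (exp h c) (a * b) =
    pairing hh (exp h c) a * pairing hh (exp h c) b := by
  rw [pairing_mul_right, act_exp, map_smul, LinearMap.smul_apply, smul_eq_mul, mul_comm (_ : K)]

theorem pairing_algebraMap (a : A h) (r : K) :
    pairing hh a (algebraMap K (B h) r) = r * counit h a := by
  rw [pairing_apply, AlgHom.commutes, Module.algebraMap_end_apply, map_smul, smul_eq_mul]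

theorem pairing_gen_ser (a : A h) (f : K⟦X⟧) : pairing hh a (B.ser h f) = counit h (dX h f a) := by
  rw [pairing_apply, act_ser]
theorem pairing_gen_H (a : A h) : pairing hh a (B.H h) = counit h (opH h a) := by
  rw [pairing_apply, act_H]
theorem pairing_gen_V (a : A h) : pairing hh a (B.V h) = counit h (opV h a) := by
  rw [pairing_apply, act_V]

/-- The span of `x` and `1` is a submodule, and the matrix of `b` on it consists of values of the
pairing. Read through `pairing_mul_right`, this is the coproduct of `x`. -/
theorem act_x (b : B h) :
    act h hh b (x h) = pairing hh 1 b • x h + pairing hh (x h) b • (1 : A h) := by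
  let S : Subalgebra K (B h) :=
    { carrier := {b | act h hh b (x h) = pairing hh 1 b • x h + pairing hh (x h) b • (1 : A h)}
      add_mem' := by
        rintro a b ha hb
        rw [Set.mem_ofPred_eq] at ha hb ⊢
        rw [map_add, LinearMap.add_apply, ha, hb, map_add, map_add]
        module
      mul_mem' := by
        rintro a b ha hb
        rw [Set.mem_ofPred_eq] at ha hb ⊢
        rw [pairing_mul_right, pairing_mul_right, hb, act_one, map_mul, Module.End.mul_apply, hb,
          map_add, map_smul, map_smul, ha, act_one, ← pairing_one hh, ← pairing_one hh]
        simp only [map_add, map_smul, LinearMap.add_apply, LinearMap.smul_apply, smul_eq_mul]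
        module
      algebraMap_mem' := by
        intro r
        rw [Set.mem_ofPred_eq, pairing_algebraMap, pairing_algebraMap, AlgHom.commutes, x, counit_ser,
          map_one]
        simp [Module.algebraMap_end_apply] }
  refine B.mem_of_generators S (fun f => ?_) ?_ ?_ b
  all_goals change act h hh _ _ = _
  · rw [pairing_gen_ser, pairing_gen_ser, act_ser, x, dX_ser, dX_one, map_smul, map_smul,
      counit_ser, map_one]
    simp
  · rw [pairing_gen_H, pairing_gen_H, act_H, x, opH_ser, opH_one, PowerSeries.derivative_X,
      ser_one, map_zero, map_one, zero_smul, one_smul, zero_add]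
  · rw [pairing_gen_V, pairing_gen_V, act_V, x, opV_ser, opV_one, map_zero, zero_smul, zero_smul,
      zero_add]

theorem opV_z_mul_exp (c : K) : opV h (z h * exp h c) = exp h c := by
  rw [exp, opV_mul_ser, opV_z, one_mul]

theorem opH_z_mul_exp (c : K) : opH h (z h * exp h c) = (c - 1 / 2) • (z h * exp h c) := by
  rw [exp, opH_mul_ser, ← one_mul (z h), opT_mul_z, opT_one, one_mul, opH_z, derivative_expS,
    ser_smul, mul_smul_comm c, smul_mul_assoc (-(1 / 2) : K), ← add_smul, ← sub_eq_add_neg c]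

theorem dX_z_mul_exp (f : K⟦X⟧) (c : K) :
    dX h f (z h * exp h c) = PowerSeries.constantCoeff f • (z h * exp h c) := by
  rw [exp, dX_mul_ser, dX_z, smul_mul_assoc (PowerSeries.constantCoeff f)]

theorem counit_z_mul (a : A h) : counit h (z h * a) = 0 := by
  rw [map_mul, counit_z, zero_mul]

/-- Here `H` multiplies `z e^{cx}` by `c - 1/2`, which explains the shifted exponent. The value `c =
0` is needed for `z` itself and `c = -1/2` for the odd term of `Δ(y)`. -/
theorem act_z_mul_exp (c : K) (b : B h) : act h hh b (z h * exp h c) =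
    pairing hh (exp h (c - 1 / 2)) b • (z h * exp h c) +
      pairing hh (z h * exp h c) b • exp h c := by
  let S : Subalgebra K (B h) :=
    { carrier := {b | act h hh b (z h * exp h c) =
        pairing hh (exp h (c - 1 / 2)) b • (z h * exp h c) +
        pairing hh (z h * exp h c) b • exp h c}
      add_mem' := by
        rintro a b ha hb
        rw [Set.mem_ofPred_eq] at ha hb ⊢
        rw [map_add, LinearMap.add_apply, ha, hb, map_add, map_add]
        module
      mul_mem' := by
        rintro a b ha hb
        rw [Set.mem_ofPred_eq] at ha hb ⊢
        rw [pairing_exp_mul, pairing_mul_right, hb, map_mul (act h hh), Module.End.mul_apply, hb,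
          map_add, map_smul, map_smul, ha, act_exp]
        simp only [map_add, map_smul, LinearMap.add_apply, LinearMap.smul_apply, smul_eq_mul]
        module
      algebraMap_mem' := by
        intro r
        rw [Set.mem_ofPred_eq, pairing_algebraMap, pairing_algebraMap, AlgHom.commutes, counit_exp,
          counit_z_mul]
        simp [Module.algebraMap_end_apply] }
  refine B.mem_of_generators S (fun f => ?_) ?_ ?_ b
  all_goals change act h hh _ _ = _
  · rw [pairing_gen_ser, pairing_gen_ser, act_ser, dX_z_mul_exp, dX_exp, map_smul, map_smul,
      counit_exp, counit_z_mul]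
    simp
  · rw [pairing_gen_H, pairing_gen_H, act_H, opH_z_mul_exp, opH_exp, map_smul, map_smul, counit_exp,
      counit_z_mul]
    simp
  · rw [pairing_gen_V, pairing_gen_V, act_V, opV_z_mul_exp, counit_exp, exp, exp, opV_ser,
      map_zero, zero_smul, zero_add, one_smul]

theorem act_z (b : B h) : act h hh b (z h) =
    pairing hh (exp h (-1 / 2)) b • z h + pairing hh (z h) b • (1 : A h) := by
  have := act_z_mul_exp hh 0 b
  rwa [exp_zero, mul_one, zero_sub, ← neg_div] at this

/-- The span of `y`, `z`, `1` is a submodule; its matrix contains the functionals of `e^{-x}` and `z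
e^{-x/2}`, and the factor `1/4` comes from `V y = z / 4`. -/
theorem act_y (b : B h) : act h hh b (y h) = pairing hh (exp h (-1)) b • y h +
    pairing hh (y h) b • (1 : A h) +
    (1 / 4 * pairing hh (z h * exp h (-1 / 2)) b) • z h := by
  have hw (b : B h) := act_z_mul_exp hh (-1 / 2) b
  rw [show (-1 / 2 - 1 / 2 : K) = -1 by norm_num] at hw
  let S : Subalgebra K (B h) :=
    { carrier := {b | act h hh b (y h) = pairing hh (exp h (-1)) b • y h +
        pairing hh (y h) b • (1 : A h) +
        (1 / 4 * pairing hh (z h * exp h (-1 / 2)) b) • z h}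
      add_mem' := by
        rintro a b ha hb
        rw [Set.mem_ofPred_eq] at ha hb ⊢
        rw [map_add, LinearMap.add_apply, ha, hb, map_add, map_add, map_add]
        module
      mul_mem' := by
        rintro a b ha hb
        rw [Set.mem_ofPred_eq] at ha hb ⊢
        rw [pairing_exp_mul, pairing_mul_right, pairing_mul_right, hb, hw, map_mul (act h hh),
          Module.End.mul_apply, hb, map_add, map_add, map_smul, map_smul, map_smul, ha, act_one,
          act_z, ← pairing_one hh]
        simp only [map_add, map_smul, LinearMap.add_apply, LinearMap.smul_apply, smul_eq_mul]
        module
      algebraMap_mem' := by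
        intro r
        rw [Set.mem_ofPred_eq, pairing_algebraMap, pairing_algebraMap, pairing_algebraMap,
          AlgHom.commutes, counit_exp, counit_z_mul, counit_y]
        simp [Module.algebraMap_end_apply] }
  refine B.mem_of_generators S (fun f => ?_) ?_ ?_ b
  all_goals change act h hh _ _ = _
  · rw [pairing_gen_ser, pairing_gen_ser, pairing_gen_ser, act_ser, dX_z_mul_exp, dX_exp, dX_y]
    simp only [map_add, map_smul, counit_exp, counit_z_mul, counit_y, map_one]
    simp
  · rw [pairing_gen_H, pairing_gen_H, pairing_gen_H, act_H, opH_z_mul_exp, opH_exp, opH_y]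
    simp only [map_add, map_smul, map_neg, counit_exp, counit_z_mul, counit_y, map_one]
    simp
  · rw [pairing_gen_V, pairing_gen_V, pairing_gen_V, act_V, opV_z_mul_exp, exp, opV_ser, opV_y,
      counit_exp, map_smul, counit_z]
    simp

theorem pairing_x_mul (a b : B h) : pairing hh (x h) (a * b) =
    pairing hh (x h) a * pairing hh 1 b + pairing hh 1 a * pairing hh (x h) b := by
  rw [pairing_mul_right, act_x]
  simp only [map_add, map_smul, LinearMap.add_apply, LinearMap.smul_apply, smul_eq_mul]
  ring

theorem pairing_z_mul (a b : B h) : pairing hh (z h) (a * b) =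
    pairing hh (z h) a * pairing hh (exp h (-1 / 2)) b + pairing hh 1 a * pairing hh (z h) b := by
  rw [pairing_mul_right, act_z]
  simp only [map_add, map_smul, LinearMap.add_apply, LinearMap.smul_apply, smul_eq_mul]
  ring

theorem pairing_y_mul (a b : B h) : pairing hh (y h) (a * b) =
    pairing hh (y h) a * pairing hh (exp h (-1)) b + pairing hh 1 a * pairing hh (y h) b +
      1 / 4 * (pairing hh (z h) a * pairing hh (z h * exp h (-1 / 2)) b) := by
  rw [pairing_mul_right, act_y]
  simp only [map_add, map_smul, LinearMap.add_apply, LinearMap.smul_apply, smul_eq_mul]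
  ring

/-! ### The antipode of the dual on generators -/

open TensorProduct

/-- The antipode axiom in the dual algebra. -/
theorem mul_eq_of_antipode (a : A h) (v : A h ⊗[K] A h)
    (hv : ∀ (i : (ℕ × Fin 2) × (ℕ × Fin 2)) (l l' : ℕ), counitMul h (act₂ h hh
      (BB.mono h i (MvPowerSeries.X 0 ^ l * MvPowerSeries.X 1 ^ l')) v) =
      pairing hh a (B.antipode h (B.E h i.1.1 l i.1.2) * B.E h i.2.1 l' i.2.2)) :
    LinearMap.mul' K (A h) v = counit h a • 1 := by
  refine pairing_injective hh (LinearMap.ext fun b => ?_)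
  -- Two evaluations of one functional at `Δ(b)`: the module algebra property gives `ε(b · μ(v))`,
  -- the antipode axiom of `B` gives `ε(a) ε(b)`.
  have h1 := BB.matrixCoeff_eq_pair (locNil₂ h) (act₂ h hh) (act₂_ser hh) (counitMul h) v
    (expand₂_bijective hh).1 (fun b b' => pairing hh a (B.antipode h b * b')) hv
    (BB.comul h hh b)
  have h2 := Bdual.evalLeft_eq_pair (expand₂_bijective hh).1 (theta hh a) (BB.comul h hh b)
  replace h1 := h1.trans (h2.symm.trans (Bdual.evalLeft_comul hh b (theta hh a)))
  rw [theta_apply, pairing_one_right] at h1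
  rw [map_smul, LinearMap.smul_apply, pairing_one, smul_eq_mul, ← h1, pairing_apply]
  change _ = counit h (LinearMap.mul' K (A h) _)
  rw [mul_act₂_comul]

theorem exists_pairing_antipode (a : A h) : ∃ a', ∀ b, pairing hh a' b =
    pairing hh a (B.antipode h b) := by
  obtain ⟨a', ha'⟩ := (thetaL_bijective hh).2
    ⟨_, B.comp_antipode_mem_Bdual (pairing_mem_Bdual hh a)⟩
  exact ⟨a', fun b => LinearMap.congr_fun (congrArg Subtype.val ha') b⟩

theorem pairing_one_antipode (b : B h) : pairing hh 1 (B.antipode h b) = pairing hh 1 b := by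
  rw [pairing_one, pairing_one, B.counit_antipode]

/-- The functional `x ∘ S` is continuous, hence comes from an element of `A`; the antipode axiom
applied to the coproduct of `x` is a linear equation for it. The same method serves for `z` and `y`.
-/
theorem pairing_x_antipode (b : B h) :
    pairing hh (x h) (B.antipode h b) = pairing hh (-x h) b := by
  obtain ⟨a, ha⟩ := exists_pairing_antipode hh (x h)
  have := mul_eq_of_antipode hh (x h) (a ⊗ₜ 1 + 1 ⊗ₜ x h) (fun i l l' => by
    rw [map_add, map_add]
    change counit h (LinearMap.mul' K (A h) _) + counit h (LinearMap.mul' K (A h) _) = _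
    rw [counit_act₂_mono, counit_act₂_mono, pairing_x_mul, ha, pairing_one_antipode])
  rw [map_add, LinearMap.mul'_apply, LinearMap.mul'_apply, mul_one, one_mul, x, counit_ser,
    PowerSeries.constantCoeff_X, zero_smul] at this
  rw [← ha, eq_neg_of_add_eq_zero_left this]; rfl

theorem pairing_z_antipode (b : B h) :
    pairing hh (z h) (B.antipode h b) = pairing hh (-(z h * exp h (1 / 2))) b := by
  obtain ⟨a, ha⟩ := exists_pairing_antipode hh (z h)
  have := mul_eq_of_antipode hh (z h) (a ⊗ₜ exp h (-1 / 2) + 1 ⊗ₜ z h) (fun i l l' => by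
    rw [map_add, map_add]
    change counit h (LinearMap.mul' K (A h) _) + counit h (LinearMap.mul' K (A h) _) = _
    rw [counit_act₂_mono, counit_act₂_mono, pairing_z_mul, ha, pairing_one_antipode])
  rw [map_add, LinearMap.mul'_apply, LinearMap.mul'_apply, one_mul, counit_z, zero_smul] at this
  rw [← ha]
  congr 2
  have e := congrArg (· * exp h (1 / 2 : K)) (eq_neg_of_add_eq_zero_left this)
  simp only [mul_assoc, neg_mul, exp_mul_exp] at e
  rwa [neg_div, neg_add_cancel, exp_zero, mul_one] at e

theorem exp_mul_z (c : K) : exp h c * z h = z h * exp h c := ser_mul_z _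

theorem pairing_y_antipode (b : B h) : pairing hh (y h) (B.antipode h b) =
    pairing hh (-(y h * exp h 1) + (h / 2) • (exp h 1 - 1)) b := by
  obtain ⟨a, ha⟩ := exists_pairing_antipode hh (y h)
  have := mul_eq_of_antipode hh (y h) (a ⊗ₜ exp h (-1) + 1 ⊗ₜ y h +
      (1 / 4 : K) • (-(z h * exp h (1 / 2))) ⊗ₜ (z h * exp h (-1 / 2))) (fun i l l' => by
    rw [map_add, map_add, map_add, map_add, map_smul (act₂ h hh _), map_smul (counitMul h)]
    change counit h (LinearMap.mul' K (A h) _) + counit h (LinearMap.mul' K (A h) _) +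
      (1 / 4 : K) * counit h (LinearMap.mul' K (A h) _) = _
    rw [counit_act₂_mono, counit_act₂_mono, counit_act₂_mono, pairing_y_mul, ha, pairing_one_antipode,
      pairing_z_antipode])
  -- The odd term of the axiom contributes `z²`, because the exponentials commute with `z` and
  -- cancel.
  have hz : z h * exp h (1 / 2) * (z h * exp h (-1 / 2)) = (2 * h) • (1 - exp h (-1)) := by
    rw [mul_assoc, ← mul_assoc (exp h _), exp_mul_z, mul_assoc, exp_mul_exp, neg_div, add_neg_cancel,
      exp_zero, mul_one, z_mul_z, ← ser_eq_smul, dl, ser_smul, ← serHom_apply, map_sub, map_one]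
    rfl
  rw [map_add, map_add, map_smul, LinearMap.mul'_apply, LinearMap.mul'_apply, LinearMap.mul'_apply,
    one_mul, counit_y, zero_smul, neg_mul (z h * _), hz, add_assoc] at this
  rw [← ha]
  congr 2
  -- Multiplication by `e^x` on the right solves the equation for the unknown element.
  have e := congrArg (· * exp h (1 : K)) (eq_neg_of_add_eq_zero_left this)
  simp only [neg_mul, add_mul, smul_mul_assoc, sub_mul, one_mul] at e
  rw [mul_assoc, exp_mul_exp, neg_add_cancel, exp_zero, mul_one] at e
  rw [e]
  have : (1 / 4 : K) * (2 * h) = h / 2 := by ring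
  rw [smul_neg, smul_smul, this]
  abel

end A

/-! ### The antipode and products in the dual -/

namespace B
variable {h : K}

theorem antipode_H_mul (b : B h) : antipode h (H h * b) = antipode h b * SH h := by
  rw [antipode_apply, anti_mul, anti_H, mul_one, ← one_mul (SH h), anti_mul_even _ _ _ par_SH,
    one_mul, antipode_apply]

/-- Writing the sign `(-1)^p` as the parity automorphism makes the formula linear in `b`, so
homogeneity is not required. -/
theorem antipode_V_mul (b : B h) :
    antipode h (V h * b) = -(par h (antipode h b) * V h) := by
  have hpart (p : Fin 2) (b : B h) (hb : b ∈ part h p) :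
      antipode h (V h * b) = -(par h (antipode h b) * V h) := by
    rw [antipode_mul 1 p _ _ V_mem_part hb, antipode_V, (mem_part_iff p _).1 (antipode_mem_part hb)]
    fin_cases p <;> simp
  have htop : b ∈ part h 0 ⊔ part h 1 := by rw [isCompl_part.sup_eq_top]; trivial
  obtain ⟨b₀, h₀, b₁, h₁, rfl⟩ := Submodule.mem_sup.1 htop
  rw [mul_add, map_add, hpart 0 b₀ h₀, hpart 1 b₁ h₁, map_add, map_add, add_mul, neg_add]

end B

namespace A
open TensorProduct
variable {h : K} (hh : h ≠ 0)

variable (h) in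
/-- The operator dual to `c ↦ c S(H)`. -/
def opHs : Module.End K (A h) := -opH h - (1 / 2 : K) • dX h (sinhS h)

variable (h) in
/-- The operator dual to `c ↦ c S(V)`, up to the sign of `c`. -/
def opVs : Module.End K (A h) := opV h * opP h

theorem opHs_apply (a : A h) : opHs h a = -opH h a - (1 / 2 : K) • dX h (sinhS h) a := rfl
theorem opVs_apply (a : A h) : opVs h a = opV h (opP h a) := rfl

theorem act_SH : act h hh (B.SH h) = opHs h := by
  rw [B.SH, map_sub, map_neg, map_smul, act_H, act_ser]; rfl

theorem pairing_opHs (a : A h) (b : B h) :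
    pairing hh (opHs h a) (B.antipode h b) = pairing hh a (B.antipode h (B.H h * b)) := by
  rw [B.antipode_H_mul, pairing_mul_right, act_SH]

theorem pairing_opVs (a : A h) (b : B h) :
    pairing hh (opVs h a) (B.antipode h b) = pairing hh a (B.antipode h (B.V h * b)) := by
  rw [B.antipode_V_mul, opVs_apply, ← act_V hh, ← pairing_mul_right, ← pairing_par, opP_opP,
    map_mul (B.par h), B.par_V, mul_neg (B.par h _)]

theorem pairing_dX_antipode (f : K⟦X⟧) (a : A h) (b : B h) :
    pairing hh (dX h (PowerSeries.rescale (-1) f) a) (B.antipode h b) =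
      pairing hh a (B.antipode h (B.ser h f * b)) := by
  rw [B.antipode_ser_mul, pairing_mul_right, act_ser]

theorem neg_D_eq_dX : -D h = dX h (PowerSeries.rescale (-1) PowerSeries.X) := by
  rw [B.rescale_neg_one_X, map_neg, D_eq_dX]

theorem neg_D_pow_eq_dX (l : ℕ) :
    (-D h) ^ l = dX h (PowerSeries.rescale (-1) (PowerSeries.X ^ l)) := by
  rw [neg_D_eq_dX, map_pow (PowerSeries.rescale _), map_pow]

variable (h) in
/-- The operators by which `X ⊗ 1` and `1 ⊗ X` act after exchanging the tensor factors and
applying the antipode. -/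
def Ds₂ : Fin 2 → Module.End K (A h ⊗[K] A h) :=
  ![TensorProduct.map LinearMap.id (-D h), TensorProduct.map (-D h) LinearMap.id]

variable (h) in
/-- The operators by which `H ⊗ 1` and `1 ⊗ H` act after exchanging the tensor factors and
applying the antipode. -/
def opHs₂ : Fin 2 → Module.End K (A h ⊗[K] A h) :=
  ![TensorProduct.map LinearMap.id (opHs h), TensorProduct.map (opHs h) LinearMap.id]

variable (h) in
/-- The operators by which `V ⊗ 1` and `1 ⊗ V` act after exchanging the tensor factors and
applying the antipode. -/
def opVs₂ : Fin 2 → Module.End K (A h ⊗[K] A h) :=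
  ![TensorProduct.map (opP h) (opVs h), TensorProduct.map (opVs h) LinearMap.id]

theorem map_id_right_pow (F : Module.End K (A h)) (n : ℕ) (a b : A h) :
    ((TensorProduct.map LinearMap.id F : Module.End K (A h ⊗[K] A h)) ^ n) (a ⊗ₜ b) =
      a ⊗ₜ (F ^ n) b := by
  rw [TensorProduct.map_pow, ← Module.End.one_eq_id, one_pow]; rfl

theorem map_id_left_pow (F : Module.End K (A h)) (n : ℕ) (a b : A h) :
    ((TensorProduct.map F LinearMap.id : Module.End K (A h ⊗[K] A h)) ^ n) (a ⊗ₜ b) =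
      (F ^ n) a ⊗ₜ b := by
  rw [TensorProduct.map_pow, ← Module.End.one_eq_id, one_pow]; rfl

theorem dX_rescale_X_pow_mul {n : ℕ} {a : A h} (hn : (D h ^ n) a = 0) (c : K) (g : K⟦X⟧) :
    dX h (PowerSeries.rescale c (PowerSeries.X ^ n * g)) a = 0 := by
  obtain ⟨g', hg'⟩ := Bdual.rescale_X_pow_mul c n g
  rw [hg', dX_X_pow_mul hn]

theorem neg_D_pow_apply {n : ℕ} {a : A h} (hn : (D h ^ n) a = 0) : ((-D h) ^ n) a = 0 := by
  have := dX_rescale_X_pow_mul hn (-1) 1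
  rwa [mul_one, ← neg_D_pow_eq_dX] at this

variable (h) in
theorem locNilS : LocNil (Ds₂ h) where
  comm := TensorProduct.ext' fun _ _ => rfl
  nil v := by
    induction v with
    | zero => exact ⟨0, fun _ => map_zero _⟩
    | tmul a b =>
      obtain ⟨n, hn⟩ := (locNil h).exists_common a b
      refine ⟨n, fun i => ?_⟩
      fin_cases i
      · exact (map_id_right_pow _ n a b).trans
          (by rw [neg_D_pow_apply (show (D h ^ n) b = 0 from hn.2 0), tmul_zero])
      · exact (map_id_left_pow _ n a b).trans
          (by rw [neg_D_pow_apply (show (D h ^ n) a = 0 from hn.1 0), zero_tmul])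
    | add v w hv hw =>
      obtain ⟨n, hn⟩ := hv
      obtain ⟨m, hm⟩ := hw
      have le {i : Fin 2} {v : A h ⊗[K] A h} {n m : ℕ} (hn : (Ds₂ h i ^ n) v = 0) (hm : n ≤ m) :
          (Ds₂ h i ^ m) v = 0 := by
        obtain ⟨k, rfl⟩ := Nat.exists_eq_add_of_le hm
        rw [add_comm, pow_add, Module.End.mul_apply, hn, map_zero]
      exact ⟨max n m, fun i => by
        rw [map_add, le (hn i) (le_max_left _ _), le (hm i) (le_max_right _ _), add_zero]⟩

theorem actS_slot_zero (f : K⟦X⟧) (a b : A h) : (locNilS h).act (slot 0 f) (a ⊗ₜ b) =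
    a ⊗ₜ dX h (PowerSeries.rescale (-1) f) b := by
  obtain ⟨m, hm⟩ := D_nil b
  exact (locNilS h).apply_act_slot 0 (a ⊗ₜ b) LinearMap.id
    (TensorProduct.mk K (A h) (A h) a ∘ₗ LinearMap.applyₗ b ∘ₗ (dX h).toLinearMap ∘ₗ
      (rescaleHom (-1)).toLinearMap) m
    (fun g => (congrArg (a ⊗ₜ[K] ·) (dX_rescale_X_pow_mul hm (-1) g)).trans (tmul_zero _ _))
    (fun l => (map_id_right_pow _ l a b).trans (by rw [neg_D_pow_eq_dX]; rfl)) f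

theorem actS_slot_one (f : K⟦X⟧) (a b : A h) : (locNilS h).act (slot 1 f) (a ⊗ₜ b) =
    dX h (PowerSeries.rescale (-1) f) a ⊗ₜ b := by
  obtain ⟨m, hm⟩ := D_nil a
  exact (locNilS h).apply_act_slot 1 (a ⊗ₜ b) LinearMap.id
    ((TensorProduct.mk K (A h) (A h)).flip b ∘ₗ LinearMap.applyₗ a ∘ₗ (dX h).toLinearMap ∘ₗ
      (rescaleHom (-1)).toLinearMap) m
    (fun g => (congrArg (· ⊗ₜ[K] b) (dX_rescale_X_pow_mul hm (-1) g)).trans (zero_tmul _ _))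
    (fun l => (map_id_left_pow _ l a b).trans (by rw [neg_D_pow_eq_dX]; rfl)) f

include hh in
theorem neg_D_opHs (a : A h) : (-D h) (opHs h a) = opHs h ((-D h) a) +
    dX h (PowerSeries.rescale (-1) (dlB h)) a := by
  rw [neg_D_eq_dX, ← act_SH hh, ← act_ser hh, ← act_ser hh, ← Module.End.mul_apply,
    ← Module.End.mul_apply, ← map_mul (act h hh), ← map_mul (act h hh), ← LinearMap.add_apply,
    ← map_add (act h hh), B.ser_mul_SH, PowerSeries.derivative_X, mul_one]

theorem opP_opHs (a : A h) : opP h (opHs h a) = opHs h (opP h a) := by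
  rw [opHs_apply, opHs_apply, map_sub, map_neg, map_smul, opP_opH, opP_dX]

theorem opP_opVs (a : A h) : opP h (opVs h a) = -opVs h (opP h a) := by
  rw [opVs_apply, opVs_apply, opP_opV]

theorem opP_neg_D (a : A h) : opP h ((-D h) a) = (-D h) (opP h a) := by
  rw [LinearMap.neg_apply, map_neg, opP_D, LinearMap.neg_apply]

theorem opVs_dX (f : K⟦X⟧) (a : A h) : opVs h (dX h f a) = dX h f (opVs h a) := by
  rw [opVs_apply, opP_dX, opV_dX, opVs_apply]

include hh in
theorem opVs_opHs (a : A h) : opVs h (opHs h a) = opHs h (opVs h a) +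
    dX h (PowerSeries.rescale (-1) (gmB h)) (opVs h a) := by
  rw [opVs_apply, opP_opHs, opVs_apply, B.rescale_gmB]
  generalize opP h a = a
  rw [← act_SH hh, ← act_V hh, ← act_ser hh,
    ← Module.End.mul_apply, ← Module.End.mul_apply, ← Module.End.mul_apply, ← map_mul (act h hh),
    ← map_mul (act h hh), ← map_mul (act h hh), ← LinearMap.add_apply, ← map_add (act h hh),
    B.SH_mul_V, sub_add_cancel]

include hh in
theorem opVs_opVs (a : A h) : opVs h (opVs h a) = dX h (PowerSeries.rescale (-1) (sqB h)) a := by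
  rw [opVs_apply, opVs_apply, opP_opV, opP_opP, map_neg, opV_opV hh, B.rescale_sqB, map_neg]; rfl

theorem isLift₂_antipode (hh : h ≠ 0) : IsLift₂ (dlB h) (gmB h) (sqB h)
    ((locNilS h).act.toOpposite fun f g => (Commute.all f g).map (locNilS h).act)
    (fun i => MulOpposite.op (opHs₂ h i)) (fun i => MulOpposite.op (opVs₂ h i)) := by
  refine (locNilS h).isLift₂_op _ _ ?_ ?_ ?_ ?_ ?_ ?_ ?_ ?_
  · intro i v
    refine LinearMap.congr_fun (f := Ds₂ h i ∘ₗ opHs₂ h i) (g := opHs₂ h i ∘ₗ Ds₂ h i +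
      (locNilS h).act (slot i (dlB h))) (TensorProduct.ext' fun a b => ?_) v
    fin_cases i
    · change a ⊗ₜ (-D h) (opHs h b) = a ⊗ₜ opHs h ((-D h) b) +
        (locNilS h).act (slot 0 (dlB h)) (a ⊗ₜ b)
      rw [actS_slot_zero, neg_D_opHs hh, tmul_add]
    · change (-D h) (opHs h a) ⊗ₜ b = opHs h ((-D h) a) ⊗ₜ b +
        (locNilS h).act (slot 1 (dlB h)) (a ⊗ₜ b)
      rw [actS_slot_one, neg_D_opHs hh, add_tmul]
  · intro i j hij v
    refine LinearMap.congr_fun (f := opHs₂ h i ∘ₗ Ds₂ h j) (g := Ds₂ h j ∘ₗ opHs₂ h i)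
      (TensorProduct.ext' fun a b => ?_) v
    fin_cases i <;> fin_cases j <;> first | rfl | simp at hij
  · intro i j v
    refine LinearMap.congr_fun (f := opVs₂ h i ∘ₗ Ds₂ h j) (g := Ds₂ h j ∘ₗ opVs₂ h i)
      (TensorProduct.ext' fun a b => ?_) v
    have hV (a : A h) : opVs h ((-D h) a) = (-D h) (opVs h a) := by rw [neg_D_eq_dX, opVs_dX]
    fin_cases i <;> fin_cases j
    · change opP h a ⊗ₜ opVs h ((-D h) b) = opP h a ⊗ₜ (-D h) (opVs h b)
      rw [hV]
    · change opP h ((-D h) a) ⊗ₜ opVs h b = (-D h) (opP h a) ⊗ₜ opVs h b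
      rw [opP_neg_D]
    · rfl
    · change opVs h ((-D h) a) ⊗ₜ b = (-D h) (opVs h a) ⊗ₜ b
      rw [hV]
  · intro i
    refine TensorProduct.ext' fun a b => ?_
    fin_cases i
    · change opP h a ⊗ₜ opVs h (opHs h b) = opP h a ⊗ₜ opHs h (opVs h b) +
        (locNilS h).act (slot 0 (gmB h)) (opP h a ⊗ₜ opVs h b)
      rw [actS_slot_zero, opVs_opHs hh, tmul_add]
    · change opVs h (opHs h a) ⊗ₜ b = opHs h (opVs h a) ⊗ₜ b +
        (locNilS h).act (slot 1 (gmB h)) (opVs h a ⊗ₜ b)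
      rw [actS_slot_one, opVs_opHs hh, add_tmul]
  · intro i
    refine TensorProduct.ext' fun a b => ?_
    fin_cases i
    · change opP h (opP h a) ⊗ₜ opVs h (opVs h b) = (locNilS h).act (slot 0 (sqB h)) (a ⊗ₜ b)
      rw [actS_slot_zero, opVs_opVs hh, opP_opP]
    · change opVs h (opVs h a) ⊗ₜ b = (locNilS h).act (slot 1 (sqB h)) (a ⊗ₜ b)
      rw [actS_slot_one, opVs_opVs hh]
  · exact TensorProduct.ext' fun a b => rfl
  · intro i j hij
    refine TensorProduct.ext' fun a b => ?_
    fin_cases i <;> fin_cases j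
    · simp at hij
    · rfl
    · change opHs h (opP h a) ⊗ₜ opVs h b = opP h (opHs h a) ⊗ₜ opVs h b
      rw [opP_opHs]
    · simp at hij
  · refine TensorProduct.ext' fun a b => ?_
    change opP h (opVs h a) ⊗ₜ opVs h b = -(opVs h (opP h a) ⊗ₜ opVs h b)
    rw [opP_opVs, neg_tmul]

variable (h) in
/-- The right action of the tensor square on `A ⊗ A` that is dual to the exchange of the tensor
factors composed with the antipode. -/
def actS (hh : h ≠ 0) : BB h →ₐ[K] (Module.End K (A h ⊗[K] A h))ᵐᵒᵖ := lift₂ (isLift₂_antipode hh)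

theorem actS_ser (f) : (actS h hh (BB.ser h f)).unop = (locNilS h).act f :=
  congrArg MulOpposite.unop (lift₂_ser₂ ..)
theorem actS_H (i) : (actS h hh (BB.H h i)).unop = opHs₂ h i :=
  congrArg MulOpposite.unop (lift₂_genH₂ _ i)
theorem actS_V (i) : (actS h hh (BB.V h i)).unop = opVs₂ h i :=
  congrArg MulOpposite.unop (lift₂_genV₂ _ i)
theorem actS_mul (u v : BB h) (w : A h ⊗[K] A h) :
    (actS h hh (u * v)).unop w = (actS h hh v).unop ((actS h hh u).unop w) := by
  rw [map_mul]; rfl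

theorem actS_mono (i : (ℕ × Fin 2) × (ℕ × Fin 2)) (f) (w : A h ⊗[K] A h) :
    (actS h hh (BB.mono h i f)).unop w = (opVs₂ h 1 ^ (i.2.2 : ℕ)) ((opVs₂ h 0 ^ (i.1.2 : ℕ))
      ((locNilS h).act f ((opHs₂ h 1 ^ i.2.1) ((opHs₂ h 0 ^ i.1.1) w)))) := by
  rw [BB.mono, actS_mul, actS_mul, actS_mul, actS_mul, actS_ser]
  simp only [map_pow, MulOpposite.unop_pow, actS_H, actS_V]

theorem mul_actS_addHom (f : K⟦X⟧) (w : A h ⊗[K] A h) : LinearMap.mul' K (A h)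
    ((locNilS h).act (addHom f) w) =
      dX h (PowerSeries.rescale (-1) f) (LinearMap.mul' K (A h) w) := by
  have hD (w) : LinearMap.mul' K (A h) ((Ds₂ h 0 + Ds₂ h 1) w) =
      (-D h) (LinearMap.mul' K (A h) w) := by
    refine LinearMap.congr_fun (f := LinearMap.mul' K (A h) ∘ₗ (Ds₂ h 0 + Ds₂ h 1))
      (g := (-D h) ∘ₗ LinearMap.mul' K (A h)) (TensorProduct.ext' fun a b => ?_) w
    change LinearMap.mul' K (A h) (a ⊗ₜ (-D h b) + (-D h a) ⊗ₜ b) =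
      -D h (LinearMap.mul' K (A h) (a ⊗ₜ b))
    rw [map_add, LinearMap.mul'_apply, LinearMap.mul'_apply, LinearMap.mul'_apply, D_mul, neg_add,
      mul_neg, neg_mul, add_comm]
  have hDpow (l : ℕ) (w) : LinearMap.mul' K (A h) (((Ds₂ h 0 + Ds₂ h 1) ^ l) w) =
      ((-D h) ^ l) (LinearMap.mul' K (A h) w) := by
    induction l generalizing w with
    | zero => rfl
    | succ l ih => rw [pow_succ, pow_succ, Module.End.mul_apply, Module.End.mul_apply, ih, hD]
  obtain ⟨m, hm⟩ := D_nil (LinearMap.mul' K (A h) w)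
  exact (locNilS h).apply_act_addHom w (LinearMap.mul' K (A h))
    (LinearMap.applyₗ (LinearMap.mul' K (A h) w) ∘ₗ (dX h).toLinearMap ∘ₗ
      (rescaleHom (-1)).toLinearMap) m (fun g => dX_rescale_X_pow_mul hm (-1) g)
    (fun l => (hDpow l w).trans (by rw [neg_D_pow_eq_dX]; rfl)) f

theorem mul_actS_comulV (w : A h ⊗[K] A h) : LinearMap.mul' K (A h)
    ((actS h hh (BB.comulV h)).unop w) = opVs h (LinearMap.mul' K (A h) w) := by
  refine LinearMap.congr_fun (f := LinearMap.mul' K (A h) ∘ₗ (actS h hh (BB.comulV h)).unop)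
    (g := opVs h ∘ₗ LinearMap.mul' K (A h)) (TensorProduct.ext' fun a b => ?_) w
  rw [LinearMap.comp_apply, BB.comulV, map_add, MulOpposite.unop_add, LinearMap.add_apply, actS_mul,
    actS_mul, BB.exp, BB.exp, actS_ser, actS_ser, actS_V, actS_V, actS_slot_zero, rescale_expS]
  change LinearMap.mul' K (A h) ((locNilS h).act _ (opP h a ⊗ₜ opVs h b) +
    opVs h a ⊗ₜ dX h (expS (-1 * (h / 2))) b) = opVs h (a * b)
  rw [actS_slot_one, rescale_expS, map_add, LinearMap.mul'_apply, LinearMap.mul'_apply, opVs_apply,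
    opVs_apply, opVs_apply, show opP h (a * b) = opP h a * opP h b from map_mul (par h) a b, opV_mul, opP_dX, opP_opP]
  congr 5
  · ring
  · ring

theorem mul_actS_comulH (w : A h ⊗[K] A h) : LinearMap.mul' K (A h)
    ((actS h hh (BB.comulH h)).unop w) = opHs h (LinearMap.mul' K (A h) w) := by
  refine LinearMap.congr_fun (f := LinearMap.mul' K (A h) ∘ₗ (actS h hh (BB.comulH h)).unop)
    (g := opHs h ∘ₗ LinearMap.mul' K (A h)) (TensorProduct.ext' fun a b => ?_) w
  have e1 : -1 * -h = h := by ring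
  have e2 : -1 * (-h / 2) = h / 2 := by ring
  have e3 : -1 * (h / 2) = -h / 2 := by ring
  rw [LinearMap.comp_apply, BB.comulH, map_add, map_add, map_smul, MulOpposite.unop_add,
    MulOpposite.unop_add, MulOpposite.unop_smul, LinearMap.add_apply, LinearMap.add_apply,
    LinearMap.smul_apply, actS_mul, actS_mul, actS_mul, actS_mul, actS_mul]
  simp only [BB.exp, actS_ser, actS_V, actS_H]
  rw [actS_slot_zero, rescale_expS]
  change LinearMap.mul' K (A h) ((locNilS h).act _ (a ⊗ₜ opHs h b) +
    opHs h a ⊗ₜ dX h (expS (-1 * h)) b + (2 * h) • (locNilS h).act _ (opVs₂ h 1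
      ((locNilS h).act _ (opP h a ⊗ₜ opVs h b)))) = opHs h (a * b)
  rw [actS_slot_zero]
  change LinearMap.mul' K (A h) (_ + _ + (2 * h) • (locNilS h).act _
    (opVs h (opP h a) ⊗ₜ dX h _ (opVs h b))) = opHs h (a * b)
  rw [actS_slot_one, actS_slot_one, map_add, map_add, map_smul]
  simp only [LinearMap.mul'_apply, rescale_expS, e1, e2, e3]
  simp only [opHs_apply, opVs_apply, opP_opP, opH_mul', opW_eq, dX_dX, ← expS_add, sinhS, map_smul,
    map_sub, LinearMap.smul_apply, LinearMap.sub_apply, dX_expS_mul, opP_opV, opT]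
  have e4 : h / 2 + -h = -h / 2 := by ring
  simp only [neg_one_mul h, e4, opV_dX, opP_dX, mul_sub, mul_neg, sub_mul, neg_mul, mul_smul_comm,
    smul_mul_assoc, smul_sub, smul_neg]
  module

/-- The dual form of the fact that `S` reverses the coproduct. The additional factor `c` is carried
along because it makes the set of good `b` closed under products. -/
theorem pairing_mul_actS (b c : B h) (w : A h ⊗[K] A h) :
    pairing hh (LinearMap.mul' K (A h) ((actS h hh (BB.comul h hh b)).unop w)) (B.antipode h c) =
      pairing hh (LinearMap.mul' K (A h) w) (B.antipode h (b * c)) := by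
  let S : Subalgebra K (B h) :=
    { carrier := {b | ∀ c w, pairing hh (LinearMap.mul' K (A h)
        ((actS h hh (BB.comul h hh b)).unop w)) (B.antipode h c) =
        pairing hh (LinearMap.mul' K (A h) w) (B.antipode h (b * c))}
      add_mem' := by
        intro a b ha hb c w
        rw [map_add, map_add, MulOpposite.unop_add, LinearMap.add_apply, map_add, map_add,
          LinearMap.add_apply, ha, hb, add_mul, map_add, map_add]
      mul_mem' := by
        intro a b ha hb c w
        rw [map_mul, actS_mul, hb, ha, mul_assoc]
      algebraMap_mem' := by
        intro r c w
        rw [AlgHom.commutes, AlgHom.commutes, ← Algebra.smul_def, map_smul, map_smul]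
        change pairing hh (LinearMap.mul' K (A h) (r • w)) _ = _
        rw [map_smul, map_smul, LinearMap.smul_apply] }
  refine B.mem_of_generators S (fun f c w => ?_) (fun c w => ?_) (fun c w => ?_) b c w
  · rw [BB.comul_ser, actS_ser, mul_actS_addHom, pairing_dX_antipode]
  · rw [BB.comul_H, mul_actS_comulH, pairing_opHs]
  · rw [BB.comul_V, mul_actS_comulV, pairing_opVs]

theorem counit_opVs_pow (k l : ℕ) (m : Fin 2) (a : A h) :
    counit h ((opVs h ^ (m : ℕ)) (((-D h) ^ l) ((opHs h ^ k) a))) =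
      pairing hh a (B.antipode h (B.E h k l m)) := by
  have hH (k : ℕ) (a : A h) (c : B h) : pairing hh ((opHs h ^ k) a) (B.antipode h c) =
      pairing hh a (B.antipode h (B.H h ^ k * c)) := by
    induction k generalizing a with
    | zero => rw [pow_zero, pow_zero, one_mul]; rfl
    | succ k ih => rw [pow_succ, Module.End.mul_apply, ih, pairing_opHs, pow_succ', mul_assoc]
  have hV (a : A h) : pairing hh ((opVs h ^ (m : ℕ)) a) (B.antipode h 1) =
      pairing hh a (B.antipode h (B.V h ^ (m : ℕ))) := by
    fin_cases m
    · rw [Fin.zero_eta, Fin.val_zero, pow_zero, pow_zero]; rfl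
    · rw [Fin.mk_one, Fin.val_one, pow_one, pow_one, pairing_opVs, mul_one]
  have h1 : B.antipode h 1 = 1 := by rw [B.antipode_apply, B.anti_one]
  rw [← pairing_one_right hh, ← h1, hV, neg_D_pow_eq_dX, pairing_dX_antipode, hH, B.E, mul_assoc]

theorem opVs₂_zero_pow (m : Fin 2) (a b : A h) : (opVs₂ h 0 ^ (m : ℕ)) (a ⊗ₜ b) =
    (opP h ^ (m : ℕ)) a ⊗ₜ (opVs h ^ (m : ℕ)) b := by
  fin_cases m <;> rfl

/-- The functional dual to the product of `A`, composed with the antipode, on a monomial. -/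
theorem counit_actS_mono (a a' : A h) (i : (ℕ × Fin 2) × (ℕ × Fin 2)) (l l' : ℕ) :
    counitMul h ((actS h hh
      (BB.mono h i (MvPowerSeries.X 0 ^ l * MvPowerSeries.X 1 ^ l'))).unop (a ⊗ₜ a')) =
    pairing hh ((opP h ^ (i.1.2 : ℕ)) a) (B.antipode h (B.E h i.2.1 l' i.2.2)) *
      pairing hh a' (B.antipode h (B.E h i.1.1 l i.1.2)) := by
  have hP (m : ℕ) (k l : ℕ) (a : A h) : (opP h ^ m) (((-D h) ^ l) ((opHs h ^ k) a)) =
      ((-D h) ^ l) ((opHs h ^ k) ((opP h ^ m) a)) := by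
    have h1 : Commute (opP h) (-D h) := LinearMap.ext opP_neg_D
    have h2 : Commute (opP h) (opHs h) := LinearMap.ext opP_opHs
    exact (LinearMap.congr_fun (h1.pow_pow m l).eq _).trans
      (congrArg ((-D h) ^ l) (LinearMap.congr_fun (h2.pow_pow m k).eq a))
  rw [actS_mono, (locNilS h).act_X_pow, Module.End.mul_apply, ← counit_opVs_pow, ← counit_opVs_pow,
    ← hP, ← map_mul (counit h)]
  change counitMul h _ = counitMul h (_ ⊗ₜ[K] _)
  refine congrArg (counitMul h) ?_
  -- The operators are applied to a pure tensor from the inside out, in the order `H₀`, `H₁`, `X₁`,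
  -- `X₀`, `V₀`, `V₁`.
  refine (congrArg _ (congrArg _ (congrArg _ (congrArg _ (congrArg _
    (map_id_right_pow _ _ a a')))))).trans ?_
  refine (congrArg _ (congrArg _ (congrArg _ (congrArg _ (map_id_left_pow _ _ a _))))).trans ?_
  refine (congrArg _ (congrArg _ (congrArg _ (map_id_left_pow _ _ _ _)))).trans ?_
  refine (congrArg _ (congrArg _ (map_id_right_pow _ _ _ _))).trans ?_
  refine (congrArg _ (opVs₂_zero_pow _ _ _)).trans ?_
  exact map_id_left_pow _ _ _ _

/-- The case `c = 1` of `pairing_mul_actS`: the result is a continuous functional of `Δ(b)`,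
determined by its values on monomials. The sign rule is left in `β`, which depends on the parity of
the first factor. -/
theorem counitMul_actS_eq_pair (a a' : A h) (β : B h → B h → K)
    (hβ : ∀ (i : (ℕ × Fin 2) × (ℕ × Fin 2)) (l l' : ℕ),
      pairing hh ((opP h ^ (i.1.2 : ℕ)) a) (B.antipode h (B.E h i.2.1 l' i.2.2)) *
        pairing hh a' (B.antipode h (B.E h i.1.1 l i.1.2)) =
      β (B.E h i.1.1 l i.1.2) (B.E h i.2.1 l' i.2.2)) (b : B h) :
    pairing hh (a * a') (B.antipode h b) = BB.pair h β (BB.comul h hh b) := by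
  let Φ : BB h →ₗ[K] K :=
    { toFun := fun u => counitMul h ((actS h hh u).unop (a ⊗ₜ a'))
      map_add' := fun u v => by rw [map_add]; exact map_add (counitMul h) _ _
      map_smul' := fun c u => by rw [map_smul]; exact map_smul (counitMul h) _ _ }
  have h1 : B.antipode h 1 = 1 := by rw [B.antipode_apply, B.anti_one]
  have key := BB.eq_pair (expand₂_bijective hh).1 Φ β (fun i => ?_)
    (fun i l l' => (counit_actS_mono hh a a' i l l').trans (hβ i l l')) (BB.comul h hh b)
  · have := pairing_mul_actS hh b 1 (a ⊗ₜ a')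
    rw [h1, mul_one, pairing_one_right, LinearMap.mul'_apply] at this
    exact this.symm.trans key
  · obtain ⟨n, hn⟩ := (locNilS h).nil ((opHs₂ h 1 ^ i.2.1) ((opHs₂ h 0 ^ i.1.1) (a ⊗ₜ a')))
    refine ⟨n, fun j g => ?_⟩
    change counitMul h ((actS h hh (BB.mono h i _)).unop (a ⊗ₜ a')) = 0
    rw [actS_mono, (locNilS h).act_X_pow_mul j hn le_rfl, map_zero, map_zero, map_zero]

/-- The antipode of the dual reverses products, for an even first factor. -/
theorem pairing_even_mul_antipode {a a' s s' : A h} (ha : opP h a = a)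
    (hs : ∀ b, pairing hh a (B.antipode h b) = pairing hh s b)
    (hs' : ∀ b, pairing hh a' (B.antipode h b) = pairing hh s' b) (b : B h) :
    pairing hh (a * a') (B.antipode h b) = pairing hh (s' * s) b := by
  refine (counitMul_actS_eq_pair hh a a' _ (fun i l l' => ?_) b).trans (pairing_mul ..).symm
  have : (opP h ^ (i.1.2 : ℕ)) a = a := by
    generalize i.1.2 = m
    fin_cases m
    · rfl
    · exact ha
  rw [this, hs, hs', mul_comm]

/-- The antipode of the dual reverses products, for an odd first factor. -/
theorem pairing_odd_mul_antipode {a a' s s' : A h} (ha : opP h a = -a)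
    (hs : ∀ b, pairing hh a (B.antipode h b) = pairing hh s b)
    (hs' : ∀ b, pairing hh a' (B.antipode h b) = pairing hh s' b) (b : B h) :
    pairing hh (a * a') (B.antipode h b) = pairing hh (opP h s' * s) b := by
  refine (counitMul_actS_eq_pair hh a a' _ (fun i l l' => ?_) b).trans (pairing_mul ..).symm
  have h1 : (opP h ^ (i.1.2 : ℕ)) a = (-1 : K) ^ (i.1.2 : ℕ) • a := by
    generalize i.1.2 = m
    fin_cases m
    · simp
    · simpa using ha
  have h2 : pairing hh (opP h s') (B.E h i.1.1 l i.1.2) =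
      (-1 : K) ^ (i.1.2 : ℕ) * pairing hh s' (B.E h i.1.1 l i.1.2) := by
    rw [← pairing_par, opP_opP, B.E_eq, B.par_mono, map_smul, smul_eq_mul]
  rw [h1, h2, map_smul, LinearMap.smul_apply, hs, hs', smul_eq_mul]
  ring

/-- On `f(x)` the operator of `S(H)` is `-d/dx`, since `sinh` has no constant term; the signs
`(-1)^k` turn `f(x)` into `f(-x)`. -/
theorem pairing_ser_antipode (f : K⟦X⟧) (b : B h) : pairing hh (ser h f) (B.antipode h b) =
    pairing hh (ser h (PowerSeries.rescale (-1) f)) b := by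
  refine LinearMap.congr_fun (f := pairing hh (ser h f) ∘ₗ B.antipode h)
    (B.linearMap_ext_mono fun k u m => ?_) b
  have hS (g : K⟦X⟧) : opHs h (ser h g) = -ser h (PowerSeries.derivative K g) := by
    rw [opHs_apply, opH_ser, dX_ser, constantCoeff_sinhS, zero_smul, smul_zero, sub_zero]
  have hSk (k : ℕ) (g : K⟦X⟧) : (opHs h ^ k) (ser h g) =
      (-1 : K) ^ k • ser h ((PowerSeries.derivative K)^[k] g) := by
    induction k generalizing g with
    | zero => rw [pow_zero, pow_zero, one_smul]; rfl
    | succ k ih =>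
      rw [pow_succ, Module.End.mul_apply, hS, map_neg, ih, Function.iterate_succ_apply, pow_succ,
        mul_neg_one, neg_smul]
  rw [LinearMap.comp_apply, B.antipode_mono, pairing_ser, pairing_apply, map_mul (act h hh),
    map_mul (act h hh), map_pow (act h hh), map_pow (act h hh), act_SH, act_ser, map_neg, act_V,
    Module.End.mul_apply, Module.End.mul_apply, hSk, map_smul, map_smul, map_smul, dX_ser, map_smul]
  have hc : PowerSeries.constantCoeff (PowerSeries.rescale (-1 : K) u) =
      PowerSeries.constantCoeff u := by
    rw [← PowerSeries.coeff_zero_eq_constantCoeff_apply, PowerSeries.coeff_rescale]; simp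
  rw [hc, PowerSeries.coeff_rescale]
  fin_cases m
  · change (-1 : K) ^ k * counit h (PowerSeries.constantCoeff u • ser h _) = _
    rw [map_smul, counit_ser, PowerSeries.constantCoeff_iterate_derivative, smul_eq_mul]
    simp only [Fin.zero_eta, if_true]
    ring
  · change (-1 : K) ^ k * counit h (PowerSeries.constantCoeff u • ((-opV h) ^ 1) (ser h _)) = _
    rw [pow_one, LinearMap.neg_apply, opV_ser, neg_zero, smul_zero, map_zero, mul_zero,
      if_neg (by decide)]

end A

/-! ### The Borel subalgebra and the algebra presenting its dual are isomorphic -/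

namespace A
variable {h : K}

theorem ser_add (f g : K⟦X⟧) : ser h (f + g) = ser h f + ser h g := map_add (serHom h) f g
theorem ser_sub (f g : K⟦X⟧) : ser h (f - g) = ser h f - ser h g := map_sub (serHom h) f g

theorem ser_dl : ser h (dl h) = (2 * h) • (1 - exp h (-1)) := by
  rw [dl, ser_smul, ser_sub, ser_one]; rfl

theorem y_mul_z' : y h * z h = z h * y h + h • (z h * exp h (-1)) := by
  refine (OspBorel.genH_mul_genV (δ := dl h) (γ := gm h) (s := dl h)).trans ?_
  change z h * y h + z h * ser h (gm h) = _
  rw [gm, ser_smul, mul_smul_comm]; rfl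

theorem z_mul_z' : z h * z h = (2 * h) • (1 - exp h (-1)) := by
  rw [← ser_dl]; exact OspBorel.genV_mul_genV

theorem ser_mul_y (f : K⟦X⟧) :
    ser h f * y h = y h * ser h f - ser h (dl h * PowerSeries.derivative K f) := by
  rw [y_mul_ser, add_sub_cancel_right]

theorem exp_mul_y (c : K) : exp h c * y h = y h * exp h c - (2 * h * c) • (exp h c - exp h (c - 1)) := by
  rw [exp, ser_mul_y, derivative_expS, mul_smul_comm, ser_smul, ser_mul, ser_dl]
  change _ - c • ((2 * h) • (1 - exp h (-1)) * exp h c) = _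
  rw [smul_mul_assoc, sub_mul, one_mul, exp_mul_exp, smul_smul, neg_add_eq_sub]
  congr 2
  ring

theorem ser_rescale_sinhS (hh : h ≠ 0) : ser h (PowerSeries.rescale (2 * h)⁻¹ (sinhS h)) =
    (1 / 2 : K) • (exp h (1 / 2) - exp h (-1 / 2)) := by
  have e1 : (2 * h)⁻¹ * h = 1 / 2 := by field_simp
  have e2 : (2 * h)⁻¹ * -h = -1 / 2 := by field_simp
  rw [sinhS, rescale_smul, map_sub, rescale_expS, rescale_expS, ser_smul, ser_sub, e1, e2]; rfl

theorem ser_rescale_coshS (hh : h ≠ 0) : ser h (PowerSeries.rescale (2 * h)⁻¹ (coshS h)) =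
    (1 / 2 : K) • (exp h (1 / 2) + exp h (-1 / 2)) := by
  have e1 : (2 * h)⁻¹ * h = 1 / 2 := by field_simp
  have e2 : (2 * h)⁻¹ * -h = -1 / 2 := by field_simp
  rw [coshS, rescale_smul, map_add, rescale_expS, rescale_expS, ser_smul, ser_add, e1, e2]; rfl

variable (h) in
/-- The image of `H` in `A`. -/
def imH : A h := (2 * h)⁻¹ • (y h * exp h (1 / 2))
variable (h) in
/-- The image of `V` in `A`. -/
def imV : A h := (4 * h)⁻¹ • (z h * exp h (1 / 4))

/-- The factor `e^{x/2}` symmetrises the relation of `A`: `(1 - e^{-x}) e^{x/2} = e^{x/2} -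
e^{-x/2}`, which is `2 sinh (hX)` for `x = 2hX`. -/
theorem imH_mul_ser (hh : h ≠ 0) (f : K⟦X⟧) :
    imH h * ser h (PowerSeries.rescale (2 * h)⁻¹ f) =
      ser h (PowerSeries.rescale (2 * h)⁻¹ f) * imH h +
      ser h (PowerSeries.rescale (2 * h)⁻¹ (dlB h * PowerSeries.derivative K f)) := by
  have hc (g : K⟦X⟧) (c : K) : exp h c * ser h g = ser h g * exp h c := by
    rw [exp, ← ser_mul, mul_comm, ser_mul]
  rw [imH, smul_mul_assoc, mul_smul_comm, mul_assoc, hc, ← mul_assoc, y_mul_ser, add_mul, smul_add,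
    mul_assoc, derivative_rescale, map_mul, ser_mul (PowerSeries.rescale _ (dlB h)), dlB,
    rescale_smul, ser_smul, ser_rescale_sinhS hh, mul_smul_comm, ser_smul, smul_mul_assoc, ser_mul,
    ser_dl, mul_assoc, ← hc, ← mul_assoc, smul_mul_assoc (2 * h), sub_mul, one_mul,
    ← mul_assoc (exp h (-1)), exp_mul_exp, show (-1 + 1 / 2 : K) = -1 / 2 by norm_num, ← sub_mul]
  generalize exp h (1 / 2) - exp h (-1 / 2) = e
  generalize ser h _ = g
  simp only [smul_mul_assoc, smul_smul]
  congr 2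
  field_simp

theorem imV_mul_ser (f : K⟦X⟧) : imV h * ser h (PowerSeries.rescale (2 * h)⁻¹ f) =
    ser h (PowerSeries.rescale (2 * h)⁻¹ f) * imV h := by
  rw [imV, smul_mul_assoc, mul_smul_comm, mul_assoc, exp, ← ser_mul, mul_comm (expS _), ser_mul, ← mul_assoc,
    z_mul_ser, mul_assoc]

theorem imH_mul_imV (hh : h ≠ 0) : imH h * imV h =
    imV h * imH h + imV h * ser h (PowerSeries.rescale (2 * h)⁻¹ (gmB h)) := by
  -- Both orders are expanded in `z y e^{3x/4}`, `z e^{3x/4}` and `z e^{-x/4}`; their difference is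
  -- the product of `z e^{x/4}` with the hyperbolic cosine.
  have e1 : y h * exp h (1 / 2) * (z h * exp h (1 / 4)) =
      z h * y h * exp h (3 / 4) + h • (z h * exp h (-1 / 4)) := by
    rw [mul_assoc, ← mul_assoc (exp h _), exp_mul_z, mul_assoc, exp_mul_exp, ← mul_assoc, y_mul_z',
      add_mul, smul_mul_assoc, mul_assoc (z h) (exp h _), exp_mul_exp]
    norm_num
  have e2 : z h * exp h (1 / 4) * (y h * exp h (1 / 2)) =
      z h * y h * exp h (3 / 4) - (h / 2) • (z h * exp h (3 / 4) - z h * exp h (-1 / 4)) := by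
    rw [mul_assoc, ← mul_assoc (exp h _), exp_mul_y, sub_mul, mul_assoc (y h), exp_mul_exp,
      smul_mul_assoc, sub_mul, exp_mul_exp, exp_mul_exp, mul_sub, mul_smul_comm, mul_sub, ← mul_assoc,
      show 2 * h * (1 / 4) = h / 2 by ring]
    norm_num
  have e3 : z h * exp h (1 / 4) * (exp h (1 / 2) + exp h (-1 / 2)) =
      z h * exp h (3 / 4) + z h * exp h (-1 / 4) := by
    rw [mul_add, mul_assoc, mul_assoc, exp_mul_exp, exp_mul_exp]
    norm_num
  rw [imH, imV, gmB, rescale_smul, ser_smul, ser_rescale_coshS hh]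
  simp only [smul_mul_assoc, mul_smul_comm]
  rw [e1, e2, e3]
  match_scalars <;> field_simp <;> ring

theorem imV_mul_imV (hh : h ≠ 0) : imV h * imV h =
    ser h (PowerSeries.rescale (2 * h)⁻¹ (sqB h)) := by
  rw [imV, sqB, rescale_smul, ser_smul, ser_rescale_sinhS hh, smul_mul_assoc, mul_smul_comm,
    mul_assoc, ← mul_assoc (exp h _), exp_mul_z, mul_assoc, exp_mul_exp, ← mul_assoc, z_mul_z',
    smul_mul_assoc, sub_mul, one_mul, exp_mul_exp, show (1 / 4 + 1 / 4 : K) = 1 / 2 by norm_num,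
    show (-1 + 1 / 2 : K) = -1 / 2 by norm_num]
  match_scalars <;> field_simp <;> norm_num

end A

namespace B
variable {h : K}

theorem exp_mul_exp (a b : K) : ser h (expS a) * ser h (expS b) = ser h (expS (a + b)) := by
  rw [← ser_mul, ← expS_add]

theorem V_mul_exp (c : K) : V h * ser h (expS c) = ser h (expS c) * V h := V_mul_ser _

theorem ser_sinhS :
    ser h (sinhS h) = (1 / 2 : K) • (ser h (expS h) - ser h (expS (-h))) := by
  rw [← ser_sub, ← ser_smul]; rfl

theorem ser_coshS :
    ser h (coshS h) = (1 / 2 : K) • (ser h (expS h) + ser h (expS (-h))) := by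
  rw [← ser_add, ← ser_smul]; rfl

theorem exp_mul_H (hh : h ≠ 0) (c : K) : ser h (expS (c * h)) * H h =
    H h * ser h (expS (c * h)) -
      (c / 2) • (ser h (expS (c * h + h)) - ser h (expS (c * h - h))) := by
  rw [H_mul_expS hh, ser_mul (sinhS h), ser_sinhS, smul_mul_assoc, sub_mul, exp_mul_exp, exp_mul_exp,
    smul_smul, add_comm h, neg_add_eq_sub, mul_one_div, add_sub_cancel_right]

variable (h) in
/-- The image of `y` in the Borel subalgebra. -/
def imy : B h := (2 * h) • (H h * ser h (expS (-h)))
variable (h) in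
/-- The image of `z` in the Borel subalgebra. -/
def imz : B h := (4 * h) • (V h * ser h (expS (-h / 2)))

/-- The inverse substitution `x = 2hX` rests on `2 sinh (hX) e^{-hX} = 1 - e^{-2hX}`. -/
theorem imy_mul_ser (hh : h ≠ 0) (f : K⟦X⟧) : imy h * ser h (PowerSeries.rescale (2 * h) f) =
    ser h (PowerSeries.rescale (2 * h) f) * imy h +
      ser h (PowerSeries.rescale (2 * h) (A.dl h * PowerSeries.derivative K f)) := by
  have e : (2 * h) • (dlB h * (2 * h) • PowerSeries.rescale (2 * h) (PowerSeries.derivative K f)) *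
      expS (-h) = PowerSeries.rescale (2 * h) (A.dl h * PowerSeries.derivative K f) := by
    have e2 : expS h * expS (-h) = 1 := expS_mul_neg h
    have e3 : expS (-h) * expS (-h) = expS (2 * h * -1) := by
      rw [← expS_add]; ring_nf
    rw [map_mul, A.dl, rescale_smul, map_sub, map_one, rescale_expS, ← e3, ← e2, dlB, sinhS]
    generalize PowerSeries.rescale (2 * h) (PowerSeries.derivative K f) = g
    have : expS h * expS (-h) - expS (-h) * expS (-h) = (expS h - expS (-h)) * expS (-h) := by ring
    rw [this]
    generalize expS h - expS (-h) = u
    simp only [smul_mul_assoc, mul_smul_comm, smul_smul]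
    rw [mul_right_comm u]
    congr 1
    field_simp
  rw [imy, smul_mul_assoc, mul_smul_comm, mul_assoc, ← ser_mul, mul_comm (expS (-h)), ser_mul,
    ← mul_assoc, H_mul_ser, add_mul, smul_add, mul_assoc, ← ser_mul (dlB h * _), ← ser_smul,
    derivative_rescale, ← e]
  congr 2
  exact (smul_mul_assoc _ _ _).symm

theorem imz_mul_ser (f : K⟦X⟧) : imz h * ser h (PowerSeries.rescale (2 * h) f) =
    ser h (PowerSeries.rescale (2 * h) f) * imz h := by
  rw [imz, smul_mul_assoc, mul_smul_comm, mul_assoc, ← ser_mul, mul_comm (expS _), ser_mul,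
    ← mul_assoc, V_mul_ser, mul_assoc]

theorem H_mul_V' : H h * V h = V h * H h +
    (1 / 4 : K) • (V h * (ser h (expS h) + ser h (expS (-h)))) := by
  rw [H_mul_V, gmB, ser_smul, ser_coshS, mul_smul_comm, mul_smul_comm, smul_smul]
  norm_num

theorem V_mul_V' : V h * V h = (8 * h)⁻¹ • (ser h (expS h) - ser h (expS (-h))) := by
  rw [V_mul_V, sqB, ser_smul, ser_sinhS, smul_smul]
  congr 1
  rw [mul_one_div, div_eq_mul_inv, ← mul_inv]
  ring_nf

theorem imy_mul_imz (hh : h ≠ 0) : imy h * imz h =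
    imz h * imy h + imz h * ser h (PowerSeries.rescale (2 * h) (A.gm h)) := by
  have e1 : H h * ser h (expS (-h)) * (V h * ser h (expS (-h / 2))) =
      V h * H h * ser h (expS (-(3 * h / 2))) + (1 / 4 : K) • (V h * ser h (expS (-h / 2)) +
        V h * ser h (expS (-(5 * h / 2)))) := by
    rw [mul_assoc, ← mul_assoc (ser h _), ← V_mul_exp, mul_assoc (V h), exp_mul_exp, ← mul_assoc,
      H_mul_V', add_mul, smul_mul_assoc, mul_assoc (V h) (_ + _), add_mul, exp_mul_exp, exp_mul_exp,
      mul_add]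
    ring_nf
  have e2 : V h * ser h (expS (-h / 2)) * (H h * ser h (expS (-h))) =
      V h * H h * ser h (expS (-(3 * h / 2))) + (1 / 4 : K) • (V h * ser h (expS (-h / 2)) -
        V h * ser h (expS (-(5 * h / 2)))) := by
    have := exp_mul_H hh (-1 / 2)
    rw [show -1 / 2 * h = -h / 2 by ring] at this
    rw [mul_assoc, ← mul_assoc (ser h _), this, sub_mul, mul_assoc (H h), exp_mul_exp,
      smul_mul_assoc, sub_mul, exp_mul_exp, exp_mul_exp, mul_sub, mul_smul_comm, mul_sub, ← mul_assoc,
      show (-1 / 2 / 2 : K) = -(1 / 4) by norm_num, neg_smul, sub_neg_eq_add]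
    ring_nf
  have e3 : V h * ser h (expS (-h / 2)) * ser h (expS (2 * h * -1)) =
      V h * ser h (expS (-(5 * h / 2))) := by
    rw [mul_assoc, exp_mul_exp]
    ring_nf
  rw [imy, imz, A.gm, rescale_smul, ser_smul, rescale_expS]
  simp only [smul_mul_assoc, mul_smul_comm]
  rw [e1, e2, e3]
  match_scalars <;> ring

theorem imz_mul_imz (hh : h ≠ 0) : imz h * imz h =
    ser h (PowerSeries.rescale (2 * h) (A.dl h)) := by
  have e : ser h (expS (-h / 2 + -h / 2)) = ser h (expS (-h)) := by ring_nf
  rw [imz, A.dl, rescale_smul, ser_smul, map_sub, map_one, rescale_expS, ser_sub, smul_mul_assoc,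
    mul_smul_comm, mul_assoc, ← mul_assoc (ser h _), ← V_mul_exp, mul_assoc (V h), exp_mul_exp, e,
    ← mul_assoc, V_mul_V', smul_mul_assoc, sub_mul, exp_mul_exp, exp_mul_exp, add_neg_cancel, expS_zero,
    show -h + -h = 2 * h * -1 by ring]
  match_scalars <;> field_simp <;> norm_num

end B

section iso
variable (h : K) (hh : h ≠ 0)

/-- The isomorphism on generators, from the Borel subalgebra to `A`. -/
def toA : B h →ₐ[K] A h :=
  lift ((A.serHom h).comp (rescaleHom (2 * h)⁻¹)) (A.imH h) (A.imV h) (A.imH_mul_ser hh)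
    A.imV_mul_ser (A.imH_mul_imV hh) (A.imV_mul_imV hh)

/-- The isomorphism on generators, from `A` to the Borel subalgebra. -/
def ofA : A h →ₐ[K] B h :=
  lift ((B.serHom h).comp (rescaleHom (2 * h))) (B.imy h) (B.imz h) (B.imy_mul_ser hh)
    B.imz_mul_ser (B.imy_mul_imz hh) (B.imz_mul_imz hh)

variable {h}

theorem toA_ser (f : K⟦X⟧) : toA h hh (B.ser h f) = A.ser h (PowerSeries.rescale (2 * h)⁻¹ f) :=
  lift_ser ..
theorem toA_H : toA h hh (B.H h) = A.imH h := lift_genH ..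
theorem toA_V : toA h hh (B.V h) = A.imV h := lift_genV ..
theorem ofA_ser (f : K⟦X⟧) : ofA h hh (A.ser h f) = B.ser h (PowerSeries.rescale (2 * h) f) :=
  lift_ser ..
theorem ofA_y : ofA h hh (A.y h) = B.imy h := lift_genH ..
theorem ofA_z : ofA h hh (A.z h) = B.imz h := lift_genV ..

theorem toA_comp_ofA : (toA h hh).comp (ofA h hh) = AlgHom.id K (A h) := by
  have hr (f : K⟦X⟧) : PowerSeries.rescale (2 * h)⁻¹ (PowerSeries.rescale (2 * h) f) = f := by
    rw [PowerSeries.rescale_rescale, mul_inv_cancel₀ (by simpa using hh), B.rescale_one_apply]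
  have he (c : K) : A.ser h (PowerSeries.rescale (2 * h)⁻¹ (expS (c * h))) = A.exp h (c / 2) := by
    rw [rescale_expS, A.exp]
    congr 2
    field_simp
  refine A.algHom_ext (fun f => ?_) ?_ ?_
  · rw [AlgHom.comp_apply, ofA_ser, toA_ser, hr]; rfl
  · have := he (-1)
    rw [neg_one_mul] at this
    rw [AlgHom.comp_apply, ofA_y, B.imy, map_smul, map_mul, toA_H, toA_ser, this, A.imH,
      smul_mul_assoc, mul_assoc, A.exp_mul_exp, show (1 / 2 + -1 / 2 : K) = 0 by norm_num, A.exp_zero,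
      mul_one, smul_smul, mul_inv_cancel₀ (by simpa using hh), one_smul]
    rfl
  · have := he (-1 / 2)
    rw [show -1 / 2 * h = -h / 2 by ring] at this
    rw [AlgHom.comp_apply, ofA_z, B.imz, map_smul, map_mul, toA_V, toA_ser, this, A.imV,
      smul_mul_assoc, mul_assoc, A.exp_mul_exp, show (1 / 4 + -1 / 2 / 2 : K) = 0 by norm_num,
      A.exp_zero, mul_one, smul_smul, mul_inv_cancel₀ (by simpa using hh), one_smul]
    rfl

theorem ofA_comp_toA : (ofA h hh).comp (toA h hh) = AlgHom.id K (B h) := by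
  have hr (f : K⟦X⟧) : PowerSeries.rescale (2 * h) (PowerSeries.rescale (2 * h)⁻¹ f) = f := by
    rw [PowerSeries.rescale_rescale, inv_mul_cancel₀ (by simpa using hh), B.rescale_one_apply]
  refine B.algHom_ext (fun f => ?_) ?_ ?_
  · rw [AlgHom.comp_apply, toA_ser, ofA_ser, hr]; rfl
  · rw [AlgHom.comp_apply, toA_H, A.imH, map_smul, map_mul, ofA_y, A.exp, ofA_ser, rescale_expS,
      B.imy, smul_mul_assoc, mul_assoc, B.exp_mul_exp, smul_smul, inv_mul_cancel₀ (by simpa using hh),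
      one_smul, show -h + 2 * h * (1 / 2) = 0 by ring, expS_zero, B.ser_one, mul_one]
    rfl
  · rw [AlgHom.comp_apply, toA_V, A.imV, map_smul, map_mul, ofA_z, A.exp, ofA_ser, rescale_expS,
      B.imz, smul_mul_assoc, mul_assoc, B.exp_mul_exp, smul_smul, inv_mul_cancel₀ (by simpa using hh),
      one_smul, show -h / 2 + 2 * h * (1 / 4) = 0 by ring, expS_zero, B.ser_one, mul_one]
    rfl

/-- The Borel subalgebra is isomorphic to `A`. -/
def isoA : B h ≃ₐ[K] A h := AlgEquiv.ofAlgHom (toA h hh) (ofA h hh) (toA_comp_ofA hh)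
  (ofA_comp_toA hh)

theorem isoA_ser (f : K⟦X⟧) : isoA hh (B.ser h f) = A.ser h (PowerSeries.rescale (2 * h)⁻¹ f) :=
  toA_ser hh f
theorem isoA_H : isoA hh (B.H h) = A.imH h := toA_H hh
theorem isoA_V : isoA hh (B.V h) = A.imV h := toA_V hh

theorem opP_isoA (b : B h) : A.opP h (isoA hh b) = isoA hh (B.par h b) := by
  have : (A.par h).comp (isoA hh).toAlgHom = (isoA hh).toAlgHom.comp (B.par h) := by
    refine B.algHom_ext (fun f => ?_) ?_ ?_
    · change A.par h (isoA hh _) = isoA hh (B.par h _)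
      rw [isoA_ser, B.par_ser, isoA_ser, A.par_ser]
    · change A.par h (isoA hh _) = isoA hh (B.par h _)
      rw [isoA_H, B.par_H, isoA_H, A.imH, map_smul, map_mul, A.exp, A.par_ser, A.par_y]
    · change A.par h (isoA hh _) = isoA hh (B.par h _)
      rw [isoA_V, B.par_V, map_neg, isoA_V, A.imV, map_smul, map_mul, A.exp, A.par_ser, A.par_z,
        neg_mul, smul_neg]
  exact DFunLike.congr_fun this b

theorem counit_isoA (b : B h) : A.counit h (isoA hh b) = B.counit h b := by
  have : (A.counit h).comp (isoA hh).toAlgHom = B.counit h := by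
    refine B.algHom_ext (fun f => ?_) ?_ ?_
    · change A.counit h (isoA hh _) = _
      rw [isoA_ser, A.counit_ser, B.counit_ser, ← PowerSeries.coeff_zero_eq_constantCoeff_apply,
        PowerSeries.coeff_rescale]
      simp
    · change A.counit h (isoA hh _) = _
      rw [isoA_H, A.imH, map_smul, map_mul, A.counit_y, zero_mul, smul_zero, B.counit_H]
    · change A.counit h (isoA hh _) = _
      rw [isoA_V, A.imV, map_smul, map_mul, A.counit_z, zero_mul, smul_zero, B.counit_V]
  exact DFunLike.congr_fun this b

end iso

/-! ### Compatibility of the isomorphism with the antipodes -/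

section antipode
open A
variable {h : K} (hh : h ≠ 0)

/-- Both antipodes reverse products with the same sign, so the identity for `a` implies that for `g
a` when `g` is a generator; it holds at `1`. -/
theorem pairing_isoA_antipode (a b : B h) : pairing hh (isoA hh a) (B.antipode h b) =
    pairing hh (isoA hh (B.antipode h a)) b := by
  let P (a : B h) : Prop := ∀ b, pairing hh (isoA hh a) (B.antipode h b) =
    pairing hh (isoA hh (B.antipode h a)) b
  let S : Subalgebra K (B h) :=
    -- Stability under left multiplication is the right notion of closure: the reversal rules ask
    -- for the parity of the left factor only, so `a` need not be homogeneous.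
    { carrier := {g | ∀ a, P a → P (g * a)}
      add_mem' := by
        intro g g' hg hg' a ha b
        rw [add_mul, map_add, map_add, map_add, map_add, map_add, LinearMap.add_apply,
          LinearMap.add_apply, hg a ha, hg' a ha]
      mul_mem' := by
        intro g g' hg hg' a ha
        rw [mul_assoc]
        exact hg _ (hg' a ha)
      algebraMap_mem' := by
        intro r a ha b
        rw [← Algebra.smul_def, map_smul, map_smul, map_smul, map_smul, map_smul,
          LinearMap.smul_apply, LinearMap.smul_apply, ha] }
  have key (g : B h) : ∀ a, P a → P (g * a) := by
    refine B.mem_of_generators S (fun f a ha b => ?_) (fun a ha b => ?_) (fun a ha b => ?_) g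
    · have hs (b : B h) : pairing hh (isoA hh (B.ser h f)) (B.antipode h b) =
          pairing hh (isoA hh (B.ser h (PowerSeries.rescale (-1) f))) b := by
        rw [isoA_ser, isoA_ser, pairing_ser_antipode, PowerSeries.rescale_rescale,
          PowerSeries.rescale_rescale, mul_comm (2 * h)⁻¹]
      rw [map_mul (isoA hh), pairing_even_mul_antipode hh (by rw [opP_isoA, B.par_ser]) hs ha,
        B.antipode_ser_mul, map_mul (isoA hh)]
    · have hs (b : B h) : pairing hh (isoA hh (B.H h)) (B.antipode h b) =
          pairing hh (isoA hh (B.SH h)) b := by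
        have hexp (b : B h) : pairing hh (exp h (1 / 2)) (B.antipode h b) =
            pairing hh (exp h (-1 / 2)) b := by
          rw [exp, pairing_ser_antipode, rescale_expS, neg_one_mul, neg_div]; rfl
        rw [isoA_H, imH, map_smul, LinearMap.smul_apply,
          pairing_even_mul_antipode hh (show opP h (y h) = y h from par_y) (pairing_y_antipode hh)
            hexp, ← LinearMap.smul_apply, ← map_smul]
        congr 2
        -- The reversed product begins with `e^{-x/2}`; moving it past `y` gives the exponentials
        -- that match the correction in `S(H)`.
        rw [B.SH, map_sub, map_neg, map_smul, isoA_H, isoA_ser, ser_rescale_sinhS hh, imH, mul_add,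
          mul_neg, mul_smul_comm, mul_sub, mul_one, ← mul_assoc, exp_mul_y, sub_mul, mul_assoc,
          smul_mul_assoc, sub_mul]
        simp only [exp_mul_exp]
        norm_num
        match_scalars <;> field_simp <;> ring
      rw [map_mul (isoA hh), pairing_even_mul_antipode hh (by rw [opP_isoA, B.par_H]) hs ha,
        B.antipode_H_mul, map_mul (isoA hh)]
    · have hs (b : B h) : pairing hh (isoA hh (B.V h)) (B.antipode h b) =
          pairing hh (-isoA hh (B.V h)) b := by
        have hexp (b : B h) : pairing hh (exp h (1 / 4)) (B.antipode h b) =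
            pairing hh (exp h (-1 / 4)) b := by
          rw [exp, pairing_ser_antipode, rescale_expS, neg_one_mul, neg_div]; rfl
        rw [isoA_V, imV, map_smul, LinearMap.smul_apply,
          pairing_odd_mul_antipode hh opP_z (pairing_z_antipode hh)
            hexp, ← LinearMap.smul_apply, ← map_smul, exp, opP_ser]
        congr 2
        rw [← exp, mul_neg, ← mul_assoc, exp_mul_z, mul_assoc, exp_mul_exp, smul_neg]
        norm_num
      rw [map_mul (isoA hh), pairing_odd_mul_antipode hh (by rw [opP_isoA, B.par_V, map_neg]) hs ha,
        B.antipode_V_mul, map_neg, map_mul (isoA hh), opP_isoA, mul_neg]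
  have h1 : P 1 := fun b => by
    rw [B.antipode_apply 1, B.anti_one, map_one, pairing_one_antipode]
  have := key a 1 h1 b
  rwa [mul_one] at this

end antipode

/-! ### The symmetric form on the Borel subalgebra -/

namespace A
variable {h : K}

variable (h) in
/-- The image of `V e^{hX/2}`. -/
def imW : A h := (4 * h)⁻¹ • (z h * exp h (1 / 2))

theorem dX_mul_exp (f : K⟦X⟧) (a : A h) (c : K) : dX h f (a * exp h c) = dX h f a * exp h c :=
  dX_mul_ser f _ a

theorem dX_mul_imW (f : K⟦X⟧) (a : A h) : dX h f (a * imW h) = dX h f a * imW h := by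
  rw [imW, mul_smul_comm, map_smul, ← mul_assoc, dX_mul_exp, dX_mul_z, mul_smul_comm, mul_assoc]

theorem dX_mul_imH (f : K⟦X⟧) (a : A h) : dX h f (a * imH h) = dX h f a * imH h +
    (2 * h)⁻¹ • (dX h (PowerSeries.derivative K f) a * exp h (1 / 2)) := by
  rw [imH, mul_smul_comm, map_smul, ← mul_assoc, dX_mul_exp, dX_mul_y, mul_smul_comm, add_mul,
    smul_add, mul_assoc]

theorem opW_mul_exp (a : A h) (c : K) : opW h (a * exp h c) = opW h a * exp h c := opW_mul_ser a _

theorem opH_mul_exp (a : A h) (c : K) :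
    opH h (a * exp h c) = c • (opT h a * exp h c) + opH h a * exp h c := by
  rw [exp, opH_mul_ser, derivative_expS, ser_smul, mul_smul_comm]

/-- In these rules an operator on `a g'` is a combination of products of an operator on `a` with the
image of a generator, where `e^{x/2}` is the image of `T`. The array of coefficients is symmetric
under interchanging operators and images; this is the source of the symmetry of the form. -/
theorem opW_mul_imW (a : A h) : opW h (a * imW h) =
    (4 * h)⁻¹ • (opT h a * exp h (1 / 2)) - opW h a * imW h := by
  rw [imW, mul_smul_comm, map_smul, ← mul_assoc, opW_mul_exp, opW_mul_z, mul_smul_comm, sub_mul,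
    smul_sub, mul_assoc]

variable (hh : h ≠ 0)
include hh

theorem opW_mul_imH (a : A h) :
    opW h (a * imH h) = (1 / 2 : K) • (opT h a * imW h) + opW h a * imH h := by
  rw [imH, mul_smul_comm, map_smul, ← mul_assoc, opW_mul_exp, opW_mul_y, imW]
  simp only [mul_smul_comm, add_mul, smul_mul_assoc, mul_assoc]
  match_scalars <;> field_simp

theorem opH_mul_imW (a : A h) :
    opH h (a * imW h) = (1 / 2 : K) • (opW h a * exp h (1 / 2)) + opH h a * imW h := by
  rw [imW, mul_smul_comm, map_smul, ← mul_assoc, opH_mul_exp, opH_mul_z, opT_mul_z]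
  simp only [mul_smul_comm, add_mul, sub_mul, smul_mul_assoc, mul_assoc]
  match_scalars <;> field_simp <;> norm_num

theorem opH_mul_imH (a : A h) : opH h (a * imH h) =
    (1 / 4 : K) • (opT h a * exp h (1 / 2)) - (1 / 2 : K) • (opT h a * imH h) -
      h • (opW h a * imW h) + opH h a * imH h - (1 / 2 : K) • (opH h a * exp h (1 / 2)) := by
  rw [imH, mul_smul_comm, map_smul, ← mul_assoc, opH_mul_exp, opH_mul_y, opT_mul_y, imW]
  simp only [mul_smul_comm, add_mul, sub_mul, smul_mul_assoc, mul_assoc]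
  match_scalars <;> field_simp <;> norm_num

end A

namespace B
variable {h : K}

variable (h) in
/-- The element `V e^{hX/2}`. -/
def W : B h := V h * ser h (expS (h / 2))

/-- `W` may replace `V` among the generators, since `V = W e^{-hX/2}`. -/
theorem mem_of_mul_right (N : Submodule K (B h)) (h1 : 1 ∈ N) (hs : ∀ f, ∀ b ∈ N, b * ser h f ∈ N)
    (hH : ∀ b ∈ N, b * H h ∈ N) (hW : ∀ b ∈ N, b * W h ∈ N) (b : B h) : b ∈ N := by
  refine OspBorel.mem_of_mul_right N h1 hs hH (fun b hb => ?_) b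
  have := hs (expS (-(h / 2))) _ (hW b hb)
  rw [W, mul_assoc, mul_assoc, ← ser_mul, expS_mul_neg, ser_one, mul_one] at this
  exact this

end B

namespace A
variable {h : K} (hh : h ≠ 0)

theorem act_W (a : A h) : act h hh (B.W h) a = opW h a := by
  rw [B.W, map_mul (act h hh), act_V, act_ser, Module.End.mul_apply, ← opW_eq]

theorem isoA_W : isoA hh (B.W h) = imW h := by
  rw [B.W, map_mul (isoA hh), isoA_V, isoA_ser, rescale_expS, imV, smul_mul_assoc, mul_assoc, imW]
  change _ • (_ * (exp h _ * exp h _)) = _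
  rw [exp_mul_exp]
  congr 4
  field_simp
  norm_num

theorem isoA_T : isoA hh (B.ser h (expS h)) = exp h (1 / 2) := by
  rw [isoA_ser, rescale_expS, exp]
  congr 2
  field_simp

/-- The form `⟨a, u⟩` on `A` transported from the pairing by the isomorphism. -/
def form : A h →ₗ[K] A h →ₗ[K] K := (pairing hh).compl₂ (isoA hh).symm.toLinearMap

theorem form_isoA (a : A h) (b : B h) : form hh a (isoA hh b) = pairing hh a b := by
  change pairing hh a ((isoA hh).symm (isoA hh b)) = _
  rw [AlgEquiv.symm_apply_apply]

theorem form_mul_isoA (a u : A h) (b : B h) :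
    form hh a (u * isoA hh b) = form hh (act h hh b a) u := by
  obtain ⟨c, rfl⟩ := (isoA hh).surjective u
  rw [← map_mul (isoA hh), form_isoA, form_isoA, pairing_mul_right]

theorem form_mul_ser (a u : A h) (f : K⟦X⟧) :
    form hh a (u * ser h (PowerSeries.rescale (2 * h)⁻¹ f)) = form hh (dX h f a) u := by
  rw [← isoA_ser hh, form_mul_isoA, act_ser]
theorem form_mul_exp (a u : A h) : form hh a (u * exp h (1 / 2)) = form hh (opT h a) u := by
  rw [← isoA_T hh, form_mul_isoA, act_ser, opT]
theorem form_mul_imH (a u : A h) : form hh a (u * imH h) = form hh (opH h a) u := by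
  rw [← isoA_H hh, form_mul_isoA, act_H]
theorem form_mul_imW (a u : A h) : form hh a (u * imW h) = form hh (opW h a) u := by
  rw [← isoA_W hh, form_mul_isoA, act_W]

theorem form_one (a : A h) : form hh a 1 = counit h a := by
  rw [← map_one (isoA hh), form_isoA, pairing_one_right]

include hh in
/-- Two families of functionals agree if they agree at `1` and the agreement propagates. -/
theorem eq_of_mul_right {ι : Type*} (F G : ι → A h →ₗ[K] K) (h1 : ∀ i, F i 1 = G i 1)
    (hs : ∀ f u, (∀ i, F i u = G i u) → ∀ i, F i (u * ser h (PowerSeries.rescale (2 * h)⁻¹ f)) =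
      G i (u * ser h (PowerSeries.rescale (2 * h)⁻¹ f)))
    (hH : ∀ u, (∀ i, F i u = G i u) → ∀ i, F i (u * imH h) = G i (u * imH h))
    (hW : ∀ u, (∀ i, F i u = G i u) → ∀ i, F i (u * imW h) = G i (u * imW h)) (i : ι) (u : A h) :
    F i u = G i u := by
  obtain ⟨b, rfl⟩ := (isoA hh).surjective u
  let N : Submodule K (B h) := ⨅ i, LinearMap.eqLocus (F i ∘ₗ (isoA hh).toLinearMap)
    (G i ∘ₗ (isoA hh).toLinearMap)
  have hN {b : B h} : b ∈ N ↔ ∀ i, F i (isoA hh b) = G i (isoA hh b) := Submodule.mem_iInf _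
  refine hN.1 (B.mem_of_mul_right N ?_ ?_ ?_ ?_ b) i
  · refine hN.2 fun i => ?_
    rw [map_one (isoA hh), h1]
  · refine fun f b hb => hN.2 ?_
    rw [map_mul (isoA hh), isoA_ser]
    exact hs f _ (hN.1 hb)
  · refine fun b hb => hN.2 ?_
    rw [map_mul (isoA hh), isoA_H]
    exact hH _ (hN.1 hb)
  · refine fun b hb => hN.2 ?_
    rw [map_mul (isoA hh), isoA_W]
    exact hW _ (hN.1 hb)

/-- The mirror image of `form_mul_ser`: both sides satisfy the same recursion in `u`. The family
ranges over `f` and `a` together, because right multiplication by the image of `H` replaces `f` by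
`f'` and `a` by `T a`. -/
theorem form_ser_mul (f : K⟦X⟧) (a u : A h) :
    form hh (a * ser h (PowerSeries.rescale (2 * h)⁻¹ f)) u = form hh a (dX h f u) := by
  refine eq_of_mul_right hh (ι := K⟦X⟧ × A h)
    (fun i => form hh (i.2 * ser h (PowerSeries.rescale (2 * h)⁻¹ i.1)))
    (fun i => form hh i.2 ∘ₗ dX h i.1) ?_ ?_ ?_ ?_ (f, a) u
  · rintro ⟨f, a⟩
    rw [LinearMap.comp_apply, dX_one, map_smul, form_one, form_one, map_mul (counit h), counit_ser,
      smul_eq_mul, mul_comm (counit h a), ← PowerSeries.coeff_zero_eq_constantCoeff_apply,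
      PowerSeries.coeff_rescale, pow_zero, one_mul, PowerSeries.coeff_zero_eq_constantCoeff_apply]
  all_goals simp only [Prod.forall, LinearMap.comp_apply]
  · intro g u ih f a
    rw [form_mul_ser, dX_mul_ser, ih, dX_mul_ser, form_mul_ser]
  · intro u ih f a
    rw [form_mul_imH, opH_mul_ser, derivative_rescale, ser_smul, mul_smul_comm, map_add, map_smul,
      LinearMap.add_apply, LinearMap.smul_apply, ih, ih, dX_mul_imH, map_add, map_smul,
      form_mul_imH, form_mul_exp, add_comm]
  · intro u ih f a
    rw [form_mul_imW, opW_mul_ser, ih, dX_mul_imW, form_mul_imW]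

theorem form_exp_mul (a u : A h) : form hh (a * exp h (1 / 2)) u = form hh a (opT h u) := by
  rw [← isoA_T hh, isoA_ser, form_ser_mul, opT]

theorem form_imW_mul (a u : A h) : form hh (a * imW h) u = form hh a (opW h u) := by
  refine eq_of_mul_right hh (ι := A h) (fun a => form hh (a * imW h))
    (fun a => form hh a ∘ₗ opW h) ?_ ?_ ?_ ?_ a u
  · intro a
    rw [LinearMap.comp_apply, form_one, opW_one, map_zero, imW, mul_smul_comm, map_smul,
      map_mul (counit h), map_mul (counit h), counit_z, zero_mul, mul_zero, smul_zero]
  all_goals simp only [LinearMap.comp_apply]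
  · intro g u ih a
    rw [form_mul_ser, dX_mul_imW, ih, opW_mul_ser, form_mul_ser]
  · intro u ih a
    rw [form_mul_imH, opH_mul_imW hh, opW_mul_imH hh]
    simp only [map_add, map_smul, LinearMap.add_apply, LinearMap.smul_apply]
    rw [ih, form_mul_imH, form_mul_imW, form_exp_mul]
  · intro u ih a
    rw [form_mul_imW, opW_mul_imW, opW_mul_imW]
    simp only [map_sub, map_smul, LinearMap.sub_apply, LinearMap.smul_apply]
    rw [ih, form_mul_imW, form_mul_exp, form_exp_mul]

/-- This case comes last because the rule for `H` against its own image also involves `T` and `W`,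
whose mirror rules are used here. -/
theorem form_imH_mul (a u : A h) : form hh (a * imH h) u = form hh a (opH h u) := by
  refine eq_of_mul_right hh (ι := A h) (fun a => form hh (a * imH h))
    (fun a => form hh a ∘ₗ opH h) ?_ ?_ ?_ ?_ a u
  · intro a
    rw [LinearMap.comp_apply, form_one, opH_one, map_zero, imH, mul_smul_comm, map_smul,
      map_mul (counit h), map_mul (counit h), counit_y, zero_mul, mul_zero, smul_zero]
  all_goals simp only [LinearMap.comp_apply]
  · intro g u ih a
    rw [form_mul_ser, dX_mul_imH, opH_mul_ser, derivative_rescale, ser_smul, mul_smul_comm]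
    simp only [map_add, map_smul, LinearMap.add_apply, LinearMap.smul_apply]
    rw [ih, form_mul_ser, form_mul_ser, form_exp_mul, add_comm]
  · intro u ih a
    rw [form_mul_imH, opH_mul_imH hh, opH_mul_imH hh]
    simp only [map_add, map_sub, map_smul, LinearMap.add_apply, LinearMap.sub_apply,
      LinearMap.smul_apply]
    simp only [ih, form_mul_imH, form_mul_imW, form_mul_exp, form_exp_mul, form_imW_mul]
    ring
  · intro u ih a
    rw [form_mul_imW, opH_mul_imW hh, opW_mul_imH hh]
    simp only [map_add, map_smul, LinearMap.add_apply, LinearMap.smul_apply]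
    rw [ih, form_mul_imW, form_mul_exp, form_imW_mul]

/-- A generator moves from right multiplication on `u` to an operator on `a` by adjointness, then
the inductive hypothesis exchanges the arguments, and the mirror rule moves it back onto `u`. -/
theorem form_symm (a u : A h) : form hh a u = form hh u a := by
  refine eq_of_mul_right hh (ι := A h) (fun a => form hh a) (fun a => (form hh).flip a)
    ?_ ?_ ?_ ?_ a u
  · intro a
    obtain ⟨b, rfl⟩ := (isoA hh).surjective a
    rw [LinearMap.flip_apply, form_one, form_isoA, pairing_one, counit_isoA]
  all_goals simp only [LinearMap.flip_apply]
  · intro f u ih a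
    rw [form_mul_ser, ih, form_ser_mul]
  · intro u ih a
    rw [form_mul_imH, ih, form_imH_mul]
  · intro u ih a
    rw [form_mul_imW, ih, form_imW_mul]

theorem pairing_isoA_comm (a b : B h) : pairing hh (isoA hh a) b = pairing hh (isoA hh b) a := by
  rw [← form_isoA, form_symm, form_isoA]

/-- By symmetry, evaluating `a` on a product equals evaluating that product on `a`, where duality of
product and coproduct is already known. -/
theorem pairing_isoA_mul (a b b' : B h) : pairing hh (isoA hh a) (b * b') =
    BB.pair h (fun a₁ a₂ => pairing hh (isoA hh a₁) b * pairing hh (isoA hh a₂) b')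
      (BB.comul h hh a) := by
  rw [pairing_isoA_comm, map_mul (isoA hh), pairing_mul]
  simp only [pairing_isoA_comm hh _ b, pairing_isoA_comm hh _ b']

end A

end OspBorel

end

/-! ### The main theorem -/

open OspBorel PowerSeries in
theorem mainTheorem2 {K : Type*} [Field K] [CharZero K] (h : K) (hh : h ≠ 0) :
    -- bases of `B` and of its completed tensor square; the grading
    Function.Bijective (B.expand h) ∧ Function.Bijective (BB.expand h) ∧
    IsCompl (B.part h 0) (B.part h 1) ∧
    ∃ (Δ : B h →ₐ[K] BB h) (ε : B h →ₐ[K] K) (S : B h →ₗ[K] B h),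
      -- the structure maps of `B`, and their uniqueness
      IsStructure h Δ ε S ∧
      (∀ (Δ' : B h →ₐ[K] BB h) (ε' : B h →ₐ[K] K) (S' : B h →ₗ[K] B h),
        IsStructure h Δ' ε' S' → Δ' = Δ ∧ ε' = ε ∧ S' = S) ∧
      -- the antipode axiom, tested on the functionals in `B*`
      (∀ (φ : Bdual h) (b : B h),
        BB.pair h (fun a a' => φ.1 (S a * a')) (Δ b) = φ.1 1 * ε b ∧
        BB.pair h (fun a a' => φ.1 (a * S a')) (Δ b) = φ.1 1 * ε b) ∧
      -- `B*` is the algebra presented by `x, y, z`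
      ∃ θ : A h ≃ₗ[K] Bdual h,
        (∀ a a' b, (θ (a * a')).1 b = dualMul Δ (θ a) (θ a') b) ∧
        (∀ b, (θ 1).1 b = ε b) ∧
        (∀ b, (θ (A.x h)).1 b = B.e h 1 0 0 b) ∧
        (∀ b, (θ (A.y h)).1 b = B.e h 0 1 0 b) ∧
        (∀ b, (θ (A.z h)).1 b = B.e h 0 0 1 b) ∧
        (∀ (f : K⟦X⟧) (k l : ℕ) (m : Fin 2), (θ (A.ser h f)).1 (B.E h k l m) =
          if l = 0 ∧ m = 0 then (k.factorial : K) * coeff k f else 0) ∧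
        (∀ (f : K⟦X⟧) (k l : ℕ) (m : Fin 2), (θ (A.ser h f * A.z h)).1 (B.E h k l m) =
          if l = 0 ∧ m = 1 then (k.factorial : K) * coeff k f else 0) ∧
        IsDualParity 0 (θ (A.x h)) ∧ IsDualParity 0 (θ (A.y h)) ∧ IsDualParity 1 (θ (A.z h)) ∧
        -- coproduct
        (∀ a b, dualComul (θ (A.x h)) a b = (θ (A.x h)).1 a * (θ 1).1 b +
          (θ 1).1 a * (θ (A.x h)).1 b) ∧
        (∀ a b, dualComul (θ (A.y h)) a b = (θ (A.y h)).1 a * (θ (A.exp h (-1 : K))).1 b +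
          (θ 1).1 a * (θ (A.y h)).1 b +
          1 / 4 * ((θ (A.z h)).1 a * (θ (A.z h * A.exp h (-1 / 2 : K))).1 b)) ∧
        (∀ a b, dualComul (θ (A.z h)) a b = (θ (A.z h)).1 a * (θ (A.exp h (-1 / 2 : K))).1 b +
          (θ 1).1 a * (θ (A.z h)).1 b) ∧
        -- counit
        dualCounit (θ (A.x h)) = 0 ∧ dualCounit (θ (A.y h)) = 0 ∧ dualCounit (θ (A.z h)) = 0 ∧
        -- antipode
        (∀ b, dualAntipode S (θ (A.x h)) b = (θ (-A.x h)).1 b) ∧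
        (∀ b, dualAntipode S (θ (A.y h)) b =
          (θ (-(A.y h * A.exp h 1) + (h / 2) • (A.exp h 1 - 1))).1 b) ∧
        (∀ b, dualAntipode S (θ (A.z h)) b = (θ (-(A.z h * A.exp h (1 / 2)))).1 b) ∧
        -- self-duality: an isomorphism of Hopf superalgebras `ρ : B ≅ B*`
        ∃ ρ : B h ≃ₗ[K] Bdual h,
          ρ (B.H h) = θ ((2 * h)⁻¹ • (A.y h * A.exp h (1 / 2))) ∧
          ρ (B.ser h X) = θ ((2 * h)⁻¹ • A.x h) ∧
          (∀ f : K⟦X⟧, ρ (B.ser h f) = θ (A.ser h (rescale (2 * h)⁻¹ f))) ∧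
          ρ (B.V h) = θ ((4 * h)⁻¹ • (A.z h * A.exp h (1 / 4))) ∧
          (∀ a a' b, (ρ (a * a')).1 b = dualMul Δ (ρ a) (ρ a') b) ∧
          (∀ b, (ρ 1).1 b = ε b) ∧
          (∀ a b b', dualComul (ρ a) b b' =
            BB.pair h (fun a₁ a₂ => (ρ a₁).1 b * (ρ a₂).1 b') (Δ a)) ∧
          (∀ a, dualCounit (ρ a) = ε a) ∧
          (∀ a b, dualAntipode S (ρ a) b = (ρ (S a)).1 b) ∧
          (∀ (p : Fin 2) (a : B h), a ∈ B.part h p → IsDualParity p (ρ a)) := by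
  have hinj := (A.expand₂_bijective hh).1
  refine ⟨B.expand_bijective hh, A.expand₂_bijective hh, B.isCompl_part, BB.comul h hh, B.counit h,
    B.antipode h, B.isStructure hh, fun Δ' ε' S' hS' => (B.isStructure hh).unique hS',
    fun φ b => ⟨?_, ?_⟩, A.theta hh, fun a a' b => A.pairing_mul hh a a' b, A.pairing_one hh,
    A.pairing_x_eq_e hh, A.pairing_y_eq_e hh, A.pairing_z_eq_e hh, A.pairing_ser_E hh,
    A.pairing_ser_mul_z_E hh, A.isDualParity_theta_zero hh (A.par_ser _),
    A.isDualParity_theta_zero hh A.par_y, A.isDualParity_theta_one hh A.par_z,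
    A.pairing_x_mul hh, A.pairing_y_mul hh, A.pairing_z_mul hh, ?_, ?_, ?_,
    A.pairing_x_antipode hh, A.pairing_y_antipode hh, A.pairing_z_antipode hh,
    (OspBorel.isoA hh).toLinearEquiv.trans (A.theta hh), ?_, ?_, ?_, ?_, ?_, ?_,
    fun a b b' => A.pairing_isoA_mul hh a b b', ?_, fun a b => OspBorel.pairing_isoA_antipode hh a b, ?_⟩
  · exact (Bdual.evalLeft_eq_pair hinj φ _).symm.trans (Bdual.evalLeft_comul hh b φ)
  · exact (Bdual.evalRight_eq_pair hinj φ _).symm.trans (Bdual.evalRight_comul hh b φ)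
  · exact (A.pairing_one_right hh _).trans ((A.counit_ser _).trans constantCoeff_X)
  · exact (A.pairing_one_right hh _).trans A.counit_y
  · exact (A.pairing_one_right hh _).trans A.counit_z
  · exact congrArg (A.theta hh) (OspBorel.isoA_H hh)
  · refine congrArg (A.theta hh) ((OspBorel.isoA_ser hh X).trans ?_)
    rw [A.x, ← A.ser_smul, rescale_X, smul_eq_C_mul]
  · exact fun f => congrArg (A.theta hh) (OspBorel.isoA_ser hh f)
  · exact congrArg (A.theta hh) (OspBorel.isoA_V hh)
  · intro a a' b
    refine Eq.trans ?_ (A.pairing_mul hh (OspBorel.isoA hh a) (OspBorel.isoA hh a') b)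
    rw [← map_mul (OspBorel.isoA hh)]
    rfl
  · intro b
    refine Eq.trans ?_ (A.pairing_one hh b)
    rw [← map_one (OspBorel.isoA hh)]
    rfl
  · exact fun a => (A.pairing_one_right hh _).trans (OspBorel.counit_isoA hh a)
  · intro p a ha
    fin_cases p
    · refine A.isDualParity_theta_zero hh ((OspBorel.opP_isoA hh a).trans ?_)
      rw [B.par_even ha]
      rfl
    · refine A.isDualParity_theta_one hh ((OspBorel.opP_isoA hh a).trans ?_)
      rw [B.par_odd ha, map_neg]
      rfl
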